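/- **Setting.** Let $d\ge 1$, $T>0$, $M>0$. For vector fields on $\mathbb R^d$ put $$\tilde{\mathcal B}=\{b\in W^{2,\infty}(\mathbb R^d,\mathbb R^d)\cap H^1(\mathbb R^d,\mathbb R^d):\ \|b\|_{L^\infty}\le M,\ \|b\|_{H^1}\le M,\ \|\operatorname{div} b\|_{W^{1,\infty}}\le M\},$$ where $\|u\|_{W^{1,\infty}}=\|u\|_\infty+\|\nabla u\|_\infty$, and for $t\in[0,T]$ let $\mathcal B(t)$ be the set of $\beta\in L^2([t,T],W^{2,\infty}\cap H^1)$ with $\beta(\cdot,s)\in\tilde{\mathcal B}$ for a.e. $s$. Let $A\subset\mathbb R^k$ be compact and nonempty, let $\mathcal A(t)$ be the set of measurable $\alpha:[t,T]\to A$, and let $f:\mathbb R^d\times A\to\mathbb R^d$ be continuous, with $\|f\|\le C$, and Lipschitz in $x$ uniformly in $a$. Let $\ell:\mathbb R^d\times H^1(\mathbb R^d)\times[0,T]\times\mathbb R^k\times L^2(\mathbb R^d,\mathbb R^d)\to[0,\infty)$ be bounded, continuous, and uniformly continuous in $(x,m,s)$ with a modulus independent of $(a,b)$; let $\psi:\mathbb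 R^d\times H^1(\mathbb R^d)\to[0,\infty)$ be bounded and uniformly continuous. For $\alpha\in\mathcal A(t)$, $\beta\in\mathcal B(t)$, let $y_{(x,t)}(\cdot;\alpha)$ be the solution of $y'=f(y,\alpha)$, $y(t)=x$, on $[t,T]$, and $m(\cdot,\cdot;\beta,t,\bar m)\in C([t,T],H^1(\mathbb R^d))$ the distributional solution of $m_s+\operatorname{div}(\beta m)=0$, $m(\cdot,t)=\bar m\in H^1(\mathbb R^d)$. Put $$J(x,\bar m,t,\alpha,\beta)=\int_t^T\ell\big(y_{(x,t)}(s),m(\cdot,s),s,\alpha(s),\beta(\cdot,s)\big)\,ds+\psi\big(y_{(x,t)}(T),m(\cdot,T)\big).$$ Let $\Gamma(t)$ be the set of maps $\gamma:\mathcal B(t)\to\mathcal A(t)$ which are non-anticipating: for all $\tau\in[t,T]$, $\beta_1=\beta_2$ a.e. on $[t,\tau]$ implies $\gamma[\beta_1]=\gamma[\beta_2]$ a.e. on $[t,\tau]$. The lower value function is $$\underline V(x,\bar m,t)=\inf_{\gamma\in\Gamma(t)}\ \sup_{\beta\in\mathcal B(t)}J(x,\bar m,t,\gamma[\beta],\beta).$$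 Let $\Omega\subset\mathbb R^d$ be open and bounded, $R>0$, $\Omega_1(t)=\{x:\operatorname{dist}(x,\Omega)\le Mt\}$, $\Omega_2(t)=\{x:\operatorname{dist}(x,\Omega)\le Ct\}$. Let $X(t)$ be the set of $\bar m\in H^1(\mathbb R^d)\cap W^{1,\infty}(\mathbb R^d)$ with $\operatorname{supp}\bar m\subset\Omega_1(t)$ and $\|m(\cdot,s;\beta,t,\bar m)\|_{W^{1,\infty}}\le R$ for all $s\in[t,T]$ and $\beta\in\mathcal B(t)$, and let $$\tilde X=\bigcup_{t\in[0,T]}\Omega_2(t)\times X(t)\times\{t\}\subset\mathbb R^d\times H^1(\mathbb R^d)\times[0,T].$$ For $p\in\mathbb R^d$, $q\in L^2(\mathbb R^d)$ put $$H(x,m,t,p,q)=\inf_{b\in\tilde{\mathcal B}}\ \max_{a\in A}\{-f(x,a)\cdot p+\langle q,\operatorname{div}(bm)\rangle_{L^2(\mathbb R^d)}-\ell(x,m,t,a,b)\}.$$ **Theorem 4.1.** The lower value function $\underline V$ is a viscosity solution on $\tilde X$ of $$-V_t+H(x,m,t,D_xV,D_mV)=0,$$ and $\underline V(x,m,T)=\psi(x,m)$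 for all $x\in\Omega_2(T)$, $m\in X(T)$. That is: $\underline V$ is continuous on $\tilde X$ (topology of $\mathbb R^d\times H^1(\mathbb R^d)\times[0,T]$), and for every $\varphi\in C^1(\mathbb R^d\times L^2(\mathbb R^d)\times[0,T])$ and every $(\bar x,\bar m,\bar t)\in\tilde X$ with $\bar t<T$, the number $-\varphi_t+H(\cdot,D_x\varphi,D_m\varphi)$ evaluated at $(\bar x,\bar m,\bar t)$ is $\le 0$ if $\underline V-\varphi$ has a local maximum relative to $\tilde X$ at that point, and $\ge 0$ if $\underline V-\varphi$ has a local minimum relative to $\tilde X$ there. Local extrema are understood in the topology of $\mathbb R^d\times H^1(\mathbb R^d)\times[0,T]$ (so extrema local in $\mathbb R^d\times L^2(\mathbb R^d)\times[0,T]$ are included). -/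

import Mathlib

open MeasureTheory Set Filter Topology
open scoped ENNReal BoundedContinuousFunction

noncomputable section

namespace MassGame

/-- The space `ℝ^d` with the Euclidean norm. -/
abbrev Pt (d : ℕ) := EuclideanSpace ℝ (Fin d)

/-- `L²(ℝ^d)`. -/
abbrev L2s (d : ℕ) := Lp ℝ 2 (volume : Measure (Pt d))

/-- `L²(ℝ^d, ℝ^d)`. -/
abbrev L2v (d : ℕ) := Lp (Pt d) 2 (volume : Measure (Pt d))

section WeakDerivative

variable {d : ℕ} {F : Type*} [NormedAddCommGroup F] [NormedSpace ℝ F]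

/-- `g` is the weak (distributional) derivative of `u` on `ℝ^d`:
`∫ (∂_v φ) u = - ∫ φ (g v)` for every `φ ∈ C_c^∞(ℝ^d)` and every direction `v`. -/
def HasWeakFDeriv (u : Pt d → F) (g : Pt d → (Pt d →L[ℝ] F)) : Prop :=
  LocallyIntegrable u volume ∧ LocallyIntegrable g volume ∧
    ∀ φ : Pt d → ℝ, ContDiff ℝ (⊤ : ℕ∞) φ → HasCompactSupport φ → ∀ v : Pt d,
      ∫ x, (fderiv ℝ φ x v) • u x = - ∫ x, φ x • g x v

theorem HasWeakFDeriv.congr {u u' : Pt d → F} {g g' : Pt d → (Pt d →L[ℝ] F)}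
    (h : HasWeakFDeriv u g) (hu : u =ᵐ[volume] u') (hg : g =ᵐ[volume] g') :
    HasWeakFDeriv u' g' := by
  refine ⟨h.1.congr hu, h.2.1.congr hg, fun φ hφ hc v => ?_⟩
  have h1 : ∫ x, (fderiv ℝ φ x v) • u' x = ∫ x, (fderiv ℝ φ x v) • u x :=
    integral_congr_ae (by filter_upwards [hu] with x hx; rw [hx])
  have h2 : ∫ x, φ x • g' x v = ∫ x, φ x • g x v :=
    integral_congr_ae (by filter_upwards [hg] with x hx; rw [hx])
  rw [h1, h2, h.2.2 φ hφ hc v]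

theorem HasWeakFDeriv.zero : HasWeakFDeriv (0 : Pt d → F) 0 := by
  refine ⟨continuous_const.locallyIntegrable, continuous_const.locallyIntegrable,
    fun φ _ _ v => ?_⟩
  simp

theorem HasWeakFDeriv.add {u₁ u₂ : Pt d → F} {g₁ g₂ : Pt d → (Pt d →L[ℝ] F)}
    (h₁ : HasWeakFDeriv u₁ g₁) (h₂ : HasWeakFDeriv u₂ g₂) :
    HasWeakFDeriv (u₁ + u₂) (g₁ + g₂) := by
  have hg : LocallyIntegrable (g₁ + g₂) volume := by
    have h := h₁.2.1.sub h₂.2.1.neg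
    rwa [sub_neg_eq_add] at h
  refine ⟨h₁.1.add h₂.1, hg, fun φ hφ hc v => ?_⟩
  have hd : Continuous fun x => fderiv ℝ φ x v :=
    (hφ.continuous_fderiv (by simp)).clm_apply continuous_const
  have hdc : HasCompactSupport fun x => fderiv ℝ φ x v := hc.fderiv_apply ℝ v
  have iu : ∀ {u : Pt d → F}, LocallyIntegrable u volume →
      Integrable (fun x => (fderiv ℝ φ x v) • u x) volume := fun hu =>
    hu.integrable_smul_left_of_hasCompactSupport hd hdc
  have ig : ∀ {g : Pt d → (Pt d →L[ℝ] F)}, LocallyIntegrable g volume →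
      Integrable (fun x => φ x • g x v) volume := fun {g} hg => by
    have := hg.integrable_smul_left_of_hasCompactSupport hφ.continuous hc
    exact this.apply_continuousLinearMap v
  simp only [Pi.add_apply, smul_add, add_apply]
  rw [integral_add (iu h₁.1) (iu h₂.1), integral_add (ig h₁.2.1) (ig h₂.2.1),
    h₁.2.2 φ hφ hc v, h₂.2.2 φ hφ hc v, neg_add]

theorem HasWeakFDeriv.smul {u : Pt d → F} {g : Pt d → (Pt d →L[ℝ] F)} (c : ℝ)
    (h : HasWeakFDeriv u g) : HasWeakFDeriv (c • u) (c • g) := by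
  refine ⟨h.1.smul c, h.2.1.smul c, fun φ hφ hc v => ?_⟩
  simp only [Pi.smul_apply, _root_.smul_apply, smul_comm _ c]
  rw [integral_smul, integral_smul, h.2.2 φ hφ hc v, smul_neg]

end WeakDerivative

/-- The Sobolev space `H¹(ℝ^d)`: pairs `(u, ∇u) ∈ L²(ℝ^d) × L²(ℝ^d, ℝ^d)` with `∇u` the weak
gradient of `u`, with the norm `(‖u‖² + ‖∇u‖²)^{1/2}` of the `ℓ²`-product. -/
def H1sub (d : ℕ) : Submodule ℝ (WithLp 2 (L2s d × L2v d)) where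
  carrier := {w | HasWeakFDeriv (w.fst : Pt d → ℝ) (fun x => innerSL ℝ (w.snd x))}
  zero_mem' := by
    refine HasWeakFDeriv.zero.congr (Lp.coeFn_zero ℝ 2 volume).symm ?_
    filter_upwards [Lp.coeFn_zero (Pt d) 2 (volume : Measure (Pt d))] with x hx
    change (0 : Pt d →L[ℝ] ℝ) = innerSL ℝ ((0 : L2v d) x)
    rw [hx, Pi.zero_apply, map_zero]
  add_mem' := by
    intro a b ha hb
    refine (HasWeakFDeriv.add ha hb).congr (Lp.coeFn_add a.fst b.fst).symm ?_
    filter_upwards [Lp.coeFn_add a.snd b.snd] with x hx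
    change innerSL ℝ (a.snd x) + innerSL ℝ (b.snd x) = innerSL ℝ ((a.snd + b.snd) x)
    rw [hx, Pi.add_apply, map_add]
  smul_mem' := by
    intro c a ha
    refine (HasWeakFDeriv.smul c ha).congr (Lp.coeFn_smul c a.fst).symm ?_
    filter_upwards [Lp.coeFn_smul c a.snd] with x hx
    change c • innerSL ℝ (a.snd x) = innerSL ℝ ((c • a.snd) x)
    rw [hx, Pi.smul_apply, map_smul]

/-- `H¹(ℝ^d)` as a normed space. -/
abbrev H1 (d : ℕ) := ↥(H1sub d)

/-- The embedding `H¹(ℝ^d) → L²(ℝ^d)`. -/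
def H1.toL2 {d : ℕ} (m : H1 d) : L2s d := (m : WithLp 2 (L2s d × L2v d)).fst

/-- The weak gradient of an element of `H¹(ℝ^d)`. -/
def H1.grad {d : ℕ} (m : H1 d) : L2v d := (m : WithLp 2 (L2s d × L2v d)).snd

/-- `‖m‖_{W^{1,∞}(ℝ^d)} = ‖m‖_∞ + ‖∇m‖_∞`, with value `∞` if `m ∉ W^{1,∞}(ℝ^d)`. -/
def H1.normW1inf {d : ℕ} (m : H1 d) : ℝ≥0∞ :=
  eLpNorm m.toL2 ∞ volume + eLpNorm m.grad ∞ volume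

/-- The ambient space of tuples `(b, Db, D²b, b, Db)`. -/
abbrev FieldTuple (d : ℕ) :=
  (Pt d →ᵇ Pt d) × (Pt d →ᵇ (Pt d →L[ℝ] Pt d)) ×
    Lp (Pt d →L[ℝ] (Pt d →L[ℝ] Pt d)) ∞ (volume : Measure (Pt d)) ×
    L2v d × Lp (Pt d →L[ℝ] Pt d) 2 (volume : Measure (Pt d))

/-- The space `W^{2,∞}(ℝ^d, ℝ^d) ∩ H¹(ℝ^d, ℝ^d)` of vector fields. An element is recorded as
`(b, Db, D²b, b, Db)`. Since `W^{2,∞} ⊂ C¹`, the first two entries are the `C¹` representative `b`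
and its derivative, as bounded continuous functions with the sup norm; the third entry is the weak
derivative of `Db`, in `L^∞`; the last two are `b` and `Db` as elements of `L²`. The norm is the
maximum of the norms of the entries, which is equivalent to `‖·‖_{W^{2,∞}} + ‖·‖_{H¹}`. -/
def FieldSub (d : ℕ) : Submodule ℝ (FieldTuple d) where
  carrier := {w | (∀ x, HasFDerivAt w.1 (w.2.1 x) x) ∧ HasWeakFDeriv w.2.1 w.2.2.1 ∧
    w.2.2.2.1 =ᵐ[volume] w.1 ∧ w.2.2.2.2 =ᵐ[volume] w.2.1}
  zero_mem' := by
    refine ⟨fun x => hasFDerivAt_const (0 : Pt d) x, ?_, Lp.coeFn_zero _ _ _, Lp.coeFn_zero _ _ _⟩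
    exact HasWeakFDeriv.zero.congr (Eventually.of_forall fun _ => rfl) (Lp.coeFn_zero _ _ _).symm
  add_mem' := by
    rintro a b ⟨ha1, ha2, ha3, ha4⟩ ⟨hb1, hb2, hb3, hb4⟩
    refine ⟨fun x => (ha1 x).add (hb1 x), ?_, ?_, ?_⟩
    · exact (ha2.add hb2).congr (Eventually.of_forall fun _ => rfl) (Lp.coeFn_add _ _).symm
    · exact (Lp.coeFn_add _ _).trans (ha3.add hb3)
    · exact (Lp.coeFn_add _ _).trans (ha4.add hb4)
  smul_mem' := by
    rintro c a ⟨ha1, ha2, ha3, ha4⟩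
    refine ⟨fun x => (ha1 x).const_smul c, ?_, ?_, ?_⟩
    · exact (ha2.smul c).congr (Eventually.of_forall fun _ => rfl) (Lp.coeFn_smul _ _).symm
    · exact (Lp.coeFn_smul _ _).trans (ha3.const_smul c)
    · exact (Lp.coeFn_smul _ _).trans (ha4.const_smul c)

/-- `W^{2,∞}(ℝ^d, ℝ^d) ∩ H¹(ℝ^d, ℝ^d)` as a normed space. -/
abbrev FieldSpace (d : ℕ) := ↥(FieldSub d)

set_option synthInstance.maxHeartbeats 400000 in
instance (d : ℕ) : NormedAddCommGroup (FieldTuple d) := inferInstance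

set_option synthInstance.maxHeartbeats 400000 in
instance (d : ℕ) : NormedAddCommGroup (FieldSpace d) := inferInstance

set_option synthInstance.maxHeartbeats 400000 in
instance (d : ℕ) : NormedSpace ℝ (FieldTuple d) := inferInstance

set_option synthInstance.maxHeartbeats 400000 in
instance (d : ℕ) : NormedSpace ℝ (FieldSpace d) := inferInstance

instance (d : ℕ) : SMul ℝ (FieldSpace d) := (NormedSpace.toModule : Module ℝ (FieldSpace d)).toSMul

namespace FieldSpace

variable {d : ℕ}

/-- The (continuously differentiable) vector field. -/
def toFun (b : FieldSpace d) : Pt d → Pt d := b.1.1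

/-- Its derivative `Db`. -/
def deriv1 (b : FieldSpace d) : Pt d → (Pt d →L[ℝ] Pt d) := b.1.2.1

/-- Its second weak derivative, `D²b(x) v w = (∂_v Db)(x) w`. -/
def deriv2 (b : FieldSpace d) : Pt d → (Pt d →L[ℝ] (Pt d →L[ℝ] Pt d)) := b.1.2.2.1

/-- The vector field as an element of `L²(ℝ^d, ℝ^d)`. -/
def toL2v (b : FieldSpace d) : L2v d := b.1.2.2.2.1

/-- The trace of a linear map `ℝ^d → ℝ^d`, as a continuous linear functional. -/
def traceL (d : ℕ) : (Pt d →L[ℝ] Pt d) →L[ℝ] ℝ :=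
  ∑ i : Fin d, (EuclideanSpace.proj i : Pt d →L[ℝ] ℝ).comp
    (ContinuousLinearMap.apply ℝ (Pt d) (EuclideanSpace.single i (1 : ℝ)))

/-- The divergence `div b = ∑ i, ∂_i b_i`. -/
def div (b : FieldSpace d) (x : Pt d) : ℝ := traceL d (b.deriv1 x)

/-- The weak derivative of `div b`, i.e. `v ↦ ∂_v (div b)`. -/
def gradDiv (b : FieldSpace d) (x : Pt d) : Pt d →L[ℝ] ℝ := (traceL d).comp (b.deriv2 x)

/-- `‖b‖²_{H¹} = ∫ |b|² + ∑ i, ∫ |∂_i b|²`. -/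
def sqNormH1 (b : FieldSpace d) : ℝ :=
  (∫ x, ‖b.toFun x‖ ^ 2) + ∑ i : Fin d, ∫ x, ‖b.deriv1 x (EuclideanSpace.single i (1 : ℝ))‖ ^ 2

end FieldSpace

/-- The admissible fields: `‖b‖_∞ ≤ M`, `‖b‖_{H¹} ≤ M` and `‖div b‖_{W^{1,∞}} ≤ M`. -/
def Btilde (d : ℕ) (M : ℝ) : Set (FieldSpace d) :=
  {b | (∀ x, ‖b.toFun x‖ ≤ M) ∧ Real.sqrt b.sqNormH1 ≤ M ∧
    eLpNorm b.div ∞ volume + eLpNorm b.gradDiv ∞ volume ≤ ENNReal.ofReal M}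

/-- The data of the game: horizon `T`, the bound `M` on the fields of the mass, the compact control
set `A ⊂ ℝ^k` and the dynamics `f` of the single player, a bound `C` for `f`, the costs `ℓ` and `ψ`,
the set `Ω` containing the initial supports, and the bound `R` on the densities in `W^{1,∞}`. -/
structure Data (d k : ℕ) where
  T : ℝ
  M : ℝ
  A : Set (Pt k)
  f : Pt d → Pt k → Pt d
  C : ℝ
  ℓ : Pt d → H1 d → ℝ → Pt k → L2v d → ℝ
  ψ : Pt d → H1 d → ℝ
  Ω : Set (Pt d)
  R : ℝ

/-- `ω : [0, ∞) → [0, ∞)` is nondecreasing, vanishes at `0` and is continuous there. -/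
def IsModulus (ω : ℝ → ℝ) : Prop :=
  MonotoneOn ω (Ici 0) ∧ ω 0 = 0 ∧ ContinuousWithinAt ω (Ici 0) 0

namespace Data

variable {d k : ℕ} (G : Data d k)

/-- The hypotheses on the data. -/
structure Standing : Prop where
  T_pos : 0 < G.T
  M_pos : 0 < G.M
  A_compact : IsCompact G.A
  A_nonempty : G.A.Nonempty
  f_cont : ContinuousOn (fun z : Pt d × Pt k => G.f z.1 z.2) (univ ×ˢ G.A)
  f_bdd : ∀ x, ∀ a ∈ G.A, ‖G.f x a‖ ≤ G.C
  f_lip : ∃ L : ℝ, 0 < L ∧ ∀ x z, ∀ a ∈ G.A, ‖G.f x a - G.f z a‖ ≤ L * ‖x - z‖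
  ℓ_nonneg : ∀ x m, ∀ s ∈ Icc 0 G.T, ∀ a b, 0 ≤ G.ℓ x m s a b
  ℓ_bdd : ∃ G₁ : ℝ, ∀ x m, ∀ s ∈ Icc 0 G.T, ∀ a b, G.ℓ x m s a b ≤ G₁
  ℓ_cont : ContinuousOn
    (fun z : Pt d × H1 d × ℝ × Pt k × L2v d => G.ℓ z.1 z.2.1 z.2.2.1 z.2.2.2.1 z.2.2.2.2)
    {z | z.2.2.1 ∈ Icc 0 G.T}
  ℓ_unif : ∃ ω : ℝ → ℝ, IsModulus ω ∧ ∀ a b, ∀ x₁ x₂ m₁ m₂, ∀ s₁ ∈ Icc 0 G.T, ∀ s₂ ∈ Icc 0 G.T,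
    |G.ℓ x₁ m₁ s₁ a b - G.ℓ x₂ m₂ s₂ a b| ≤ ω (‖x₁ - x₂‖ + ‖m₁ - m₂‖ + |s₁ - s₂|)
  ψ_nonneg : ∀ x m, 0 ≤ G.ψ x m
  ψ_bdd : ∃ G₂ : ℝ, ∀ x m, G.ψ x m ≤ G₂
  ψ_unif : UniformContinuous (fun z : Pt d × H1 d => G.ψ z.1 z.2)
  Ω_open : IsOpen G.Ω
  Ω_bdd : Bornology.IsBounded G.Ω

/-- The controls `𝒜(t)` of the single player: measurable, with values in `A` on `[t,T]`. -/
def ControlA (t : ℝ) : Set (ℝ → Pt k) :=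
  {α | AEMeasurable α (volume.restrict (Icc t G.T)) ∧ ∀ s ∈ Icc t G.T, α s ∈ G.A}

/-- The controls `ℬ(t)` of the mass: `β ∈ L²([t,T], W^{2,∞} ∩ H¹)` with admissible values. -/
def ControlB (t : ℝ) : Set (ℝ → FieldSpace d) :=
  {β | MemLp β 2 (volume.restrict (Icc t G.T)) ∧
    ∀ᵐ s ∂(volume.restrict (Icc t G.T)), β s ∈ Btilde d G.M}

/-- `y` solves `y' = f(y, α)` on `[t,T]`, `y(t) = x` (in the sense of Carathéodory). -/
def IsTrajectory (x : Pt d) (t : ℝ) (α : ℝ → Pt k) (y : ℝ → Pt d) : Prop :=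
  ContinuousOn y (Icc t G.T) ∧ ∀ s ∈ Icc t G.T, y s = x + ∫ τ in t..s, G.f (y τ) (α τ)

/-- The trajectory `y_{(x,t)}(·; α)` of the single player. -/
def traj (x : Pt d) (t : ℝ) (α : ℝ → Pt k) : ℝ → Pt d :=
  Classical.epsilon (G.IsTrajectory x t α)

/-- `m ∈ C([t,T], H¹)` is the solution of `m_s + div(β m) = 0` on `[t,T]`, `m(t) = m₀`, in the sense
of distributions: `⟨m(s), φ⟩ = ⟨m₀, φ⟩ + ∫_t^s ∫ m(τ) β(τ)·∇φ dx dτ` for all `φ ∈ C_c^∞(ℝ^d)`. -/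
def IsMassEvolution (m₀ : H1 d) (t : ℝ) (β : ℝ → FieldSpace d) (m : ℝ → H1 d) : Prop :=
  ContinuousOn m (Icc t G.T) ∧
    ∀ φ : Pt d → ℝ, ContDiff ℝ (⊤ : ℕ∞) φ → HasCompactSupport φ → ∀ s ∈ Icc t G.T,
      ∫ x, (m s).toL2 x * φ x = (∫ x, m₀.toL2 x * φ x) +
        ∫ τ in t..s, ∫ x, (m τ).toL2 x * fderiv ℝ φ x ((β τ).toFun x)

/-- The density `m(·, s; β, t, m₀)` of the mass. -/
def mass (m₀ : H1 d) (t : ℝ) (β : ℝ → FieldSpace d) : ℝ → H1 d :=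
  Classical.epsilon (G.IsMassEvolution m₀ t β)

/-- The cost functional `J(x, m₀, t, α, β)`. -/
def J (x : Pt d) (m₀ : H1 d) (t : ℝ) (α : ℝ → Pt k) (β : ℝ → FieldSpace d) : ℝ :=
  (∫ s in t..G.T, G.ℓ (G.traj x t α s) (G.mass m₀ t β s) s (α s) (β s).toL2v) +
    G.ψ (G.traj x t α G.T) (G.mass m₀ t β G.T)

/-- The non-anticipating strategies `Γ(t)` of the single player. -/
def Strategy (t : ℝ) : Set ((ℝ → FieldSpace d) → ℝ → Pt k) :=
  {γ | (∀ β ∈ G.ControlB t, γ β ∈ G.ControlA t) ∧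
    ∀ τ ∈ Icc t G.T, ∀ β₁ ∈ G.ControlB t, ∀ β₂ ∈ G.ControlB t,
      (∀ᵐ s ∂(volume.restrict (Icc t τ)), β₁ s = β₂ s) →
        ∀ᵐ s ∂(volume.restrict (Icc t τ)), γ β₁ s = γ β₂ s}

/-- The lower value function `V(x, m, t) = inf_{γ ∈ Γ(t)} sup_{β ∈ ℬ(t)} J(x, m, t, γ[β], β)`. -/
def lowerValue (z : Pt d × H1 d × ℝ) : ℝ :=
  ⨅ γ : G.Strategy z.2.2, ⨆ β : G.ControlB z.2.2, J G z.1 z.2.1 z.2.2 (γ.1 β.1) β.1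

/-- `Ω₁(t) = {x : dist(x, Ω) ≤ M t}`. -/
def Omega1 (t : ℝ) : Set (Pt d) := Metric.cthickening (G.M * t) G.Ω

/-- `Ω₂(t) = {x : dist(x, Ω) ≤ C t}`. -/
def Omega2 (t : ℝ) : Set (Pt d) := Metric.cthickening (G.C * t) G.Ω

/-- The set `X(t)` of admissible densities at time `t`: those in `H¹ ∩ W^{1,∞}` supported in `Ω₁(t)`
all of whose evolutions stay in the ball of radius `R` of `W^{1,∞}` (for `s = t` this includes
the density itself). -/
def X (t : ℝ) : Set (H1 d) :=
  {m₀ | m₀.normW1inf < ∞ ∧ (∀ᵐ x ∂(volume : Measure (Pt d)), x ∉ G.Omega1 t → m₀.toL2 x = 0) ∧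
    ∀ β ∈ G.ControlB t, ∀ s ∈ Icc t G.T, (G.mass m₀ t β s).normW1inf ≤ ENNReal.ofReal G.R}

/-- The set `X̃ = ⋃_{t ∈ [0,T]} Ω₂(t) × X(t) × {t}`. -/
def Xtilde : Set (Pt d × H1 d × ℝ) :=
  {z | z.2.2 ∈ Icc 0 G.T ∧ z.1 ∈ G.Omega2 z.2.2 ∧ z.2.1 ∈ G.X z.2.2}

/-- `⟨q, div(b m)⟩_{L²}`, where `div(b m) = b·∇m + m div b ∈ L²`. -/
def pairDiv (q : L2s d) (b : FieldSpace d) (m : H1 d) : ℝ :=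
  ∫ x, q x * (inner ℝ (b.toFun x) (m.grad x) + b.div x * m.toL2 x)

/-- The Hamiltonian
`H(x,m,t,p,q) = inf_{b ∈ B̃} max_{a ∈ A} {-f(x,a)·p + ⟨q, div(b m)⟩ - ℓ(x,m,t,a,b)}`. -/
def Ham (x : Pt d) (m : H1 d) (t : ℝ) (p : Pt d) (q : L2s d) : ℝ :=
  ⨅ b : Btilde d G.M, ⨆ a : G.A,
    (-(inner ℝ (G.f x a.1) p) + pairDiv q b.1 m - G.ℓ x m t a.1 b.1.toL2v)

/-- Test functions: `φ ∈ C¹(ℝ^d × L²(ℝ^d) × [0,T])`. -/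
def IsTest (φ : Pt d × L2s d × ℝ → ℝ) : Prop :=
  ContDiffOn ℝ 1 φ (univ ×ˢ univ ×ˢ Icc 0 G.T)

/-- The left-hand side `-φ_t + H(x, m, t, D_x φ, D_m φ)` at a point `z = (x, m, t)`. -/
def isaacs (φ : Pt d × L2s d × ℝ → ℝ) (z : Pt d × H1 d × ℝ) : ℝ :=
  -(derivWithin (fun s => φ (z.1, z.2.1.toL2, s)) (Icc 0 G.T) z.2.2) +
    G.Ham z.1 z.2.1 z.2.2
      (gradient (fun x => φ (x, z.2.1.toL2, z.2.2)) z.1)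
      (gradient (fun q => φ (z.1, q, z.2.2)) z.2.1.toL2)

/-- The function `u - φ` on `ℝ^d × H¹ × [0,T]`. -/
def diffTest (u : Pt d × H1 d × ℝ → ℝ) (φ : Pt d × L2s d × ℝ → ℝ) (z : Pt d × H1 d × ℝ) : ℝ :=
  u z - φ (z.1, z.2.1.toL2, z.2.2)

/-- `u ∈ C⁰(X̃)` is a viscosity subsolution of `-u_t + H(x, m, t, D_x u, D_m u) = 0` in `X̃`; local
maxima are relative to `X̃ ⊂ ℝ^d × H¹ × [0,T]`, and the inequality is required before the final
time, where the final condition is imposed. -/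
def IsViscositySubsolution (u : Pt d × H1 d × ℝ → ℝ) : Prop :=
  ContinuousOn u G.Xtilde ∧
    ∀ φ : Pt d × L2s d × ℝ → ℝ, G.IsTest φ → ∀ z ∈ G.Xtilde, z.2.2 < G.T →
      IsLocalMaxOn (diffTest u φ) G.Xtilde z → G.isaacs φ z ≤ 0

/-- `u ∈ C⁰(X̃)` is a viscosity supersolution of `-u_t + H(x, m, t, D_x u, D_m u) = 0` in `X̃`. -/
def IsViscositySupersolution (u : Pt d × H1 d × ℝ → ℝ) : Prop :=
  ContinuousOn u G.Xtilde ∧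
    ∀ φ : Pt d × L2s d × ℝ → ℝ, G.IsTest φ → ∀ z ∈ G.Xtilde, z.2.2 < G.T →
      IsLocalMinOn (diffTest u φ) G.Xtilde z → 0 ≤ G.isaacs φ z

/-- Viscosity solution: simultaneously a sub- and a supersolution. -/
def IsViscositySolution (u : Pt d × H1 d × ℝ → ℝ) : Prop :=
  G.IsViscositySubsolution u ∧ G.IsViscositySupersolution u

end Data

end MassGame

end

/-! The result is dynamic programming, once the evolution of the mass is understood on `Xtilde`. The
single player has bounded Lipschitz dynamics, so its trajectories are classical. The difficulty is
the mass: a field in `Btilde` has controlled sup norm, H¹ norm and divergence, but for d ≥ 2 nothing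
bounds its full gradient uniformly, so no uniform H¹ estimate for the continuity equation is
available. Two facts remove this obstacle.

In dimension one the derivative of a field is its divergence, so all fields of `Btilde` are C^{1,1}
with the same constant M (`C11_of_Btilde_one`). Energy estimates for m and for its difference
quotients then control the H¹ norm. A central difference scheme gives existence (`exists_isStrong`),
the L² energy gives uniqueness (`IsStrong.unique`), and boundedness of the energy increments
together with the Radon–Riesz property gives continuity in H¹ (`H1.radial_close`).

In dimension d ≥ 2 the set X(t) is rigid: before the final time it contains at most the zero density
(`eq_zero_of_bounded_evolutions`). A fixed planar shear, rescaled to a ball of radius r, keeps its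
sup norm, and its H¹ norm stays bounded because d ≥ 2; hence it remains in `Btilde` although its
shear rate c/r is unbounded. In the available time it brings within distance h = O(r²) of each other
two bits of mass that were about r/2 apart. Since the later density is R-Lipschitz, the initial
density varies by only O(r²) over the distance r/2. Its derivative therefore vanishes, and a
translation invariant density of bounded support is zero. `X_cases` records the resulting
alternative: d = 1, or zero density, or final time.

In each of these cases the evolution exists and is unique, depends on its initial density in a
Lipschitz way, moves little in H¹ over short times, and stays in X(s). The last point uses an
exponentially weighted energy, which gives propagation with speed at most M. The two halves of the
dynamic programming principle (`lowerValue_le_of_strategy`, `le_lowerValue_of_control`) then yield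
continuity of the value.

For the viscosity inequalities, running cost plus increment of a test function is to first order the
elapsed time times φ_t + `rate`, uniformly in the controls (`exists_expansion`). The mass is
Lipschitz in time in L² only, which suffices because test functions live on L²; its H¹ continuity is
used to freeze the state in `rate`. If the Isaacs expression were positive at a local maximum, every
field would have a reply making φ_t + `rate` at most -θ. A measurable selection of replies is a
non-anticipating strategy, and it would push the value below itself. If the expression were negative
at a local minimum, one constant field would do the opposite against every control. -/

noncomputable section

namespace MassGame

section

/-! ### Primitives of bounded functions with values in a normed space. -/

section Primitive

variable {E F : Type*} [NormedAddCommGroup E] [NormedSpace ℝ E] [NormedAddCommGroup F]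
  [NormedSpace ℝ F] {t T : ℝ} {v w v' w' : ℝ → E}

/-- `v` is on `[t, T]` a primitive of the essentially bounded function `w`. -/
structure IsPrim (t T : ℝ) (v w : ℝ → E) : Prop where
  meas : AEStronglyMeasurable w (volume.restrict (Icc t T))
  bdd : ∃ C, ∀ᵐ s ∂(volume.restrict (Icc t T)), ‖w s‖ ≤ C
  eq : ∀ s ∈ Icc t T, v s = v t + ∫ τ in t..s, w τ

theorem intervalIntegrable_of_bdd {r s : ℝ} (hr : r ∈ Icc t T) (hs : s ∈ Icc t T) {C : ℝ}
    (hm : AEStronglyMeasurable w (volume.restrict (Icc t T)))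
    (hb : ∀ᵐ s ∂(volume.restrict (Icc t T)), ‖w s‖ ≤ C) : IntervalIntegrable w volume r s := by
  have hI : IntegrableOn w (Icc t T) :=
    ⟨hm, HasFiniteIntegral.of_bounded hb⟩
  refine IntegrableOn.intervalIntegrable (hI.mono_set ?_)
  exact uIcc_subset_Icc hr hs

theorem ae_uIoc_of_ae_Icc {p : ℝ → Prop} {r s : ℝ} (hr : r ∈ Icc t T) (hs : s ∈ Icc t T)
    (h : ∀ᵐ s ∂(volume.restrict (Icc t T)), p s) : ∀ᵐ x, x ∈ uIoc r s → p x := by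
  rw [ae_restrict_iff' measurableSet_Icc] at h
  filter_upwards [h] with x hx hxs
  exact hx (uIcc_subset_Icc hr hs (uIoc_subset_uIcc hxs))

theorem norm_integral_le_of_ae {r s C : ℝ} (hr : r ∈ Icc t T) (hs : s ∈ Icc t T)
    (hb : ∀ᵐ s ∂(volume.restrict (Icc t T)), ‖w s‖ ≤ C) :
    ‖∫ τ in r..s, w τ‖ ≤ C * |s - r| :=
  intervalIntegral.norm_integral_le_of_norm_le_const_ae (ae_uIoc_of_ae_Icc hr hs hb)

theorem integral_congr_of_ae {r s : ℝ} (hr : r ∈ Icc t T) (hs : s ∈ Icc t T)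
    (hb : ∀ᵐ s ∂(volume.restrict (Icc t T)), w s = w' s) :
    ∫ τ in r..s, w τ = ∫ τ in r..s, w' τ :=
  intervalIntegral.integral_congr_ae (ae_uIoc_of_ae_Icc hr hs hb)

theorem integral_mono_of_ae {f g : ℝ → ℝ} {r s : ℝ} (hr : r ∈ Icc t T) (hs : s ∈ Icc t T)
    (hrs : r ≤ s) (hf : IntervalIntegrable f volume r s) (hg : IntervalIntegrable g volume r s)
    (h : ∀ᵐ s ∂(volume.restrict (Icc t T)), f s ≤ g s) :
    ∫ τ in r..s, f τ ≤ ∫ τ in r..s, g τ := by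
  refine intervalIntegral.integral_mono_ae_restrict hrs hf hg ?_
  exact ae_restrict_of_ae_restrict_of_subset (Icc_subset_Icc hr.1 hs.2) h

theorem IsPrim.intervalIntegrable (h : IsPrim t T v w) {r s : ℝ} (hr : r ∈ Icc t T)
    (hs : s ∈ Icc t T) : IntervalIntegrable w volume r s :=
  let ⟨_, hC⟩ := h.bdd
  intervalIntegrable_of_bdd hr hs h.meas hC

theorem IsPrim.sub_eq (h : IsPrim t T v w) {r s : ℝ} (hr : r ∈ Icc t T) (hs : s ∈ Icc t T) :
    v s - v r = ∫ τ in r..s, w τ := by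
  have ht : t ∈ Icc t T := ⟨le_rfl, hr.1.trans hr.2⟩
  rw [h.eq s hs, h.eq r hr, add_sub_add_left_eq_sub,
    intervalIntegral.integral_interval_sub_left (h.intervalIntegrable ht hs)
      (h.intervalIntegrable ht hr)]

theorem IsPrim.norm_sub_le (h : IsPrim t T v w) {C : ℝ}
    (hC : ∀ᵐ s ∂(volume.restrict (Icc t T)), ‖w s‖ ≤ C) {r s : ℝ} (hr : r ∈ Icc t T)
    (hs : s ∈ Icc t T) : ‖v s - v r‖ ≤ C * |s - r| := by
  rw [h.sub_eq hr hs]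
  exact norm_integral_le_of_ae hr hs hC

theorem IsPrim.exists_lipschitz (h : IsPrim t T v w) :
    ∃ C, 0 ≤ C ∧ ∀ r ∈ Icc t T, ∀ s ∈ Icc t T, ‖v s - v r‖ ≤ C * |s - r| := by
  obtain ⟨C, hC⟩ := h.bdd
  refine ⟨max C 0, le_max_right _ _, fun r hr s hs => (h.norm_sub_le hC hr hs).trans ?_⟩
  gcongr
  exact le_max_left _ _

theorem continuousOn_of_lipschitz {E : Type*} [NormedAddCommGroup E] {v : ℝ → E} {C : ℝ}
    (h : ∀ r ∈ Icc t T, ∀ s ∈ Icc t T, ‖v s - v r‖ ≤ C * |s - r|) :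
    ContinuousOn v (Icc t T) := by
  refine (LipschitzOnWith.of_dist_le_mul (K := C.toNNReal) fun s hs r hr => ?_).continuousOn
  rw [dist_eq_norm, Real.dist_eq]
  refine (h r hr s hs).trans ?_
  gcongr
  exact Real.le_coe_toNNReal C

theorem IsPrim.continuousOn (h : IsPrim t T v w) : ContinuousOn v (Icc t T) :=
  let ⟨_, _, hC⟩ := h.exists_lipschitz
  continuousOn_of_lipschitz hC

theorem IsPrim.mono (h : IsPrim t T v w) {r : ℝ} (hr : r ∈ Icc t T) : IsPrim r T v w := by
  have hsub : Icc r T ⊆ Icc t T := Icc_subset_Icc_left hr.1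
  refine ⟨h.meas.mono_measure (Measure.restrict_mono hsub le_rfl), ?_, fun s hs => ?_⟩
  · obtain ⟨C, hC⟩ := h.bdd
    exact ⟨C, ae_restrict_of_ae_restrict_of_subset hsub hC⟩
  · rw [← h.sub_eq hr (hsub hs)]
    abel

theorem IsPrim.sub (h : IsPrim t T v w) (h' : IsPrim t T v' w') :
    IsPrim t T (fun s => v s - v' s) (fun s => w s - w' s) := by
  refine ⟨h.meas.sub h'.meas, ?_, fun s hs => ?_⟩
  · obtain ⟨C, hC⟩ := h.bdd
    obtain ⟨C', hC'⟩ := h'.bdd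
    refine ⟨C + C', ?_⟩
    filter_upwards [hC, hC'] with s h1 h2
    exact (_root_.norm_sub_le _ _).trans (add_le_add h1 h2)
  · have ht : t ∈ Icc t T := ⟨le_rfl, hs.1.trans hs.2⟩
    rw [intervalIntegral.integral_sub (h.intervalIntegrable ht hs) (h'.intervalIntegrable ht hs),
      h.eq s hs, h'.eq s hs]
    abel

theorem IsPrim.clm_comp [CompleteSpace E] [CompleteSpace F] (h : IsPrim t T v w) (A : E →L[ℝ] F) :
    IsPrim t T (fun s => A (v s)) (fun s => A (w s)) := by
  refine ⟨A.continuous.comp_aestronglyMeasurable h.meas, ?_, fun s hs => ?_⟩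
  · obtain ⟨C, hC⟩ := h.bdd
    refine ⟨‖A‖ * C, ?_⟩
    filter_upwards [hC] with s h1
    exact (A.le_opNorm _).trans (by gcongr)
  · have ht : t ∈ Icc t T := ⟨le_rfl, hs.1.trans hs.2⟩
    rw [ContinuousLinearMap.intervalIntegral_comp_comm A (h.intervalIntegrable ht hs), ← map_add,
      ← h.eq s hs]

end Primitive

/-! ### The energy identity along a Lipschitz curve in a Hilbert space. -/

section Energy

variable {E : Type*} [NormedAddCommGroup E] [InnerProductSpace ℝ E] [CompleteSpace E] {t T : ℝ}
  {v w : ℝ → E}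

theorem IsPrim.inner_integrable (h : IsPrim t T v w) {r s : ℝ} (hr : r ∈ Icc t T)
    (hs : s ∈ Icc t T) : IntervalIntegrable (fun τ => 2 * inner ℝ (v τ) (w τ)) volume r s := by
  obtain ⟨C, hC⟩ := h.bdd
  obtain ⟨B, hB⟩ := isCompact_Icc.exists_bound_of_continuousOn h.continuousOn
  refine intervalIntegrable_of_bdd (C := 2 * (B * C)) hr hs ?_ ?_
  · exact ((h.continuousOn.aestronglyMeasurable measurableSet_Icc).inner h.meas).const_mul 2
  · filter_upwards [hC, ae_restrict_mem measurableSet_Icc] with τ h1 h2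
    rw [norm_mul, Real.norm_two]
    gcongr
    exact (norm_inner_le_norm _ _).trans
      (mul_le_mul (hB τ h2) h1 (norm_nonneg _) ((norm_nonneg _).trans (hB τ h2)))

/-- The squared norm of a Lipschitz curve is Lipschitz on a compact interval, hence the integral of
its almost everywhere derivative. Lebesgue differentiation of the primitive identifies the
derivative of v with w. -/
theorem IsPrim.energy (h : IsPrim t T v w) {r s : ℝ} (hr : r ∈ Icc t T) (hs : s ∈ Icc t T) :
    ‖v s‖ ^ 2 - ‖v r‖ ^ 2 = ∫ τ in r..s, 2 * inner ℝ (v τ) (w τ) := by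
  have ht : t ∈ Icc t T := ⟨le_rfl, hr.1.trans hr.2⟩
  have hsub : uIcc r s ⊆ Icc t T := uIcc_subset_Icc hr hs
  obtain ⟨C, hC0, hC⟩ := h.exists_lipschitz
  obtain ⟨B, hB⟩ := isCompact_Icc.exists_bound_of_continuousOn h.continuousOn
  have hB0 : 0 ≤ B := (norm_nonneg _).trans (hB r hr)
  have hac : AbsolutelyContinuousOnInterval (fun τ => ‖v τ‖ ^ 2) r s := by
    refine (LipschitzOnWith.of_dist_le_mul (K := (C * (2 * B)).toNNReal)
      fun x hx y hy => ?_).absolutelyContinuousOnInterval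
    rw [Real.dist_eq, Real.dist_eq, Real.coe_toNNReal _ (by positivity)]
    have e : ‖v x‖ ^ 2 - ‖v y‖ ^ 2 = (‖v x‖ - ‖v y‖) * (‖v x‖ + ‖v y‖) := by ring
    rw [e, abs_mul, mul_right_comm]
    have h1 : |‖v x‖ - ‖v y‖| ≤ C * |x - y| :=
      (abs_norm_sub_norm_le _ _).trans (hC y (hsub hy) x (hsub hx))
    have h2 : |‖v x‖ + ‖v y‖| ≤ 2 * B := by
      rw [abs_of_nonneg (by positivity), two_mul]
      exact add_le_add (hB x (hsub hx)) (hB y (hsub hy))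
    exact mul_le_mul h1 h2 (abs_nonneg _) (by positivity)
  rw [← hac.integral_deriv_eq_sub]
  refine intervalIntegral.integral_congr_ae ?_
  -- The formula for v is known on [t, T] only, so v can be differentiated at interior points; the
  -- two endpoints form a null set.
  have hne1 : ∀ᵐ x : ℝ, x ≠ t := by simp [ae_iff, measure_singleton]
  have hne2 : ∀ᵐ x : ℝ, x ≠ T := by simp [ae_iff, measure_singleton]
  have hd := (h.intervalIntegrable ht ⟨hr.1.trans hr.2, le_rfl⟩).ae_hasDerivAt_integral
  filter_upwards [hne1, hne2, hd] with x h1 h2 h3 hx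
  have hxI : x ∈ Icc t T := hsub (uIoc_subset_uIcc hx)
  have huIcc : uIcc t T = Icc t T := uIcc_of_le ht.2
  have hv : HasDerivAt v (w x) x := by
    have := (h3 (huIcc ▸ hxI) t (huIcc ▸ ht)).const_add (v t)
    refine this.congr_of_eventuallyEq ?_
    filter_upwards [Icc_mem_nhds (lt_of_le_of_ne hxI.1 (Ne.symm h1)) (lt_of_le_of_ne hxI.2 h2)]
      with y hy
    exact h.eq y hy
  exact hv.norm_sq.deriv

theorem IsPrim.energy_le (h : IsPrim t T v w) {g : ℝ → ℝ} {r s : ℝ} (hr : r ∈ Icc t T)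
    (hs : s ∈ Icc t T) (hrs : r ≤ s) (hg : IntervalIntegrable g volume r s)
    (hle : ∀ᵐ τ ∂(volume.restrict (Icc t T)), 2 * inner ℝ (v τ) (w τ) ≤ g τ) :
    ‖v s‖ ^ 2 ≤ ‖v r‖ ^ 2 + ∫ τ in r..s, g τ := by
  have := h.energy hr hs
  have h2 := integral_mono_of_ae hr hs hrs (h.inner_integrable hr hs) hg hle
  linarith

/-- Transport is reversible in time, and the backward estimate is what makes the increments of the
norm two-sided, as needed for continuity. -/
theorem IsPrim.le_energy (h : IsPrim t T v w) {g : ℝ → ℝ} {r s : ℝ} (hr : r ∈ Icc t T)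
    (hs : s ∈ Icc t T) (hrs : r ≤ s) (hg : IntervalIntegrable g volume r s)
    (hle : ∀ᵐ τ ∂(volume.restrict (Icc t T)), -g τ ≤ 2 * inner ℝ (v τ) (w τ)) :
    ‖v r‖ ^ 2 ≤ ‖v s‖ ^ 2 + ∫ τ in r..s, g τ := by
  have := h.energy hr hs
  have h2 := integral_mono_of_ae hr hs hrs (show IntervalIntegrable (fun τ => -g τ) volume r s from hg.neg) (h.inner_integrable hr hs) hle
  rw [intervalIntegral.integral_neg] at h2
  linarith

end Energy

/-! ### Gronwall's inequality and Carathéodory's theorem. -/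

section Integral

variable {t T : ℝ}

theorem gronwall_integral {f : ℝ → ℝ} {a K : ℝ} (hK : 0 ≤ K) (hf : ContinuousOn f (Icc t T))
    (h : ∀ s ∈ Icc t T, f s ≤ a + K * ∫ τ in t..s, f τ) :
    ∀ s ∈ Icc t T, f s ≤ a * Real.exp (K * (s - t)) := by
  intro s hs
  have htT : t ≤ T := hs.1.trans hs.2
  have ht : t ∈ Icc t T := ⟨le_rfl, htT⟩
  -- Extending f by its endpoint values makes the integral differentiable at every point.
  set g : ℝ → ℝ := IccExtend htT (fun x : Icc t T => f x) with hg
  have hgc : Continuous g := (continuousOn_iff_continuous_domRestrict.1 hf).Icc_extend'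
  have hgf : ∀ x ∈ Icc t T, g x = f x := fun x hx => by
    rw [hg, IccExtend_of_mem _ _ hx]
  have hint : ∀ x ∈ Icc t T, ∫ τ in t..x, f τ = ∫ τ in t..x, g τ := fun x hx => by
    refine intervalIntegral.integral_congr fun y hy => ?_
    exact (hgf y (uIcc_subset_Icc ht hx hy)).symm
  have hF : ∀ x, HasDerivAt (fun x => a + K * ∫ τ in t..x, g τ) (K * g x) x := fun x =>
    ((hgc.integral_hasStrictDerivAt t x).hasDerivAt.const_mul K).const_add a
  have key := le_gronwallBound_of_liminf_deriv_right_le (f := fun x => a + K * ∫ τ in t..x, g τ)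
    (f' := fun x => K * g x) (δ := a) (K := K) (ε := 0) (a := t) (b := T)
    (fun x _ => (hF x).continuousAt.continuousWithinAt)
    (fun x _ r hr => ((hF x).hasDerivWithinAt (s := Ici x)).liminf_right_slope_le hr) (by simp)
    (fun x hx => by
      have hx' : x ∈ Icc t T := ⟨hx.1, hx.2.le⟩
      rw [add_zero]
      refine mul_le_mul_of_nonneg_left ?_ hK
      rw [hgf x hx', ← hint x hx']
      exact h x hx') s hs
  rw [gronwallBound_ε0] at key
  rw [← hint s hs] at key
  exact (h s hs).trans key

variable {E : Type*} [NormedAddCommGroup E] [NormedSpace ℝ E]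

/-- Carathéodory's existence theorem for a bounded right-hand side that is Lipschitz in the
state. -/
theorem exists_integral_solution [CompleteSpace E] (htT : t ≤ T) (F : ℝ → E → E) {L C : ℝ}
    (hL : 0 ≤ L)
    (hm : ∀ u : ℝ → E, Continuous u →
      AEStronglyMeasurable (fun τ => F τ (u τ)) (volume.restrict (Icc t T)))
    (hlip : ∀ᵐ τ ∂(volume.restrict (Icc t T)), ∀ u v, ‖F τ u - F τ v‖ ≤ L * ‖u - v‖)
    (hb : ∀ᵐ τ ∂(volume.restrict (Icc t T)), ‖F τ 0‖ ≤ C) (x : E) :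
    ∃ u : ℝ → E, Continuous u ∧ u t = x ∧ IsPrim t T u (fun τ => F τ (u τ)) := by
  have htm : t ∈ Icc t T := ⟨le_rfl, htT⟩
  have hprim : ∀ u : ℝ → E, Continuous u →
      ∃ B, ∀ᵐ τ ∂(volume.restrict (Icc t T)), ‖F τ (u τ)‖ ≤ B := by
    intro u hu
    obtain ⟨B, hB⟩ := (isCompact_Icc (a := t) (b := T)).exists_bound_of_continuousOn
      hu.continuousOn
    refine ⟨L * B + C, ?_⟩
    filter_upwards [hlip, hb, ae_restrict_mem measurableSet_Icc] with τ h1 h2 h3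
    calc ‖F τ (u τ)‖ = ‖(F τ (u τ) - F τ 0) + F τ 0‖ := by rw [sub_add_cancel]
      _ ≤ ‖F τ (u τ) - F τ 0‖ + ‖F τ 0‖ := norm_add_le _ _
      _ ≤ L * ‖u τ - 0‖ + C := add_le_add (h1 _ _) h2
      _ ≤ L * B + C := by
        rw [sub_zero]
        gcongr
        exact hB τ h3
  have hP : ∀ u : ℝ → E, Continuous u →
      IsPrim t T (fun s => x + ∫ τ in t..s, F τ (u τ)) (fun τ => F τ (u τ)) := fun u hu =>
    ⟨hm u hu, hprim u hu, fun s _ => by simp⟩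
  -- Exponential weight: the unknown is v(s) = exp(-lam s) u(s). Integrating exp(lam τ) gains a
  -- factor 1/lam, so the Picard map contracts by L/lam ≤ 1/2 on the whole interval at once.
  set lam : ℝ := 2 * L + 1 with hlam
  have hlam0 : 0 < lam := by positivity
  -- the weighted unknown
  let ext : C(Icc t T, E) → ℝ → E := fun v s => Real.exp (lam * s) • IccExtend htT v s
  have hext : ∀ v, Continuous (ext v) := fun v =>
    (Real.continuous_exp.comp (continuous_const.mul continuous_id)).smul
      (v.continuous.Icc_extend')
  let Q : C(Icc t T, E) → C(Icc t T, E) := fun v =>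
    ⟨fun s => Real.exp (-(lam * s)) • (x + ∫ τ in t..(s : ℝ), F τ (ext v τ)), by
      refine Continuous.smul (by fun_prop) ?_
      exact continuousOn_iff_continuous_domRestrict.1 (hP _ (hext v)).continuousOn⟩
  have hQ : ContractingWith (1 / 2) Q := by
    refine ⟨by rw [← NNReal.coe_lt_coe]; norm_num, LipschitzWith.of_dist_le_mul fun v w => ?_⟩
    rw [ContinuousMap.dist_le (by positivity)]
    intro s
    have hs := s.2
    have hi : ∀ v, IntervalIntegrable (fun τ => F τ (ext v τ)) volume t s := fun v =>
      (hP _ (hext v)).intervalIntegrable htm hs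
    change dist (Real.exp (-(lam * s)) • (x + ∫ τ in t..(s : ℝ), F τ (ext v τ)))
      (Real.exp (-(lam * s)) • (x + ∫ τ in t..(s : ℝ), F τ (ext w τ))) ≤ _
    rw [dist_eq_norm, ← smul_sub, add_sub_add_left_eq_sub,
      ← intervalIntegral.integral_sub (hi v) (hi w), norm_smul, Real.norm_of_nonneg (by positivity)]
    have hbound : ‖∫ τ in t..(s : ℝ), (F τ (ext v τ) - F τ (ext w τ))‖ ≤
        ∫ τ in t..(s : ℝ), L * dist v w * Real.exp (lam * τ) := by
      refine intervalIntegral.norm_integral_le_of_norm_le hs.1 ?_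
        (Continuous.intervalIntegrable (by fun_prop) _ _)
      have := ae_uIoc_of_ae_Icc htm hs hlip
      rw [uIoc_of_le hs.1] at this
      filter_upwards [this] with τ h1 h2
      refine (h1 h2 _ _).trans ?_
      change L * ‖Real.exp (lam * τ) • IccExtend htT v τ - Real.exp (lam * τ) • IccExtend htT w τ‖
        ≤ _
      rw [← smul_sub, norm_smul, Real.norm_of_nonneg (by positivity), mul_assoc, mul_comm (dist v w)]
      gcongr
      rw [← dist_eq_norm]
      exact ContinuousMap.dist_apply_le_dist _
    have hint : ∫ τ in t..(s : ℝ), L * dist v w * Real.exp (lam * τ) =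
        L * dist v w * ((Real.exp (lam * s) - Real.exp (lam * t)) / lam) := by
      rw [intervalIntegral.integral_const_mul, intervalIntegral.integral_comp_mul_left
        (fun y => Real.exp y) hlam0.ne', integral_exp, smul_eq_mul]
      ring
    rw [hint] at hbound
    calc Real.exp (-(lam * s)) * ‖∫ τ in t..(s : ℝ), (F τ (ext v τ) - F τ (ext w τ))‖
        ≤ Real.exp (-(lam * s)) * (L * dist v w * ((Real.exp (lam * s)) / lam)) := by
          gcongr
          refine hbound.trans ?_
          gcongr
          linarith [Real.exp_pos (lam * t)]
      _ = (L / lam) * dist v w := by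
          rw [Real.exp_neg]
          have := (Real.exp_pos (lam * s)).ne'
          field_simp
      _ ≤ ((1 / 2 : NNReal) : ℝ) * dist v w := by
          gcongr
          rw [div_le_iff₀ hlam0]
          push_cast
          linarith
  have : Nonempty (Icc t T) := ⟨⟨t, htm⟩⟩
  set v := hQ.fixedPoint Q with hv
  have hfix : Q v = v := hQ.fixedPoint_isFixedPt
  have hval : ∀ s ∈ Icc t T, ext v s = x + ∫ τ in t..s, F τ (ext v τ) := by
    intro s hs
    have h1 : v ⟨s, hs⟩ = Real.exp (-(lam * s)) • (x + ∫ τ in t..s, F τ (ext v τ)) := by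
      conv_lhs => rw [← hfix]
      rfl
    change Real.exp (lam * s) • IccExtend htT v s = _
    rw [IccExtend_of_mem _ _ hs, h1, smul_smul, ← Real.exp_add, add_neg_cancel, Real.exp_zero,
      one_smul]
  have ht' : ext v t = x := by
    rw [hval t htm]; simp
  exact ⟨ext v, hext v, ht', hm _ (hext v), hprim _ (hext v), fun s hs => by rw [ht', hval s hs]⟩

end Integral

end

section

/-! ### Weak limits in a Hilbert space. -/

section WeakLimit

variable {H : Type*} [NormedAddCommGroup H] [InnerProductSpace ℝ H] [CompleteSpace H]

/-- Banach–Alaoglu along an ultrafilter. No subsequence is extracted, since only pairings that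
already converge have to be identified. -/
theorem exists_weak_limit {x : ℕ → H} {C : ℝ} (hx : ∀ n, ‖x n‖ ≤ C) :
    ∃ y : H, ∀ z l, Tendsto (fun n => inner ℝ (x n) z) atTop (𝓝 l) → inner ℝ y z = l := by
  let D : ℕ → WeakDual ℝ H := fun n => StrongDual.toWeakDual (InnerProductSpace.toDual ℝ H (x n))
  have hc := WeakDual.isCompact_closedBall (𝕜 := ℝ) (E := H) 0 C
  have hD : ∀ n, D n ∈ WeakDual.toStrongDual ⁻¹' Metric.closedBall (0 : StrongDual ℝ H) C := by
    intro n
    rw [mem_preimage, mem_closedBall_zero_iff]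
    change ‖InnerProductSpace.toDual ℝ H (x n)‖ ≤ C
    rw [LinearIsometryEquiv.norm_map]
    exact hx n
  obtain ⟨y, -, hy⟩ := hc.ultrafilter_le_nhds ((Filter.hyperfilter ℕ).map D)
    (by rw [le_principal_iff]; exact Filter.mem_map.2 (Eventually.of_forall hD))
  refine ⟨(InnerProductSpace.toDual ℝ H).symm (WeakDual.toStrongDual y), fun z l hl => ?_⟩
  rw [InnerProductSpace.toDual_symm_apply]
  have h1 : Tendsto (fun n => D n z) (Filter.hyperfilter ℕ) (𝓝 (y z)) :=
    ((WeakDual.eval_continuous z).tendsto y).comp hy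
  have h2 : Tendsto (fun n => D n z) (Filter.hyperfilter ℕ) (𝓝 l) :=
    (hl.congr fun n => rfl).mono_left (Nat.hyperfilter_le_atTop)
  exact tendsto_nhds_unique h1 h2

end WeakLimit

variable {d : ℕ}

/-- The standard basis vector `e_i`. -/
abbrev bvec (i : Fin d) : Pt d := EuclideanSpace.single i (1 : ℝ)

/-! ### The translation group on L². -/

section Trans

/-- Translation `u ↦ u(· + v)` on `L²`. -/
def trans (v : Pt d) : L2s d →ₗᵢ[ℝ] L2s d :=
  Lp.compMeasurePreservingₗᵢ ℝ (fun x : Pt d => x + v) (measurePreserving_add_right volume v)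

theorem trans_coe (v : Pt d) (u : L2s d) : trans v u =ᵐ[volume] fun x => u (x + v) :=
  Lp.coeFn_compMeasurePreserving u (measurePreserving_add_right volume v)

theorem trans_trans (v w : Pt d) (u : L2s d) : trans v (trans w u) = trans (v + w) u := by
  apply Lp.ext
  have h1 := (measurePreserving_add_right (volume : Measure (Pt d)) v).quasiMeasurePreserving.ae_eq_comp
    (trans_coe w u)
  filter_upwards [trans_coe v (trans w u), trans_coe (v + w) u, h1] with x h2 h3 h4
  rw [h2, h3]
  simp only [Function.comp_apply] at h4
  rw [h4, add_assoc]

theorem trans_zero (u : L2s d) : trans 0 u = u := by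
  apply Lp.ext
  filter_upwards [trans_coe 0 u] with x h
  rw [h, add_zero]

theorem continuous_trans (u : L2s d) : Continuous fun v : Pt d => trans v u := by
  have hg : Continuous fun v : Pt d => (⟨fun x : Pt d => x + v, by fun_prop⟩ : C(Pt d, Pt d)) :=
    ContinuousMap.continuous_of_continuous_uncurry _ (by
      change Continuous fun p : Pt d × Pt d => p.2 + p.1
      fun_prop)
  exact Continuous.compMeasurePreservingLp (f := fun _ => u) continuous_const hg
    (fun v => measurePreserving_add_right volume v) (by simp)

theorem inner_trans_left (v : Pt d) (u w : L2s d) :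
    inner ℝ (trans v u) w = inner ℝ u (trans (-v) w) := by
  rw [← (trans v).inner_map_map u (trans (-v) w), trans_trans, add_neg_cancel, trans_zero]

/-- Translation of bounded continuous functions. -/
def transB (v : Pt d) (c : Pt d →ᵇ ℝ) : Pt d →ᵇ ℝ :=
  c.compContinuous ⟨fun x => x + v, by fun_prop⟩

@[simp] theorem transB_apply (v : Pt d) (c : Pt d →ᵇ ℝ) (x : Pt d) : transB v c x = c (x + v) := rfl

theorem transB_zero (c : Pt d →ᵇ ℝ) : transB 0 c = c := by
  ext x; simp

end Trans

/-! ### Multiplication operators on L². -/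

section Mul

theorem memLp_bcf_mul (c : Pt d →ᵇ ℝ) (u : L2s d) :
    MemLp (fun x => c x * u x) 2 (volume : Measure (Pt d)) := by
  refine MemLp.of_le_mul (c := ‖c‖) (Lp.memLp u)
    (c.continuous.aestronglyMeasurable.mul (Lp.aestronglyMeasurable u)) ?_
  refine Eventually.of_forall fun x => ?_
  rw [norm_mul]
  gcongr
  exact c.norm_coe_le_norm x

/-- Multiplication of `L²` functions by bounded continuous functions, as a bilinear map. -/
def mulBil : (Pt d →ᵇ ℝ) →L[ℝ] L2s d →L[ℝ] L2s d :=
  LinearMap.mkContinuous₂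
    (LinearMap.mk₂ ℝ (fun c u => (memLp_bcf_mul c u).toLp _)
      (fun c c' u => by
        rw [← MemLp.toLp_add]
        refine MemLp.toLp_congr _ _ (Eventually.of_forall fun x => ?_)
        simp [add_mul])
      (fun a c u => by
        rw [← MemLp.toLp_const_smul]
        refine MemLp.toLp_congr _ _ (Eventually.of_forall fun x => ?_)
        simp [mul_assoc])
      (fun c u u' => by
        rw [← MemLp.toLp_add]
        refine MemLp.toLp_congr _ _ ?_
        filter_upwards [Lp.coeFn_add u u'] with x hx
        rw [hx, Pi.add_apply, Pi.add_apply, mul_add])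
      (fun a c u => by
        rw [← MemLp.toLp_const_smul]
        refine MemLp.toLp_congr _ _ ?_
        filter_upwards [Lp.coeFn_smul a u] with x hx
        simp [hx, mul_left_comm]))
    1 (fun c u => by
      rw [one_mul]
      refine Lp.norm_le_mul_norm_of_ae_le_mul ?_
      filter_upwards [(memLp_bcf_mul c u).coeFn_toLp] with x hx
      change ‖((memLp_bcf_mul c u).toLp _ : L2s d) x‖ ≤ _
      rw [hx, norm_mul]
      gcongr
      exact c.norm_coe_le_norm x)

/-- Multiplication by a bounded continuous function on `L²`. -/
def mulL (c : Pt d →ᵇ ℝ) : L2s d →L[ℝ] L2s d := mulBil c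

theorem continuous_mulL : Continuous (mulL : (Pt d →ᵇ ℝ) → L2s d →L[ℝ] L2s d) := mulBil.continuous

theorem mulL_smul_left (a : ℝ) (c : Pt d →ᵇ ℝ) (u : L2s d) : mulL (a • c) u = a • mulL c u :=
  congrArg (fun A : L2s d →L[ℝ] L2s d => A u) (mulBil.map_smul a c)

theorem mulL_sub_left (c c' : Pt d →ᵇ ℝ) (u : L2s d) : mulL (c - c') u = mulL c u - mulL c' u :=
  congrArg (fun A : L2s d →L[ℝ] L2s d => A u) (mulBil.map_sub c c')

theorem mulL_sum_left {ι : Type*} (s : Finset ι) (c : ι → Pt d →ᵇ ℝ) (u : L2s d) :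
    mulL (∑ i ∈ s, c i) u = ∑ i ∈ s, mulL (c i) u := by
  have : mulL (∑ i ∈ s, c i) = ∑ i ∈ s, mulL (c i) := map_sum mulBil c s
  rw [this]
  exact _root_.sum_apply _ _ _

theorem hasDerivAt_mulL {f : ℝ → Pt d →ᵇ ℝ} {c : Pt d →ᵇ ℝ} {s : ℝ} (h : HasDerivAt f c s) :
    HasDerivAt (fun r => mulL (f r)) (mulL c) s :=
  (mulBil.hasFDerivAt).comp_hasDerivAt s h

theorem mulL_coe (c : Pt d →ᵇ ℝ) (u : L2s d) : mulL c u =ᵐ[volume] fun x => c x * u x :=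
  (memLp_bcf_mul c u).coeFn_toLp

theorem norm_mulL_le {c : Pt d →ᵇ ℝ} {K : ℝ} (h : ∀ x, |c x| ≤ K) (u : L2s d) :
    ‖mulL c u‖ ≤ K * ‖u‖ := by
  refine Lp.norm_le_mul_norm_of_ae_le_mul ?_
  filter_upwards [mulL_coe c u] with x hx
  rw [hx, norm_mul]
  gcongr
  exact h x

theorem inner_L2s (u w : L2s d) : inner ℝ u w = ∫ x, u x * w x := by
  rw [L2.inner_def]
  refine integral_congr_ae (Eventually.of_forall fun x => ?_)
  simp [mul_comm]

theorem integrable_mul_L2s (u w : L2s d) : Integrable (fun x => u x * w x) volume := by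
  have := L2.integrable_inner (𝕜 := ℝ) u w
  refine this.congr (Eventually.of_forall fun x => ?_)
  simp [mul_comm]

theorem inner_mulL_left (c : Pt d →ᵇ ℝ) (u w : L2s d) :
    inner ℝ (mulL c u) w = ∫ x, c x * u x * w x := by
  rw [inner_L2s]
  refine integral_congr_ae ?_
  filter_upwards [mulL_coe c u] with x hx
  rw [hx]

theorem inner_mulL_comm (c : Pt d →ᵇ ℝ) (u w : L2s d) :
    inner ℝ (mulL c u) w = inner ℝ u (mulL c w) := by
  rw [inner_mulL_left, inner_L2s]
  refine integral_congr_ae ?_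
  filter_upwards [mulL_coe c w] with x hx
  rw [hx]; ring

theorem mulL_mulL (c c' : Pt d →ᵇ ℝ) (u : L2s d) : mulL c (mulL c' u) = mulL (c * c') u := by
  apply Lp.ext
  filter_upwards [mulL_coe c (mulL c' u), mulL_coe c' u, mulL_coe (c * c') u] with x h1 h2 h3
  rw [h1, h2, h3, BoundedContinuousFunction.mul_apply, mul_assoc]

theorem trans_mulL (v : Pt d) (c : Pt d →ᵇ ℝ) (u : L2s d) :
    trans v (mulL c u) = mulL (transB v c) (trans v u) := by
  apply Lp.ext
  have h1 := (measurePreserving_add_right (volume : Measure (Pt d)) v).quasiMeasurePreserving.ae_eq_comp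
    (mulL_coe c u)
  filter_upwards [trans_coe v (mulL c u), mulL_coe (transB v c) (trans v u), trans_coe v u, h1]
    with x h2 h3 h4 h5
  rw [h2, h3, h4]
  exact h5

theorem inner_mulL_self_le {c : Pt d →ᵇ ℝ} {K : ℝ} (h : ∀ x, |c x| ≤ K) (u : L2s d) :
    |inner ℝ (mulL c u) u| ≤ K * ‖u‖ ^ 2 := by
  refine (abs_real_inner_le_norm _ _).trans ?_
  rw [pow_two, ← mul_assoc]
  gcongr
  exact norm_mulL_le h u

end Mul

/-! ### Partial derivatives as derivatives of the translation group. -/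

section Dpart

/-- `g` is the `i`-th partial derivative of `u` as a limit of difference quotients in `L²`. -/
def Dpart (i : Fin d) (u g : L2s d) : Prop :=
  HasDerivAt (fun h : ℝ => trans (h • bvec i) u) g 0

/-- `c'` is the `i`-th partial derivative of `c` as a uniform limit of difference quotients. -/
def DpartB (i : Fin d) (c c' : Pt d →ᵇ ℝ) : Prop :=
  HasDerivAt (fun h : ℝ => transB (h • bvec i) c) c' 0

/-- The mean value inequality for s ↦ c(x + s e_i) - s c'(x) bounds the error by the oscillation of
c' over a distance |s|, and uniform continuity makes this independent of x. -/
theorem DpartB.of_uniformContinuous {i : Fin d} {c c' : Pt d →ᵇ ℝ}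
    (h : ∀ x, HasDerivAt (fun s : ℝ => c (x + s • bvec i)) (c' x) 0)
    (hu : UniformContinuous c') : DpartB i c c' := by
  have hall : ∀ x (s : ℝ), HasDerivAt (fun s : ℝ => c (x + s • bvec i)) (c' (x + s • bvec i)) s := by
    intro x s
    have h1 := (h (x + s • bvec i))
    have h2 : HasDerivAt (fun r : ℝ => c (x + s • bvec i + (r - s) • bvec i))
        (c' (x + s • bvec i)) s := by
      have h1' : HasDerivAt (fun r : ℝ => c (x + s • bvec i + r • bvec i))
          (c' (x + s • bvec i)) (s - s) := by rwa [sub_self]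
      exact h1'.comp_sub_const s s
    refine h2.congr_of_eventuallyEq (Eventually.of_forall fun r => ?_)
    simp only
    rw [add_assoc, ← add_smul, add_sub_cancel]
  rw [DpartB, hasDerivAt_iff_isLittleO_nhds_zero, Asymptotics.isLittleO_iff]
  intro ε hε
  obtain ⟨δ, hδ, hu⟩ := Metric.uniformContinuous_iff.1 hu ε hε
  filter_upwards [Metric.ball_mem_nhds (0 : ℝ) hδ] with r hr
  rw [mem_ball_zero_iff, Real.norm_eq_abs] at hr
  rw [BoundedContinuousFunction.norm_le (by positivity)]
  intro x
  have key : ∀ s ∈ uIcc 0 r, ‖c' (x + s • bvec i) - c' x‖ ≤ ε := by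
    intro s hs
    have hs' : |s| ≤ |r| := by
      have := abs_sub_left_of_mem_uIcc hs
      simpa using this
    refine (hu ?_).le
    rw [dist_eq_norm, add_sub_cancel_left, norm_smul]
    simpa using hs'.trans_lt hr
  have hd : ∀ s ∈ uIcc 0 r, HasDerivWithinAt (fun s : ℝ => c (x + s • bvec i) - s * c' x)
      (c' (x + s • bvec i) - c' x) (uIcc 0 r) s := fun s _ => by
    have h2 : HasDerivAt (fun s : ℝ => s * c' x) (1 * c' x) s := (hasDerivAt_id s).mul_const _
    rw [one_mul] at h2
    exact ((hall x s).sub h2).hasDerivWithinAt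
  have := (convex_uIcc 0 r).norm_image_sub_le_of_norm_hasDerivWithin_le hd key left_mem_uIcc
    right_mem_uIcc
  simp only [zero_smul, add_zero, zero_mul, sub_zero] at this
  simp only [zero_add, zero_smul, transB_zero, BoundedContinuousFunction.coe_sub, Pi.sub_apply,
    BoundedContinuousFunction.coe_smul, smul_eq_mul, transB_apply]
  have e : c (x + r • bvec i) - c x - r * c' x = c (x + r • bvec i) - r * c' x - c x := by ring
  rw [e]
  exact this

variable {i : Fin d} {u g w k : L2s d} {c c' : Pt d →ᵇ ℝ}

theorem Dpart.sub (h : Dpart i u g) (h' : Dpart i w k) : Dpart i (u - w) (g - k) := by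
  unfold Dpart
  simp only [map_sub]
  exact HasDerivAt.sub h h'

theorem Dpart.smul (a : ℝ) (h : Dpart i u g) : Dpart i (a • u) (a • g) := by
  unfold Dpart
  simp only [map_smul]
  exact HasDerivAt.const_smul a h

theorem Dpart.unique (h : Dpart i u g) (h' : Dpart i u k) : g = k := HasDerivAt.unique h h'

theorem Dpart.translate (v : Pt d) (h : Dpart i u g) : Dpart i (trans v u) (trans v g) := by
  have := ((trans v).toContinuousLinearMap.hasFDerivAt (x := trans ((0 : ℝ) • bvec i) u)).comp_hasDerivAt
    (0 : ℝ) h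
  refine HasDerivAt.congr_of_eventuallyEq this (Eventually.of_forall fun s => ?_)
  simp only [Function.comp_apply, LinearIsometry.coe_toContinuousLinearMap]
  rw [trans_trans, trans_trans, add_comm]

theorem Dpart.hasDerivAt (h : Dpart i u g) (s : ℝ) :
    HasDerivAt (fun h : ℝ => trans (h • bvec i) u) (trans (s • bvec i) g) s := by
  have h1 : HasDerivAt (fun h : ℝ => trans (h • bvec i) (trans (s • bvec i) u))
    (trans (s • bvec i) g) (s - s) := by
    rw [sub_self]; exact h.translate _
  refine (h1.comp_sub_const s s).congr_of_eventuallyEq (Eventually.of_forall fun r => ?_)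
  simp only
  rw [trans_trans, ← add_smul, sub_add_cancel]

theorem Dpart.norm_trans_sub_le (h : Dpart i u g) (s : ℝ) :
    ‖trans (s • bvec i) u - u‖ ≤ |s| * ‖g‖ := by
  have := (convex_univ (𝕜 := ℝ) (E := ℝ)).norm_image_sub_le_of_norm_hasDerivWithin_le
    (C := ‖g‖) (x := 0) (y := s) (fun r _ => (h.hasDerivAt r).hasDerivWithinAt)
    (fun r _ => ((trans _).norm_map g).le) (mem_univ _) (mem_univ _)
  simpa [trans_zero, mul_comm] using this

/-- Translations are multiplicative, so the Leibniz rule is the product rule for s ↦ (τ_s c)(τ_s u)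
at s = 0. -/
theorem Dpart.mulL (hc : DpartB i c c') (h : Dpart i u g) :
    Dpart i (mulL c u) (mulL c' u + mulL c g) := by
  have h1 : HasDerivAt (fun s : ℝ => MassGame.mulL (transB (s • bvec i) c)) (MassGame.mulL c') 0 :=
    hasDerivAt_mulL hc
  have h2 := h1.clm_apply h
  simp only [zero_smul, trans_zero, transB_zero] at h2
  refine HasDerivAt.congr_of_eventuallyEq h2 (Eventually.of_forall fun s => ?_)
  exact trans_mulL _ _ _

/-- Integration by parts. -/
theorem Dpart.inner_add_inner (h : Dpart i u g) (h' : Dpart i w k) :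
    inner ℝ u k + inner ℝ g w = 0 := by
  -- Translations are isometries: ⟨τ_s u, τ_s w⟩ does not depend on s, and its derivative at 0 is
  -- the left-hand side.
  have h1 := HasDerivAt.inner ℝ h h'
  simp only [zero_smul, trans_zero, LinearIsometry.inner_map_map] at h1
  exact h1.unique (hasDerivAt_const _ _)

/-- The cancellation behind all transport estimates: no derivative of u survives on the right. -/
theorem Dpart.inner_mulL (hc : DpartB i c c') (h : Dpart i u g) :
    2 * inner ℝ u (MassGame.mulL c g) = - inner ℝ (MassGame.mulL c' u) u := by
  have h1 := (h.mulL hc).inner_add_inner h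
  have h2 : inner ℝ (MassGame.mulL c g) u = inner ℝ u (MassGame.mulL c g) := real_inner_comm _ _
  rw [inner_add_left, inner_mulL_comm c u g, h2] at h1
  linarith

end Dpart

end

/-! ### Test functions and H¹ in terms of translations. -/

section

variable {d : ℕ}

/-- Test functions `φ ∈ C_c^∞(ℝ^d)`. -/
structure Test (d : ℕ) where
  f : Pt d → ℝ
  smooth : ContDiff ℝ (⊤ : ℕ∞) f
  supp : HasCompactSupport f

namespace Test

theorem memLp (φ : Test d) : MemLp φ.f 2 (volume : Measure (Pt d)) :=
  φ.smooth.continuous.memLp_of_hasCompactSupport φ.supp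

/-- A test function as an element of `L²`. -/
def toL2 (φ : Test d) : L2s d := φ.memLp.toLp φ.f

theorem toL2_coe (φ : Test d) : φ.toL2 =ᵐ[volume] φ.f := φ.memLp.coeFn_toLp

/-- A test function as a bounded continuous function. -/
def toB (φ : Test d) : Pt d →ᵇ ℝ :=
  BoundedContinuousFunction.ofNormedAddCommGroup φ.f φ.smooth.continuous
    (Classical.choose (φ.supp.exists_bound_of_continuous φ.smooth.continuous))
    (Classical.choose_spec (φ.supp.exists_bound_of_continuous φ.smooth.continuous))

@[simp] theorem toB_apply (φ : Test d) (x : Pt d) : φ.toB x = φ.f x := rfl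

/-- The derivative of a test function in a direction. -/
def der (φ : Test d) (v : Pt d) : Test d where
  f := fun x => fderiv ℝ φ.f x v
  smooth := (φ.smooth.fderiv_right (m := (⊤ : ℕ∞)) (by simp)).clm_apply contDiff_const
  supp := φ.supp.fderiv_apply ℝ v

/-- Translates of test functions. -/
def shift (φ : Test d) (v : Pt d) : Test d where
  f := fun x => φ.f (x + v)
  smooth := φ.smooth.comp (contDiff_id.add contDiff_const)
  supp := φ.supp.comp_homeomorph (Homeomorph.addRight v)

theorem trans_toL2 (φ : Test d) (v : Pt d) : trans v φ.toL2 = (φ.shift v).toL2 := by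
  apply Lp.ext
  have h1 := (measurePreserving_add_right (volume : Measure (Pt d)) v).quasiMeasurePreserving.ae_eq_comp
    φ.toL2_coe
  filter_upwards [trans_coe v φ.toL2, (φ.shift v).toL2_coe, h1] with x h2 h3 h4
  rw [h2, h3]
  exact h4

theorem der_shift (φ : Test d) (v w : Pt d) : (φ.der w).shift v = (φ.shift v).der w := by
  simp only [der, shift, Test.mk.injEq]
  funext x
  rw [fderiv_comp_add_right]

theorem inner_toL2 (u : L2s d) (φ : Test d) : inner ℝ u φ.toL2 = ∫ x, u x * φ.f x := by
  rw [inner_L2s]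
  refine integral_congr_ae ?_
  filter_upwards [φ.toL2_coe] with x hx
  rw [hx]

theorem _root_.MassGame.ext_of_test {u w : L2s d}
    (h : ∀ φ : Test d, inner ℝ u φ.toL2 = inner ℝ w φ.toL2) : u = w := by
  apply Lp.ext
  refine ae_eq_of_integral_contDiff_smul_eq ((Lp.memLp u).locallyIntegrable (by norm_num))
    ((Lp.memLp w).locallyIntegrable (by norm_num)) fun φ hφ hc => ?_
  have := h ⟨φ, hφ, hc⟩
  rw [inner_toL2, inner_toL2] at this
  simpa [mul_comm] using this

theorem dpartB (φ : Test d) (i : Fin d) : DpartB i φ.toB (φ.der (bvec i)).toB := by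
  refine DpartB.of_uniformContinuous (fun x => ?_) ?_
  · have h1 : HasFDerivAt φ.f (fderiv ℝ φ.f x) (x + (0 : ℝ) • bvec i) := by
      rw [zero_smul, add_zero]
      exact (φ.smooth.differentiable (by simp) x).hasFDerivAt
    have h2 : HasDerivAt (fun s : ℝ => x + s • bvec i) (bvec i) 0 := by
      simpa using ((hasDerivAt_id (0 : ℝ)).smul_const (bvec i)).const_add x
    exact h1.comp_hasDerivAt (0 : ℝ) h2
  · exact (φ.der (bvec i)).supp.uniformContinuous_of_continuous
      (φ.der (bvec i)).smooth.continuous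

theorem dpart (φ : Test d) (i : Fin d) : Dpart i φ.toL2 (φ.der (bvec i)).toL2 := by
  obtain ⟨ρ, hρ⟩ := φ.supp.isCompact.isBounded.subset_closedBall 0
  -- For |s| < 1 the translates of φ live in the ball of radius ρ + 1. Multiplying by its indicator
  -- turns uniform convergence of difference quotients into convergence in L².
  set χ : L2s d := indicatorConstLp 2 (s := Metric.closedBall (0 : Pt d) (ρ + 1))
    measurableSet_closedBall measure_closedBall_lt_top.ne (1 : ℝ) with hχ
  have hχc : χ =ᵐ[volume] (Metric.closedBall (0 : Pt d) (ρ + 1)).indicator fun _ => (1 : ℝ) :=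
    indicatorConstLp_coeFn
  have h1 : HasDerivAt (fun s : ℝ => mulL (transB (s • bvec i) φ.toB) χ)
      (mulL (φ.der (bvec i)).toB χ) 0 := by
    have h1 : HasDerivAt (fun s : ℝ => MassGame.mulL (transB (s • bvec i) φ.toB))
        (MassGame.mulL (φ.der (bvec i)).toB) 0 :=
      hasDerivAt_mulL (φ.dpartB i)
    simpa using h1.clm_apply (hasDerivAt_const (0 : ℝ) χ)
  have h2 : mulL (φ.der (bvec i)).toB χ = (φ.der (bvec i)).toL2 := by
    apply Lp.ext
    filter_upwards [mulL_coe (φ.der (bvec i)).toB χ, hχc, (φ.der (bvec i)).toL2_coe] with x h1 h2 h3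
    rw [h1, h2, h3, toB_apply]
    by_cases hx : x ∈ Metric.closedBall (0 : Pt d) (ρ + 1)
    · rw [indicator_of_mem hx, mul_one]
    · rw [indicator_of_notMem hx, mul_zero]
      refine (image_eq_zero_of_notMem_tsupport fun h => hx ?_).symm
      exact (hρ.trans (Metric.closedBall_subset_closedBall (by linarith)))
        (tsupport_fderiv_apply_subset ℝ (bvec i) h)
  rw [h2] at h1
  refine h1.congr_of_eventuallyEq ?_
  filter_upwards [Metric.ball_mem_nhds (0 : ℝ) one_pos] with s hs
  rw [mem_ball_zero_iff, Real.norm_eq_abs] at hs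
  rw [trans_toL2]
  apply Lp.ext
  filter_upwards [mulL_coe (transB (s • bvec i) φ.toB) χ, hχc, (φ.shift (s • bvec i)).toL2_coe]
    with x h1 h2 h3
  rw [h1, h2, h3, transB_apply, toB_apply]
  by_cases hx : x ∈ Metric.closedBall (0 : Pt d) (ρ + 1)
  · rw [indicator_of_mem hx, mul_one]; rfl
  · rw [indicator_of_notMem hx, mul_zero]
    change φ.f (x + s • bvec i) = 0
    refine image_eq_zero_of_notMem_tsupport fun h => hx ?_
    have h4 := hρ h
    rw [mem_closedBall_zero_iff] at h4 ⊢
    calc ‖x‖ = ‖x + s • bvec i - s • bvec i‖ := by rw [add_sub_cancel_right]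
      _ ≤ ‖x + s • bvec i‖ + ‖s • bvec i‖ := norm_sub_le _ _
      _ ≤ ρ + 1 := by
        gcongr
        rw [norm_smul]
        simpa using hs.le

end Test

/-- The `i`-th component of an `L²` vector field. -/
def comp (i : Fin d) : L2v d →L[ℝ] L2s d :=
  (EuclideanSpace.proj i : Pt d →L[ℝ] ℝ).compLpL 2 volume

theorem comp_coe (i : Fin d) (w : L2v d) : comp i w =ᵐ[volume] fun x => w x i :=
  ContinuousLinearMap.coeFn_compLpL _ _

/-- The `L²` vector field with given components. -/
def vecL (g : Fin d → L2s d) : L2v d :=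
  ∑ i, (ContinuousLinearMap.toSpanSingleton ℝ (bvec i)).compLpL 2 volume (g i)

theorem vecL_coe (g : Fin d → L2s d) : vecL g =ᵐ[volume] fun x => ∑ i, g i x • bvec i := by
  have h1 : ∀ i, ((ContinuousLinearMap.toSpanSingleton ℝ (bvec i)).compLpL 2 volume (g i) : L2v d)
      =ᵐ[volume] fun x => g i x • bvec i := fun i => by
    refine (ContinuousLinearMap.coeFn_compLpL _ _).trans (Eventually.of_forall fun x => ?_)
    simp
  have h2 := Lp.coeFn_finsetSum (p := 2) (μ := (volume : Measure (Pt d))) Finset.univ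
    (fun i => ((ContinuousLinearMap.toSpanSingleton ℝ (bvec i)).compLpL 2 volume (g i) : L2v d))
  have h3 := (eventually_countable_forall (l := ae (volume : Measure (Pt d)))).2 h1
  filter_upwards [h2, h3] with x hx hx3
  rw [vecL, hx, Finset.sum_apply]
  exact Finset.sum_congr rfl fun i _ => hx3 i

theorem comp_vecL (i : Fin d) (g : Fin d → L2s d) : comp i (vecL g) = g i := by
  apply Lp.ext
  filter_upwards [comp_coe i (vecL g), vecL_coe g] with x h1 h2
  rw [h1, h2]
  simp [Finset.sum_apply, Pi.single_apply]

theorem norm_sq_L2v (w : L2v d) : ‖w‖ ^ 2 = ∑ i, ‖comp i w‖ ^ 2 := by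
  rw [← real_inner_self_eq_norm_sq, L2.inner_def]
  simp only [← real_inner_self_eq_norm_sq, inner_L2s]
  rw [← integral_finsetSum _ (fun i _ => integrable_mul_L2s _ _)]
  have h3 := (eventually_countable_forall (l := ae (volume : Measure (Pt d)))).2
    (fun i => comp_coe i w)
  refine integral_congr_ae ?_
  filter_upwards [h3] with x hx
  rw [real_inner_self_eq_norm_sq, EuclideanSpace.norm_sq_eq]
  refine Finset.sum_congr rfl fun i _ => ?_
  rw [hx i, Real.norm_eq_abs, sq_abs, pow_two]

namespace H1

/-- The embedding `H¹ → L²` as a continuous linear map. -/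
def toL2L : H1 d →L[ℝ] L2s d :=
  (WithLp.fstL 2 ℝ (L2s d) (L2v d)).comp (H1sub d).subtypeL

theorem toL2L_apply (m : H1 d) : toL2L m = m.toL2 := rfl

/-- The partial derivatives of an `H¹` function. -/
def gradi (i : Fin d) : H1 d →L[ℝ] L2s d :=
  (comp i).comp ((WithLp.sndL 2 ℝ (L2s d) (L2v d)).comp (H1sub d).subtypeL)

theorem gradi_apply (i : Fin d) (m : H1 d) : gradi i m = comp i m.grad := rfl

theorem norm_sq (m : H1 d) : ‖m‖ ^ 2 = ‖m.toL2‖ ^ 2 + ∑ i, ‖gradi i m‖ ^ 2 := by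
  have : ‖m‖ = ‖(m : WithLp 2 (L2s d × L2v d))‖ := rfl
  rw [this, WithLp.prod_norm_sq_eq_of_L2]
  change ‖m.toL2‖ ^ 2 + ‖m.grad‖ ^ 2 = _
  rw [norm_sq_L2v]
  rfl

theorem norm_toL2_le (m : H1 d) : ‖m.toL2‖ ≤ ‖m‖ := by
  refine le_of_sq_le_sq ?_ (norm_nonneg _)
  rw [norm_sq]
  have : 0 ≤ ∑ i, ‖gradi i m‖ ^ 2 := Finset.sum_nonneg fun i _ => by positivity
  linarith

theorem norm_gradi_le (i : Fin d) (m : H1 d) : ‖gradi i m‖ ≤ ‖m‖ := by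
  refine le_of_sq_le_sq ?_ (norm_nonneg _)
  rw [norm_sq]
  have := Finset.single_le_sum (f := fun i => ‖gradi i m‖ ^ 2) (fun i _ => by positivity)
    (Finset.mem_univ i)
  have h2 : 0 ≤ ‖m.toL2‖ ^ 2 := by positivity
  linarith

theorem inner_gradi_test (m : H1 d) (i : Fin d) (φ : Test d) :
    inner ℝ (gradi i m) φ.toL2 = - inner ℝ m.toL2 (φ.der (bvec i)).toL2 := by
  have h := m.2.2.2 φ.f φ.smooth φ.supp (bvec i)
  rw [Test.inner_toL2, Test.inner_toL2, eq_neg_iff_add_eq_zero, add_comm, ← eq_neg_iff_add_eq_zero]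
  have h1 : ∫ x, m.toL2 x * (φ.der (bvec i)).f x = ∫ x, (fderiv ℝ φ.f x (bvec i)) • m.toL2 x := by
    refine integral_congr_ae (Eventually.of_forall fun x => ?_)
    simp only [smul_eq_mul]
    rw [mul_comm]; rfl
  have h2 : ∫ x, gradi i m x * φ.f x = ∫ x, φ.f x • (innerSL ℝ (m.grad x)) (bvec i) := by
    refine integral_congr_ae ?_
    filter_upwards [comp_coe i m.grad] with x hx
    rw [gradi_apply, hx, innerSL_apply_apply, smul_eq_mul, mul_comm]
    simp [EuclideanSpace.inner_single_right]
  rw [h1, h2]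
  exact h

/-- Tested against φ, the function s ↦ τ_s m has derivative τ_s ∂_i m, so τ_h m - m is the integral
of τ_s ∂_i m over [0, h]. The integrand is continuous in L², so this weak statement gives a
derivative in norm. -/
theorem dpart (m : H1 d) (i : Fin d) : Dpart i m.toL2 (gradi i m) := by
  have hc : Continuous fun s : ℝ => trans (s • bvec i) (gradi i m) :=
    (continuous_trans _).comp (continuous_id.smul continuous_const)
  have key : ∀ h : ℝ, trans (h • bvec i) m.toL2 =
      m.toL2 + ∫ s in (0 : ℝ)..h, trans (s • bvec i) (gradi i m) := by
    intro h
    refine ext_of_test fun φ => ?_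
    have hd : ∀ s : ℝ, HasDerivAt (fun s : ℝ => inner ℝ (trans (s • bvec i) m.toL2) φ.toL2)
        (inner ℝ (trans (s • bvec i) (gradi i m)) φ.toL2) s := by
      intro s
      have h1 := ((φ.dpart i).hasDerivAt (-s)).scomp s (hasDerivAt_neg s)
      have h2 := (hasDerivAt_const s m.toL2).inner ℝ h1
      refine (h2.congr_of_eventuallyEq (Eventually.of_forall fun r => ?_)).congr_deriv ?_
      · simp only [Function.comp_apply]
        rw [inner_trans_left, neg_smul]
      · simp only [Function.comp_apply]
        rw [inner_trans_left, inner_zero_left, add_zero, neg_smul, neg_smul, inner_neg_right,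
          one_smul,
          Test.trans_toL2, Test.trans_toL2, inner_gradi_test, Test.der_shift]
    have hcont : Continuous fun s : ℝ => inner ℝ (trans (s • bvec i) (gradi i m)) φ.toL2 :=
      hc.inner continuous_const
    have hFTC := intervalIntegral.integral_eq_sub_of_hasDerivAt (fun s _ => hd s)
      (hcont.intervalIntegrable 0 h)
    have hin : ∫ s in (0 : ℝ)..h, inner ℝ (trans (s • bvec i) (gradi i m)) φ.toL2 =
        inner ℝ (∫ s in (0 : ℝ)..h, trans (s • bvec i) (gradi i m)) φ.toL2 := by
      rw [real_inner_comm, ← innerSL_apply_apply ℝ, ← ContinuousLinearMap.intervalIntegral_comp_comm _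
        (hc.intervalIntegrable 0 h)]
      refine intervalIntegral.integral_congr fun s _ => ?_
      simp only [innerSL_apply_apply]
      rw [real_inner_comm]
    rw [inner_add_left, ← hin, hFTC, zero_smul, trans_zero]
    ring
  have h1 := (hc.integral_hasStrictDerivAt 0 0).hasDerivAt.const_add m.toL2
  rw [zero_smul, trans_zero] at h1
  exact h1.congr_of_eventuallyEq (Eventually.of_forall key)

theorem exists_of_test {u : L2s d} {g : Fin d → L2s d}
    (h : ∀ i, ∀ φ : Test d, inner ℝ (g i) φ.toL2 = - inner ℝ u (φ.der (bvec i)).toL2) :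
    ∃ m : H1 d, m.toL2 = u ∧ ∀ i, gradi i m = g i := by
  have hmem : WithLp.toLp 2 (u, vecL g) ∈ H1sub d := by
    refine ⟨(Lp.memLp u).locallyIntegrable (by norm_num), ?_, fun φ hφ hc v => ?_⟩
    · have h1 : LocallyIntegrable (vecL g) (volume : Measure (Pt d)) :=
        (Lp.memLp (vecL g)).locallyIntegrable (by norm_num)
      intro x
      obtain ⟨s, hs, hI⟩ := h1 x
      exact ⟨s, hs, (innerSL ℝ : Pt d →L[ℝ] Pt d →L[ℝ] ℝ).integrable_comp hI⟩
    · set ψ : Test d := ⟨φ, hφ, hc⟩ with hψ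
      have h1 : ∫ x, (fderiv ℝ φ x v) • u x = ∑ i, v i * inner ℝ u (ψ.der (bvec i)).toL2 := by
        have h2 : ∀ x, fderiv ℝ φ x v = ∑ i, v i * fderiv ℝ φ x (bvec i) := fun x => by
          conv_lhs => rw [← (EuclideanSpace.basisFun (Fin d) ℝ).sum_repr v]
          simp [map_sum]
        simp_rw [Test.inner_toL2, ← integral_const_mul]
        rw [← integral_finsetSum]
        · refine integral_congr_ae (Eventually.of_forall fun x => ?_)
          simp only [smul_eq_mul]
          rw [h2, Finset.sum_mul]
          refine Finset.sum_congr rfl fun i _ => ?_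
          change _ = v i * (u x * fderiv ℝ φ x (bvec i))
          ring
        · intro i _
          refine Integrable.const_mul ?_ _
          refine (integrable_mul_L2s u (ψ.der (bvec i)).toL2).congr ?_
          filter_upwards [(ψ.der (bvec i)).toL2_coe] with x hx
          rw [hx]
      have h3 : ∫ x, φ x • (innerSL ℝ ((vecL g : L2v d) x)) v = ∑ i, v i * inner ℝ (g i) ψ.toL2 := by
        simp_rw [Test.inner_toL2, ← integral_const_mul]
        rw [← integral_finsetSum]
        · refine integral_congr_ae ?_
          filter_upwards [vecL_coe g] with x hx
          rw [hx, innerSL_apply_apply, smul_eq_mul, sum_inner, Finset.mul_sum]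
          refine Finset.sum_congr rfl fun i _ => ?_
          rw [inner_smul_left, EuclideanSpace.inner_single_left]
          simp only [conj_trivial, one_mul]
          change _ = v i * (g i x * φ x)
          ring
        · intro i _
          refine Integrable.const_mul ?_ _
          refine (integrable_mul_L2s (g i) ψ.toL2).congr ?_
          filter_upwards [ψ.toL2_coe] with x hx
          rw [hx]
      change ∫ x, (fderiv ℝ φ x v) • u x = - ∫ x, φ x • (innerSL ℝ ((vecL g : L2v d) x)) v
      rw [h1, h3, ← Finset.sum_neg_distrib]
      refine Finset.sum_congr rfl fun i _ => ?_
      rw [h i ψ]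
      ring
  exact ⟨⟨_, hmem⟩, rfl, fun i => comp_vecL i g⟩

theorem exists_of_dpart {u : L2s d} {g : Fin d → L2s d} (h : ∀ i, Dpart i u (g i)) :
    ∃ m : H1 d, m.toL2 = u ∧ ∀ i, gradi i m = g i :=
  exists_of_test fun i φ => by
    have := (h i).inner_add_inner (φ.dpart i)
    linarith

theorem ext_toL2 {m m' : H1 d} (h : m.toL2 = m'.toL2) : m = m' := by
  have h1 : ∀ i, gradi i (m - m') = 0 := fun i => by
    have h2 := m.dpart i
    rw [h] at h2
    rw [map_sub, h2.unique (m'.dpart i), sub_self]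
  rw [← sub_eq_zero, ← norm_eq_zero, ← sq_eq_zero_iff, norm_sq]
  have h3 : (m - m').toL2 = 0 := by
    rw [← toL2L_apply, map_sub, toL2L_apply, toL2L_apply, h, sub_self]
  simp [h1, h3]

/-- An `L²` function with bounded difference quotients is in `H¹`. -/
theorem exists_of_diffQuot {u : L2s d} {C : ℝ}
    (h : ∀ i, ∀ s : ℝ, 0 < s → ‖trans (s • bvec i) u - u‖ ≤ C * s) :
    ∃ m : H1 d, m.toL2 = u := by
  have hs : ∀ n : ℕ, (0 : ℝ) < 1 / ((n : ℝ) + 1) := fun n => by positivity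
  have hb : ∀ i, ∀ n : ℕ, ‖(1 / ((n : ℝ) + 1))⁻¹ • (trans ((1 / ((n : ℝ) + 1)) • bvec i) u - u)‖ ≤ C := by
    intro i n
    rw [norm_smul, norm_inv, Real.norm_of_nonneg (hs n).le, inv_mul_le_iff₀ (hs n), mul_comm _ C]
    exact h i _ (hs n)
  -- The candidates for the partial derivatives are weak limits of difference quotients. Against a
  -- test function the quotient is moved onto the test function, where it converges.
  choose g hg using fun i => exists_weak_limit (hb i)
  obtain ⟨m, hm, -⟩ := exists_of_test (u := u) (g := g) fun i φ => by
    refine hg i _ _ ?_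
    have h1 := (φ.dpart i).hasDerivAt 0
    have h2 : HasDerivAt (fun s : ℝ => inner ℝ u (trans ((-s) • bvec i) φ.toL2))
        (-inner ℝ u (φ.der (bvec i)).toL2) 0 := by
      have h1' : HasDerivAt (fun h : ℝ => trans (h • bvec i) φ.toL2)
          (trans ((0 : ℝ) • bvec i) (φ.der (bvec i)).toL2) (-(0 : ℝ)) := by rwa [neg_zero]
      have h3 := (hasDerivAt_const (0 : ℝ) u).inner ℝ (h1'.scomp (0 : ℝ) (hasDerivAt_neg 0))
      refine h3.congr_deriv ?_
      simp [trans_zero]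
    have h4 := h2.tendsto_slope_zero
    have h5 : Tendsto (fun n : ℕ => 1 / ((n : ℝ) + 1)) atTop (𝓝[≠] 0) :=
      tendsto_nhdsWithin_iff.2 ⟨tendsto_one_div_add_atTop_nhds_zero_nat,
        Eventually.of_forall fun n => (hs n).ne'⟩
    refine (h4.comp h5).congr fun n => ?_
    simp only [Function.comp_apply, zero_add, neg_zero, zero_smul, trans_zero]
    rw [inner_smul_left, inner_sub_left, inner_trans_left, neg_smul]
    simp
  exact ⟨m, hm⟩

/-- A test function as an element of `H¹`. -/
theorem exists_of_test_fun (φ : Test d) :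
    ∃ m : H1 d, m.toL2 = φ.toL2 ∧ ∀ i, gradi i m = (φ.der (bvec i)).toL2 :=
  exists_of_dpart fun i => φ.dpart i

end H1

end

/-! ### Regularity of the admissible fields and the operator div (b m). -/

section

variable {d : ℕ}

/-- A continuous function with weak derivative bounded by `K` is `K`-Lipschitz. -/
theorem lipschitz_of_hasWeakFDeriv {w : Pt d → ℝ} {g : Pt d → (Pt d →L[ℝ] ℝ)} {K : ℝ}
    (hw : Continuous w) (h : HasWeakFDeriv w g)
    (hK : ∀ᵐ x ∂(volume : Measure (Pt d)), ‖g x‖ ≤ K) (x y : Pt d) :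
    |w x - w y| ≤ K * ‖x - y‖ := by
  have hK0 : 0 ≤ K := by
    obtain ⟨x, hx⟩ := hK.exists
    exact (norm_nonneg _).trans hx
  let L := ContinuousLinearMap.lsmul ℝ ℝ (E := ℝ)
  -- The mollified function is smooth and its derivative is the average of g against a probability
  -- density, hence bounded by K. The Lipschitz bound passes to the limit as the bump shrinks.
  have hlip : ∀ φ : ContDiffBump (0 : Pt d), ∀ x y,
      |(MeasureTheory.convolution (φ.normed volume) w L volume) x -
        (MeasureTheory.convolution (φ.normed volume) w L volume) y| ≤ K * ‖x - y‖ := by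
    intro φ x y
    set f := φ.normed (volume : Measure (Pt d)) with hf
    have hfs : ContDiff ℝ (⊤ : ℕ∞) f := φ.contDiff_normed
    have hfc : HasCompactSupport f := φ.hasCompactSupport_normed
    have hd := fun x₀ => hfc.hasFDerivAt_convolution_left L (hfs.of_le (by simp)) h.1 x₀
    refine (convex_univ (𝕜 := ℝ) (E := Pt d)).norm_image_sub_le_of_norm_hasFDerivWithin_le
      (fun z _ => (hd z).hasFDerivWithinAt) (fun z _ => ?_) (mem_univ y) (mem_univ x)
    refine ContinuousLinearMap.opNorm_le_bound _ hK0 fun v => ?_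
    have hex : Integrable (fun t => (L.precompL (Pt d)) (fderiv ℝ f t) (w (z - t))) volume :=
      ((hfc.fderiv ℝ).convolutionExists_left _ (hfs.continuous_fderiv (by simp)) h.1 z)
    have e1 : (MeasureTheory.convolution (fderiv ℝ f) w (L.precompL (Pt d)) volume) z v =
        ∫ t, fderiv ℝ f t v * w (z - t) := by
      rw [convolution_def, ContinuousLinearMap.integral_apply hex]
      rfl
    set ψ : Pt d → ℝ := fun t => f (z - t) with hψ
    have hψs : ContDiff ℝ (⊤ : ℕ∞) ψ := hfs.comp (contDiff_const.sub contDiff_id)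
    have hψc : HasCompactSupport ψ := hfc.comp_homeomorph (Homeomorph.subLeft z)
    have hψd : ∀ t, fderiv ℝ ψ t v = - fderiv ℝ f (z - t) v := fun t => by
      have h1 : HasFDerivAt f (fderiv ℝ f (z - t)) (z - t) :=
        (hfs.differentiable (by simp) _).hasFDerivAt
      have h2 := h1.comp t ((hasFDerivAt_id t).const_sub z)
      have h3 : fderiv ℝ ψ t = _ := h2.fderiv
      rw [h3]
      simp
    have e2 : ∫ t, fderiv ℝ f t v * w (z - t) = ∫ t, fderiv ℝ f (z - t) v * w t := by
      rw [← integral_sub_left_eq_self _ volume z]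
      refine integral_congr_ae (Eventually.of_forall fun t => ?_)
      simp
    have e3 : ∫ t, fderiv ℝ f (z - t) v * w t = ∫ t, ψ t * g t v := by
      have := h.2.2 ψ hψs hψc v
      simp only [smul_eq_mul] at this
      rw [← neg_inj, ← this, ← integral_neg]
      refine integral_congr_ae (Eventually.of_forall fun t => ?_)
      simp only [hψd]
      ring
    rw [e1, e2, e3]
    have hψ0 : ∀ t, 0 ≤ ψ t := fun t => φ.nonneg_normed _
    have hψ1 : ∫ t, ψ t = 1 := by
      rw [hψ, integral_sub_left_eq_self f volume z]
      exact φ.integral_normed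
    calc ‖∫ t, ψ t * g t v‖ ≤ ∫ t, ψ t * (K * ‖v‖) := by
          refine norm_integral_le_of_norm_le ?_ ?_
          · exact (hψs.continuous.integrable_of_hasCompactSupport hψc).mul_const _
          · filter_upwards [hK] with t ht
            rw [norm_mul, Real.norm_of_nonneg (hψ0 t)]
            exact mul_le_mul_of_nonneg_left (((g t).le_opNorm v).trans (by gcongr)) (hψ0 t)
      _ = K * ‖v‖ := by rw [integral_mul_const, hψ1, one_mul]
  let φ : ℕ → ContDiffBump (0 : Pt d) := fun n =>
    ⟨1 / ((n : ℝ) + 2), 1 / ((n : ℝ) + 1), by positivity,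
      one_div_lt_one_div_of_lt (by positivity) (by linarith)⟩
  have hφ : Tendsto (fun n => (φ n).rOut) atTop (𝓝 0) :=
    tendsto_one_div_add_atTop_nhds_zero_nat
  have ht := fun z => ContDiffBump.convolution_tendsto_right_of_continuous
    (μ := (volume : Measure (Pt d))) hφ hw z
  exact le_of_tendsto ((ht x).sub (ht y)).abs (Eventually.of_forall fun n => hlip (φ n) x y)

theorem HasWeakFDeriv.clm_comp {F : Type*} [NormedAddCommGroup F] [NormedSpace ℝ F]
    [CompleteSpace F] {u : Pt d → F} {g : Pt d → (Pt d →L[ℝ] F)} (h : HasWeakFDeriv u g)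
    (l : F →L[ℝ] ℝ) : HasWeakFDeriv (fun x => l (u x)) (fun x => l.comp (g x)) := by
  have h2 : LocallyIntegrable (fun x => l.comp (g x)) (volume : Measure (Pt d)) := by
    intro x
    obtain ⟨s, hs, hI⟩ := h.2.1 x
    exact ⟨s, hs, (ContinuousLinearMap.compL ℝ (Pt d) F ℝ l).integrable_comp hI⟩
  have h1 : LocallyIntegrable (fun x => l (u x)) (volume : Measure (Pt d)) := by
    intro x
    obtain ⟨s, hs, hI⟩ := h.1 x
    exact ⟨s, hs, l.integrable_comp hI⟩
  refine ⟨h1, h2, fun φ hφ hc v => ?_⟩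
  have i1 : Integrable (fun x => (fderiv ℝ φ x v) • u x) volume :=
    h.1.integrable_smul_left_of_hasCompactSupport
      ((hφ.continuous_fderiv (by simp)).clm_apply continuous_const) (hc.fderiv_apply ℝ v)
  have i2 : Integrable (fun x => φ x • g x v) volume :=
    (h.2.1.integrable_smul_left_of_hasCompactSupport hφ.continuous hc).apply_continuousLinearMap v
  have := congrArg l (h.2.2 φ hφ hc v)
  rw [map_neg, ← l.integral_comp_comm i1, ← l.integral_comp_comm i2] at this
  simpa using this

namespace FieldSpace

/-- The components of a vector field. -/
def compB (i : Fin d) (b : FieldSpace d) : Pt d →ᵇ ℝ :=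
  (EuclideanSpace.proj i : Pt d →L[ℝ] ℝ).compLeftContinuousBounded (Pt d) b.1.1

/-- The linear functional `A ↦ (A e_j)_i`. -/
def entryL (i j : Fin d) : (Pt d →L[ℝ] Pt d) →L[ℝ] ℝ :=
  (EuclideanSpace.proj i : Pt d →L[ℝ] ℝ).comp (ContinuousLinearMap.apply ℝ (Pt d) (bvec j))

/-- The partial derivatives `∂_j b_i` of a vector field. -/
def dB (i j : Fin d) (b : FieldSpace d) : Pt d →ᵇ ℝ :=
  (entryL i j).compLeftContinuousBounded (Pt d) b.1.2.1

/-- The divergence as a bounded continuous function. -/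
def divB (b : FieldSpace d) : Pt d →ᵇ ℝ := ∑ i, dB i i b

theorem compB_apply (i : Fin d) (b : FieldSpace d) (x : Pt d) : compB i b x = b.toFun x i := rfl

theorem continuous_fieldTuple : Continuous fun b : FieldSpace d => b.1 := continuous_subtype_val

theorem continuous_compB (i : Fin d) : Continuous (compB i : FieldSpace d → _) :=
  (ContinuousLinearMap.continuous _).comp (continuous_fst.comp continuous_fieldTuple)

theorem continuous_dB (i j : Fin d) : Continuous (dB i j : FieldSpace d → _) :=
  (ContinuousLinearMap.continuous _).comp
    (continuous_fst.comp (continuous_snd.comp continuous_fieldTuple))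

theorem continuous_divB : Continuous (divB : FieldSpace d → _) :=
  continuous_finsetSum _ fun i _ => continuous_dB i i

theorem continuous_toL2v : Continuous (toL2v : FieldSpace d → L2v d) :=
  continuous_fst.comp (continuous_snd.comp (continuous_snd.comp
    (continuous_snd.comp continuous_fieldTuple)))

theorem divB_apply (b : FieldSpace d) (x : Pt d) : divB b x = b.div x := by
  rw [divB, BoundedContinuousFunction.coe_sum, Finset.sum_apply, div, traceL, _root_.sum_apply]
  rfl

theorem hasFDerivAt (b : FieldSpace d) (x : Pt d) : HasFDerivAt b.toFun (b.deriv1 x) x := b.2.1 x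

theorem hasWeakFDeriv (b : FieldSpace d) : HasWeakFDeriv b.deriv1 b.deriv2 := b.2.2.1

/-- The first derivatives of `b` are bounded by `K` and `K`-Lipschitz. -/
def C11 (K : ℝ) (b : FieldSpace d) : Prop :=
  (∀ i j x, |dB i j b x| ≤ K) ∧ ∀ i j x y, |dB i j b x - dB i j b y| ≤ K * ‖x - y‖

/-- The constant comes from D²b and depends on the field. This is enough to solve the continuity
equation for one fixed field, but not for a time-dependent control. -/
theorem exists_C11 (b : FieldSpace d) : ∃ K, 0 ≤ K ∧ C11 K b := by
  have h2 : ∃ K, ∀ᵐ x ∂(volume : Measure (Pt d)), ‖b.deriv2 x‖ ≤ K := by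
    have := Lp.memLp b.1.2.2.1
    obtain ⟨K, hK⟩ := eLpNormEssSup_lt_top_iff_isBoundedUnder.1
      (by simpa [eLpNorm_exponent_top] using this.2)
    refine ⟨K, ?_⟩
    filter_upwards [eventually_map.1 hK] with x hx
    exact_mod_cast hx
  obtain ⟨K, hK⟩ := h2
  have hlip : ∀ i j : Fin d, ∃ K, 0 ≤ K ∧ (∀ x, |dB i j b x| ≤ K) ∧
      ∀ x y, |dB i j b x - dB i j b y| ≤ K * ‖x - y‖ := by
    intro i j
    set l : (Pt d →L[ℝ] Pt d) →L[ℝ] ℝ := entryL i j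
    refine ⟨max ‖dB i j b‖ (‖l‖ * K), (norm_nonneg _).trans (le_max_left _ _),
      fun x => ((dB i j b).norm_coe_le_norm x).trans (le_max_left _ _), fun x y => ?_⟩
    refine (lipschitz_of_hasWeakFDeriv (K := ‖l‖ * K) (dB i j b).continuous
      (b.hasWeakFDeriv.clm_comp l) ?_ x y).trans ?_
    · filter_upwards [hK] with x hx
      exact (ContinuousLinearMap.opNorm_comp_le _ _).trans (by gcongr)
    · gcongr
      exact le_max_right _ _
  choose C hC0 hC1 hC2 using hlip
  have hle : ∀ i j, C i j ≤ ∑ i, ∑ j, C i j := fun i j =>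
    (Finset.single_le_sum (f := fun j => C i j) (fun j _ => hC0 i j) (Finset.mem_univ j)).trans
      (Finset.single_le_sum (f := fun i => ∑ j, C i j)
        (fun i _ => Finset.sum_nonneg fun j _ => hC0 i j) (Finset.mem_univ i))
  refine ⟨∑ i, ∑ j, C i j, Finset.sum_nonneg fun i _ => Finset.sum_nonneg fun j _ => hC0 i j,
    fun i j x => (hC1 i j x).trans (hle i j), fun i j x y => (hC2 i j x y).trans ?_⟩
  gcongr
  exact hle i j

theorem hasDerivAt_compB (b : FieldSpace d) (i j : Fin d) (x : Pt d) :
    HasDerivAt (fun s : ℝ => compB i b (x + s • bvec j)) (dB i j b x) 0 := by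
  have h1 : HasFDerivAt b.toFun (b.deriv1 x) (x + (0 : ℝ) • bvec j) := by
    rw [zero_smul, add_zero]
    exact b.hasFDerivAt x
  have h2 : HasDerivAt (fun s : ℝ => x + s • bvec j) (bvec j) 0 := by
    simpa using ((hasDerivAt_id (0 : ℝ)).smul_const (bvec j)).const_add x
  have h3 := h1.comp_hasDerivAt (0 : ℝ) h2
  exact (EuclideanSpace.proj i : Pt d →L[ℝ] ℝ).hasFDerivAt.comp_hasDerivAt (0 : ℝ) h3

theorem dpartB (b : FieldSpace d) (i j : Fin d) : DpartB j (compB i b) (dB i j b) := by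
  obtain ⟨K, hK0, -, hK⟩ := b.exists_C11
  refine DpartB.of_uniformContinuous (b.hasDerivAt_compB i j) ?_
  exact (LipschitzWith.of_dist_le_mul (K := K.toNNReal) fun x y => by
    rw [Real.dist_eq, dist_eq_norm, Real.coe_toNNReal K hK0]
    exact hK i j x y).uniformContinuous

theorem abs_compB_sub_le {b : FieldSpace d} {K : ℝ} (hb : C11 K b) (i j : Fin d) (x : Pt d)
    (s : ℝ) : |compB i b (x + s • bvec j) - compB i b x| ≤ K * |s| := by
  have hd : ∀ r : ℝ, HasDerivAt (fun s : ℝ => compB i b (x + s • bvec j))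
      (dB i j b (x + r • bvec j)) r := fun r => by
    have h1 : HasDerivAt (fun s : ℝ => compB i b (x + r • bvec j + s • bvec j))
        (dB i j b (x + r • bvec j)) (r - r) := by
      rw [sub_self]; exact b.hasDerivAt_compB i j _
    refine (h1.comp_sub_const r r).congr_of_eventuallyEq (Eventually.of_forall fun s => ?_)
    simp only
    rw [add_assoc, ← add_smul, add_sub_cancel]
  have := (convex_univ (𝕜 := ℝ) (E := ℝ)).norm_image_sub_le_of_norm_hasDerivWithin_le
    (C := K) (x := 0) (y := s) (fun r _ => (hd r).hasDerivWithinAt)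
    (fun r _ => hb.1 i j _) (mem_univ _) (mem_univ _)
  simpa using this

/-- Second differences of a `C^{1,1}` field. -/
theorem abs_second_diff_le {b : FieldSpace d} {K : ℝ} (hb : C11 K b) (i j l : Fin d) (x : Pt d)
    (s r : ℝ) : |(compB i b (x + r • bvec l + s • bvec j) - compB i b (x + r • bvec l)) -
      (compB i b (x + s • bvec j) - compB i b x)| ≤ K * |r| * |s| := by
  have hd : ∀ (y : Pt d) (r : ℝ), HasDerivAt (fun s : ℝ => compB i b (y + s • bvec j))
      (dB i j b (y + r • bvec j)) r := fun y r => by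
    have h1 : HasDerivAt (fun s : ℝ => compB i b (y + r • bvec j + s • bvec j))
        (dB i j b (y + r • bvec j)) (r - r) := by
      rw [sub_self]; exact b.hasDerivAt_compB i j _
    refine (h1.comp_sub_const r r).congr_of_eventuallyEq (Eventually.of_forall fun s => ?_)
    simp only
    rw [add_assoc, ← add_smul, add_sub_cancel]
  have := (convex_univ (𝕜 := ℝ) (E := ℝ)).norm_image_sub_le_of_norm_hasDerivWithin_le
    (f := fun s => compB i b (x + r • bvec l + s • bvec j) - compB i b (x + s • bvec j))
    (C := K * |r|) (x := 0) (y := s)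
    (fun q _ => ((hd (x + r • bvec l) q).sub (hd x q)).hasDerivWithinAt)
    (fun q _ => by
      refine (hb.2 i j _ _).trans (le_of_eq ?_)
      congr 1
      rw [add_sub_add_right_eq_sub, add_sub_cancel_left, norm_smul]
      simp) (mem_univ _) (mem_univ _)
  simp only [Real.norm_eq_abs, zero_smul, add_zero, sub_zero] at this
  convert this using 2
  ring

section Btilde

variable {M : ℝ} {b : FieldSpace d}

theorem abs_compB_le (hb : b ∈ Btilde d M) (i : Fin d) (x : Pt d) : |compB i b x| ≤ M :=
  (PiLp.norm_apply_le (b.toFun x) i).trans (hb.1 x)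

theorem nonneg_of_Btilde (hb : b ∈ Btilde d M) : 0 ≤ M := (norm_nonneg _).trans (hb.1 0)

theorem abs_le_of_eLpNorm_top_le {g : Pt d → ℝ} (hg : Continuous g) (hM : 0 ≤ M)
    (h : eLpNorm g ∞ volume ≤ ENNReal.ofReal M) (x : Pt d) : |g x| ≤ M := by
  have h1 : ∀ᵐ x ∂(volume : Measure (Pt d)), |g x| ≤ M := by
    rw [eLpNorm_exponent_top] at h
    filter_upwards [ae_le_eLpNormEssSup (f := g) (μ := (volume : Measure (Pt d)))] with x hx
    have := hx.trans h
    rw [← ofReal_norm, ENNReal.ofReal_le_ofReal_iff hM] at this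
    exact this
  have h2 : Dense {x | |g x| ≤ M} := Measure.dense_of_ae h1
  have h3 : IsClosed {x | |g x| ≤ M} := isClosed_le hg.abs continuous_const
  have := h3.closure_eq ▸ h2.closure_eq
  exact (this ▸ mem_univ x : x ∈ {x | |g x| ≤ M})

theorem abs_divB_le (hb : b ∈ Btilde d M) (x : Pt d) : |divB b x| ≤ M := by
  refine abs_le_of_eLpNorm_top_le (divB b).continuous (nonneg_of_Btilde hb) ?_ x
  have : (divB b : Pt d → ℝ) = b.div := funext (divB_apply b)
  rw [this]
  exact le_self_add.trans hb.2.2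

/-- On the line the only entry of Db is the divergence, so the bound on div b in W^{1,∞} is a
C^{1,1} bound, uniform over all admissible fields. This is the sole source of uniform regularity. -/
theorem C11_of_Btilde_one {M : ℝ} {b : FieldSpace 1} (hb : b ∈ Btilde 1 M) : C11 M b := by
  have hM := nonneg_of_Btilde hb
  have hd : ∀ i j : Fin 1, dB i j b = divB b := fun i j => by
    obtain rfl : i = 0 := Subsingleton.elim _ _
    obtain rfl : j = 0 := Subsingleton.elim _ _
    simp [divB]
  have hw : HasWeakFDeriv (fun x => traceL 1 (b.deriv1 x)) b.gradDiv :=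
    b.hasWeakFDeriv.clm_comp (traceL 1)
  have hg : ∀ᵐ x ∂(volume : Measure (Pt 1)), ‖b.gradDiv x‖ ≤ M := by
    have h : eLpNorm b.gradDiv ∞ volume ≤ ENNReal.ofReal M := le_add_self.trans hb.2.2
    rw [eLpNorm_exponent_top] at h
    filter_upwards [ae_le_eLpNormEssSup (f := b.gradDiv) (μ := (volume : Measure (Pt 1)))] with x hx
    have := hx.trans h
    rwa [← ofReal_norm, ENNReal.ofReal_le_ofReal_iff hM] at this
  have he : (fun x => traceL 1 (b.deriv1 x)) = divB b := (funext (divB_apply b)).symm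
  rw [he] at hw
  refine ⟨fun i j x => ?_, fun i j x y => ?_⟩
  · rw [hd]; exact abs_divB_le hb x
  · rw [hd]
    exact lipschitz_of_hasWeakFDeriv (divB b).continuous hw hg x y

theorem zero_mem_Btilde (hM : 0 ≤ M) : (0 : FieldSpace d) ∈ Btilde d M := by
  have h1 : ∀ x, (0 : FieldSpace d).toFun x = 0 := fun _ => rfl
  have h2 : ∀ x, (0 : FieldSpace d).deriv1 x = 0 := fun _ => rfl
  refine ⟨fun x => by rw [h1, norm_zero]; exact hM, ?_, ?_⟩
  · have : (0 : FieldSpace d).sqNormH1 = 0 := by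
      simp [sqNormH1, h1, h2]
    rw [this, Real.sqrt_zero]; exact hM
  · have h3 : eLpNorm (0 : FieldSpace d).div ∞ volume = 0 := by
      refine eLpNorm_eq_zero_of_ae_zero (Eventually.of_forall fun x => ?_)
      rw [div, h2, map_zero]; rfl
    have h4 : eLpNorm (0 : FieldSpace d).gradDiv ∞ volume = 0 := by
      rw [eLpNorm_exponent_top, eLpNormEssSup]
      have h5 : (fun x => ‖(0 : FieldSpace d).gradDiv x‖ₑ) =ᵐ[volume] fun _ => 0 := by
        filter_upwards [Lp.coeFn_zero (Pt d →L[ℝ] (Pt d →L[ℝ] Pt d)) ∞ (volume : Measure (Pt d))]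
          with x hx
        have h5 : (0 : FieldSpace d).deriv2 x = 0 := hx
        rw [gradDiv, h5, ContinuousLinearMap.comp_zero, ← ofReal_norm, norm_zero,
          ENNReal.ofReal_zero]
      rw [essSup_congr_ae h5]
      exact essSup_const_bot
    rw [h3, h4, add_zero]
    exact zero_le

end Btilde

/-- `div (b m) = b · ∇m + m div b ∈ L²`. -/
def divMul (b : FieldSpace d) (m : H1 d) : L2s d :=
  ∑ i, mulL (compB i b) (H1.gradi i m) + mulL (divB b) m.toL2

theorem mulL_divB (b : FieldSpace d) (u : L2s d) : mulL (divB b) u = ∑ i, mulL (dB i i b) u :=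
  mulL_sum_left _ _ u

theorem continuous_divMul : Continuous fun p : FieldSpace d × H1 d => divMul p.1 p.2 := by
  have h : ∀ (A : FieldSpace d → (Pt d →ᵇ ℝ)) (B : H1 d →L[ℝ] L2s d), Continuous A →
      Continuous fun p : FieldSpace d × H1 d => mulL (A p.1) (B p.2) := fun A B hA =>
    (continuous_mulL.comp (hA.comp continuous_fst)).clm_apply
      (B.continuous.comp continuous_snd)
  exact (continuous_finsetSum _ fun i _ => h (compB i) (H1.gradi i) (continuous_compB i)).add
    (h divB H1.toL2L continuous_divB)

theorem divMul_sub (b : FieldSpace d) (m m' : H1 d) :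
    divMul b (m - m') = divMul b m - divMul b m' := by
  have : (m - m').toL2 = m.toL2 - m'.toL2 := map_sub H1.toL2L m m'
  simp only [divMul, map_sub, this, Finset.sum_sub_distrib]
  abel

theorem norm_divMul_le {M : ℝ} {b : FieldSpace d} (hb : b ∈ Btilde d M) (m : H1 d) :
    ‖divMul b m‖ ≤ (d + 1) * M * ‖m‖ := by
  have hM := nonneg_of_Btilde hb
  calc ‖divMul b m‖ ≤ ∑ i : Fin d, M * ‖m‖ + M * ‖m‖ := by
        refine (norm_add_le _ _).trans (add_le_add ((norm_sum_le _ _).trans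
          (Finset.sum_le_sum fun i _ => ?_)) ?_)
        · refine (norm_mulL_le (abs_compB_le hb i) _).trans ?_
          gcongr
          exact m.norm_gradi_le i
        · refine (norm_mulL_le (abs_divB_le hb) _).trans ?_
          gcongr
          exact m.norm_toL2_le
    _ = (d + 1) * M * ‖m‖ := by simp; ring

theorem pairDiv_eq (q : L2s d) (b : FieldSpace d) (m : H1 d) :
    Data.pairDiv q b m = inner ℝ q (divMul b m) := by
  rw [inner_L2s, Data.pairDiv]
  refine integral_congr_ae ?_
  have h1 := (eventually_countable_forall (l := ae (volume : Measure (Pt d)))).2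
    fun i => mulL_coe (compB i b) (H1.gradi i m)
  have h2 := (eventually_countable_forall (l := ae (volume : Measure (Pt d)))).2
    fun i => comp_coe i m.grad
  filter_upwards [h1, h2, mulL_coe (divB b) m.toL2,
    Lp.coeFn_add (∑ i, mulL (compB i b) (H1.gradi i m)) (mulL (divB b) m.toL2),
    Lp.coeFn_finsetSum (p := 2) (μ := (volume : Measure (Pt d))) Finset.univ
      fun i => mulL (compB i b) (H1.gradi i m)] with x h1 h2 h3 h4 h5
  rw [divMul, h4, Pi.add_apply, h3, h5, Finset.sum_apply, divB_apply]
  congr 2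
  rw [PiLp.inner_apply]
  refine Finset.sum_congr rfl fun i _ => ?_
  rw [h1 i, H1.gradi_apply, h2 i]
  simp [compB_apply, mul_comm]

theorem integral_mul_fderiv_eq (b : FieldSpace d) (m : H1 d) (φ : Test d) :
    ∫ x, m.toL2 x * fderiv ℝ φ.f x (b.toFun x) = - inner ℝ (divMul b m) φ.toL2 := by
  have h1 : ∀ i, inner ℝ (mulL (compB i b) m.toL2) (φ.der (bvec i)).toL2 =
      - inner ℝ (mulL (dB i i b) m.toL2 + mulL (compB i b) (H1.gradi i m)) φ.toL2 := fun i => by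
    have := ((m.dpart i).mulL (b.dpartB i i)).inner_add_inner (φ.dpart i)
    linarith
  have h2 : ∫ x, m.toL2 x * fderiv ℝ φ.f x (b.toFun x) =
      ∑ i, inner ℝ (mulL (compB i b) m.toL2) (φ.der (bvec i)).toL2 := by
    simp_rw [inner_L2s]
    rw [← integral_finsetSum _ fun i _ => integrable_mul_L2s _ _]
    refine integral_congr_ae ?_
    have h1 := (eventually_countable_forall (l := ae (volume : Measure (Pt d)))).2
      fun i => mulL_coe (compB i b) m.toL2
    have h2 := (eventually_countable_forall (l := ae (volume : Measure (Pt d)))).2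
      fun i : Fin d => (φ.der (bvec i)).toL2_coe
    filter_upwards [h1, h2] with x h1 h2
    have h3 : fderiv ℝ φ.f x (b.toFun x) = ∑ i, b.toFun x i * fderiv ℝ φ.f x (bvec i) := by
      conv_lhs => rw [← (EuclideanSpace.basisFun (Fin d) ℝ).sum_repr (b.toFun x)]
      simp [map_sum]
    rw [h3, Finset.mul_sum]
    refine Finset.sum_congr rfl fun i _ => ?_
    rw [h1 i, h2 i, compB_apply]
    change _ = _ * fderiv ℝ φ.f x (bvec i)
    ring
  rw [h2, Finset.sum_congr rfl fun i _ => h1 i, Finset.sum_neg_distrib, ← sum_inner,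
    Finset.sum_add_distrib, divMul, mulL_divB, add_comm]

/-- `2 ⟨m, div (b m)⟩ = ∫ div b m²`. -/
theorem inner_divMul_self (b : FieldSpace d) (m : H1 d) :
    2 * inner ℝ m.toL2 (divMul b m) = inner ℝ (mulL (divB b) m.toL2) m.toL2 := by
  have h1 : ∀ i, 2 * inner ℝ m.toL2 (mulL (compB i b) (H1.gradi i m)) =
      - inner ℝ (mulL (dB i i b) m.toL2) m.toL2 := fun i => (m.dpart i).inner_mulL (b.dpartB i i)
  have h2 : inner ℝ m.toL2 (mulL (divB b) m.toL2) = inner ℝ (mulL (divB b) m.toL2) m.toL2 :=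
    (inner_mulL_comm _ _ _).symm
  have h3 : ∑ i, inner ℝ (mulL (dB i i b) m.toL2) m.toL2 =
      inner ℝ (mulL (divB b) m.toL2) m.toL2 := by
    rw [mulL_divB, sum_inner]
  rw [divMul, inner_add_right, inner_sum, mul_add, Finset.mul_sum,
    Finset.sum_congr rfl fun i _ => h1 i, h2, Finset.sum_neg_distrib, h3]
  ring

end FieldSpace

end

/-! ### Difference quotients and their commutator with transport. -/

section

variable {d : ℕ}

theorem norm_trans (v : Pt d) (u : L2s d) : ‖trans v u‖ = ‖u‖ := (trans v).norm_map u

theorem abs_inner_le (u w : L2s d) : |inner ℝ u w| ≤ ‖u‖ * ‖w‖ := abs_real_inner_le_norm u w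

theorem abs_two_inner_neg (u w : L2s d) : |2 * inner ℝ u (-w)| = |2 * inner ℝ u w| := by
  rw [inner_neg_right, mul_neg, abs_neg]

theorem aestronglyMeasurable_of_continuousOn_Icc {E : Type*} [NormedAddCommGroup E] {t T : ℝ}
    {f : ℝ → E} (hf : ContinuousOn f (Icc t T)) :
    AEStronglyMeasurable f (volume.restrict (Icc t T)) :=
  hf.aestronglyMeasurable measurableSet_Icc

section DiffQuot

/-- Difference quotients on `L²`. -/
def diffQ (i : Fin d) (h : ℝ) : L2s d →L[ℝ] L2s d :=
  h⁻¹ • ((trans (h • bvec i)).toContinuousLinearMap - ContinuousLinearMap.id ℝ (L2s d))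

theorem diffQ_apply (i : Fin d) (h : ℝ) (u : L2s d) :
    diffQ i h u = h⁻¹ • (trans (h • bvec i) u - u) := rfl

/-- Difference quotients of bounded continuous functions. -/
def diffB (i : Fin d) (h : ℝ) (c : Pt d →ᵇ ℝ) : Pt d →ᵇ ℝ := h⁻¹ • (transB (h • bvec i) c - c)

theorem diffB_apply (i : Fin d) (h : ℝ) (c : Pt d →ᵇ ℝ) (x : Pt d) :
    diffB i h c x = h⁻¹ * (c (x + h • bvec i) - c x) := rfl

theorem diffQ_mulL (i : Fin d) (h : ℝ) (c : Pt d →ᵇ ℝ) (u : L2s d) :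
    diffQ i h (mulL c u) = mulL c (diffQ i h u) + mulL (diffB i h c) (trans (h • bvec i) u) := by
  have h1 : mulL (diffB i h c) (trans (h • bvec i) u) =
      h⁻¹ • (mulL (transB (h • bvec i) c) (trans (h • bvec i) u) - mulL c (trans (h • bvec i) u)) := by
    rw [diffB, mulL_smul_left, mulL_sub_left]
  have h2 : mulL c (diffQ i h u) = h⁻¹ • (mulL c (trans (h • bvec i) u) - mulL c u) := by
    rw [diffQ_apply, (mulL c).map_smul, (mulL c).map_sub]
  rw [h1, h2, diffQ_apply, trans_mulL, ← smul_add, add_comm, sub_add_sub_cancel]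

theorem Dpart.norm_diffQ_le {i : Fin d} {u g : L2s d} (hu : Dpart i u g) (h : ℝ) :
    ‖diffQ i h u‖ ≤ ‖g‖ := by
  rw [diffQ_apply, norm_smul, norm_inv, Real.norm_eq_abs]
  rcases eq_or_ne h 0 with rfl | h0
  · simp
  · rw [inv_mul_le_iff₀ (abs_pos.2 h0)]
    exact hu.norm_trans_sub_le h

theorem Dpart.tendsto_diffQ {i : Fin d} {u g : L2s d} (hu : Dpart i u g) :
    Tendsto (fun h => diffQ i h u) (𝓝[≠] 0) (𝓝 g) := by
  have := HasDerivAt.tendsto_slope_zero hu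
  refine this.congr fun h => ?_
  rw [zero_add, zero_smul, trans_zero, diffQ_apply]

theorem tendsto_one_div_nat_nhdsNE : Tendsto (fun n : ℕ => 1 / ((n : ℝ) + 1)) atTop (𝓝[≠] 0) :=
  tendsto_nhdsWithin_iff.2 ⟨tendsto_one_div_add_atTop_nhds_zero_nat,
    Eventually.of_forall fun n => (by positivity : (0 : ℝ) < 1 / ((n : ℝ) + 1)).ne'⟩

theorem Dpart.diffQ {i j : Fin d} {u g : L2s d} (hu : Dpart i u g) (h : ℝ) :
    Dpart i (MassGame.diffQ j h u) (MassGame.diffQ j h g) :=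
  ((hu.translate _).sub hu).smul _

theorem H1.exists_diffQ (m : H1 d) (j : Fin d) (h : ℝ) :
    ∃ n : H1 d, n.toL2 = diffQ j h m.toL2 ∧ ∀ i, H1.gradi i n = diffQ j h (H1.gradi i m) :=
  H1.exists_of_dpart fun i => (m.dpart i).diffQ h

end DiffQuot

namespace FieldSpace

theorem abs_diffB_compB_le {b : FieldSpace d} {K : ℝ} (hb : C11 K b) (hK : 0 ≤ K) (i j : Fin d)
    (h : ℝ) (x : Pt d) : |diffB j h (compB i b) x| ≤ K := by
  rw [diffB_apply, abs_mul, abs_inv]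
  rcases eq_or_ne h 0 with rfl | h0
  · simpa using hK
  · rw [inv_mul_le_iff₀ (abs_pos.2 h0), mul_comm]
    exact abs_compB_sub_le hb i j x h

theorem abs_diffB_divB_le {b : FieldSpace d} {K : ℝ} (hb : C11 K b) (hK : 0 ≤ K) (j : Fin d)
    (h : ℝ) (x : Pt d) : |diffB j h (divB b) x| ≤ d * K := by
  rw [diffB_apply, abs_mul, abs_inv]
  rcases eq_or_ne h 0 with rfl | h0
  · simpa using mul_nonneg (Nat.cast_nonneg d) hK
  · rw [inv_mul_le_iff₀ (abs_pos.2 h0), divB, BoundedContinuousFunction.coe_sum, Finset.sum_apply,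
      Finset.sum_apply, ← Finset.sum_sub_distrib]
    calc |∑ i, (dB i i b (x + h • bvec j) - dB i i b x)| ≤ ∑ i : Fin d, K * |h| := by
          refine (Finset.abs_sum_le_sum_abs _ _).trans (Finset.sum_le_sum fun i _ => ?_)
          refine (hb.2 i i _ _).trans (le_of_eq ?_)
          rw [add_sub_cancel_left, norm_smul]
          simp
      _ = |h| * (d * K) := by simp; ring

/-- Commutator of difference quotients with the transport operator. -/
theorem diffQ_divMul (b : FieldSpace d) (m n : H1 d) (j : Fin d) (h : ℝ)
    (hn : n.toL2 = diffQ j h m.toL2) (hg : ∀ i, H1.gradi i n = diffQ j h (H1.gradi i m)) :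
    diffQ j h (divMul b m) = divMul b n +
      (∑ i, mulL (diffB j h (compB i b)) (trans (h • bvec j) (H1.gradi i m)) +
        mulL (diffB j h (divB b)) (trans (h • bvec j) m.toL2)) := by
  simp only [divMul, map_add, map_sum, diffQ_mulL, hn, hg, Finset.sum_add_distrib]
  abel

/-- The difference quotient of m is itself in H¹, so the transport term reduces to an integral
against div b and costs only M. The commutator falls on the coefficients and is bounded by 2dK‖m‖.
Nothing depends on the step h. -/
theorem abs_inner_diffQ_divMul_le {b : FieldSpace d} {M K : ℝ} (hb : b ∈ Btilde d M)
    (hK : 0 ≤ K) (hC : C11 K b) (m : H1 d) (j : Fin d) (h : ℝ) :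
    |2 * inner ℝ (diffQ j h m.toL2) (diffQ j h (divMul b m))| ≤ (M + 4 * d * K) * ‖m‖ ^ 2 := by
  obtain ⟨n, hn, hg⟩ := m.exists_diffQ j h
  have hD : ‖diffQ j h m.toL2‖ ≤ ‖m‖ := ((m.dpart j).norm_diffQ_le h).trans (m.norm_gradi_le j)
  have hM := nonneg_of_Btilde hb
  rw [diffQ_divMul b m n j h hn hg, inner_add_right, mul_add]
  refine (abs_add_le _ _).trans ?_
  rw [add_mul]
  refine add_le_add ?_ ?_
  · rw [← hn, inner_divMul_self]
    refine (inner_mulL_self_le (abs_divB_le hb) _).trans ?_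
    rw [hn]
    gcongr
  · rw [abs_mul, abs_two]
    have h1 : ‖∑ i, mulL (diffB j h (compB i b)) (trans (h • bvec j) (H1.gradi i m)) +
        mulL (diffB j h (divB b)) (trans (h • bvec j) m.toL2)‖ ≤ 2 * d * K * ‖m‖ := by
      calc _ ≤ ∑ i : Fin d, K * ‖m‖ + d * K * ‖m‖ := by
            refine (norm_add_le _ _).trans (add_le_add ((norm_sum_le _ _).trans
              (Finset.sum_le_sum fun i _ => ?_)) ?_)
            · refine (norm_mulL_le (abs_diffB_compB_le hC hK i j h) _).trans ?_
              rw [norm_trans]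
              gcongr
              exact m.norm_gradi_le i
            · refine (norm_mulL_le (abs_diffB_divB_le hC hK j h) _).trans ?_
              rw [norm_trans]
              gcongr
              exact m.norm_toL2_le
        _ = 2 * d * K * ‖m‖ := by simp; ring
    calc _ ≤ 2 * (‖m‖ * (2 * d * K * ‖m‖)) := by
          gcongr
          exact (abs_inner_le _ _).trans (mul_le_mul hD h1 (norm_nonneg _) (norm_nonneg _))
      _ = _ := by ring

end FieldSpace

open FieldSpace

/-! ### Strong closeness in H¹ from L² closeness and norms. -/

section Weak

set_option maxHeartbeats 1600000 in
-- On a bounded set of H¹, closeness in L² implies weak closeness of gradients. The pairing of the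
-- gradient with w is replaced by a difference quotient; the error is governed by the L² continuity
-- of translations of w, and the quotient is controlled by the L² distance once its step h is fixed.
theorem H1.weak_close (w : L2s d) (i : Fin d) (C : ℝ) {ε : ℝ} (hε : 0 < ε) :
    ∃ δ > 0, ∀ m m' : H1 d, ‖m‖ ≤ C → ‖m'‖ ≤ C → ‖m.toL2 - m'.toL2‖ < δ →
      |inner ℝ (H1.gradi i m - H1.gradi i m') w| < ε := by
  set η := ε / (4 * (|C| + 1)) with hη
  have hη0 : 0 < η := by positivity
  have hcont : Continuous fun s : ℝ => trans (s • bvec i) w :=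
    (continuous_trans _).comp (continuous_id.smul continuous_const)
  obtain ⟨r, hr, hball⟩ := Metric.continuous_iff.1 hcont 0 η hη0
  set h := r / 2 with hh
  have hh0 : 0 < h := by positivity
  have hw : ∀ s ∈ uIcc 0 h, ‖trans (-(s • bvec i)) w - w‖ ≤ η := by
    intro s hs
    rw [uIcc_of_le hh0.le] at hs
    have := hball (-s) (by
      rw [Real.dist_eq, sub_zero, abs_neg, abs_of_nonneg hs.1]
      linarith [hs.2])
    rw [zero_smul, trans_zero, dist_eq_norm, neg_smul] at this
    exact this.le
  refine ⟨ε * h / (4 * (‖w‖ + 1)), by positivity, fun m m' hm hm' hd => ?_⟩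
  set n := m - m' with hn
  have hnu : n.toL2 = m.toL2 - m'.toL2 := map_sub H1.toL2L m m'
  have hng : H1.gradi i n = H1.gradi i m - H1.gradi i m' := map_sub _ _ _
  have hnC : ‖H1.gradi i n‖ ≤ 2 * (|C| + 1) := by
    refine (n.norm_gradi_le i).trans ((norm_sub_le _ _).trans ?_)
    linarith [le_abs_self C]
  have hd1 : ∀ s ∈ uIcc 0 h, HasDerivWithinAt
      (fun s : ℝ => inner ℝ (trans (s • bvec i) n.toL2) w - s * inner ℝ (H1.gradi i n) w)
      (inner ℝ (H1.gradi i n) (trans (-(s • bvec i)) w - w)) (uIcc 0 h) s := fun s _ => by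
    have h1 := ((n.dpart i).hasDerivAt s).inner ℝ (hasDerivAt_const s w)
    have h2 := (hasDerivAt_id s).mul_const (inner ℝ (H1.gradi i n) w)
    refine ((h1.sub h2).congr_deriv ?_).hasDerivWithinAt
    rw [inner_zero_right, zero_add, inner_trans_left, inner_sub_right, one_mul]
  have hmv := (convex_uIcc 0 h).norm_image_sub_le_of_norm_hasDerivWithin_le
    (C := 2 * (|C| + 1) * η) hd1 (fun s hs => by
      refine (abs_inner_le _ _).trans ?_
      exact mul_le_mul hnC (hw s hs) (norm_nonneg _) (by positivity)) left_mem_uIcc right_mem_uIcc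
  rw [zero_smul, trans_zero, zero_mul, sub_zero, sub_zero, Real.norm_eq_abs, Real.norm_eq_abs,
    abs_of_pos hh0] at hmv
  have e1 : 2 * (|C| + 1) * η = ε / 2 := by
    rw [hη]; field_simp; norm_num
  rw [e1] at hmv
  have hA : |inner ℝ (trans (h • bvec i) n.toL2) w| ≤ ‖n.toL2‖ * ‖w‖ := by
    refine (abs_inner_le _ _).trans ?_
    rw [norm_trans]
  have hB : |inner ℝ n.toL2 w| ≤ ‖n.toL2‖ * ‖w‖ := abs_inner_le n.toL2 w
  have hsm : ‖n.toL2‖ * ‖w‖ < ε * h / 4 := by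
    rw [hnu]
    calc ‖m.toL2 - m'.toL2‖ * ‖w‖ ≤ ‖m.toL2 - m'.toL2‖ * (‖w‖ + 1) := by gcongr; linarith
      _ < ε * h / (4 * (‖w‖ + 1)) * (‖w‖ + 1) := by gcongr
      _ = ε * h / 4 := by field_simp
  rw [← hng]
  have h3 : h * |inner ℝ (H1.gradi i n) w| < h * ε := by
    rw [← abs_of_pos hh0, ← abs_mul, abs_of_pos hh0]
    have := abs_le.1 hmv
    have := abs_le.1 hA
    have := abs_le.1 hB
    rw [abs_lt]
    constructor <;> nlinarith
  exact lt_of_mul_lt_mul_left h3 hh0.le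

theorem H1.norm_sub_sq (m m₀ : H1 d) : ‖m - m₀‖ ^ 2 = ‖m‖ ^ 2 - ‖m₀‖ ^ 2 -
    2 * (inner ℝ (m.toL2 - m₀.toL2) m₀.toL2 +
      ∑ i, inner ℝ (H1.gradi i m - H1.gradi i m₀) (H1.gradi i m₀)) := by
  have e : ∀ a b : L2s d, ‖a - b‖ ^ 2 = ‖a‖ ^ 2 - ‖b‖ ^ 2 - 2 * inner ℝ (a - b) b := fun a b => by
    rw [_root_.norm_sub_sq_real, inner_sub_left, real_inner_self_eq_norm_sq]
    ring
  have hu : (m - m₀).toL2 = m.toL2 - m₀.toL2 := map_sub H1.toL2L m m₀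
  rw [H1.norm_sq, H1.norm_sq m, H1.norm_sq m₀, hu, e]
  simp only [map_sub, e, Finset.sum_sub_distrib, ← Finset.mul_sum]
  ring

/-- The Radon–Riesz property: in the expansion of ‖m - m₀‖² the cross terms are small by weak
closeness, and an upper bound for ‖m‖ is then enough. -/
theorem H1.radial_close (m₀ : H1 d) {ε : ℝ} (hε : 0 < ε) :
    ∃ δ > 0, ∀ m : H1 d, ‖m‖ ^ 2 ≤ ‖m₀‖ ^ 2 + δ → ‖m.toL2 - m₀.toL2‖ < δ → ‖m - m₀‖ < ε := by
  set κ := ε ^ 2 / (4 * (d + 2)) with hκ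
  have hκ0 : 0 < κ := by positivity
  choose δ hδ0 hδ using fun i : Fin d =>
    H1.weak_close (H1.gradi i m₀) i (‖m₀‖ + 1) hκ0
  have hfin : ∃ δ₁ > 0, ∀ i, δ₁ ≤ δ i := by
    rcases isEmpty_or_nonempty (Fin d) with h | h
    · exact ⟨1, one_pos, fun i => h.elim i⟩
    · obtain ⟨i, hi⟩ := Finite.exists_min δ
      exact ⟨δ i, hδ0 i, hi⟩
  obtain ⟨δ₁, hδ₁, hle⟩ := hfin
  set δ₀ := min (min δ₁ 1) (min κ (κ / (‖m₀‖ + 1))) with hδ₀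
  have l1 : δ₀ ≤ δ₁ := (min_le_left _ _).trans (min_le_left _ _)
  have l2 : δ₀ ≤ 1 := (min_le_left _ _).trans (min_le_right _ _)
  have l3 : δ₀ ≤ κ := (min_le_right _ _).trans (min_le_left _ _)
  have l4 : δ₀ ≤ κ / (‖m₀‖ + 1) := (min_le_right _ _).trans (min_le_right _ _)
  refine ⟨δ₀, by positivity, fun m hm hu => ?_⟩
  have hmC : ‖m‖ ≤ ‖m₀‖ + 1 := by
    refine le_of_sq_le_sq ?_ (by positivity)
    nlinarith [norm_nonneg m₀]
  have h1 : ∀ i, -inner ℝ (H1.gradi i m - H1.gradi i m₀) (H1.gradi i m₀) ≤ κ := fun i =>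
    (neg_le_abs _).trans (hδ i m m₀ hmC (by linarith) (hu.trans_le (l1.trans (hle i)))).le
  have h2 : -inner ℝ (m.toL2 - m₀.toL2) m₀.toL2 ≤ κ := by
    refine (neg_le_abs _).trans ((abs_inner_le _ _).trans ?_)
    calc ‖m.toL2 - m₀.toL2‖ * ‖m₀.toL2‖ ≤ κ / (‖m₀‖ + 1) * (‖m₀‖ + 1) := by
          gcongr
          · exact hu.le.trans l4
          · linarith [m₀.norm_toL2_le]
      _ = κ := by field_simp
  have h3 : -∑ i, inner ℝ (H1.gradi i m - H1.gradi i m₀) (H1.gradi i m₀) ≤ d * κ := by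
    rw [← Finset.sum_neg_distrib]
    refine (Finset.sum_le_sum fun i _ => h1 i).trans ?_
    simp
  have h4 : ‖m - m₀‖ ^ 2 < ε ^ 2 := by
    rw [H1.norm_sub_sq]
    have : κ * (4 * (d + 2)) = ε ^ 2 := by rw [hκ]; field_simp
    nlinarith
  exact lt_of_pow_lt_pow_left₀ 2 hε.le h4

end Weak

/-- `β` is measurable on `[t, T]` with values in the admissible fields. -/
def Adm (t T M : ℝ) (β : ℝ → FieldSpace d) : Prop :=
  AEStronglyMeasurable β (volume.restrict (Icc t T)) ∧
    ∀ᵐ s ∂(volume.restrict (Icc t T)), β s ∈ Btilde d M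

/-- `m_s + div (β m) = 0` on `[t, T]` in `L²`. -/
def IsStrong (t T : ℝ) (β : ℝ → FieldSpace d) (m : ℝ → H1 d) : Prop :=
  IsPrim t T (fun s => (m s).toL2) (fun s => -divMul (β s) (m s))

/-! ### Energy estimates for the continuity equation. -/

section Strong

variable {t T M K : ℝ} {β : ℝ → FieldSpace d} {m m' : ℝ → H1 d}

theorem IsStrong.sub (h : IsStrong t T β m) (h' : IsStrong t T β m') :
    IsStrong t T β (fun s => m s - m' s) := by
  have h1 := IsPrim.sub h h'
  have e1 : (fun s => (m s).toL2 - (m' s).toL2) = fun s => (m s - m' s).toL2 :=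
    funext fun s => (map_sub H1.toL2L (m s) (m' s)).symm
  have e2 : (fun s => -divMul (β s) (m s) - -divMul (β s) (m' s)) =
      fun s => -divMul (β s) (m s - m' s) := funext fun s => by
    rw [divMul_sub]; abel
  rw [e1, e2] at h1
  exact h1

theorem IsStrong.norm_toL2_sq_le (h : IsStrong t T β m) (hβ : Adm t T M β) (hM : 0 ≤ M) :
    ∀ s ∈ Icc t T, ‖(m s).toL2‖ ^ 2 ≤ ‖(m t).toL2‖ ^ 2 * Real.exp (M * (s - t)) := by
  have hc : ContinuousOn (fun s => ‖(m s).toL2‖ ^ 2) (Icc t T) :=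
    (IsPrim.continuousOn h).norm.pow 2
  refine gronwall_integral hM hc fun s hs => ?_
  have ht : t ∈ Icc t T := ⟨le_rfl, hs.1.trans hs.2⟩
  have hi : IntervalIntegrable (fun s => M * ‖(m s).toL2‖ ^ 2) volume t s :=
    (ContinuousOn.intervalIntegrable (by
      rw [uIcc_of_le hs.1]; exact hc.mono (Icc_subset_Icc_right hs.2))).const_mul M
  have := IsPrim.energy_le h (g := fun s => M * ‖(m s).toL2‖ ^ 2) ht hs hs.1 hi (by
    filter_upwards [hβ.2] with τ hτ
    rw [inner_neg_right, mul_neg, inner_divMul_self]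
    exact (neg_le_abs _).trans (inner_mulL_self_le (abs_divB_le hτ) _))
  rwa [intervalIntegral.integral_const_mul] at this

/-- The difference of two solutions solves the same equation, and its L² growth is governed by div β
alone. Uniqueness therefore holds in every dimension, without a C^{1,1} bound. -/
theorem IsStrong.unique (h : IsStrong t T β m) (h' : IsStrong t T β m') (hβ : Adm t T M β)
    (hM : 0 ≤ M) (h0 : m t = m' t) : ∀ s ∈ Icc t T, m s = m' s := by
  intro s hs
  have := (h.sub h').norm_toL2_sq_le hβ hM s hs
  rw [h0, sub_self] at this
  have h1 : (0 : H1 d).toL2 = 0 := map_zero H1.toL2L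
  rw [h1, norm_zero] at this
  have h2 : ‖(m s - m' s).toL2‖ = 0 := by
    have : ‖(m s - m' s).toL2‖ ^ 2 ≤ 0 := by simpa using this
    exact pow_eq_zero_iff two_ne_zero |>.1 (le_antisymm this (by positivity))
  have h3 : (m s).toL2 - (m' s).toL2 = 0 := by
    rw [← norm_eq_zero, ← h2]
    exact congrArg _ (map_sub H1.toL2L (m s) (m' s)).symm
  exact H1.ext_toL2 (sub_eq_zero.1 h3)

set_option maxHeartbeats 1600000 in
/-- The `H¹` energy estimate. -/
theorem IsStrong.abs_norm_sq_sub_le (h : IsStrong t T β m) (hβ : Adm t T M β) (hM : 0 ≤ M)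
    (hK : 0 ≤ K) (hC : ∀ᵐ s ∂(volume.restrict (Icc t T)), C11 K (β s)) {f : ℝ → ℝ} {r s : ℝ}
    (hr : r ∈ Icc t T) (hs : s ∈ Icc t T) (hrs : r ≤ s) (hf : IntervalIntegrable f volume r s)
    (hmf : ∀ᵐ s ∂(volume.restrict (Icc t T)), ‖m s‖ ^ 2 ≤ f s) :
    |‖m s‖ ^ 2 - ‖m r‖ ^ 2| ≤ (d + 1) * (M + 4 * d * K) * ∫ τ in r..s, f τ := by
  set c := M + 4 * d * K with hc
  have hc0 : 0 ≤ c := by positivity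
  have hi : IntervalIntegrable (fun s => c * f s) volume r s := hf.const_mul c
  have habs : ∀ {v w : ℝ → L2s d}, IsPrim t T v w →
      (∀ᵐ τ ∂(volume.restrict (Icc t T)), |2 * inner ℝ (v τ) (w τ)| ≤ c * f τ) →
      |‖v s‖ ^ 2 - ‖v r‖ ^ 2| ≤ c * ∫ τ in r..s, f τ := by
    intro v w hv hb
    have h1 := hv.energy_le hr hs hrs hi (by filter_upwards [hb] with τ hτ using (abs_le.1 hτ).2)
    have h2 := hv.le_energy hr hs hrs hi (by filter_upwards [hb] with τ hτ using (abs_le.1 hτ).1)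
    rw [intervalIntegral.integral_const_mul] at h1 h2
    rw [abs_le]
    constructor <;> linarith
  have hL : |‖(m s).toL2‖ ^ 2 - ‖(m r).toL2‖ ^ 2| ≤ c * ∫ τ in r..s, f τ := by
    refine habs (v := fun s => (m s).toL2) (w := fun s => -divMul (β s) (m s)) h ?_
    filter_upwards [hβ.2, hmf] with τ h1 h2
    rw [abs_two_inner_neg, inner_divMul_self]
    refine (inner_mulL_self_le (abs_divB_le h1) _).trans ?_
    have h3 : ‖(m τ).toL2‖ ^ 2 ≤ f τ := by
      refine le_trans ?_ h2
      gcongr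
      exact (m τ).norm_toL2_le
    have h4 : M ≤ c := by rw [hc]; linarith [show (0:ℝ) ≤ 4 * d * K by positivity]
    exact mul_le_mul h4 h3 (by positivity) hc0
  -- Since div (β m) is only in L², the gradient of m has no evolution equation in L². Its
  -- difference quotients do, with bounds uniform in the step, and the step tends to 0 at the two
  -- fixed times.
  have hG : ∀ j, |‖H1.gradi j (m s)‖ ^ 2 - ‖H1.gradi j (m r)‖ ^ 2| ≤ c * ∫ τ in r..s, f τ := by
    intro j
    have h1 : ∀ n : ℕ, |‖diffQ j (1 / ((n : ℝ) + 1)) (m s).toL2‖ ^ 2 -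
        ‖diffQ j (1 / ((n : ℝ) + 1)) (m r).toL2‖ ^ 2| ≤ c * ∫ τ in r..s, f τ := by
      intro n
      refine habs (v := fun s => diffQ j (1 / ((n : ℝ) + 1)) (m s).toL2)
        (w := fun s => diffQ j (1 / ((n : ℝ) + 1)) (-divMul (β s) (m s)))
        (IsPrim.clm_comp h (diffQ j (1 / ((n : ℝ) + 1)))) ?_
      filter_upwards [hβ.2, hmf, hC] with τ h1 h2 h3
      rw [ContinuousLinearMap.map_neg, abs_two_inner_neg]
      refine (abs_inner_diffQ_divMul_le h1 hK h3 _ _ _).trans ?_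
      gcongr
    have ht : ∀ s, Tendsto (fun n : ℕ => ‖diffQ j (1 / ((n : ℝ) + 1)) (m s).toL2‖ ^ 2) atTop
        (𝓝 (‖H1.gradi j (m s)‖ ^ 2)) := fun s =>
      ((((m s).dpart j).tendsto_diffQ.comp tendsto_one_div_nat_nhdsNE).norm).pow 2
    exact le_of_tendsto ((ht s).sub (ht r)).abs (Eventually.of_forall h1)
  have e : ‖m s‖ ^ 2 - ‖m r‖ ^ 2 = (‖(m s).toL2‖ ^ 2 - ‖(m r).toL2‖ ^ 2) +
      ∑ j, (‖H1.gradi j (m s)‖ ^ 2 - ‖H1.gradi j (m r)‖ ^ 2) := by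
    rw [H1.norm_sq, H1.norm_sq (m r), Finset.sum_sub_distrib]
    ring
  rw [e]
  calc _ ≤ c * (∫ τ in r..s, f τ) + ∑ j : Fin d, c * ∫ τ in r..s, f τ :=
        (abs_add_le _ _).trans (add_le_add hL ((Finset.abs_sum_le_sum_abs _ _).trans
          (Finset.sum_le_sum fun j _ => hG j)))
    _ = _ := by simp; ring

/-- A bounded solution is continuous in `H¹`. -/
theorem IsStrong.continuousOn (h : IsStrong t T β m) (hβ : Adm t T M β) (hM : 0 ≤ M)
    (hK : 0 ≤ K) (hC : ∀ᵐ s ∂(volume.restrict (Icc t T)), C11 K (β s)) {B : ℝ}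
    (hB : ∀ s ∈ Icc t T, ‖m s‖ ≤ B) : ContinuousOn m (Icc t T) := by
  intro r hr
  rw [Metric.continuousWithinAt_iff']
  intro ε hε
  obtain ⟨δ, hδ, hclose⟩ := (m r).radial_close hε
  set c := (d + 1) * (M + 4 * d * K) * B ^ 2 with hc
  have hc0 : 0 ≤ c := by positivity
  have hest : ∀ s ∈ Icc t T, |‖m s‖ ^ 2 - ‖m r‖ ^ 2| ≤ c * |s - r| := by
    have key : ∀ r ∈ Icc t T, ∀ s ∈ Icc t T, r ≤ s → |‖m s‖ ^ 2 - ‖m r‖ ^ 2| ≤ c * |s - r| := by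
      intro r hr s hs hrs
      -- A constant majorant is used because integrability of ‖m‖² in time is not known before
      -- continuity.
      refine (h.abs_norm_sq_sub_le hβ hM hK hC hr hs hrs (f := fun _ => B ^ 2)
        intervalIntegrable_const ?_).trans (le_of_eq ?_)
      · filter_upwards [ae_restrict_mem measurableSet_Icc] with τ hτ
        have := hB τ hτ
        gcongr
      · rw [intervalIntegral.integral_const, smul_eq_mul, abs_of_nonneg (sub_nonneg.2 hrs)]
        ring
    intro s hs
    rcases le_total r s with hrs | hrs
    · exact key r hr s hs hrs
    · rw [abs_sub_comm, abs_sub_comm s]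
      exact key s hs r hr hrs
  have h1 : ∀ᶠ s in 𝓝[Icc t T] r, ‖(m s).toL2 - (m r).toL2‖ < δ := by
    have := Metric.continuousWithinAt_iff'.1 (IsPrim.continuousOn h r hr) δ hδ
    filter_upwards [this] with s hs
    rwa [dist_eq_norm] at hs
  have h2 : ∀ᶠ s in 𝓝[Icc t T] r, c * |s - r| < δ := by
    have : ContinuousWithinAt (fun s => c * |s - r|) (Icc t T) r := by fun_prop
    refine this.eventually_lt continuousWithinAt_const ?_
    simpa using hδ
  filter_upwards [h1, h2, self_mem_nhdsWithin] with s h1 h2 hs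
  rw [dist_eq_norm]
  refine hclose _ ?_ h1
  have := (abs_le.1 (hest s hs)).2
  linarith

/-- Growth of the `H¹` norm. -/
theorem IsStrong.norm_sq_le (h : IsStrong t T β m) (hm : ContinuousOn m (Icc t T))
    (hβ : Adm t T M β) (hM : 0 ≤ M)
    (hK : 0 ≤ K) (hC : ∀ᵐ s ∂(volume.restrict (Icc t T)), C11 K (β s)) :
    ∀ s ∈ Icc t T, ‖m s‖ ^ 2 ≤ ‖m t‖ ^ 2 * Real.exp ((d + 1) * (M + 4 * d * K) * (s - t)) := by
  have hc : ContinuousOn (fun s => ‖m s‖ ^ 2) (Icc t T) := hm.norm.pow 2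
  refine gronwall_integral (by positivity) hc fun s hs => ?_
  have ht : t ∈ Icc t T := ⟨le_rfl, hs.1.trans hs.2⟩
  have hi : IntervalIntegrable (fun s => ‖m s‖ ^ 2) volume t s :=
    (ContinuousOn.intervalIntegrable (by
      rw [uIcc_of_le hs.1]; exact hc.mono (Icc_subset_Icc_right hs.2)))
  have := h.abs_norm_sq_sub_le hβ hM hK hC ht hs hs.1 hi (Eventually.of_forall fun s => le_rfl)
  linarith [(abs_le.1 this).2]

end Strong

/-! ### Equivalence of the distributional and the L² formulation. -/

section WeakForm

variable {t T M K : ℝ} {β : ℝ → FieldSpace d} {m m' : ℝ → H1 d} {m₀ : H1 d}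

/-- The distributional formulation of `m_s + div (β m) = 0`, `m(t) = m₀` on `[t, T]`. -/
def IsWeak (m₀ : H1 d) (t T : ℝ) (β : ℝ → FieldSpace d) (m : ℝ → H1 d) : Prop :=
  ContinuousOn m (Icc t T) ∧
    ∀ φ : Pt d → ℝ, ContDiff ℝ (⊤ : ℕ∞) φ → HasCompactSupport φ → ∀ s ∈ Icc t T,
      ∫ x, (m s).toL2 x * φ x = (∫ x, m₀.toL2 x * φ x) +
        ∫ τ in t..s, ∫ x, (m τ).toL2 x * fderiv ℝ φ x ((β τ).toFun x)

theorem inner_intervalIntegral_left {w : ℝ → L2s d} {r s : ℝ} (hw : IntervalIntegrable w volume r s)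
    (v : L2s d) : inner ℝ (∫ τ in r..s, w τ) v = ∫ τ in r..s, inner ℝ (w τ) v := by
  rw [real_inner_comm, ← innerSL_apply_apply ℝ,
    ← ContinuousLinearMap.intervalIntegral_comp_comm _ hw]
  refine intervalIntegral.integral_congr fun s _ => ?_
  simp only [innerSL_apply_apply]
  rw [real_inner_comm]

theorem Adm.bdd_divMul (hβ : Adm t T M β) (hM : 0 ≤ M) {B : ℝ} (hB : ∀ s ∈ Icc t T, ‖m s‖ ≤ B) :
    ∀ᵐ s ∂(volume.restrict (Icc t T)), ‖-divMul (β s) (m s)‖ ≤ (d + 1) * M * B := by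
  filter_upwards [hβ.2, ae_restrict_mem measurableSet_Icc] with s h1 h2
  rw [norm_neg]
  refine (norm_divMul_le h1 _).trans ?_
  have := hB s h2
  gcongr

theorem isStrong_of_test (hβ : Adm t T M β) (hM : 0 ≤ M) {B : ℝ} (hB : ∀ s ∈ Icc t T, ‖m s‖ ≤ B)
    (hmeas : AEStronglyMeasurable (fun s => -divMul (β s) (m s)) (volume.restrict (Icc t T)))
    (h : ∀ φ : Test d, ∀ s ∈ Icc t T, inner ℝ (m s).toL2 φ.toL2 = inner ℝ (m t).toL2 φ.toL2 +
      ∫ τ in t..s, inner ℝ (-divMul (β τ) (m τ)) φ.toL2) : IsStrong t T β m := by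
  refine ⟨hmeas, ⟨_, hβ.bdd_divMul hM hB⟩, fun s hs => ext_of_test fun φ => ?_⟩
  have ht : t ∈ Icc t T := ⟨le_rfl, hs.1.trans hs.2⟩
  rw [h φ s hs, inner_add_left, inner_intervalIntegral_left
    (intervalIntegrable_of_bdd ht hs hmeas (hβ.bdd_divMul hM hB))]

theorem IsWeak.init (htT : t ≤ T) (h : IsWeak m₀ t T β m) : m t = m₀ := by
  refine H1.ext_toL2 (ext_of_test fun φ => ?_)
  have := h.2 φ.f φ.smooth φ.supp t ⟨le_rfl, htT⟩
  rw [intervalIntegral.integral_same, add_zero] at this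
  rwa [Test.inner_toL2, Test.inner_toL2]

/-- Continuity in H¹ makes div (β m) bounded and measurable with values in L². The scalar identities
against test functions then combine into one Bochner integral. -/
theorem IsWeak.isStrong (htT : t ≤ T) (h : IsWeak m₀ t T β m) (hβ : Adm t T M β) (hM : 0 ≤ M) :
    IsStrong t T β m := by
  obtain ⟨B, hB⟩ := isCompact_Icc.exists_bound_of_continuousOn h.1
  refine isStrong_of_test hβ hM hB ?_ fun φ s hs => ?_
  · exact (continuous_divMul.comp_aestronglyMeasurable
      (hβ.1.prodMk (aestronglyMeasurable_of_continuousOn_Icc h.1))).neg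
  · rw [h.init htT, Test.inner_toL2, Test.inner_toL2, h.2 φ.f φ.smooth φ.supp s hs]
    congr 1
    refine intervalIntegral.integral_congr fun τ _ => ?_
    rw [integral_mul_fderiv_eq, inner_neg_left]

theorem IsStrong.isWeak (h : IsStrong t T β m) (hm : ContinuousOn m (Icc t T)) (h0 : m t = m₀) :
    IsWeak m₀ t T β m := by
  refine ⟨hm, fun φ hφ hc s hs => ?_⟩
  set ψ : Test d := ⟨φ, hφ, hc⟩ with hψ
  have h1 := congrArg (fun u => inner ℝ u ψ.toL2) (IsPrim.eq h s hs)
  rw [inner_add_left, inner_intervalIntegral_left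
    (IsPrim.intervalIntegrable h ⟨le_rfl, hs.1.trans hs.2⟩ hs), Test.inner_toL2, Test.inner_toL2,
    h0] at h1
  refine h1.trans ?_
  congr 1
  refine intervalIntegral.integral_congr fun τ _ => ?_
  rw [inner_neg_left, ← integral_mul_fderiv_eq]

end WeakForm

end

section

open FieldSpace

variable {d : ℕ}

/-! ### Central differences. -/

section CentralDiff

theorem diffQ_neg_apply (i : Fin d) (h : ℝ) (u : L2s d) :
    diffQ i (-h) u = trans (-(h • bvec i)) (diffQ i h u) := by
  rw [diffQ_apply, diffQ_apply, (trans _).map_smul, (trans _).map_sub, trans_trans, neg_add_cancel,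
    trans_zero, neg_smul, inv_neg, neg_smul, ← smul_neg, neg_sub]

theorem norm_diffQ_neg (i : Fin d) (h : ℝ) (u : L2s d) : ‖diffQ i (-h) u‖ = ‖diffQ i h u‖ := by
  rw [diffQ_neg_apply, norm_trans]

theorem norm_diffQ_le (i : Fin d) (h : ℝ) (u : L2s d) : ‖diffQ i h u‖ ≤ 2 * |h|⁻¹ * ‖u‖ := by
  rw [diffQ_apply, norm_smul, norm_inv, Real.norm_eq_abs, mul_comm 2, mul_assoc]
  gcongr
  refine (norm_sub_le _ _).trans ?_
  rw [norm_trans]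
  linarith

theorem inner_diffQ_left (i : Fin d) (h : ℝ) (u w : L2s d) :
    inner ℝ (diffQ i h u) w = -inner ℝ u (diffQ i (-h) w) := by
  rw [diffQ_apply, diffQ_apply, real_inner_smul_left, real_inner_smul_right, inner_sub_left,
    inner_sub_right, inner_trans_left, neg_smul, inv_neg]
  ring

theorem trans_diffQ (v : Pt d) (i : Fin d) (h : ℝ) (u : L2s d) :
    trans v (diffQ i h u) = diffQ i h (trans v u) := by
  rw [diffQ_apply, diffQ_apply, (trans _).map_smul, (trans _).map_sub, trans_trans, trans_trans,
    add_comm]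

theorem diffQ_comm (i j : Fin d) (h k : ℝ) (u : L2s d) :
    diffQ j k (diffQ i h u) = diffQ i h (diffQ j k u) := by
  rw [diffQ_apply j k, trans_diffQ, diffQ_apply j k u, (diffQ i h).map_smul, (diffQ i h).map_sub]

/-- Central difference quotients on `L²`. -/
def cDiff (i : Fin d) (h : ℝ) : L2s d →L[ℝ] L2s d := (2⁻¹ : ℝ) • (diffQ i h + diffQ i (-h))

theorem cDiff_apply (i : Fin d) (h : ℝ) (u : L2s d) :
    cDiff i h u = (2⁻¹ : ℝ) • (diffQ i h u + diffQ i (-h) u) := rfl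

theorem norm_cDiff_le_diffQ (i : Fin d) (h : ℝ) (u : L2s d) : ‖cDiff i h u‖ ≤ ‖diffQ i h u‖ := by
  rw [cDiff_apply, norm_smul]
  have := norm_add_le (diffQ i h u) (diffQ i (-h) u)
  rw [norm_diffQ_neg] at this
  rw [Real.norm_of_nonneg (by norm_num)]
  linarith

theorem inner_cDiff_left (i : Fin d) (h : ℝ) (u w : L2s d) :
    inner ℝ (cDiff i h u) w = -inner ℝ u (cDiff i h w) := by
  rw [cDiff_apply, cDiff_apply, real_inner_smul_left, real_inner_smul_right, inner_add_left,
    inner_add_right, inner_diffQ_left, inner_diffQ_left, neg_neg]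
  ring

theorem diffQ_cDiff (i j : Fin d) (h k : ℝ) (u : L2s d) :
    diffQ j k (cDiff i h u) = cDiff i h (diffQ j k u) := by
  rw [cDiff_apply, (diffQ j k).map_smul, (diffQ j k).map_add, diffQ_comm i j h, diffQ_comm i j (-h),
    cDiff_apply]

theorem trans_cDiff (v : Pt d) (i : Fin d) (h : ℝ) (u : L2s d) :
    trans v (cDiff i h u) = cDiff i h (trans v u) := by
  rw [cDiff_apply, (trans v).map_smul, (trans v).map_add, trans_diffQ, trans_diffQ, cDiff_apply]

theorem norm_cDiff_mulL_sub_le {c : Pt d →ᵇ ℝ} {K : ℝ} (i : Fin d)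
    (hc : ∀ h x, |diffB i h c x| ≤ K) (h : ℝ) (u : L2s d) :
    ‖cDiff i h (mulL c u) - mulL c (cDiff i h u)‖ ≤ K * ‖u‖ := by
  have e : cDiff i h (mulL c u) - mulL c (cDiff i h u) = (2⁻¹ : ℝ) •
      (mulL (diffB i h c) (trans (h • bvec i) u) +
        mulL (diffB i (-h) c) (trans ((-h) • bvec i) u)) := by
    rw [cDiff_apply, cDiff_apply, diffQ_mulL, diffQ_mulL, (mulL c).map_smul, (mulL c).map_add,
      ← smul_sub]
    congr 1
    abel
  have h1 := norm_mulL_le (hc h) (trans (h • bvec i) u)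
  have h2 := norm_mulL_le (hc (-h)) (trans ((-h) • bvec i) u)
  rw [norm_trans] at h1 h2
  rw [e, norm_smul, Real.norm_of_nonneg (by norm_num)]
  linarith [norm_add_le (mulL (diffB i h c) (trans (h • bvec i) u))
    (mulL (diffB i (-h) c) (trans ((-h) • bvec i) u))]

/-- Central differences are skew-adjoint and multiplication is self-adjoint, so twice the pairing
equals ⟨u, [D, c] u⟩. The commutator is bounded on L² uniformly in the step. -/
theorem abs_inner_cDiff_mulL_le {c : Pt d →ᵇ ℝ} {K : ℝ} (i : Fin d)
    (hc : ∀ h x, |diffB i h c x| ≤ K) (h : ℝ) (u : L2s d) :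
    |2 * inner ℝ u (cDiff i h (mulL c u))| ≤ K * ‖u‖ ^ 2 := by
  have e : 2 * inner ℝ u (cDiff i h (mulL c u)) =
      inner ℝ u (cDiff i h (mulL c u) - mulL c (cDiff i h u)) := by
    have h1 := inner_cDiff_left i h u (mulL c u)
    have h2 := inner_mulL_comm c (cDiff i h u) u
    rw [← h2] at h1
    rw [inner_sub_right]
    linarith [real_inner_comm (mulL c (cDiff i h u)) u]
  rw [e]
  refine (abs_inner_le _ _).trans ?_
  calc ‖u‖ * _ ≤ ‖u‖ * (K * ‖u‖) := by gcongr; exact norm_cDiff_mulL_sub_le i hc h u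
    _ = _ := by ring

/-- The translation is moved onto w, where the derivative of w bounds ‖τ_{-s} w - w‖ by |s|‖gw‖.
First-order accuracy thus needs one derivative of each factor, and no second derivative of z. -/
theorem Dpart.abs_inner_diffQ_sub_le {i : Fin d} {w gw z gz : L2s d} (hw : Dpart i w gw)
    (hz : Dpart i z gz) {h : ℝ} (h0 : h ≠ 0) :
    |inner ℝ w (MassGame.diffQ i h z) - inner ℝ w gz| ≤ |h| * (‖gw‖ * ‖gz‖) := by
  have hd1 : ∀ s ∈ uIcc 0 h, HasDerivWithinAt
      (fun s : ℝ => inner ℝ w (trans (s • bvec i) z) - s * inner ℝ w gz)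
      (inner ℝ (trans (-(s • bvec i)) w - w) gz) (uIcc 0 h) s := fun s _ => by
    have h1 := (hasDerivAt_const s w).inner ℝ (hz.hasDerivAt s)
    have h2 := (hasDerivAt_id s).mul_const (inner ℝ w gz)
    refine ((h1.sub h2).congr_deriv ?_).hasDerivWithinAt
    rw [inner_zero_left, add_zero, inner_sub_left, one_mul, inner_trans_left, neg_neg]
  have hmv := (convex_uIcc 0 h).norm_image_sub_le_of_norm_hasDerivWithin_le
    (C := |h| * ‖gw‖ * ‖gz‖) hd1 (fun s hs => by
      refine (abs_inner_le _ _).trans ?_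
      have h2 := hw.norm_trans_sub_le (-s)
      have h3 := abs_sub_left_of_mem_uIcc hs
      rw [neg_smul, abs_neg] at h2
      rw [sub_zero, sub_zero] at h3
      exact mul_le_mul_of_nonneg_right
        (h2.trans (mul_le_mul_of_nonneg_right h3 (norm_nonneg _))) (norm_nonneg _)) left_mem_uIcc right_mem_uIcc
  rw [zero_smul, trans_zero, zero_mul, sub_zero, sub_zero, Real.norm_eq_abs, Real.norm_eq_abs] at hmv
  have e : inner ℝ w (MassGame.diffQ i h z) - inner ℝ w gz =
      h⁻¹ * (inner ℝ w (trans (h • bvec i) z) - h * inner ℝ w gz - inner ℝ w z) := by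
    rw [diffQ_apply, real_inner_smul_right, inner_sub_right]
    field_simp
    ring
  rw [e, abs_mul, abs_inv, inv_mul_le_iff₀ (abs_pos.2 h0)]
  linarith

end CentralDiff

end

section

open FieldSpace

variable {d : ℕ}

/-! ### The difference scheme: stability and consistency. -/

section Scheme

/-- The operator `u ↦ ∑ i, D_i^h (b_i u)` with central differences. -/
def schemeOp (h : ℝ) (b : FieldSpace d) : L2s d →L[ℝ] L2s d :=
  ∑ i, (cDiff i h).comp (mulL (compB i b))

theorem schemeOp_apply (h : ℝ) (b : FieldSpace d) (u : L2s d) :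
    schemeOp h b u = ∑ i, cDiff i h (mulL (compB i b) u) := by
  simp [schemeOp]

theorem continuous_schemeOp (h : ℝ) :
    Continuous fun p : FieldSpace d × L2s d => schemeOp h p.1 p.2 := by
  simp only [schemeOp_apply]
  exact continuous_finsetSum _ fun i _ => (cDiff i h).continuous.comp
    ((continuous_mulL.comp ((continuous_compB i).comp continuous_fst)).clm_apply continuous_snd)

variable {M K : ℝ} {b : FieldSpace d}

/-- The bound degenerates as h → 0; it serves only to solve the scheme as an ordinary differential
equation in L² for each fixed step. -/
theorem norm_schemeOp_le (hb : b ∈ Btilde d M) (h : ℝ) (u : L2s d) :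
    ‖schemeOp h b u‖ ≤ d * (2 * |h|⁻¹ * M) * ‖u‖ := by
  rw [schemeOp_apply]
  refine (norm_sum_le _ _).trans ((Finset.sum_le_sum (g := fun _ => 2 * |h|⁻¹ * M * ‖u‖)
    fun i _ => ?_).trans (le_of_eq (by simp; ring)))
  refine (norm_cDiff_le_diffQ _ _ _).trans ((norm_diffQ_le _ _ _).trans ?_)
  rw [mul_assoc _ M]
  gcongr
  exact norm_mulL_le (abs_compB_le hb i) u

theorem abs_inner_schemeOp_le (hC : C11 K b) (hK : 0 ≤ K) (h : ℝ) (u : L2s d) :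
    |2 * inner ℝ u (schemeOp h b u)| ≤ d * K * ‖u‖ ^ 2 := by
  rw [schemeOp_apply, inner_sum, Finset.mul_sum]
  refine (Finset.abs_sum_le_sum_abs _ _).trans ((Finset.sum_le_sum fun i _ =>
    abs_inner_cDiff_mulL_le i (abs_diffB_compB_le hC hK i i) h u).trans (le_of_eq (by simp; ring)))

theorem abs_diffB_diffB_le (hC : C11 K b) (hK : 0 ≤ K) (i j l : Fin d) (h k : ℝ) (x : Pt d) :
    |diffB j h (diffB l k (compB i b)) x| ≤ K := by
  rw [diffB_apply, diffB_apply, diffB_apply, ← mul_sub, abs_mul, abs_mul, abs_inv, abs_inv]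
  rcases eq_or_ne h 0 with rfl | h0
  · simpa using hK
  rcases eq_or_ne k 0 with rfl | k0
  · simpa using hK
  rw [inv_mul_le_iff₀ (abs_pos.2 h0), inv_mul_le_iff₀ (abs_pos.2 k0)]
  calc _ ≤ K * |h| * |k| := abs_second_diff_le hC i l j x k h
    _ = _ := by ring

theorem diffQ_schemeOp (j : Fin d) (h k : ℝ) (u : L2s d) :
    diffQ j k (schemeOp h b u) = schemeOp h b (diffQ j k u) +
      ∑ i, cDiff i h (mulL (diffB j k (compB i b)) (trans (k • bvec j) u)) := by
  rw [schemeOp_apply, schemeOp_apply, map_sum, ← Finset.sum_add_distrib]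
  refine Finset.sum_congr rfl fun i _ => ?_
  rw [diffQ_cDiff, diffQ_mulL, (cDiff i h).map_add]

/-- The commutator term is a step-h difference of a product, hence a second difference of b times u
plus a first difference of b times a step-h difference of u. So the estimate for step k closes only
together with the one for the mesh h. The constant is dK for transport plus 2 · 2dK for the
commutator. -/
theorem abs_inner_diffQ_schemeOp_le (hC : C11 K b) (hK : 0 ≤ K) (j : Fin d) (h k : ℝ) (u : L2s d)
    {E : ℝ} (h1 : ‖u‖ ≤ E) (h2 : ∀ i, ‖diffQ i h u‖ ≤ E) (h3 : ‖diffQ j k u‖ ≤ E) :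
    |2 * inner ℝ (diffQ j k u) (schemeOp h b (diffQ j k u) +
      ∑ i, cDiff i h (mulL (diffB j k (compB i b)) (trans (k • bvec j) u)))| ≤
      5 * d * K * E ^ 2 := by
  have hE : 0 ≤ E := (norm_nonneg _).trans h1
  rw [inner_add_right, mul_add]
  refine (abs_add_le _ _).trans ?_
  have hA : |2 * inner ℝ (diffQ j k u) (schemeOp h b (diffQ j k u))| ≤ d * K * E ^ 2 := by
    refine (abs_inner_schemeOp_le hC hK h _).trans ?_
    gcongr
  have hB : ‖∑ i, cDiff i h (mulL (diffB j k (compB i b)) (trans (k • bvec j) u))‖ ≤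
      d * (2 * K * E) := by
    refine (norm_sum_le _ _).trans ((Finset.sum_le_sum (g := fun _ => 2 * K * E)
      fun i _ => ?_).trans (le_of_eq (by simp)))
    set v := trans (k • bvec j) u with hv
    set c := diffB j k (compB i b) with hc
    have e1 : ‖cDiff i h (mulL c v) - mulL c (cDiff i h v)‖ ≤ K * ‖v‖ :=
      norm_cDiff_mulL_sub_le i (fun h x => abs_diffB_diffB_le hC hK i i j h k x) h v
    have e2 : ‖mulL c (cDiff i h v)‖ ≤ K * ‖cDiff i h v‖ :=
      norm_mulL_le (abs_diffB_compB_le hC hK i j k) _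
    have e3 : ‖cDiff i h v‖ ≤ E := by
      rw [hv, ← trans_cDiff, norm_trans]
      exact (norm_cDiff_le_diffQ _ _ _).trans (h2 i)
    have e4 : ‖v‖ ≤ E := by rwa [hv, norm_trans]
    calc ‖cDiff i h (mulL c v)‖
        ≤ ‖cDiff i h (mulL c v) - mulL c (cDiff i h v)‖ + ‖mulL c (cDiff i h v)‖ := by
          have := norm_add_le (cDiff i h (mulL c v) - mulL c (cDiff i h v)) (mulL c (cDiff i h v))
          rwa [sub_add_cancel] at this
      _ ≤ K * E + K * E := by
          gcongr
          · exact e1.trans (by gcongr)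
          · exact e2.trans (by gcongr)
      _ = 2 * K * E := by ring
  rw [abs_mul (2 : ℝ) (inner ℝ _ (∑ i, _)), abs_two]
  have hC' := (abs_inner_le (diffQ j k u)
    (∑ i, cDiff i h (mulL (diffB j k (compB i b)) (trans (k • bvec j) u)))).trans
    (mul_le_mul h3 hB (norm_nonneg _) hE)
  linarith

/-- Consistency of the scheme, tested against functions with derivatives in `L²`. -/
theorem abs_inner_schemeOp_sub_le (hb : b ∈ Btilde d M) (hC : C11 K b) (w m : H1 d) {B B' : ℝ}
    (hw : ‖w‖ ≤ B') (hm : ‖m‖ ≤ B) {h : ℝ} (h0 : h ≠ 0) :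
    |inner ℝ w.toL2 (schemeOp h b m.toL2) - inner ℝ w.toL2 (divMul b m)| ≤
      |h| * (d * (B' * ((K + M) * B))) := by
  have hM := nonneg_of_Btilde hb
  have hB := (norm_nonneg _).trans hm
  have hB' := (norm_nonneg _).trans hw
  have e : divMul b m = ∑ i, (mulL (dB i i b) m.toL2 + mulL (compB i b) (H1.gradi i m)) := by
    rw [divMul, mulL_divB, Finset.sum_add_distrib, add_comm]
  rw [schemeOp_apply, e, inner_sum, inner_sum, ← Finset.sum_sub_distrib]
  refine (Finset.abs_sum_le_sum_abs _ _).trans ((Finset.sum_le_sum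
    (g := fun _ => |h| * (B' * ((K + M) * B))) fun i _ => ?_).trans (le_of_eq (by simp; ring)))
  have hz := (m.dpart i).mulL (b.dpartB i i)
  have hg : ‖mulL (dB i i b) m.toL2 + mulL (compB i b) (H1.gradi i m)‖ ≤ (K + M) * B := by
    refine (norm_add_le _ _).trans ?_
    rw [add_mul]
    have hK : 0 ≤ K := (abs_nonneg _).trans (hC.1 i i 0)
    refine add_le_add ((norm_mulL_le (hC.1 i i) _).trans ?_)
      ((norm_mulL_le (abs_compB_le hb i) _).trans ?_)
    · have := m.norm_toL2_le.trans hm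
      gcongr
    · have := (m.norm_gradi_le i).trans hm
      gcongr
  have key : ∀ h : ℝ, h ≠ 0 → |inner ℝ w.toL2 (diffQ i h (mulL (compB i b) m.toL2)) -
      inner ℝ w.toL2 (mulL (dB i i b) m.toL2 + mulL (compB i b) (H1.gradi i m))| ≤
      |h| * (B' * ((K + M) * B)) := fun h h0 => by
    refine ((w.dpart i).abs_inner_diffQ_sub_le hz h0).trans ?_
    have := (w.norm_gradi_le i).trans hw
    gcongr
  have k1 := key h h0
  have k2 := key (-h) (neg_ne_zero.2 h0)
  rw [abs_neg] at k2
  rw [cDiff_apply, real_inner_smul_right, inner_add_right (𝕜 := ℝ) w.toL2 (diffQ i h _)]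
  rw [abs_le] at *
  constructor <;> linarith [k1.1, k1.2, k2.1, k2.2]

end Scheme

end

section

open FieldSpace

variable {d : ℕ}

/-! ### Existence for the continuity equation as a limit of the scheme. -/

section Existence

variable {t T M K : ℝ} {β : ℝ → FieldSpace d}

theorem exists_scheme (htT : t ≤ T) (hβ : Adm t T M β) (hM : 0 ≤ M) (h : ℝ) (u₀ : L2s d) :
    ∃ u : ℝ → L2s d, Continuous u ∧ u t = u₀ ∧
      IsPrim t T u (fun s => -schemeOp h (β s) (u s)) := by
  refine exists_integral_solution htT (fun s v => -schemeOp h (β s) v)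
    (L := d * (2 * |h|⁻¹ * M)) (C := 0) (by positivity) (fun u hu => ?_) ?_ ?_ u₀
  · exact ((continuous_schemeOp h).comp_aestronglyMeasurable
      (hβ.1.prodMk hu.aestronglyMeasurable)).neg
  · filter_upwards [hβ.2] with s hs u v
    rw [← neg_sub', norm_neg, ← (schemeOp h (β s)).map_sub]
    exact norm_schemeOp_le hs h _
  · exact Eventually.of_forall fun s => by rw [(schemeOp h (β s)).map_zero, neg_zero, norm_zero]

/-- The bound is independent of both the mesh h and the probing step k. Letting k → 0 for fixed h
shows that the approximations lie in a fixed ball of H¹. -/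
theorem scheme_bound (hK : 0 ≤ K)
    (hC : ∀ᵐ s ∂(volume.restrict (Icc t T)), C11 K (β s)) {h : ℝ} {u : ℝ → L2s d} (m₀ : H1 d)
    (hu : IsPrim t T u (fun s => -schemeOp h (β s) (u s))) (h0 : u t = m₀.toL2) {s : ℝ}
    (hs : s ∈ Icc t T) (k : ℝ) :
    ‖u s‖ ^ 2 + ∑ j, ‖diffQ j k (u s)‖ ^ 2 ≤
      2 * ‖m₀‖ ^ 2 * Real.exp ((2 * d + 1) * (5 * d * K) * (T - t)) := by
  -- Both steps are included because the estimate for k uses the quotients of step h. There are 2d +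
  -- 1 terms, and the initial gradient enters twice, whence the factor 2.
  set E : ℝ → ℝ := fun s => ‖u s‖ ^ 2 + ∑ j, ‖diffQ j h (u s)‖ ^ 2 + ∑ j, ‖diffQ j k (u s)‖ ^ 2
    with hE
  set c := 5 * d * K with hc
  have hc0 : 0 ≤ c := by positivity
  have hcont : ContinuousOn E (Icc t T) := by
    have h1 := IsPrim.continuousOn hu
    have h2 : ∀ A : L2s d →L[ℝ] L2s d, ContinuousOn (fun s => ‖A (u s)‖ ^ 2) (Icc t T) := fun A =>
      (A.continuous.comp_continuousOn h1).norm.pow 2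
    exact ((h1.norm.pow 2).add (continuousOn_finsetSum _ fun j _ => h2 _)).add
      (continuousOn_finsetSum _ fun j _ => h2 _)
  have hp : ∀ s j, 0 ≤ ‖diffQ j h (u s)‖ ^ 2 ∧ 0 ≤ ‖diffQ j k (u s)‖ ^ 2 := fun s j =>
    ⟨by positivity, by positivity⟩
  have hs1 : ∀ s, 0 ≤ ∑ j, ‖diffQ j h (u s)‖ ^ 2 := fun s => Finset.sum_nonneg fun j _ => (hp s j).1
  have hs2 : ∀ s, 0 ≤ ∑ j, ‖diffQ j k (u s)‖ ^ 2 := fun s => Finset.sum_nonneg fun j _ => (hp s j).2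
  have hE0 : ∀ s, 0 ≤ E s := fun s => by
    have := hs1 s; have := hs2 s
    positivity
  have b1 : ∀ s, ‖u s‖ ≤ √(E s) := fun s => Real.le_sqrt_of_sq_le (by
    linarith [hs1 s, hs2 s])
  have b2 : ∀ s j, ‖diffQ j h (u s)‖ ≤ √(E s) := fun s j => Real.le_sqrt_of_sq_le (by
    have := Finset.single_le_sum (f := fun j => ‖diffQ j h (u s)‖ ^ 2) (fun j _ => (hp s j).1)
      (Finset.mem_univ j)
    have h2 : 0 ≤ ‖u s‖ ^ 2 := by positivity
    linarith [hs2 s])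
  have b3 : ∀ s j, ‖diffQ j k (u s)‖ ≤ √(E s) := fun s j => Real.le_sqrt_of_sq_le (by
    have := Finset.single_le_sum (f := fun j => ‖diffQ j k (u s)‖ ^ 2) (fun j _ => (hp s j).2)
      (Finset.mem_univ j)
    have h2 : 0 ≤ ‖u s‖ ^ 2 := by positivity
    linarith [hs1 s])
  have hgron : ∀ s ∈ Icc t T, E s ≤ E t + (2 * d + 1) * c * ∫ τ in t..s, E τ := by
    intro s hs
    have ht : t ∈ Icc t T := ⟨le_rfl, hs.1.trans hs.2⟩
    have hi : IntervalIntegrable (fun s => c * E s) volume t s :=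
      (ContinuousOn.intervalIntegrable (by
        rw [uIcc_of_le hs.1]; exact hcont.mono (Icc_subset_Icc_right hs.2))).const_mul c
    have hcomp : ∀ l : ℝ, (∀ s j, ‖diffQ j l (u s)‖ ≤ √(E s)) → ∀ j,
        ‖diffQ j l (u s)‖ ^ 2 ≤ ‖diffQ j l (u t)‖ ^ 2 + c * ∫ τ in t..s, E τ := by
      intro l hl j
      rw [← intervalIntegral.integral_const_mul]
      refine IsPrim.energy_le (v := fun s => diffQ j l (u s))
        (w := fun s => diffQ j l (-schemeOp h (β s) (u s)))
        (hu.clm_comp (diffQ j l)) ht hs hs.1 hi ?_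
      filter_upwards [hC] with τ hτ
      rw [(diffQ j l).map_neg]
      refine (le_abs_self _).trans ?_
      rw [abs_two_inner_neg, diffQ_schemeOp]
      refine (abs_inner_diffQ_schemeOp_le hτ hK j h l (u τ) (b1 τ) (b2 τ) (hl τ j)).trans ?_
      rw [Real.sq_sqrt (hE0 τ)]
    have h1 : ‖u s‖ ^ 2 ≤ ‖u t‖ ^ 2 + c * ∫ τ in t..s, E τ := by
      rw [← intervalIntegral.integral_const_mul]
      refine IsPrim.energy_le hu ht hs hs.1 hi ?_
      filter_upwards [hC] with τ hτ
      refine (le_abs_self _).trans ?_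
      rw [abs_two_inner_neg]
      refine (abs_inner_schemeOp_le hτ hK h (u τ)).trans ?_
      have h3 : ‖u τ‖ ^ 2 ≤ E τ := by linarith [hs1 τ, hs2 τ]
      have h4 : d * K ≤ c := by rw [hc]; nlinarith [show (0 : ℝ) ≤ d * K by positivity]
      exact mul_le_mul h4 h3 (by positivity) hc0
    have h2 := Finset.sum_le_sum fun j (_ : j ∈ Finset.univ) => hcomp h b2 j
    have h3 := Finset.sum_le_sum fun j (_ : j ∈ Finset.univ) => hcomp k b3 j
    rw [Finset.sum_add_distrib, Finset.sum_const, Finset.card_univ, Fintype.card_fin,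
      nsmul_eq_mul] at h2 h3
    simp only [hE] at h1 h2 h3 ⊢
    linarith
  have hmain := gronwall_integral (by positivity) hcont hgron s hs
  have hEt : E t ≤ 2 * ‖m₀‖ ^ 2 := by
    have h1 : ∀ l, ∑ j, ‖diffQ j l (u t)‖ ^ 2 ≤ ∑ j, ‖H1.gradi j m₀‖ ^ 2 := fun l =>
      Finset.sum_le_sum fun j _ => by
        rw [h0]
        have := (m₀.dpart j).norm_diffQ_le l
        gcongr
    have h2 := m₀.norm_sq
    have h3 : 0 ≤ ‖m₀.toL2‖ ^ 2 := by positivity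
    have h4 : ‖u t‖ ^ 2 = ‖m₀.toL2‖ ^ 2 := by rw [h0]
    simp only [hE]
    linarith [h1 h, h1 k]
  calc _ ≤ E s := by linarith [hs1 s]
    _ ≤ E t * Real.exp ((2 * d + 1) * c * (s - t)) := hmain
    _ ≤ _ := by
      have : s - t ≤ T - t := by linarith [hs.2]
      gcongr

theorem exists_H1_of_diffQ_bound {u : L2s d} {B : ℝ} (hB : 0 ≤ B)
    (h : ∀ k, ‖u‖ ^ 2 + ∑ j, ‖diffQ j k u‖ ^ 2 ≤ B ^ 2) :
    ∃ m : H1 d, m.toL2 = u ∧ ‖m‖ ≤ B := by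
  have h1 : ∀ j k, ‖diffQ j k u‖ ≤ B := fun j k => by
    refine le_of_sq_le_sq ?_ hB
    have h1 := Finset.single_le_sum (f := fun j => ‖diffQ j k u‖ ^ 2) (fun j _ => by positivity)
      (Finset.mem_univ j)
    have h2 : 0 ≤ ‖u‖ ^ 2 := by positivity
    linarith [h k]
  obtain ⟨m, hm⟩ := H1.exists_of_diffQuot (u := u) (C := B) fun i s hs => by
    have := h1 i s
    rw [diffQ_apply, norm_smul, norm_inv, Real.norm_of_nonneg hs.le, inv_mul_le_iff₀ hs] at this
    linarith
  refine ⟨m, hm, le_of_sq_le_sq ?_ hB⟩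
  rw [H1.norm_sq]
  have h2 : Tendsto (fun n : ℕ => ‖u‖ ^ 2 + ∑ j, ‖diffQ j (1 / ((n : ℝ) + 1)) u‖ ^ 2) atTop
      (𝓝 (‖m.toL2‖ ^ 2 + ∑ j, ‖H1.gradi j m‖ ^ 2)) := by
    rw [← hm]
    exact tendsto_const_nhds.add (tendsto_finsetSum _ fun j _ =>
      (((m.dpart j).tendsto_diffQ.comp tendsto_one_div_nat_nhdsNE).norm).pow 2)
  exact le_of_tendsto h2 (Eventually.of_forall fun n => h _)

end Existence

end

section

open FieldSpace

variable {d : ℕ} {t T M K : ℝ} {β : ℝ → FieldSpace d}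

section Existence

/-- The mesh size `1 / (n + 1)`. -/
abbrev mesh (n : ℕ) : ℝ := 1 / ((n : ℝ) + 1)

theorem mesh_pos (n : ℕ) : 0 < mesh n := by positivity

/-- The difference of two approximations is bounded in H¹, so it may be used as the test function
for consistency: replacing one mesh by the other costs O(mesh n + mesh p), and stability in L² with
Gronwall does the rest. -/
theorem scheme_cauchy (hβ : Adm t T M β) (hK : 0 ≤ K) (hM : 0 ≤ M)
    (hC : ∀ᵐ s ∂(volume.restrict (Icc t T)), C11 K (β s)) {u : ℕ → ℝ → L2s d}
    {N : ℕ → ℝ → H1 d} {B : ℝ} (hB : 0 ≤ B)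
    (hu : ∀ n, IsPrim t T (u n) (fun s => -schemeOp (mesh n) (β s) (u n s)))
    (h0 : ∀ n p, u n t = u p t) (hN : ∀ n, ∀ s ∈ Icc t T, (N n s).toL2 = u n s ∧ ‖N n s‖ ≤ B)
    {n p : ℕ} {s : ℝ} (hs : s ∈ Icc t T) :
    ‖u n s - u p s‖ ^ 2 ≤ 2 * (d * (2 * B * ((K + M) * B))) * (T - t) *
      Real.exp (d * K * (T - t)) * (mesh n + mesh p) := by
  set D := d * (2 * B * ((K + M) * B)) with hD
  have hD0 : 0 ≤ D := by positivity
  have hsub := (hu n).sub (hu p)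
  have hc : ContinuousOn (fun s => ‖u n s - u p s‖ ^ 2) (Icc t T) := hsub.continuousOn.norm.pow 2
  have hmn := mesh_pos n
  have hmp := mesh_pos p
  have key := gronwall_integral (K := d * K) (a := 2 * D * (mesh n + mesh p) * (T - t))
    (by positivity) hc (fun s hs => by
      have ht : t ∈ Icc t T := ⟨le_rfl, hs.1.trans hs.2⟩
      have hi : IntervalIntegrable (fun s => d * K * ‖u n s - u p s‖ ^ 2) volume t s :=
        (ContinuousOn.intervalIntegrable (by
          rw [uIcc_of_le hs.1]; exact hc.mono (Icc_subset_Icc_right hs.2))).const_mul _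
      have h1 := hsub.energy_le (g := fun s => d * K * ‖u n s - u p s‖ ^ 2 +
        2 * D * (mesh n + mesh p)) ht hs hs.1 (hi.add intervalIntegrable_const) (by
          filter_upwards [hβ.2, hC, ae_restrict_mem measurableSet_Icc] with τ h1 h2 h3
          obtain ⟨e1, b1⟩ := hN n τ h3
          obtain ⟨e2, b2⟩ := hN p τ h3
          set w := N n τ - N p τ with hw
          have ew : w.toL2 = u n τ - u p τ := by
            rw [← e1, ← e2]; exact map_sub H1.toL2L _ _
          have bw : ‖w‖ ≤ 2 * B := (norm_sub_le _ _).trans (by linarith)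
          have c1 := abs_inner_schemeOp_sub_le h1 h2 w (N p τ) bw b2 hmn.ne'
          have c2 := abs_inner_schemeOp_sub_le h1 h2 w (N p τ) bw b2 hmp.ne'
          rw [← hD, abs_of_pos hmn, e2] at c1
          rw [← hD, abs_of_pos hmp, e2] at c2
          have c3 := abs_inner_schemeOp_le h2 hK (mesh n) w.toL2
          rw [ew] at c1 c2 c3
          have e3 : -schemeOp (mesh n) (β τ) (u n τ) - -schemeOp (mesh p) (β τ) (u p τ) =
              schemeOp (mesh p) (β τ) (u p τ) - schemeOp (mesh n) (β τ) (u p τ) -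
                schemeOp (mesh n) (β τ) (u n τ - u p τ) := by
            rw [(schemeOp (mesh n) (β τ)).map_sub]; abel
          rw [e3, inner_sub_right, inner_sub_right]
          have a1 := abs_le.1 c1
          have a2 := abs_le.1 c2
          have a3 := abs_le.1 c3
          linarith [a1.1, a1.2, a2.1, a2.2, a3.1, a3.2])
      rw [intervalIntegral.integral_add hi intervalIntegrable_const,
        intervalIntegral.integral_const_mul, intervalIntegral.integral_const, smul_eq_mul,
        h0 n p, sub_self, norm_zero] at h1
      have h2 : (s - t) * (2 * D * (mesh n + mesh p)) ≤ (T - t) * (2 * D * (mesh n + mesh p)) := by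
        gcongr
        exact hs.2
      linarith) s hs
  refine key.trans ?_
  have h1 : s - t ≤ T - t := by linarith [hs.2]
  have h2 : 0 ≤ T - t := by linarith [hs.1, hs.2]
  calc _ ≤ 2 * D * (mesh n + mesh p) * (T - t) * Real.exp (d * K * (T - t)) := by gcongr
    _ = _ := by ring

/-- No gradient of m remains on the right, so this form passes to limits in L². -/
theorem inner_divMul_test (b : FieldSpace d) (m : H1 d) (φ : Test d) :
    inner ℝ (divMul b m) φ.toL2 =
      -∑ i, inner ℝ (mulL (compB i b) m.toL2) (φ.der (bvec i)).toL2 := by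
  have h1 : ∀ i, inner ℝ (mulL (compB i b) m.toL2) (φ.der (bvec i)).toL2 =
      - inner ℝ (mulL (dB i i b) m.toL2 + mulL (compB i b) (H1.gradi i m)) φ.toL2 := fun i => by
    have := ((m.dpart i).mulL (b.dpartB i i)).inner_add_inner (φ.dpart i)
    linarith
  rw [Finset.sum_congr rfl fun i _ => h1 i, Finset.sum_neg_distrib, ← sum_inner,
    Finset.sum_add_distrib, divMul, mulL_divB, add_comm, neg_neg]

/-- A limit in L² gives measurability of m only as an L² function; its gradient is measurable as a
pointwise limit of difference quotients. -/
theorem Adm.aestronglyMeasurable_divMul (hβ : Adm t T M β) {m : ℝ → H1 d}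
    (hm : AEStronglyMeasurable (fun s => (m s).toL2) (volume.restrict (Icc t T))) :
    AEStronglyMeasurable (fun s => -divMul (β s) (m s)) (volume.restrict (Icc t T)) := by
  have hmG : ∀ i, AEStronglyMeasurable (fun s => H1.gradi i (m s)) (volume.restrict (Icc t T)) :=
    fun i => aestronglyMeasurable_of_tendsto_ae (f := fun (n : ℕ) s => diffQ i (mesh n) (m s).toL2)
      atTop
      (fun n : ℕ => (diffQ i (mesh n)).continuous.comp_aestronglyMeasurable hm)
      (Eventually.of_forall fun s => ((m s).dpart i).tendsto_diffQ.comp tendsto_one_div_nat_nhdsNE)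
  have hmul : ∀ (A : FieldSpace d → (Pt d →ᵇ ℝ)) (v : ℝ → L2s d), Continuous A →
      AEStronglyMeasurable v (volume.restrict (Icc t T)) →
      AEStronglyMeasurable (fun s => mulL (A (β s)) (v s)) (volume.restrict (Icc t T)) :=
    fun A v hA hv => by
      have : Continuous fun p : FieldSpace d × L2s d => mulL (A p.1) p.2 :=
        (continuous_mulL.comp (hA.comp continuous_fst)).clm_apply continuous_snd
      exact this.comp_aestronglyMeasurable (hβ.1.prodMk hv)
  have hsum := Finset.aestronglyMeasurable_fun_sum (Finset.univ : Finset (Fin d)) fun i _ =>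
    hmul (compB i) (fun s => H1.gradi i (m s)) (continuous_compB i) (hmG i)
  exact (hsum.add (hmul divB (fun s => (m s).toL2) continuous_divB hm)).neg

/-- The scheme is first replaced by div (β N), with N the H¹ version of u, at the cost of O(mesh).
Then the coefficients and derivatives are put on φ, where convergence in L² suffices. The H¹ bound
gives dominated convergence in time. -/
theorem scheme_limit (htT : t ≤ T) (hβ : Adm t T M β) (hM : 0 ≤ M) (hK : 0 ≤ K)
    (hC : ∀ᵐ s ∂(volume.restrict (Icc t T)), C11 K (β s)) {u : ℕ → ℝ → L2s d}
    {N : ℕ → ℝ → H1 d} {B : ℝ} (hB : 0 ≤ B)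
    (hu : ∀ n, IsPrim t T (u n) (fun s => -schemeOp (mesh n) (β s) (u n s))) {m : ℝ → H1 d}
    (h0 : ∀ n, u n t = (m t).toL2) (hN : ∀ n, ∀ s ∈ Icc t T, (N n s).toL2 = u n s ∧ ‖N n s‖ ≤ B)
    (hm : ∀ s ∈ Icc t T, Tendsto (fun n => u n s) atTop (𝓝 (m s).toL2)) (φ : Test d) {s : ℝ}
    (hs : s ∈ Icc t T) : inner ℝ (m s).toL2 φ.toL2 = inner ℝ (m t).toL2 φ.toL2 +
      ∫ τ in t..s, inner ℝ (-divMul (β τ) (m τ)) φ.toL2 := by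
  have ht : t ∈ Icc t T := ⟨le_rfl, htT⟩
  have heq : ∀ n, inner ℝ (u n s) φ.toL2 = inner ℝ (m t).toL2 φ.toL2 +
      ∫ τ in t..s, inner ℝ (-schemeOp (mesh n) (β τ) (u n τ)) φ.toL2 := fun n => by
    rw [(hu n).eq s hs, inner_add_left, h0, inner_intervalIntegral_left
      ((hu n).intervalIntegrable ht hs)]
  obtain ⟨Φ, hΦ, -⟩ := H1.exists_of_test_fun φ
  set D := d * (‖Φ‖ * ((K + M) * B)) with hD
  have hD0 : 0 ≤ D := by positivity
  have hsch : ∀ n τ, τ ∈ Icc t T → β τ ∈ Btilde d M → C11 K (β τ) →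
      |inner ℝ (-schemeOp (mesh n) (β τ) (u n τ)) φ.toL2 -
        inner ℝ (-divMul (β τ) (N n τ)) φ.toL2| ≤ mesh n * D := fun n τ h1 h2 h3 => by
    have h4 := abs_inner_schemeOp_sub_le h2 h3 Φ (N n τ) le_rfl (hN n τ h1).2 (mesh_pos n).ne'
    rw [(hN n τ h1).1, abs_of_pos (mesh_pos n), hΦ, ← hD, real_inner_comm,
      real_inner_comm _ φ.toL2, abs_sub_comm] at h4
    rw [inner_neg_left, inner_neg_left, neg_sub_neg]
    exact h4
  have hpt : ∀ τ, τ ∈ Icc t T → β τ ∈ Btilde d M → C11 K (β τ) →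
      Tendsto (fun n => inner ℝ (-schemeOp (mesh n) (β τ) (u n τ)) φ.toL2) atTop
        (𝓝 (inner ℝ (-divMul (β τ) (m τ)) φ.toL2)) := fun τ h1 h2 h3 => by
    have l1 : Tendsto (fun n => inner ℝ (-divMul (β τ) (N n τ)) φ.toL2) atTop
        (𝓝 (inner ℝ (-divMul (β τ) (m τ)) φ.toL2)) := by
      simp only [inner_neg_left, inner_divMul_test, (hN _ τ h1).1, neg_neg]
      exact tendsto_finsetSum _ fun i _ =>
        (((mulL (compB i (β τ))).continuous.tendsto _).comp (hm τ h1)).inner tendsto_const_nhds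
    have l2 : Tendsto (fun n => inner ℝ (-schemeOp (mesh n) (β τ) (u n τ)) φ.toL2 -
        inner ℝ (-divMul (β τ) (N n τ)) φ.toL2) atTop (𝓝 0) :=
      squeeze_zero_norm (fun n => hsch n τ h1 h2 h3) (by
        have := tendsto_one_div_add_atTop_nhds_zero_nat (𝕜 := ℝ).mul_const D
        rwa [zero_mul] at this)
    have := l2.add l1
    simpa using this
  have hL : Tendsto (fun n => inner ℝ (u n s) φ.toL2) atTop (𝓝 (inner ℝ (m s).toL2 φ.toL2)) :=
    (hm s hs).inner tendsto_const_nhds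
  have hR : Tendsto (fun n => inner ℝ (m t).toL2 φ.toL2 +
      ∫ τ in t..s, inner ℝ (-schemeOp (mesh n) (β τ) (u n τ)) φ.toL2) atTop
      (𝓝 (inner ℝ (m t).toL2 φ.toL2 + ∫ τ in t..s, inner ℝ (-divMul (β τ) (m τ)) φ.toL2)) := by
    refine tendsto_const_nhds.add ?_
    refine intervalIntegral.tendsto_integral_filter_of_dominated_convergence
      (fun _ => D + (d + 1) * M * B * ‖φ.toL2‖)
      (Eventually.of_forall fun n => ?_) (Eventually.of_forall fun n => ?_)
      intervalIntegrable_const ?_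
    · have h1 := (hu n).meas.inner (aestronglyMeasurable_const (b := φ.toL2))
        (𝕜 := ℝ)
      exact h1.mono_measure (Measure.restrict_mono (by
        rw [uIoc_of_le hs.1]
        exact Ioc_subset_Icc_self.trans (Icc_subset_Icc_right hs.2)) le_rfl)
    · refine ae_uIoc_of_ae_Icc ht hs ?_
      filter_upwards [hβ.2, hC, ae_restrict_mem measurableSet_Icc] with τ h1 h2 h3
      have c1 := hsch n τ h3 h1 h2
      have c2 : |inner ℝ (-divMul (β τ) (N n τ)) φ.toL2| ≤ (d + 1) * M * B * ‖φ.toL2‖ := by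
        refine (abs_inner_le _ _).trans ?_
        rw [norm_neg]
        have := norm_divMul_le h1 (N n τ)
        have h4 := (hN n τ h3).2
        refine mul_le_mul_of_nonneg_right (this.trans ?_) (norm_nonneg _)
        gcongr
      have c3 : mesh n * D ≤ D := by
        refine mul_le_of_le_one_left hD0 ?_
        rw [mesh, div_le_one (by positivity)]
        linarith [show (0 : ℝ) ≤ n by positivity]
      rw [Real.norm_eq_abs]
      have a1 := abs_le.1 c1
      have a2 := abs_le.1 c2
      rw [abs_le]
      constructor <;> linarith [a1.1, a1.2, a2.1, a2.2]
    · refine ae_uIoc_of_ae_Icc ht hs ?_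
      filter_upwards [hβ.2, hC, ae_restrict_mem measurableSet_Icc] with τ h1 h2 h3
      exact hpt τ h3 h1 h2
  exact tendsto_nhds_unique (hL.congr heq) hR

/-- Existence for the continuity equation in `H¹`. -/
theorem exists_isStrong (htT : t ≤ T) (hβ : Adm t T M β) (hK : 0 ≤ K) (hM : 0 ≤ M)
    (hC : ∀ᵐ s ∂(volume.restrict (Icc t T)), C11 K (β s)) (m₀ : H1 d) :
    ∃ m : ℝ → H1 d, m t = m₀ ∧ IsStrong t T β m ∧ ContinuousOn m (Icc t T) := by
  choose u huc hu0 hu using fun n : ℕ => exists_scheme htT hβ hM (mesh n) m₀.toL2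
  set B := √(2 * ‖m₀‖ ^ 2 * Real.exp ((2 * d + 1) * (5 * d * K) * (T - t))) with hBdef
  have hB0 : 0 ≤ B := Real.sqrt_nonneg _
  have hB2 : B ^ 2 = 2 * ‖m₀‖ ^ 2 * Real.exp ((2 * d + 1) * (5 * d * K) * (T - t)) :=
    Real.sq_sqrt (by positivity)
  have hbound : ∀ n, ∀ s ∈ Icc t T, ∀ k,
      ‖u n s‖ ^ 2 + ∑ j, ‖diffQ j k (u n s)‖ ^ 2 ≤ B ^ 2 := fun n s hs k => by
    rw [hB2]; exact scheme_bound hK hC m₀ (hu n) (hu0 n) hs k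
  have hex : ∀ n s, ∃ m : H1 d, s ∈ Icc t T → m.toL2 = u n s ∧ ‖m‖ ≤ B := fun n s => by
    by_cases hs : s ∈ Icc t T
    · obtain ⟨m, h1, h2⟩ := exists_H1_of_diffQ_bound hB0 (hbound n s hs)
      exact ⟨m, fun _ => ⟨h1, h2⟩⟩
    · exact ⟨0, fun h => absurd h hs⟩
  choose N hN using hex
  set c := 2 * (d * (2 * B * ((K + M) * B))) * (T - t) * Real.exp (d * K * (T - t)) with hc
  have hc0 : 0 ≤ c := by
    have : 0 ≤ T - t := by linarith
    positivity
  have hcau : ∀ s ∈ Icc t T, CauchySeq fun n => u n s := by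
    intro s hs
    refine cauchySeq_of_le_tendsto_0 (fun n => √(c * (2 * mesh n))) (fun n p q hn hp => ?_) ?_
    · rw [dist_eq_norm]
      refine Real.le_sqrt_of_sq_le ((scheme_cauchy hβ hK hM hC hB0 hu
        (fun n p => (hu0 n).trans (hu0 p).symm) (fun n s hs => hN n s hs) hs).trans ?_)
      rw [← hc]
      have := one_div_le_one_div_of_le (by positivity : (0 : ℝ) < (q : ℝ) + 1)
        (by exact_mod_cast Nat.succ_le_succ hn : (q : ℝ) + 1 ≤ (n : ℝ) + 1)
      have := one_div_le_one_div_of_le (by positivity : (0 : ℝ) < (q : ℝ) + 1)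
        (by exact_mod_cast Nat.succ_le_succ hp : (q : ℝ) + 1 ≤ (p : ℝ) + 1)
      gcongr
      simp only [mesh]
      linarith
    · have h1 : Tendsto (fun n : ℕ => c * (2 * mesh n)) atTop (𝓝 (c * (2 * 0))) :=
        (tendsto_one_div_add_atTop_nhds_zero_nat.const_mul 2).const_mul c
      have := h1.sqrt
      simpa using this
  have hlim : ∀ s, ∃ m : H1 d, s ∈ Icc t T →
      Tendsto (fun n => u n s) atTop (𝓝 m.toL2) ∧ ‖m‖ ≤ B := fun s => by
    by_cases hs : s ∈ Icc t T
    · obtain ⟨v, hv⟩ := cauchySeq_tendsto_of_complete (hcau s hs)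
      obtain ⟨m, h1, h2⟩ := exists_H1_of_diffQ_bound (u := v) hB0 fun k =>
        le_of_tendsto ((hv.norm.pow 2).add (tendsto_finsetSum _ fun j _ =>
          ((((diffQ j k).continuous.tendsto v).comp hv).norm).pow 2))
          (Eventually.of_forall fun n => hbound n s hs k)
      exact ⟨m, fun _ => ⟨by rwa [h1], h2⟩⟩
    · exact ⟨0, fun h => absurd h hs⟩
  choose m hm using hlim
  have hBm : ∀ s ∈ Icc t T, ‖m s‖ ≤ B := fun s hs => (hm s hs).2
  have ht : t ∈ Icc t T := ⟨le_rfl, htT⟩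
  have hmt : m t = m₀ := H1.ext_toL2 (tendsto_nhds_unique (hm t ht).1 (by
    simp only [hu0]; exact tendsto_const_nhds))
  have hmL : AEStronglyMeasurable (fun s => (m s).toL2) (volume.restrict (Icc t T)) :=
    aestronglyMeasurable_of_tendsto_ae atTop (fun n => (huc n).aestronglyMeasurable) (by
      filter_upwards [ae_restrict_mem measurableSet_Icc] with s hs using (hm s hs).1)
  have hstrong : IsStrong t T β m :=
    isStrong_of_test hβ hM hBm (hβ.aestronglyMeasurable_divMul hmL) fun φ s hs =>
      scheme_limit htT hβ hM hK hC hB0 hu (fun n => (hu0 n).trans (by rw [hmt]))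
        (fun n s hs => hN n s hs) (fun s hs => (hm s hs).1) φ hs
  exact ⟨m, hmt, hstrong, hstrong.continuousOn hβ hM hK hC hBm⟩

end Existence

end

section

open FieldSpace

variable {d : ℕ} {t T M K : ℝ} {β : ℝ → FieldSpace d} {m : ℝ → H1 d}

/-! ### Exponential weights. -/

section Weight

variable {μ ε : ℝ} {z : Pt d}

/-- A smooth substitute for the distance to `z`. -/
def sdist (ε : ℝ) (z x : Pt d) : ℝ := √(ε ^ 2 + ‖x - z‖ ^ 2)

theorem continuous_sdist (ε : ℝ) (z : Pt d) : Continuous (sdist ε z) := by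
  unfold sdist; fun_prop

theorem norm_le_sdist (ε : ℝ) (z x : Pt d) : ‖x - z‖ ≤ sdist ε z x :=
  Real.le_sqrt_of_sq_le (by linarith [sq_nonneg ε])

theorem sdist_pos (hε : 0 < ε) (z x : Pt d) : 0 < sdist ε z x := Real.sqrt_pos.2 (by positivity)

/-- The exponential weight `exp (-μ √(ε² + |x - z|²))`. -/
def weight (μ ε : ℝ) (hμ : 0 < μ) (z : Pt d) : Pt d →ᵇ ℝ :=
  BoundedContinuousFunction.ofNormedAddCommGroup (fun x => Real.exp (-(μ * sdist ε z x)))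
    (Real.continuous_exp.comp (continuous_const.mul (continuous_sdist ε z)).neg) 1 (fun x => by
      rw [Real.norm_of_nonneg (Real.exp_pos _).le, Real.exp_le_one_iff, neg_nonpos]
      exact mul_nonneg hμ.le (Real.sqrt_nonneg _))

theorem weight_apply (hμ : 0 < μ) (x : Pt d) :
    weight μ ε hμ z x = Real.exp (-(μ * sdist ε z x)) := rfl

theorem abs_weight_der_le (hμ : 0 < μ) (hε : 0 < ε) (i : Fin d) (x : Pt d) :
    |-(μ * ((x - z) i / sdist ε z x)) * weight μ ε hμ z x| ≤ μ * weight μ ε hμ z x := by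
  have h1 : |(x - z) i / sdist ε z x| ≤ 1 := by
    rw [abs_div, abs_of_pos (sdist_pos hε z x), div_le_one (sdist_pos hε z x)]
    exact (PiLp.norm_apply_le (x - z) i).trans (norm_le_sdist ε z x)
  have h2 : 0 < weight μ ε hμ z x := Real.exp_pos _
  rw [abs_mul, abs_neg, abs_mul, abs_of_pos h2, abs_of_pos hμ, mul_assoc]
  gcongr
  exact mul_le_of_le_one_left h2.le h1

/-- The partial derivatives of the exponential weight. -/
def weightDer (μ ε : ℝ) (hμ : 0 < μ) (hε : 0 < ε) (z : Pt d) (i : Fin d) : Pt d →ᵇ ℝ :=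
  BoundedContinuousFunction.ofNormedAddCommGroup
    (fun x => -(μ * ((x - z) i / sdist ε z x)) * weight μ ε hμ z x)
    (by
      have h := continuous_sdist ε z
      have h0 : ∀ x, sdist ε z x ≠ 0 := fun x => (sdist_pos hε z x).ne'
      have h1 : Continuous fun x : Pt d => (x - z) i := by fun_prop
      exact ((continuous_const.mul (h1.div h h0)).neg).mul (weight μ ε hμ z).continuous) μ
    (fun x => (abs_weight_der_le hμ hε i x).trans (mul_le_of_le_one_right hμ.le (by
      rw [weight_apply, Real.exp_le_one_iff, neg_nonpos]
      exact mul_nonneg hμ.le (Real.sqrt_nonneg _))))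

theorem weightDer_apply (hμ : 0 < μ) (hε : 0 < ε) (i : Fin d) (x : Pt d) :
    weightDer μ ε hμ hε z i x = -(μ * ((x - z) i / sdist ε z x)) * weight μ ε hμ z x := rfl

theorem tendsto_weight (hμ : 0 < μ) : Tendsto (weight μ ε hμ z) (cocompact (Pt d)) (𝓝 0) := by
  have h1 : Tendsto (fun x : Pt d => ‖x - z‖) (cocompact (Pt d)) atTop :=
    tendsto_norm_cocompact_atTop.comp ((Homeomorph.subRight z).isClosedEmbedding.tendsto_cocompact)
  have h2 : Tendsto (sdist ε z) (cocompact (Pt d)) atTop :=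
    tendsto_atTop_mono (norm_le_sdist ε z) h1
  exact Real.tendsto_exp_neg_atTop_nhds_zero.comp (h2.const_mul_atTop hμ)

theorem dpartB_weight (hμ : 0 < μ) (hε : 0 < ε) (i : Fin d) :
    DpartB i (weight μ ε hμ z) (weightDer μ ε hμ hε z i) := by
  refine DpartB.of_uniformContinuous (fun x => ?_) ?_
  · have h1 : ∀ s : ℝ, ε ^ 2 + ‖x + s • bvec i - z‖ ^ 2 =
        ε ^ 2 + (‖x - z‖ ^ 2 + (2 * (x - z) i) * s + s ^ 2) := fun s => by
      rw [add_sub_right_comm, norm_add_sq_real, real_inner_smul_right,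
        EuclideanSpace.inner_single_right, norm_smul]
      simp
      ring
    have h2 : HasDerivAt (fun s : ℝ => ε ^ 2 + ‖x + s • bvec i - z‖ ^ 2) (2 * (x - z) i) 0 := by
      simp only [h1]
      have := (((((hasDerivAt_id (0 : ℝ)).const_mul (2 * (x - z) i)).const_add (‖x - z‖ ^ 2)).add
        (hasDerivAt_pow 2 (0 : ℝ)))).const_add (ε ^ 2)
      refine this.congr_deriv ?_
      simp
    have h3 := (((h2.sqrt (by positivity)).const_mul μ).neg).exp
    refine h3.congr_deriv ?_
    have : sdist ε z x ≠ 0 := (sdist_pos hε z x).ne'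
    rw [weightDer_apply, weight_apply]
    simp only [Pi.neg_apply, zero_smul, add_zero]
    change Real.exp (-(μ * sdist ε z x)) * -(μ * (2 * (x - z) i / (2 * sdist ε z x))) = _
    field_simp
  · refine (weightDer μ ε hμ hε z i).continuous.uniformContinuous_of_tendsto_cocompact (x := 0) ?_
    refine squeeze_zero_norm (fun x => abs_weight_der_le hμ hε i x) ?_
    have := (tendsto_weight (ε := ε) (z := z) hμ).const_mul μ
    rwa [mul_zero] at this

/-- Cauchy–Schwarz is applied to the vectors b and x - z rather than to components. This keeps the
constant equal to the sup norm M of the field, which becomes the propagation speed. -/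
theorem abs_sum_weightDer_le {b : FieldSpace d} (hb : b ∈ Btilde d M) (hμ : 0 < μ) (hε : 0 < ε)
    (x : Pt d) : |(∑ i, compB i b * weightDer μ ε hμ hε z i) x| ≤ M * μ * weight μ ε hμ z x := by
  have hw : 0 < weight μ ε hμ z x := Real.exp_pos _
  have hM := nonneg_of_Btilde hb
  have h1 : (∑ i, compB i b * weightDer μ ε hμ hε z i) x =
      -(inner ℝ (b.toFun x) (x - z) / sdist ε z x * (μ * weight μ ε hμ z x)) := by
    rw [BoundedContinuousFunction.coe_sum, Finset.sum_apply, PiLp.inner_apply, Finset.sum_div,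
      Finset.sum_mul, ← Finset.sum_neg_distrib]
    refine Finset.sum_congr rfl fun i _ => ?_
    rw [BoundedContinuousFunction.mul_apply, weightDer_apply, compB_apply]
    simp
    ring
  have h2 : |inner ℝ (b.toFun x) (x - z) / sdist ε z x| ≤ M := by
    rw [abs_div, abs_of_pos (sdist_pos hε z x), div_le_iff₀ (sdist_pos hε z x)]
    refine (abs_real_inner_le_norm _ _).trans ?_
    have := norm_le_sdist ε z x
    have := hb.1 x
    gcongr
  rw [h1, abs_neg, abs_mul, abs_of_pos (mul_pos hμ hw), mul_assoc]
  gcongr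

/-- The weighted density g m is in H¹ and g div (b m) = div (b g m) - (b·∇g) m. The first term
contributes M by the usual cancellation, the second at most 2Mμ. -/
theorem abs_inner_weight_divMul_le {b : FieldSpace d} (hb : b ∈ Btilde d M) (hμ : 0 < μ)
    (hε : 0 < ε) (m : H1 d) :
    |2 * inner ℝ (mulL (weight μ ε hμ z) m.toL2) (mulL (weight μ ε hμ z) (divMul b m))| ≤
      M * (1 + 2 * μ) * ‖mulL (weight μ ε hμ z) m.toL2‖ ^ 2 := by
  set g := weight μ ε hμ z with hg
  set g' := weightDer μ ε hμ hε z with hg'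
  set v := mulL g m.toL2 with hv
  obtain ⟨n, hn, hng⟩ := H1.exists_of_dpart fun i =>
    (m.dpart i).mulL (dpartB_weight (z := z) hμ hε i)
  have e : mulL g (divMul b m) = divMul b n - mulL (∑ i, compB i b * g' i) m.toL2 := by
    have : ∀ i, mulL g (mulL (compB i b) (H1.gradi i m)) =
        mulL (compB i b) (H1.gradi i n) - mulL (compB i b * g' i) m.toL2 := fun i => by
      rw [hng i, (mulL (compB i b)).map_add, mulL_mulL, mulL_mulL, mulL_mulL, mul_comm g,
        add_sub_cancel_left]
    rw [divMul, divMul, (mulL g).map_add, map_sum, mulL_sum_left, hn]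
    simp only [this, Finset.sum_sub_distrib]
    rw [mulL_mulL, mulL_mulL, mul_comm g]
    abel
  have hM := nonneg_of_Btilde hb
  have h1 : ‖mulL (∑ i, compB i b * g' i) m.toL2‖ ≤ M * μ * ‖v‖ := by
    have : ‖M * μ * ‖v‖‖ = M * μ * ‖v‖ := Real.norm_of_nonneg (by positivity)
    have h2 := Lp.norm_le_mul_norm_of_ae_le_mul (f := mulL (∑ i, compB i b * g' i) m.toL2) (g := v)
      (c := M * μ) (by
        filter_upwards [mulL_coe (∑ i, compB i b * g' i) m.toL2, mulL_coe g m.toL2] with x h1 h2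
        rw [h1, h2, norm_mul, norm_mul, ← mul_assoc]
        refine mul_le_mul_of_nonneg_right ?_ (norm_nonneg _)
        have hw : 0 < g x := Real.exp_pos _
        rw [Real.norm_of_nonneg hw.le]
        exact abs_sum_weightDer_le hb hμ hε x)
    exact h2
  rw [e, inner_sub_right, mul_sub]
  refine (abs_sub _ _).trans ?_
  have h2 : |2 * inner ℝ v (divMul b n)| ≤ M * ‖v‖ ^ 2 := by
    have := inner_divMul_self b n
    rw [hn] at this
    rw [this]
    exact inner_mulL_self_le (abs_divB_le hb) v
  have h3 := (abs_inner_le v (mulL (∑ i, compB i b * g' i) m.toL2)).trans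
    (mul_le_mul_of_nonneg_left h1 (norm_nonneg v))
  rw [abs_mul (2 : ℝ) (inner ℝ v (mulL (∑ i, compB i b * g' i) m.toL2)), abs_two]
  nlinarith

end Weight

/-! ### Finite speed of propagation. -/

section Propagation

/-- The weighted energy starts below a multiple of exp(-2μr), grows at most like exp(2μM(s - t)) up
to factors free of μ, and controls exp(-4μρ) times the mass of m² in the small ball. As μ → ∞ the
exponent -2μκ forces that mass to vanish. -/
theorem IsStrong.ae_eq_zero_of_ball (h : IsStrong t T β m) (hβ : Adm t T M β) (hM : 0 ≤ M)
    {z : Pt d} {r ρ s : ℝ} (hρ : 0 < ρ) (hs : s ∈ Icc t T) (hr : 2 * ρ + M * (s - t) < r)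
    (h0 : ∀ᵐ x, dist x z < r → (m t).toL2 x = 0) :
    ∀ᵐ x, dist x z < ρ → (m s).toL2 x = 0 := by
  have ht : t ∈ Icc t T := ⟨le_rfl, hs.1.trans hs.2⟩
  set κ := r - 2 * ρ - M * (s - t) with hκ
  have hκ0 : 0 < κ := by rw [hκ]; linarith
  set C := ‖(m t).toL2‖ ^ 2 * Real.exp (M * (s - t)) with hC
  set I := ∫ x in Metric.ball z ρ, (m s).toL2 x ^ 2 with hI
  have hint : Integrable (fun x => (m s).toL2 x ^ 2) volume := by
    simp only [pow_two]; exact integrable_mul_L2s _ _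
  have hr0 : 0 ≤ r := by nlinarith [mul_nonneg hM (sub_nonneg.2 hs.1)]
  have key : ∀ μ : ℝ, 0 < μ → I ≤ C * Real.exp (-(2 * κ * μ)) := by
    intro μ hμ
    -- Smoothing at scale ρ keeps the regularised distance below 2ρ on the ball of radius ρ, which
    -- explains the 2ρ in the hypothesis.
    set g := weight μ ρ hμ z with hg
    have e1 : ‖mulL g (m s).toL2‖ ^ 2 ≤
        ‖mulL g (m t).toL2‖ ^ 2 * Real.exp (M * (1 + 2 * μ) * (s - t)) := by
      have hv := IsPrim.clm_comp h (mulL g)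
      have hc : ContinuousOn (fun s => ‖mulL g (m s).toL2‖ ^ 2) (Icc t T) :=
        hv.continuousOn.norm.pow 2
      refine gronwall_integral (by positivity) hc (fun s hs => ?_) s hs
      have hi : IntervalIntegrable (fun s => M * (1 + 2 * μ) * ‖mulL g (m s).toL2‖ ^ 2) volume t s :=
        (ContinuousOn.intervalIntegrable (by
          rw [uIcc_of_le hs.1]; exact hc.mono (Icc_subset_Icc_right hs.2))).const_mul _
      have := hv.energy_le ht hs hs.1 hi (by
        filter_upwards [hβ.2] with τ hτ
        rw [(mulL g).map_neg]
        refine (le_abs_self _).trans ?_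
        rw [abs_two_inner_neg]
        exact abs_inner_weight_divMul_le hτ hμ hρ (m τ))
      rwa [intervalIntegral.integral_const_mul] at this
    have e2 : ‖mulL g (m t).toL2‖ ≤ Real.exp (-(μ * r)) * ‖(m t).toL2‖ := by
      refine Lp.norm_le_mul_norm_of_ae_le_mul ?_
      filter_upwards [mulL_coe g (m t).toL2, h0] with x h1 h2
      rw [h1, norm_mul]
      rcases lt_or_ge (dist x z) r with h3 | h3
      · rw [h2 h3, norm_zero, mul_zero, mul_zero]
      · refine mul_le_mul_of_nonneg_right ?_ (norm_nonneg _)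
        rw [hg, weight_apply, Real.norm_of_nonneg (Real.exp_pos _).le, Real.exp_le_exp,
          neg_le_neg_iff]
        rw [dist_eq_norm] at h3
        exact mul_le_mul_of_nonneg_left (h3.trans (norm_le_sdist _ _ _)) hμ.le
    have e3 : Real.exp (-(μ * (2 * ρ))) ^ 2 * I ≤ ‖mulL g (m s).toL2‖ ^ 2 := by
      rw [← real_inner_self_eq_norm_sq, inner_L2s, hI, ← integral_const_mul]
      have hint2 := integrable_mul_L2s (mulL g (m s).toL2) (mulL g (m s).toL2)
      refine le_trans ?_ (setIntegral_le_integral (s := Metric.ball z ρ) hint2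
        (Eventually.of_forall fun x => mul_self_nonneg _))
      refine setIntegral_mono_ae_restrict (hint.const_mul _).integrableOn hint2.integrableOn ?_
      filter_upwards [ae_restrict_of_ae (mulL_coe g (m s).toL2),
        ae_restrict_mem Metric.isOpen_ball.measurableSet] with x h1 h2
      rw [h1]
      have h4 : Real.exp (-(μ * (2 * ρ))) ≤ g x := by
        rw [hg, weight_apply, Real.exp_le_exp, neg_le_neg_iff]
        refine mul_le_mul_of_nonneg_left (Real.sqrt_le_iff.2 ⟨by positivity, ?_⟩) hμ.le
        rw [Metric.mem_ball, dist_eq_norm] at h2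
        nlinarith [norm_nonneg (x - z)]
      have h5 : Real.exp (-(μ * (2 * ρ))) ^ 2 ≤ g x ^ 2 := by gcongr
      nlinarith [sq_nonneg ((m s).toL2 x)]
    have e4 : ‖mulL g (m t).toL2‖ ^ 2 ≤ Real.exp (-(μ * r)) ^ 2 * ‖(m t).toL2‖ ^ 2 := by
      rw [← mul_pow]; gcongr
    have e5 : Real.exp (-(μ * (2 * ρ))) ^ 2 * I ≤ Real.exp (-(μ * r)) ^ 2 * ‖(m t).toL2‖ ^ 2 *
        Real.exp (M * (1 + 2 * μ) * (s - t)) := e3.trans (e1.trans (by gcongr))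
    have e6 : I ≤ Real.exp (μ * (2 * ρ)) ^ 2 * (Real.exp (-(μ * r)) ^ 2 * ‖(m t).toL2‖ ^ 2 *
        Real.exp (M * (1 + 2 * μ) * (s - t))) := by
      rw [Real.exp_neg, inv_pow, inv_mul_le_iff₀ (by positivity)] at e5
      exact e5
    refine e6.trans (le_of_eq ?_)
    rw [hC, ← Real.exp_nat_mul, ← Real.exp_nat_mul]
    have : ∀ a b c n e : ℝ, a + b + c = e + n → ∀ N : ℝ,
        Real.exp a * (Real.exp b * N * Real.exp c) = N * Real.exp n * Real.exp e := by
      intro a b c n e he N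
      rw [show Real.exp a * (Real.exp b * N * Real.exp c) =
        N * (Real.exp a * Real.exp b * Real.exp c) by ring, ← Real.exp_add, ← Real.exp_add, he,
        Real.exp_add]
      ring
    refine this _ _ _ _ _ ?_ _
    rw [hκ]; push_cast; ring
  have hle : I ≤ 0 := by
    have h1 : Tendsto (fun μ : ℝ => C * Real.exp (-(2 * κ * μ))) atTop (𝓝 (C * 0)) :=
      (Real.tendsto_exp_neg_atTop_nhds_zero.comp
        (tendsto_id.const_mul_atTop (by positivity : 0 < 2 * κ))).const_mul C
    rw [mul_zero] at h1
    exact ge_of_tendsto h1 ((eventually_gt_atTop 0).mono key)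
  have hI0 : I = 0 := le_antisymm hle (integral_nonneg fun x => sq_nonneg _)
  rw [hI, setIntegral_eq_zero_iff_of_nonneg_ae (Eventually.of_forall fun x => sq_nonneg _)
    hint.integrableOn] at hI0
  have h3 := (ae_restrict_iff' Metric.isOpen_ball.measurableSet).1 hI0
  filter_upwards [h3] with x hx hd
  exact pow_eq_zero_iff two_ne_zero |>.1 (hx hd)

/-- Finite speed of propagation. -/
theorem IsStrong.ae_eq_zero_of_notMem_cthickening (h : IsStrong t T β m) (hβ : Adm t T M β)
    (hM : 0 ≤ M) {Ω : Set (Pt d)} {s : ℝ} (ht0 : 0 ≤ t) (hs : s ∈ Icc t T)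
    (h0 : ∀ᵐ x, x ∉ Metric.cthickening (M * t) Ω → (m t).toL2 x = 0) :
    ∀ᵐ x, x ∉ Metric.cthickening (M * s) Ω → (m s).toL2 x = 0 := by
  have hst := hs.1
  have hloc : ∀ z ∈ (Metric.cthickening (M * s) Ω)ᶜ, ∃ ρ > 0,
      ∀ᵐ x, dist x z < ρ → (m s).toL2 x = 0 := by
    intro z hz
    rw [mem_compl_iff, Metric.mem_cthickening_iff, not_le] at hz
    obtain ⟨η, hη, h2, h3⟩ := ENNReal.lt_iff_exists_real_btwn.1 hz
    rw [ENNReal.ofReal_lt_ofReal_iff_of_nonneg (mul_nonneg hM (ht0.trans hst))] at h2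
    -- Since η lies strictly between M s and the distance from z to Ω, the ball of radius η - M t
    -- about z misses the initial neighbourhood of Ω. The quarter leaves room for 2ρ.
    refine ⟨(η - M * s) / 4, by linarith, h.ae_eq_zero_of_ball hβ hM (r := η - M * t) (by linarith)
      hs (by linarith) ?_⟩
    filter_upwards [h0] with x hx hd
    refine hx fun hmem => ?_
    rw [Metric.mem_cthickening_iff] at hmem
    have h4 : Metric.infEDist z Ω ≤ ENNReal.ofReal η := by
      refine Metric.infEDist_le_edist_add_infEDist.trans
        ((add_le_add (b := ENNReal.ofReal (η - M * t)) ?_ hmem).trans ?_)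
      · rw [edist_comm, edist_dist]
        exact ENNReal.ofReal_le_ofReal hd.le
      · rw [← ENNReal.ofReal_add (by nlinarith) (mul_nonneg hM ht0), sub_add_cancel]
    exact absurd h3 (not_lt.2 h4)
  have : volume {x | x ∉ Metric.cthickening (M * s) Ω ∧ (m s).toL2 x ≠ 0} = 0 := by
    refine measure_null_of_locally_null _ fun z hz => ?_
    obtain ⟨ρ, hρ, hz'⟩ := hloc z hz.1
    refine ⟨Metric.ball z ρ ∩ {x | (m s).toL2 x ≠ 0}, ?_, ?_⟩
    · rw [mem_nhdsWithin]
      exact ⟨Metric.ball z ρ, Metric.isOpen_ball, Metric.mem_ball_self hρ,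
        fun x hx => ⟨hx.1, hx.2.2⟩⟩
    · refine measure_mono_null (fun x hx => ?_) (ae_iff.1 hz')
      exact fun hc => hx.2 (hc hx.1)
  rw [ae_iff]
  refine measure_mono_null (fun x hx => ?_) this
  simpa using hx

end Propagation

end

section

open FieldSpace

variable {d : ℕ} {M : ℝ}

/-! ### Smooth compactly supported fields as elements of the field space. -/

section Construct

theorem hasWeakFDeriv_of_smooth {F : Type*} [NormedAddCommGroup F] [NormedSpace ℝ F]
    [CompleteSpace F] {g : Pt d → F} (hg : ContDiff ℝ (⊤ : ℕ∞) g) :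
    HasWeakFDeriv g (fderiv ℝ g) := by
  have h2 : Continuous (fderiv ℝ g) := hg.continuous_fderiv (by simp)
  refine ⟨hg.continuous.locallyIntegrable, h2.locallyIntegrable, fun φ hφ hφc v => ?_⟩
  have h3 : Continuous fun x => fderiv ℝ φ x v :=
    (hφ.continuous_fderiv (by simp)).clm_apply continuous_const
  have h4 : Continuous fun x => fderiv ℝ g x v := h2.clm_apply continuous_const
  rw [integral_smul_fderiv_eq_neg_fderiv_smul_of_integrable, neg_neg]
  · exact (h3.smul hg.continuous).integrable_of_hasCompactSupport (hφc.fderiv_apply ℝ v).smul_right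
  · exact (hφ.continuous.smul h4).integrable_of_hasCompactSupport hφc.smul_right
  · exact (hφ.continuous.smul hg.continuous).integrable_of_hasCompactSupport hφc.smul_right
  · exact fun x _ => hφ.differentiable (by simp) x
  · exact fun x _ => hg.differentiable (by simp) x

/-- The tuple `(B, DB, D²B, B, DB)` of a smooth compactly supported field. -/
def fieldTuple (c0 : Pt d →ᵇ Pt d) (c1 : Pt d →ᵇ (Pt d →L[ℝ] Pt d))
    {f2 : Pt d → (Pt d →L[ℝ] (Pt d →L[ℝ] Pt d))} {f0 : Pt d → Pt d} {f1 : Pt d → (Pt d →L[ℝ] Pt d)}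
    (m2 : MemLp f2 ∞ (volume : Measure (Pt d)))
    (m0 : MemLp f0 2 (volume : Measure (Pt d)))
    (m1 : MemLp f1 2 (volume : Measure (Pt d))) : FieldTuple d :=
  (c0, c1, m2.toLp f2, m0.toLp f0, m1.toLp f1)

theorem fieldTuple_mem (c0 : Pt d →ᵇ Pt d) (c1 : Pt d →ᵇ (Pt d →L[ℝ] Pt d))
    {f2 : Pt d → (Pt d →L[ℝ] (Pt d →L[ℝ] Pt d))}
    (m2 : MemLp f2 ∞ (volume : Measure (Pt d)))
    (m0 : MemLp c0 2 (volume : Measure (Pt d)))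
    (m1 : MemLp c1 2 (volume : Measure (Pt d)))
    (h1 : ∀ x, HasFDerivAt c0 (c1 x) x) (h2 : HasWeakFDeriv c1 f2) :
    fieldTuple c0 c1 m2 m0 m1 ∈ FieldSub d :=
  ⟨h1, h2.congr (ae_of_all _ fun _ => rfl) m2.coeFn_toLp.symm, m0.coeFn_toLp, m1.coeFn_toLp⟩

theorem exists_field_of_bcf {f0 : Pt d → Pt d} {f1 : Pt d → (Pt d →L[ℝ] Pt d)}
    {f2 : Pt d → (Pt d →L[ℝ] (Pt d →L[ℝ] Pt d))} (h0 : ∃ c : Pt d →ᵇ Pt d, ⇑c = f0)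
    (h0' : ∃ c : Pt d →ᵇ (Pt d →L[ℝ] Pt d), ⇑c = f1)
    (m2 : MemLp f2 ∞ (volume : Measure (Pt d)))
    (m0 : MemLp f0 2 (volume : Measure (Pt d)))
    (m1 : MemLp f1 2 (volume : Measure (Pt d)))
    (h1 : ∀ x, HasFDerivAt f0 (f1 x) x) (h2 : HasWeakFDeriv f1 f2) :
    ∃ b : FieldSpace d, b.toFun = f0 ∧ b.deriv1 = f1 ∧ b.deriv2 =ᵐ[volume] f2 := by
  obtain ⟨c0, rfl⟩ := h0
  obtain ⟨c1, rfl⟩ := h0'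
  exact ⟨⟨fieldTuple c0 c1 m2 m0 m1, fieldTuple_mem c0 c1 m2 m0 m1 h1 h2⟩, rfl, rfl,
    m2.coeFn_toLp⟩

theorem exists_bcf_of_hasCompactSupport {F : Type*} [NormedAddCommGroup F] [NormedSpace ℝ F]
    {g : Pt d → F} (hg : Continuous g) (hc : HasCompactSupport g) :
    ∃ c : Pt d →ᵇ F, ⇑c = g := by
  obtain ⟨C, hC⟩ := hc.exists_bound_of_continuous hg
  exact ⟨BoundedContinuousFunction.ofNormedAddCommGroup g hg C hC, rfl⟩

theorem fderiv_of_smooth {F : Type*} [NormedAddCommGroup F] [NormedSpace ℝ F] {g : Pt d → F}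
    (hg : ContDiff ℝ (⊤ : ℕ∞) g) (hc : HasCompactSupport g) :
    ContDiff ℝ (⊤ : ℕ∞) (fderiv ℝ g) ∧ HasCompactSupport (fderiv ℝ g) ∧
      ∀ p, MemLp (fderiv ℝ g) p (volume : Measure (Pt d)) :=
  ⟨hg.fderiv_right (by simp), hc.fderiv ℝ, fun _ =>
    (hg.continuous_fderiv (by simp)).memLp_of_hasCompactSupport (hc.fderiv ℝ)⟩

/-- A smooth compactly supported vector field as an element of `W^{2,∞} ∩ H¹`. -/
theorem exists_field_of_smooth {B : Pt d → Pt d} (hB : ContDiff ℝ (⊤ : ℕ∞) B)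
    (hc : HasCompactSupport B) : ∃ b : FieldSpace d, b.toFun = B ∧ b.deriv1 = fderiv ℝ B ∧
      b.deriv2 =ᵐ[volume] fderiv ℝ (fderiv ℝ B) := by
  obtain ⟨h1, hc1, m1⟩ := fderiv_of_smooth hB hc
  obtain ⟨-, -, m2⟩ := fderiv_of_smooth h1 hc1
  have m0 : MemLp B 2 (volume : Measure (Pt d)) := hB.continuous.memLp_of_hasCompactSupport hc
  have hw := hasWeakFDeriv_of_smooth h1
  have hd : ∀ x, HasFDerivAt B (fderiv ℝ B x) x := fun x =>
    (hB.differentiable (by simp) x).hasFDerivAt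
  exact exists_field_of_bcf (exists_bcf_of_hasCompactSupport hB.continuous hc)
    (exists_bcf_of_hasCompactSupport h1.continuous hc1) (m2 ∞) m0 (m1 2) hd hw

end Construct

/-! ### Concentrated shear fields that stay admissible. -/

section Shear

/-- The planar divergence-free field of a stream function `g`. -/
def curlField (i j : Fin d) (g : Pt d → ℝ) (x : Pt d) : Pt d :=
  fderiv ℝ g x (bvec j) • bvec i - fderiv ℝ g x (bvec i) • bvec j

variable {i j : Fin d} {g : Pt d → ℝ}

theorem contDiff_curlField (hg : ContDiff ℝ (⊤ : ℕ∞) g) :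
    ContDiff ℝ (⊤ : ℕ∞) (curlField i j g) := by
  have h1 : ContDiff ℝ (⊤ : ℕ∞) (fderiv ℝ g) := hg.fderiv_right (by simp)
  exact ((h1.clm_apply contDiff_const).smul contDiff_const).sub
    ((h1.clm_apply contDiff_const).smul contDiff_const)

theorem hasCompactSupport_curlField (hg : HasCompactSupport g) :
    HasCompactSupport (curlField i j g) :=
  ((hg.fderiv_apply ℝ (bvec j)).smul_right).sub ((hg.fderiv_apply ℝ (bvec i)).smul_right)

theorem traceL_apply (A : Pt d →L[ℝ] Pt d) : traceL d A = ∑ i, A (bvec i) i := by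
  simp [traceL]

/-- The two contributions to the trace are mixed second derivatives of g in opposite order. -/
theorem traceL_fderiv_curlField (hg : ContDiff ℝ (⊤ : ℕ∞) g) (x : Pt d) :
    traceL d (fderiv ℝ (curlField i j g) x) = 0 := by
  have h1 : ContDiff ℝ (⊤ : ℕ∞) (fderiv ℝ g) := hg.fderiv_right (by simp)
  have hd := (h1.differentiable (by simp) x).hasFDerivAt
  have hF : ∀ v, HasFDerivAt (fun x => fderiv ℝ g x v)
      ((ContinuousLinearMap.apply ℝ ℝ v).comp (fderiv ℝ (fderiv ℝ g) x)) x := fun v =>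
    (ContinuousLinearMap.apply ℝ ℝ v).hasFDerivAt.comp x hd
  have h2 := (((hF (bvec j)).smul_const (bvec i)).sub ((hF (bvec i)).smul_const (bvec j))).fderiv
  have hsymm : IsSymmSndFDerivAt ℝ g x := hg.contDiffAt.isSymmSndFDerivAt (by
    rw [minSmoothness_of_isRCLikeNormedField]
    exact WithTop.coe_le_coe.2 le_top)
  have h3 : fderiv ℝ (curlField i j g) x = _ := h2
  rw [h3, traceL_apply]
  simp only [sub_apply, ContinuousLinearMap.smulRight_apply, ContinuousLinearMap.comp_apply,
    ContinuousLinearMap.apply_apply, PiLp.sub_apply, PiLp.smul_apply, Finset.sum_sub_distrib,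
    smul_eq_mul]
  simp [bvec, hsymm.eq (EuclideanSpace.single i 1)]

/-- The stream function y_j²/2 generates the linear shear y_j e_i; a cutoff gives compact support.
-/
theorem exists_stream (j : Fin d) : ∃ g : Pt d → ℝ, ContDiff ℝ (⊤ : ℕ∞) g ∧
    (∀ x, 2 ≤ ‖x‖ → g x = 0) ∧ ∀ x, ‖x‖ < 1 → g =ᶠ[𝓝 x] fun y => 2⁻¹ * y j ^ 2 := by
  let χ : ContDiffBump (0 : Pt d) := ⟨1, 2, by norm_num, by norm_num⟩
  refine ⟨fun y => 2⁻¹ * y j ^ 2 * χ y, ?_, fun x hx => ?_, fun x hx => ?_⟩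
  · have h1 : ContDiff ℝ (⊤ : ℕ∞) fun y : Pt d => y j := by fun_prop
    exact ((contDiff_const.mul (h1.pow 2))).mul χ.contDiff
  · have : χ x = 0 := χ.zero_of_le_dist (by simpa using hx)
    simp [this]
  · have h1 : ∀ᶠ y in 𝓝 x, ‖y‖ < 1 := (isOpen_lt continuous_norm continuous_const).mem_nhds hx
    filter_upwards [h1] with y hy
    have : χ y = 1 := χ.one_of_mem_closedBall (by simpa using hy.le)
    rw [this, mul_one]

end Shear

end

section

open FieldSpace

variable {d : ℕ} {M : ℝ} {i j : Fin d}

section Shear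

/-- The volume of the ball contributes r^d ≤ r², and this is where d ≥ 2 enters: the factor r²
absorbs the square of a gradient of size 1/r. -/
theorem integral_norm_sq_le_of_ball {F : Type*} [NormedAddCommGroup F] {f : Pt d → F}
    {x₀ : Pt d} {r K : ℝ} (hd : 2 ≤ d) (hr : 0 < r) (hr1 : r ≤ 1)
    (h0 : ∀ x, 2 * r < ‖x - x₀‖ → f x = 0) (hK : ∀ x, ‖f x‖ ≤ K) :
    ∫ x, ‖f x‖ ^ 2 ≤ K ^ 2 * (2 ^ d * r ^ 2 * (volume : Measure (Pt d)).real (Metric.ball 0 1)) := by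
  have h1 : ∫ x, ‖f x‖ ^ 2 = ∫ x in Metric.closedBall x₀ (2 * r), ‖f x‖ ^ 2 := by
    refine (setIntegral_eq_integral_of_forall_compl_eq_zero fun x hx => ?_).symm
    rw [Metric.mem_closedBall, not_le, dist_eq_norm] at hx
    rw [h0 x hx, norm_zero, zero_pow two_ne_zero]
  have h2 : ‖∫ x in Metric.closedBall x₀ (2 * r), ‖f x‖ ^ 2‖ ≤
      K ^ 2 * (volume : Measure (Pt d)).real (Metric.closedBall x₀ (2 * r)) :=
    norm_setIntegral_le_of_norm_le_const measure_closedBall_lt_top fun x _ => by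
      rw [Real.norm_of_nonneg (by positivity)]
      have := hK x
      gcongr
  have h3 : (volume : Measure (Pt d)).real (Metric.closedBall x₀ (2 * r)) ≤
      2 ^ d * r ^ 2 * (volume : Measure (Pt d)).real (Metric.ball 0 1) := by
    rw [measureReal_def, Measure.addHaar_closedBall _ _ (by positivity), ENNReal.toReal_mul,
      ENNReal.toReal_ofReal (by positivity), finrank_euclideanSpace_fin, mul_pow, measureReal_def]
    have := pow_le_pow_of_le_one hr.le hr1 hd
    gcongr
  rw [h1]
  exact ((le_abs_self _).trans h2).trans (by gcongr)

theorem curlField_eq_zero {g : Pt d → ℝ} (hg : ∀ x, 2 ≤ ‖x‖ → g x = 0) {x : Pt d} (hx : 2 < ‖x‖) :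
    curlField i j g =ᶠ[𝓝 x] 0 := by
  have h1 : ∀ᶠ y in 𝓝 x, 2 < ‖y‖ := (isOpen_lt continuous_const continuous_norm).mem_nhds hx
  filter_upwards [h1] with y hy
  have h2 : g =ᶠ[𝓝 y] fun _ => 0 := by
    filter_upwards [(isOpen_lt continuous_const continuous_norm).mem_nhds hy] with w hw
    exact hg w (le_of_lt hw)
  simp [curlField, h2.fderiv_eq]

theorem curlField_shear {g : Pt d → ℝ} (hij : i ≠ j)
    {x : Pt d} (hg : g =ᶠ[𝓝 x] fun y => 2⁻¹ * y j ^ 2) : curlField i j g x = x j • bvec i := by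
  have h1 : HasFDerivAt (fun y : Pt d => 2⁻¹ * y j ^ 2)
      (x j • (EuclideanSpace.proj j : Pt d →L[ℝ] ℝ)) x := by
    have h2 : HasFDerivAt (fun y : Pt d => y j) (EuclideanSpace.proj j : Pt d →L[ℝ] ℝ) x :=
      (EuclideanSpace.proj j : Pt d →L[ℝ] ℝ).hasFDerivAt
    refine ((h2.pow 2).const_mul 2⁻¹).congr_fderiv ?_
    ext v
    simp
    ring
  rw [curlField, hg.fderiv_eq, h1.fderiv]
  simp [bvec, hij.symm]

theorem eLpNorm_div_add_gradDiv_le {b : FieldSpace d} (h : b.div = fun _ => 0)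
    (h' : b.gradDiv =ᵐ[volume] fun _ => 0) (M : ℝ) :
    eLpNorm b.div ∞ volume + eLpNorm b.gradDiv ∞ volume ≤ ENNReal.ofReal M := by
  have h0 : eLpNorm (fun _ : Pt d => (0 : ℝ)) ∞ volume = 0 := eLpNorm_zero
  have h1 : eLpNorm b.gradDiv ∞ volume = 0 := by
    rw [eLpNorm_exponent_top, eLpNormEssSup, essSup_congr_ae (g := fun _ => (0 : ℝ≥0∞))]
    · exact essSup_const_bot
    · filter_upwards [h'] with x hx
      rw [hx, ← ofReal_norm, norm_zero, ENNReal.ofReal_zero]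
  rw [h, h0, h1, add_zero]
  exact zero_le

set_option maxHeartbeats 1000000 in
-- The field is c B((x - x₀)/r) with B a fixed shear. Scaling preserves the sup norm and the
-- vanishing divergence, and in dimension at least two the H¹ norm stays bounded. The shear rate c/r
-- is thus unbounded within the admissible class.
theorem exists_shear (hd : 2 ≤ d) (hM : 0 < M) (hij : i ≠ j) : ∃ c : ℝ, 0 < c ∧
    ∀ (x₀ : Pt d) (r : ℝ), 0 < r → r ≤ 1 → ∃ b ∈ Btilde d M, (∀ x, divB b x = 0) ∧
      (∀ x, ‖x - x₀‖ < r → compB i b x = c / r * (x - x₀) j) ∧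
      ∀ l, l ≠ i → ∀ x, ‖x - x₀‖ < r → compB l b x = 0 := by
  obtain ⟨g, hg, hg2, hg1⟩ := exists_stream j
  have hgc : HasCompactSupport g := HasCompactSupport.intro (isCompact_closedBall 0 2) fun x hx =>
    hg2 x (by rw [mem_closedBall_zero_iff, not_le] at hx; exact hx.le)
  set B := curlField i j g with hBdef
  have hB : ContDiff ℝ (⊤ : ℕ∞) B := contDiff_curlField hg
  have hBc : HasCompactSupport B := hasCompactSupport_curlField hgc
  obtain ⟨C0, hC0⟩ := hBc.exists_bound_of_continuous hB.continuous
  obtain ⟨hB', hBc', -⟩ := fderiv_of_smooth hB hBc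
  obtain ⟨C1, hC1⟩ := hBc'.exists_bound_of_continuous hB'.continuous
  have hC00 : 0 ≤ C0 := (norm_nonneg _).trans (hC0 0)
  have hC10 : 0 ≤ C1 := (norm_nonneg _).trans (hC1 0)
  set V := (volume : Measure (Pt d)).real (Metric.ball 0 1) with hV
  have hV0 : 0 ≤ V := measureReal_nonneg
  set Q := 2 ^ d * V * (C0 ^ 2 + d * C1 ^ 2) with hQ
  have hQ0 : 0 ≤ Q := by positivity
  -- One constant for both requirements: c C0 ≤ M for the sup norm, and c² Q ≤ M² for the H¹ norm
  -- because Q ≤ (1 + C0 + Q)².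
  set c := M / (1 + C0 + Q) with hc
  have hc0 : 0 < c := by positivity
  have hcM : c * (1 + C0 + Q) = M := by rw [hc]; field_simp
  refine ⟨c, hc0, fun x₀ r hr hr1 => ?_⟩
  set A : Pt d → Pt d := fun x => r⁻¹ • (x - x₀) with hA
  have hAd : ∀ x, HasFDerivAt A (r⁻¹ • ContinuousLinearMap.id ℝ (Pt d)) x := fun x =>
    ((hasFDerivAt_id x).sub_const x₀).const_smul r⁻¹
  have hAn : ∀ x, ‖A x‖ = r⁻¹ * ‖x - x₀‖ := fun x => by
    rw [hA, norm_smul, norm_inv, Real.norm_of_nonneg hr.le]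
  set F : Pt d → Pt d := fun x => c • B (A x) with hF
  have hFs : ContDiff ℝ (⊤ : ℕ∞) F := by
    have : ContDiff ℝ (⊤ : ℕ∞) A := by rw [hA]; fun_prop
    exact (hB.comp this).const_smul c
  have hFd : ∀ x, fderiv ℝ F x = (c * r⁻¹) • fderiv ℝ B (A x) := fun x => by
    have := (((hB.differentiable (by simp) (A x)).hasFDerivAt.comp x (hAd x)).const_smul c).fderiv
    refine Eq.trans this ?_
    ext v
    simp [mul_assoc]
  have hfar : ∀ x, 2 * r < ‖x - x₀‖ → 2 < ‖A x‖ := fun x hx => by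
    rw [hAn, lt_inv_mul_iff₀ hr]; linarith
  have hF0 : ∀ x, 2 * r < ‖x - x₀‖ → F x = 0 := fun x hx => by
    have := (curlField_eq_zero (i := i) (j := j) hg2 (hfar x hx)).self_of_nhds
    simp only [hF, hBdef, this, Pi.zero_apply, smul_zero]
  have hF1 : ∀ x, 2 * r < ‖x - x₀‖ → fderiv ℝ F x = 0 := fun x hx => by
    have h : fderiv ℝ B (A x) = fderiv ℝ (0 : Pt d → Pt d) (A x) :=
      (curlField_eq_zero hg2 (hfar x hx)).fderiv_eq
    have h' : fderiv ℝ (0 : Pt d → Pt d) (A x) = 0 := fderiv_const_apply 0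
    rw [hFd, h, h']
    ext1 v
    simp only [smul_apply, zero_apply, smul_zero]
  have hFc : HasCompactSupport F :=
    HasCompactSupport.intro (isCompact_closedBall x₀ (2 * r)) fun x hx => hF0 x (by
      rwa [Metric.mem_closedBall, not_le, dist_eq_norm] at hx)
  have htr : ∀ x, traceL d (fderiv ℝ F x) = 0 := fun x => by
    rw [hFd, (traceL d).map_smul, hBdef, traceL_fderiv_curlField hg, smul_zero]
  obtain ⟨b, hb0, hb1, hb2⟩ := exists_field_of_smooth hFs hFc
  have hdiv : b.div = fun _ => 0 := funext fun x => by rw [FieldSpace.div, hb1, htr]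
  have hgd : b.gradDiv =ᵐ[volume] fun _ => 0 := by
    filter_upwards [hb2] with x hx
    rw [FieldSpace.gradDiv, hx]
    have h1 := (hFs.fderiv_right (m := (⊤ : ℕ∞)) (by simp)).differentiable (by simp) x
    have h2 := ((traceL d).hasFDerivAt.comp x h1.hasFDerivAt).fderiv
    rw [← h2]
    have h3 : (⇑(traceL d) ∘ fderiv ℝ F) = fun _ => 0 := funext htr
    rw [h3, fderiv_fun_const, Pi.zero_apply]
  have hnear : ∀ x, ‖x - x₀‖ < r → F x = (c / r * (x - x₀) j) • bvec i := fun x hx => by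
    have h1 : ‖A x‖ < 1 := by rw [hAn, inv_mul_lt_iff₀ hr]; linarith
    simp only [hF, hBdef]
    rw [curlField_shear hij (hg1 _ h1), smul_smul]
    congr 1
    simp [hA]
    ring
  refine ⟨b, ⟨fun x => ?_, ?_, ?_⟩, fun x => ?_, fun x hx => ?_, fun l hl x hx => ?_⟩
  · rw [hb0, hF, norm_smul, Real.norm_of_nonneg hc0.le]
    have := hC0 (A x)
    calc c * ‖B (A x)‖ ≤ c * (1 + C0 + Q) := by gcongr; linarith
      _ = M := hcM
  · rw [Real.sqrt_le_left hM.le, FieldSpace.sqNormH1, hb0, hb1]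
    have h1 := integral_norm_sq_le_of_ball (K := c * C0) hd hr hr1 hF0 fun x => by
      rw [hF, norm_smul, Real.norm_of_nonneg hc0.le]
      have := hC0 (A x)
      gcongr
    have h2 : ∀ l : Fin d, ∫ x, ‖fderiv ℝ F x (EuclideanSpace.single l (1 : ℝ))‖ ^ 2 ≤
        (c * r⁻¹ * C1) ^ 2 * (2 ^ d * r ^ 2 * V) := fun l => by
      refine integral_norm_sq_le_of_ball (x₀ := x₀) hd hr hr1 (fun x hx => by
        rw [hF1 x hx, zero_apply]) fun x => ?_
      refine (ContinuousLinearMap.le_opNorm _ _).trans ?_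
      rw [hFd, norm_smul, Real.norm_of_nonneg (by positivity)]
      have := hC1 (A x)
      simp only [PiLp.norm_single, norm_one, mul_one]
      gcongr
    have h3 := Finset.sum_le_sum fun l (_ : l ∈ Finset.univ) => h2 l
    rw [Finset.sum_const, Finset.card_univ, Fintype.card_fin, nsmul_eq_mul] at h3
    have h4 : (c * r⁻¹ * C1) ^ 2 * (2 ^ d * r ^ 2 * V) = c ^ 2 * (2 ^ d * V * C1 ^ 2) := by
      field_simp
    have h5 : (c * C0) ^ 2 * (2 ^ d * r ^ 2 * V) ≤ c ^ 2 * (2 ^ d * V * C0 ^ 2) := by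
      have : r ^ 2 ≤ 1 := pow_le_one₀ hr.le hr1
      calc _ = c ^ 2 * (2 ^ d * V * C0 ^ 2) * r ^ 2 := by ring
        _ ≤ _ := mul_le_of_le_one_right (by positivity) this
    have h6 : c ^ 2 * Q ≤ M ^ 2 := by
      rw [← hcM, mul_pow]
      gcongr
      nlinarith
    rw [h4] at h3
    have h7 : c ^ 2 * (2 ^ d * V * C0 ^ 2) + d * (c ^ 2 * (2 ^ d * V * C1 ^ 2)) = c ^ 2 * Q := by
      rw [hQ]; ring
    linarith
  · exact eLpNorm_div_add_gradDiv_le hdiv hgd M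
  · rw [divB_apply, hdiv]
  · rw [compB_apply, hb0, hnear x hx]
    simp
  · rw [compB_apply, hb0, hnear x hx]
    simp [hl]

end Shear

end

section

open FieldSpace

/-! ### Product rule for two Lipschitz curves. -/

section InnerProduct

variable {E : Type*} [NormedAddCommGroup E] [InnerProductSpace ℝ E] [CompleteSpace E] {t T : ℝ}
  {v w v' w' : ℝ → E}

/-- Polarisation of the energy identity for v, v' and v - v'. -/
theorem IsPrim.abs_inner_sub_le (h : IsPrim t T v w) (h' : IsPrim t T v' w') {C : ℝ}
    (hC : ∀ᵐ s ∂(volume.restrict (Icc t T)), |inner ℝ (v s) (w' s) + inner ℝ (w s) (v' s)| ≤ C)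
    {r s : ℝ} (hr : r ∈ Icc t T) (hs : s ∈ Icc t T) :
    |inner ℝ (v s) (v' s) - inner ℝ (v r) (v' r)| ≤ C * |s - r| := by
  have e : ∀ a b : E, ‖a - b‖ ^ 2 = ‖a‖ ^ 2 - 2 * inner ℝ a b + ‖b‖ ^ 2 := fun a b =>
    norm_sub_sq_real a b
  have h1 := h.energy hr hs
  have h2 := h'.energy hr hs
  have h3 := (h.sub h').energy hr hs
  have i1 := h.inner_integrable hr hs
  have i2 := h'.inner_integrable hr hs
  have i3 := (h.sub h').inner_integrable hr hs
  have h4 : 2 * (inner ℝ (v s) (v' s) - inner ℝ (v r) (v' r)) =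
      ∫ τ in r..s, (2 * inner ℝ (v τ) (w τ) + 2 * inner ℝ (v' τ) (w' τ) -
        2 * inner ℝ (v τ - v' τ) (w τ - w' τ)) := by
    rw [intervalIntegral.integral_sub (i1.add i2) i3, intervalIntegral.integral_add i1 i2, ← h1,
      ← h2, ← h3, e, e]
    ring
  have h5 := norm_integral_le_of_ae (w := fun τ => 2 * inner ℝ (v τ) (w τ) +
      2 * inner ℝ (v' τ) (w' τ) - 2 * inner ℝ (v τ - v' τ) (w τ - w' τ)) (C := 2 * C) hr hs (by
    filter_upwards [hC] with τ hτ
    have : 2 * inner ℝ (v τ) (w τ) + 2 * inner ℝ (v' τ) (w' τ) -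
        2 * inner ℝ (v τ - v' τ) (w τ - w' τ) =
        2 * (inner ℝ (v τ) (w' τ) + inner ℝ (w τ) (v' τ)) := by
      rw [inner_sub_left, inner_sub_right, inner_sub_right, real_inner_comm (w τ) (v' τ)]
      ring
    rw [this, norm_mul, Real.norm_two, Real.norm_eq_abs]
    gcongr)
  rw [← h4, norm_mul, Real.norm_two, Real.norm_eq_abs, mul_assoc] at h5
  linarith

theorem isPrim_of_hasDerivAt {v w : ℝ → E} (hd : ∀ s, HasDerivAt v (w s) s) (hw : Continuous w) :
    IsPrim t T v w := by
  obtain ⟨C, hC⟩ := (isCompact_Icc (a := t) (b := T)).exists_bound_of_continuousOn hw.continuousOn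
  refine ⟨hw.aestronglyMeasurable, ⟨C, ?_⟩, fun s _ => ?_⟩
  · filter_upwards [ae_restrict_mem measurableSet_Icc] with s hs using hC s hs
  · rw [intervalIntegral.integral_eq_sub_of_hasDerivAt (fun s _ => hd s)
      (hw.intervalIntegrable _ _)]
    abel

end InnerProduct

variable {d : ℕ} {M t T : ℝ} {i j : Fin d}

/-! ### Following a bump of mass. -/

section Displacement

/-- The `L¹` norm of a test function. -/
def Test.mass (φ : Test d) : ℝ := ∫ x, |φ.f x|

theorem Test.integrable (φ : Test d) : Integrable φ.f volume :=
  φ.smooth.continuous.integrable_of_hasCompactSupport φ.supp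

theorem Test.mass_shift (φ : Test d) (v : Pt d) : (φ.shift v).mass = φ.mass :=
  integral_add_right_eq_self (fun x => |φ.f x|) v

theorem Test.shift_shift (φ : Test d) (v w : Pt d) : (φ.shift v).shift w = φ.shift (w + v) := by
  simp only [Test.shift, add_assoc]

theorem Test.abs_inner_le (φ : Test d) {u : L2s d} {C : ℝ}
    (h : ∀ᵐ x, φ.f x ≠ 0 → |u x| ≤ C) : |inner ℝ u φ.toL2| ≤ C * φ.mass := by
  rw [Test.inner_toL2, Test.mass, ← integral_const_mul]
  refine norm_integral_le_of_norm_le (f := fun x => u x * φ.f x) (φ.integrable.abs.const_mul C) ?_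
  filter_upwards [h] with x hx
  rw [norm_mul, Real.norm_eq_abs, Real.norm_eq_abs]
  by_cases h0 : φ.f x = 0
  · simp [h0]
  · exact mul_le_mul_of_nonneg_right (hx h0) (abs_nonneg _)

/-- A bounded gradient read off on averages: the derivative in the shift is moved from φ onto m. It
replaces pointwise Lipschitz estimates for L² classes. -/
theorem abs_inner_shift_sub_le {m : H1 d} {R : ℝ} (hm : ∀ᵐ x, |H1.gradi j m x| ≤ R) (φ : Test d)
    (a : ℝ) : |inner ℝ m.toL2 (φ.shift (a • bvec j)).toL2 - inner ℝ m.toL2 φ.toL2| ≤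
      |a| * (R * φ.mass) := by
  have hd1 : ∀ s ∈ uIcc 0 a, HasDerivWithinAt
      (fun s : ℝ => inner ℝ m.toL2 (trans (s • bvec j) φ.toL2))
      (inner ℝ m.toL2 (trans (s • bvec j) (φ.der (bvec j)).toL2)) (uIcc 0 a) s := fun s _ => by
    have h1 := (hasDerivAt_const s m.toL2).inner ℝ ((φ.dpart j).hasDerivAt s)
    refine (h1.congr_deriv ?_).hasDerivWithinAt
    rw [inner_zero_left, add_zero]
  have hmv := (convex_uIcc 0 a).norm_image_sub_le_of_norm_hasDerivWithin_le
    (C := R * φ.mass) hd1 (fun s _ => by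
      rw [Test.trans_toL2, Test.der_shift, ← neg_neg (inner ℝ m.toL2 _), ← H1.inner_gradi_test,
        norm_neg, ← φ.mass_shift (s • bvec j)]
      exact Test.abs_inner_le _ (hm.mono fun x hx _ => hx)) left_mem_uIcc right_mem_uIcc
  rw [zero_smul, trans_zero, sub_zero, Test.trans_toL2, Real.norm_eq_abs, Real.norm_eq_abs] at hmv
  linarith

theorem divMul_coe (b : FieldSpace d) (m : H1 d) : divMul b m =ᵐ[volume]
    fun x => ∑ l, compB l b x * H1.gradi l m x + divB b x * m.toL2 x := by
  have h1 := (eventually_countable_forall (l := ae (volume : Measure (Pt d)))).2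
    fun l : Fin d => mulL_coe (compB l b) (H1.gradi l m)
  have h2 := Lp.coeFn_finsetSum (Finset.univ : Finset (Fin d))
    (fun l => mulL (compB l b) (H1.gradi l m))
  filter_upwards [Lp.coeFn_add (∑ l, mulL (compB l b) (H1.gradi l m)) (mulL (divB b) m.toL2), h1,
    mulL_coe (divB b) m.toL2, h2] with x h3 h1 h4 h2
  rw [divMul, h3, Pi.add_apply, h4, h2]
  simp [h1]

/-- A bump of mass moved along a direction in which the field is almost constant. -/
theorem IsStrong.abs_inner_shift_sub_le {b : FieldSpace d} {m : ℝ → H1 d} {R η V : ℝ}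
    (h : IsStrong t T (fun _ => b) m) (htT : t ≤ T)
    (hR : ∀ s ∈ Icc t T, ∀ l, ∀ᵐ x, |H1.gradi l (m s) x| ≤ R) (hη : 0 ≤ η) (φ : Test d)
    (hdiv : ∀ x, divB b x = 0)
    (hi : ∀ s ∈ Icc t T, ∀ x, φ.f (x + (-(V * (s - t))) • bvec i) ≠ 0 → |compB i b x - V| ≤ η)
    (hl : ∀ l, l ≠ i → ∀ s ∈ Icc t T, ∀ x, φ.f (x + (-(V * (s - t))) • bvec i) ≠ 0 →
      compB l b x = 0) :
    |inner ℝ (m T).toL2 (φ.shift ((-(V * (T - t))) • bvec i)).toL2 - inner ℝ (m t).toL2 φ.toL2| ≤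
      η * R * φ.mass * (T - t) := by
  have hψ : IsPrim t T (fun s => trans ((-(V * (s - t))) • bvec i) φ.toL2)
      (fun s => (-V) • trans ((-(V * (s - t))) • bvec i) (φ.der (bvec i)).toL2) := by
    refine isPrim_of_hasDerivAt (fun s => ?_) ?_
    · have h1 : HasDerivAt (fun s : ℝ => -(V * (s - t))) (-V) s := by
        have := (((hasDerivAt_id s).sub_const t).const_mul V).neg
        rwa [mul_one] at this
      exact ((φ.dpart i).hasDerivAt (-(V * (s - t)))).scomp s h1
    · have : Continuous fun s : ℝ => (-(V * (s - t))) • (bvec i : Pt d) := by fun_prop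
      exact ((continuous_trans _).comp this).const_smul (-V)
  have key := IsPrim.abs_inner_sub_le h hψ (C := η * R * φ.mass) (by
    filter_upwards [ae_restrict_mem measurableSet_Icc] with s hs
    set ψ := φ.shift ((-(V * (s - t))) • bvec i) with hψ'
    -- The test function travels with velocity V e_i. The time derivative of its pairing with m(s)
    -- sees only V ∂_i m - b·∇m on the travelling support, where b differs from V e_i by at most η.
    have e : inner ℝ (m s).toL2 ((-V) • trans ((-(V * (s - t))) • bvec i) (φ.der (bvec i)).toL2) +
        inner ℝ (-divMul b (m s)) (trans ((-(V * (s - t))) • bvec i) φ.toL2) =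
        inner ℝ (V • H1.gradi i (m s) - divMul b (m s)) ψ.toL2 := by
      rw [Test.trans_toL2, Test.trans_toL2, Test.der_shift, ← hψ', real_inner_smul_right,
        inner_sub_left, real_inner_smul_left, H1.inner_gradi_test, inner_neg_left]
      ring
    rw [e, ← φ.mass_shift ((-(V * (s - t))) • bvec i), ← hψ']
    refine Test.abs_inner_le ψ ?_
    filter_upwards [hR s hs i, divMul_coe b (m s), Lp.coeFn_sub (V • H1.gradi i (m s))
      (divMul b (m s)), Lp.coeFn_smul V (H1.gradi i (m s))] with x h1 h2 h3 h4 hx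
    have h5 : ∑ l, compB l b x * H1.gradi l (m s) x = compB i b x * H1.gradi i (m s) x :=
      Finset.sum_eq_single i (fun l _ hli => by rw [hl l hli s hs x hx, zero_mul]) (by simp)
    rw [h3, Pi.sub_apply, h4, h2, h5, hdiv, Pi.smul_apply, smul_eq_mul, zero_mul, add_zero,
      ← sub_mul, abs_mul, abs_sub_comm]
    exact mul_le_mul (hi s hs x hx) h1 (abs_nonneg _) hη)
    (⟨le_rfl, htT⟩ : t ∈ Icc t T) (⟨htT, le_rfl⟩ : T ∈ Icc t T)
  rw [sub_self, mul_zero, neg_zero, zero_smul, trans_zero, Test.trans_toL2,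
    abs_of_nonneg (sub_nonneg.2 htT)] at key
  exact key

end Displacement

end

section

open FieldSpace

variable {d : ℕ} {M t T : ℝ} {i j : Fin d}

/-! ### Rigidity of bounded evolutions in dimension at least two. -/

section Rigidity

/-- Pointwise bounds from bounds against test functions of small support. -/
theorem ae_abs_le_of_test {D : L2s d} {K C ε₀ : ℝ} (hε₀ : 0 < ε₀)
    (h : ∀ (φ : Test d) (x₀ : Pt d) (ε : ℝ), 0 < ε → ε < ε₀ →
      (∀ x, φ.f x ≠ 0 → ‖x - x₀‖ < ε) → |inner ℝ D φ.toL2| ≤ (K + C * ε) * φ.mass) :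
    ∀ᵐ x, |D x| ≤ K := by
  -- Bumps with ratio of radii 2 recover D at almost every point. Their masses are 1, and the error
  -- C ε disappears as their radii tend to 0.
  set χ : ℕ → ContDiffBump (0 : Pt d) := fun n => ⟨mesh n, 2 * mesh n, mesh_pos n, by
    linarith [mesh_pos n]⟩ with hχ
  have hlim : Tendsto (fun n => (χ n).rOut) atTop (𝓝 0) := by
    have := (tendsto_one_div_add_atTop_nhds_zero_nat (𝕜 := ℝ)).const_mul 2
    rwa [mul_zero] at this
  have hae := ContDiffBump.ae_convolution_tendsto_right_of_locallyIntegrable (μ := volume)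
    (φ := χ) (l := atTop) (K := 2) hlim (Eventually.of_forall fun n => le_rfl)
    ((Lp.memLp D).locallyIntegrable (by norm_num))
  filter_upwards [hae] with x₀ hx
  have hb : ∀ᶠ n in atTop, |(convolution ((χ n).normed volume) D (ContinuousLinearMap.lsmul ℝ ℝ)
      volume) x₀| ≤ K + C * (χ n).rOut := by
    filter_upwards [hlim.eventually (gt_mem_nhds hε₀)] with n hn
    have hs : ContDiff ℝ (⊤ : ℕ∞) fun y => (χ n).normed volume (x₀ - y) :=
      (χ n).contDiff_normed.comp (contDiff_const.sub contDiff_id)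
    have hc : HasCompactSupport fun y => (χ n).normed volume (x₀ - y) :=
      (χ n).hasCompactSupport_normed.comp_homeomorph (Homeomorph.subLeft x₀)
    have h1 := h ⟨_, hs, hc⟩ x₀ (χ n).rOut (χ n).rOut_pos hn fun x hx => by
      have : x₀ - x ∈ Function.support ((χ n).normed volume) := hx
      rw [(χ n).support_normed_eq, mem_ball_zero_iff] at this
      rwa [norm_sub_rev]
    have h2 : Test.mass ⟨_, hs, hc⟩ = 1 := by
      have h3 : ∀ y, |(χ n).normed volume (x₀ - y)| = (χ n).normed volume (x₀ - y) := fun y =>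
        abs_of_nonneg ((χ n).nonneg_normed _)
      simp only [Test.mass, h3]
      rw [integral_sub_left_eq_self (fun y => (χ n).normed volume y) volume x₀]
      exact (χ n).integral_normed
    rw [h2, mul_one, Test.inner_toL2] at h1
    rw [convolution_eq_swap]
    simpa [mul_comm] using h1
  have h1 : Tendsto (fun n => K + C * (χ n).rOut) atTop (𝓝 (K + C * 0)) :=
    tendsto_const_nhds.add (hlim.const_mul C)
  rw [mul_zero, add_zero] at h1
  exact le_of_tendsto_of_tendsto hx.abs h1 hb

theorem norm_sq_le_of_ae {D : L2s d} {K ρ : ℝ} (hK : ∀ᵐ x, |D x| ≤ K)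
    (h0 : ∀ᵐ x, ρ < ‖x‖ → D x = 0) :
    ‖D‖ ^ 2 ≤ K ^ 2 * (volume : Measure (Pt d)).real (Metric.closedBall 0 ρ) := by
  have h1 : ∫ x, D x * D x = ∫ x in Metric.closedBall 0 ρ, D x * D x := by
    refine (setIntegral_eq_integral_of_ae_compl_eq_zero ?_).symm
    filter_upwards [h0] with x hx hn
    rw [mem_closedBall_zero_iff, not_le] at hn
    rw [hx hn, mul_zero]
  rw [← real_inner_self_eq_norm_sq, inner_L2s, h1]
  refine (le_abs_self _).trans (norm_setIntegral_le_of_norm_le_const_ae' (f := fun x => D x * D x)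
    measure_closedBall_lt_top ?_)
  filter_upwards [hK] with x hx _
  rw [norm_mul, pow_two]
  exact mul_le_mul hx hx (norm_nonneg _) ((abs_nonneg _).trans hx)

theorem trans_ae_eq_zero {u : L2s d} {ρ : ℝ} (h : ∀ᵐ x, ρ < ‖x‖ → u x = 0) (v : Pt d) :
    ∀ᵐ x, ρ + ‖v‖ < ‖x‖ → trans v u x = 0 := by
  have h1 := (measurePreserving_add_right (volume : Measure (Pt d)) v).quasiMeasurePreserving.ae h
  filter_upwards [trans_coe v u, h1] with x h2 h3 hx
  rw [h2]
  refine h3 ?_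
  have := norm_sub_le (x + v) v
  rw [add_sub_cancel_right] at this
  linarith

/-- A shift by 2ρ + 1 makes the supports disjoint, so the norm squared of an invariant u equals ⟨τ
u, u⟩ = 0. -/
theorem eq_zero_of_trans_invariant {u : L2s d} {ρ : ℝ} (hρ : 0 ≤ ρ)
    (h : ∀ᵐ x, ρ < ‖x‖ → u x = 0) (ht : ∀ s : ℝ, trans (s • bvec i) u = u) : u = 0 := by
  have h1 : inner ℝ (trans ((2 * ρ + 1) • bvec i) u) u = 0 := by
    rw [inner_L2s]
    refine integral_eq_zero_of_ae ?_
    have h1 := (measurePreserving_add_right (volume : Measure (Pt d))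
      ((2 * ρ + 1) • bvec i)).quasiMeasurePreserving.ae h
    filter_upwards [trans_coe ((2 * ρ + 1) • bvec i) u, h1, h] with x h2 h3 h4
    rw [h2, Pi.zero_apply]
    rcases lt_or_ge ρ ‖x‖ with hx | hx
    · rw [h4 hx, mul_zero]
    · rw [h3, zero_mul]
      have h5 := norm_sub_le (x + (2 * ρ + 1) • bvec i) x
      rw [add_sub_cancel_left, norm_smul] at h5
      simp only [PiLp.norm_single, norm_one, mul_one] at h5
      rw [Real.norm_of_nonneg (by positivity)] at h5
      linarith
  rw [ht] at h1
  exact inner_self_eq_zero.1 h1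

/-- Two bumps are followed in the shear of rate c/r centred at x₀. The one at x₀ stays; the one at
x₀ - (r/2) e_i + h e_j drifts with velocity ch/r and ends at x₀ + h e_j. The gradient bound at time
T compares their final values up to Rh, and the bound at time t removes the offset h e_j for another
Rh. Hence the initial density differs by at most 2Rh = O(r²) over the distance r/2. -/
theorem abs_inner_trans_sub_le (hd : 2 ≤ d) (hM : 0 < M) (htT : t < T) (hij : i ≠ j) {m₀ : H1 d}
    {R : ℝ} (hR : 0 ≤ R) (hev : ∀ b ∈ Btilde d M, ∃ m : ℝ → H1 d, m t = m₀ ∧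
      IsStrong t T (fun _ => b) m ∧
      ∀ s ∈ Icc t T, ∀ l, ∀ᵐ x, |H1.gradi l (m s) x| ≤ R) :
    ∃ κ > 0, ∃ r₀ > 0, ∀ r, 0 < r → r < r₀ →
      ∀ᵐ x, |(trans (-((r / 2) • bvec i)) m₀.toL2 - m₀.toL2) x| ≤ κ * r ^ 2 := by
  obtain ⟨c, hc, hshear⟩ := exists_shear hd hM hij
  set S := T - t with hS
  have hS0 : 0 < S := sub_pos.2 htT
  have ht : t ∈ Icc t T := ⟨le_rfl, htT.le⟩
  have hTm : T ∈ Icc t T := ⟨htT.le, le_rfl⟩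
  -- Below, h = r²/(2cS) is the height at which the shear drifts exactly r/2 during the time S. The
  -- bound r < cS/2 gives h ≤ r/4, which keeps both bumps in the ball of radius r; the summand 1
  -- only ensures positivity.
  refine ⟨R / (c * S) + 1, by positivity, min 1 (c * S / 2), by positivity, fun r hr hr0 => ?_⟩
  have hr1 : r ≤ 1 := (hr0.trans_le (min_le_left _ _)).le
  have hr2 : r < c * S / 2 := hr0.trans_le (min_le_right _ _)
  set h := r ^ 2 / (2 * (c * S)) with hh
  have hh0 : 0 < h := by positivity
  have hh1 : h ≤ r / 4 := by
    rw [hh, div_le_div_iff₀ (by positivity) (by norm_num)]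
    nlinarith
  suffices hs : ∀ᵐ x, |(trans (-((r / 2) • bvec i)) m₀.toL2 - m₀.toL2) x| ≤ 2 * h * R by
    filter_upwards [hs] with x hx
    refine hx.trans ?_
    have : 2 * h * R = R / (c * S) * r ^ 2 := by rw [hh]; field_simp
    rw [this]
    nlinarith [sq_nonneg r]
  refine ae_abs_le_of_test (ε₀ := r / 4) (C := 2 * (c / r * R * S)) (by positivity)
    fun φ x₀ ε hε hεr hφ => ?_
  obtain ⟨b, hb, hdiv, hbi, hbl⟩ := hshear x₀ r hr hr1
  obtain ⟨m, hm0, hm, hmR⟩ := hev b hb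
  have hη : 0 ≤ c / r * ε := by positivity
  have hcoord : ∀ x : Pt d, |x j| ≤ ‖x‖ := fun x => PiLp.norm_apply_le x j
  set φ' := φ.shift ((r / 2) • bvec i + (-h) • bvec j) with hφ'
  have hsq : c * h / r * S = r / 2 := by rw [hh]; field_simp
  -- the bump at the fixed point of the shear
  have e1 := hm.abs_inner_shift_sub_le (i := i) (V := 0) htT.le hmR hη φ hdiv
    (fun s hs x hx => by
      rw [zero_mul, neg_zero, zero_smul, add_zero] at hx
      have hx' := hφ x hx
      rw [hbi x (by linarith), sub_zero, abs_mul, abs_of_pos (div_pos hc hr)]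
      exact mul_le_mul_of_nonneg_left ((hcoord _).trans hx'.le) (div_pos hc hr).le)
    (fun l hl s hs x hx => by
      rw [zero_mul, neg_zero, zero_smul, add_zero] at hx
      have hx' := hφ x hx
      exact hbl l hl x (by linarith))
  -- The moving bump remains in the region where the field is the exact shear, at height within ε of
  -- h. Its velocity there is ch/r up to (c/r) ε, an error that vanishes with the size of the bump.
  have hx2 : ∀ s ∈ Icc t T, ∀ x, φ'.f (x + (-(c * h / r * (s - t))) • bvec i) ≠ 0 →
      ‖x - x₀‖ < r ∧ |(x - x₀) j - h| ≤ ε := by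
    intro s hs x hx
    set y := x + (-(c * h / r * (s - t))) • bvec i + ((r / 2) • bvec i + (-h) • bvec j) - x₀ with hy
    have hyε : ‖y‖ < ε := hφ _ hx
    have e : x - x₀ = y + ((c * h / r * (s - t) - r / 2) • bvec i + h • bvec j) := by
      rw [hy]; module
    have hv0 : 0 ≤ c * h / r * (s - t) := mul_nonneg (by positivity) (sub_nonneg.2 hs.1)
    have hv1 : c * h / r * (s - t) ≤ r / 2 := by
      rw [← hsq]
      exact mul_le_mul_of_nonneg_left (by linarith [hs.2]) (by positivity)
    have hn : ∀ (a : ℝ) (l : Fin d), ‖a • (bvec l : Pt d)‖ = |a| := fun a l => by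
      rw [norm_smul]; simp
    constructor
    · rw [e]
      refine (norm_add_le _ _).trans_lt ?_
      have := norm_add_le ((c * h / r * (s - t) - r / 2) • (bvec i : Pt d)) (h • bvec j)
      rw [hn, hn, abs_of_nonpos (by linarith), abs_of_pos hh0] at this
      linarith
    · have : (x - x₀) j - h = y j := by
        rw [e]
        simp [hij.symm]
      rw [this]
      exact (hcoord y).trans hyε.le
  have e2 := hm.abs_inner_shift_sub_le (i := i) (V := c * h / r) htT.le hmR hη φ' hdiv
    (fun s hs x hx => by
      obtain ⟨h1, h2⟩ := hx2 s hs x hx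
      have : c / r * (x - x₀) j - c * h / r = c / r * ((x - x₀) j - h) := by ring
      rw [hbi x h1, this, abs_mul, abs_of_pos (div_pos hc hr)]
      exact mul_le_mul_of_nonneg_left h2 (div_pos hc hr).le)
    (fun l hl s hs x hx => hbl l hl x (hx2 s hs x hx).1)
  rw [← hS, hsq, hφ', Test.shift_shift, Test.mass_shift, hm0, neg_smul, neg_add_cancel_left] at e2
  rw [zero_mul, neg_zero, zero_smul, hm0, ← hS, ← Test.trans_toL2, trans_zero] at e1
  -- The Lipschitz bound is used at time T to compare the two arrivals, and at time t to undo the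
  -- vertical offset.
  have e3 := abs_inner_shift_sub_le (hmR T hTm j) φ (-h)
  have e4 := abs_inner_shift_sub_le (m := m₀) (by rw [← hm0]; exact hmR t ht j)
    (φ.shift ((r / 2) • bvec i)) (-h)
  rw [Test.shift_shift, Test.mass_shift, add_comm ((-h) • bvec j)] at e4
  rw [abs_neg, abs_of_pos hh0] at e3 e4
  rw [inner_sub_left, inner_trans_left, neg_neg, Test.trans_toL2]
  set A := inner ℝ m₀.toL2 (φ.shift ((r / 2) • bvec i)).toL2
  set B := inner ℝ m₀.toL2 φ.toL2
  set N := φ.mass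
  have : (2 * h * R + 2 * (c / r * R * S) * ε) * N =
      c / r * ε * R * N * S + c / r * ε * R * N * S + h * (R * N) + h * (R * N) := by ring
  rw [this]
  rw [abs_le] at *
  constructor <;> linarith [e1.1, e1.2, e2.1, e2.2, e3.1, e3.2, e4.1, e4.2]

/-- In dimension at least two, only the zero density has uniformly Lipschitz evolutions. -/
theorem eq_zero_of_bounded_evolutions (hd : 2 ≤ d) (hM : 0 < M) (htT : t < T) {m₀ : H1 d}
    {R ρ : ℝ} (hR : 0 ≤ R) (hρ : 0 ≤ ρ) (h0 : ∀ᵐ x, ρ < ‖x‖ → m₀.toL2 x = 0)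
    (hev : ∀ b ∈ Btilde d M, ∃ m : ℝ → H1 d, m t = m₀ ∧ IsStrong t T (fun _ => b) m ∧
      ∀ s ∈ Icc t T, ∀ l, ∀ᵐ x, |H1.gradi l (m s) x| ≤ R) : m₀ = 0 := by
  set i : Fin d := ⟨0, by omega⟩
  set j : Fin d := ⟨1, by omega⟩
  have hij : i ≠ j := by simp [i, j]
  obtain ⟨κ, hκ, r₀, hr₀, hmain⟩ := abs_inner_trans_sub_le hd hM htT hij hR hev
  set W := √((volume : Measure (Pt d)).real (Metric.closedBall 0 (ρ + 1))) with hW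
  -- With r = 2 mesh n a quadratic variation is divided by a linear step. The bounded support turns
  -- the pointwise bound into one in L², so the difference quotients tend to 0.
  have hbound : ∀ᶠ n : ℕ in atTop, ‖diffQ i (mesh n) m₀.toL2‖ ≤ 4 * κ * W * mesh n := by
    have hlim : Tendsto (fun n => 2 * mesh n) atTop (𝓝 0) := by
      have := (tendsto_one_div_add_atTop_nhds_zero_nat (𝕜 := ℝ)).const_mul 2
      rwa [mul_zero] at this
    filter_upwards [hlim.eventually (gt_mem_nhds hr₀),
      hlim.eventually (gt_mem_nhds one_pos)] with n h1 h2
    have hp := mesh_pos n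
    have h3 := hmain (2 * mesh n) (by positivity) h1
    rw [mul_div_cancel_left₀ _ (two_ne_zero' ℝ)] at h3
    set D := trans (-(mesh n • bvec i)) m₀.toL2 - m₀.toL2 with hD
    have h4 : ‖D‖ ^ 2 ≤ (κ * (2 * mesh n) ^ 2) ^ 2 *
        (volume : Measure (Pt d)).real (Metric.closedBall 0 (ρ + 1)) := by
      refine norm_sq_le_of_ae h3 ?_
      filter_upwards [Lp.coeFn_sub (trans (-(mesh n • bvec i)) m₀.toL2) m₀.toL2, h0,
        trans_ae_eq_zero h0 (-(mesh n • bvec i))] with x h5 h6 h7 hx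
      rw [hD, h5, Pi.sub_apply, h6 (by linarith), h7, sub_zero]
      rw [norm_neg, norm_smul, Real.norm_of_nonneg hp.le]
      simp only [PiLp.norm_single, norm_one, mul_one]
      linarith
    have h5 : ‖D‖ ≤ κ * (2 * mesh n) ^ 2 * W := by
      refine le_of_sq_le_sq (h4.trans (le_of_eq ?_)) (by positivity)
      rw [mul_pow _ W, hW, Real.sq_sqrt measureReal_nonneg]
    rw [← norm_diffQ_neg, diffQ_apply, neg_smul, ← hD, norm_smul, norm_inv, norm_neg,
      Real.norm_of_nonneg hp.le, inv_mul_le_iff₀ hp]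
    refine h5.trans (le_of_eq (by ring))
  have hg : H1.gradi i m₀ = 0 := by
    have h1 := ((m₀.dpart i).tendsto_diffQ.comp tendsto_one_div_nat_nhdsNE).norm
    have h2 : Tendsto (fun n => 4 * κ * W * mesh n) atTop (𝓝 (4 * κ * W * 0)) :=
      tendsto_one_div_add_atTop_nhds_zero_nat.const_mul _
    rw [mul_zero] at h2
    exact norm_le_zero_iff.1 (le_of_tendsto_of_tendsto h1 h2 hbound)
  refine H1.ext_toL2 ?_
  have hz : (0 : H1 d).toL2 = 0 := map_zero H1.toL2L
  rw [hz]
  refine eq_zero_of_trans_invariant (i := i) hρ h0 fun s => ?_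
  have := (m₀.dpart i).norm_trans_sub_le s
  rw [hg, norm_zero, mul_zero] at this
  exact sub_eq_zero.1 (norm_le_zero_iff.1 this)

end Rigidity

end

section

open FieldSpace

/-! ### Restriction and restart of evolutions. -/

section WeakRestrict

variable {d : ℕ} {t T M K : ℝ} {β β' : ℝ → FieldSpace d} {m m' : ℝ → H1 d} {m₀ : H1 d}

theorem Adm.mono_right (h : Adm t T M β) {r : ℝ} (hr : r ≤ T) : Adm t r M β :=
  ⟨h.1.mono_measure (Measure.restrict_mono (Icc_subset_Icc_right hr) le_rfl),
    ae_restrict_of_ae_restrict_of_subset (Icc_subset_Icc_right hr) h.2⟩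

theorem IsWeak.congr (h : IsWeak m₀ t T β m)
    (hβ : ∀ᵐ s ∂(volume.restrict (Icc t T)), β s = β' s) : IsWeak m₀ t T β' m := by
  refine ⟨h.1, fun φ h1 h2 s hs => ?_⟩
  rw [h.2 φ h1 h2 s hs]
  congr 1
  refine integral_congr_of_ae ⟨le_rfl, hs.1.trans hs.2⟩ hs ?_
  filter_upwards [hβ] with τ hτ
  rw [hτ]

theorem IsWeak.mono_right (h : IsWeak m₀ t T β m) {r : ℝ} (hr : r ≤ T) : IsWeak m₀ t r β m :=
  ⟨h.1.mono (Icc_subset_Icc_right hr), fun φ h1 h2 s hs => h.2 φ h1 h2 s ⟨hs.1, hs.2.trans hr⟩⟩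

theorem IsWeak.restart (h : IsWeak m₀ t T β m) (hβ : Adm t T M β) (hM : 0 ≤ M) {r : ℝ}
    (hr : r ∈ Icc t T) : IsWeak (m r) r T β m :=
  IsStrong.isWeak ((h.isStrong (hr.1.trans hr.2) hβ hM).mono hr)
    (h.1.mono (Icc_subset_Icc_left hr.1)) rfl

theorem IsWeak.unique (h : IsWeak m₀ t T β m) (h' : IsWeak m₀ t T β m') (hβ : Adm t T M β)
    (hM : 0 ≤ M) : ∀ s ∈ Icc t T, m s = m' s := fun s hs => by
  have htT := hs.1.trans hs.2
  exact (h.isStrong htT hβ hM).unique (h'.isStrong htT hβ hM) hβ hM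
    ((h.init htT).trans (h'.init htT).symm) s hs

theorem isWeak_zero : IsWeak (0 : H1 d) t T β fun _ => 0 := by
  refine ⟨continuousOn_const, fun φ _ _ s _ => ?_⟩
  have h0 : ((0 : H1 d).toL2 : Pt d → ℝ) =ᵐ[volume] 0 := Lp.coeFn_zero _ _ _
  have h1 : ∀ g : Pt d → ℝ, ∫ x, (0 : H1 d).toL2 x * g x = 0 := fun g =>
    integral_eq_zero_of_ae (by filter_upwards [h0] with x hx; rw [hx]; simp)
  simp only [h1, intervalIntegral.integral_zero, add_zero]

theorem isWeak_of_ge (h : T ≤ t) : IsWeak m₀ t T β fun _ => m₀ := by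
  refine ⟨continuousOn_const, fun φ _ _ s hs => ?_⟩
  have : s = t := le_antisymm (hs.2.trans h) hs.1
  rw [this, intervalIntegral.integral_same, add_zero]

end WeakRestrict

/-! ### Concatenation of controls. -/

/-- Switching from `u` to `v` at time `r`. -/
def concat {E : Type*} (r : ℝ) (u v : ℝ → E) (s : ℝ) : E := if s ≤ r then u s else v s

section Concat

variable {E : Type*} {r t T : ℝ} {u v : ℝ → E}

theorem concat_of_le {s : ℝ} (h : s ≤ r) : concat r u v s = u s := if_pos h

theorem concat_of_gt {s : ℝ} (h : r < s) : concat r u v s = v s := if_neg (not_le.2 h)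

theorem concat_ae_left : ∀ᵐ s ∂(volume.restrict (Icc t r)), concat r u v s = u s := by
  filter_upwards [ae_restrict_mem measurableSet_Icc] with s hs using concat_of_le hs.2

theorem ae_restrict_Ioc_of_Icc {p : ℝ → Prop} (h : ∀ᵐ s ∂(volume.restrict (Ioc r T)), p s) :
    ∀ᵐ s ∂(volume.restrict (Icc r T)), p s := by
  rwa [← restrict_Ioc_eq_restrict_Icc]

theorem concat_ae_right : ∀ᵐ s ∂(volume.restrict (Icc r T)), concat r u v s = v s := by
  refine ae_restrict_Ioc_of_Icc ?_
  filter_upwards [ae_restrict_mem measurableSet_Ioc] with s hs using concat_of_gt hs.1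

theorem restrict_Icc_le_add (t r T : ℝ) : (volume : Measure ℝ).restrict (Icc t T) ≤
    volume.restrict (Icc t r) + volume.restrict (Icc r T) := by
  refine le_trans (Measure.restrict_mono (fun s hs => ?_) le_rfl) (Measure.restrict_union_le _ _)
  rcases le_total s r with h | h
  · exact Or.inl ⟨hs.1, h⟩
  · exact Or.inr ⟨h, hs.2⟩

theorem ae_Icc_of_ae {p : ℝ → Prop} (h1 : ∀ᵐ s ∂(volume.restrict (Icc t r)), p s)
    (h2 : ∀ᵐ s ∂(volume.restrict (Icc r T)), p s) : ∀ᵐ s ∂(volume.restrict (Icc t T)), p s :=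
  ae_mono (restrict_Icc_le_add t r T) (ae_add_measure_iff.2 ⟨h1, h2⟩)

end Concat

/-! ### The evolution of the mass on the sets X(t). -/

namespace Data

variable {d k : ℕ} {G : Data d k} {t : ℝ} {β β' : ℝ → FieldSpace d} {m₀ : H1 d}

theorem adm_of_controlB (hβ : β ∈ G.ControlB t) : Adm t G.T G.M β := ⟨hβ.1.1, hβ.2⟩

theorem controlB_mono (hβ : β ∈ G.ControlB t) {r : ℝ} (hr : t ≤ r) : β ∈ G.ControlB r :=
  ⟨hβ.1.mono_measure (Measure.restrict_mono (Icc_subset_Icc_left hr) le_rfl),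
    ae_restrict_of_ae_restrict_of_subset (Icc_subset_Icc_left hr) hβ.2⟩

theorem const_mem_controlB {b : FieldSpace d} (hb : b ∈ Btilde d G.M) :
    (fun _ => b) ∈ G.ControlB t :=
  ⟨memLp_const b, Eventually.of_forall fun _ => hb⟩

theorem concat_mem_controlB {r : ℝ} (hβ : β ∈ G.ControlB t) (hβ' : β' ∈ G.ControlB r)
    (hr : r ≤ G.T) : concat r β β' ∈ G.ControlB t := by
  refine ⟨?_, ae_Icc_of_ae (r := r) ?_ ?_⟩
  · refine MemLp.piecewise (s := Iic r) measurableSet_Iic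
      (hβ.1.mono_measure Measure.restrict_le_self) (hβ'.1.mono_measure ?_)
    rw [Measure.restrict_restrict measurableSet_Iic.compl]
    have hsub : (Iic r)ᶜ ∩ Icc t G.T ⊆ Icc r G.T := fun s hs =>
      ⟨(lt_of_not_ge (mem_Iic.not.1 hs.1)).le, hs.2.2⟩
    exact Measure.restrict_mono hsub le_rfl
  · filter_upwards [concat_ae_left (u := β) (v := β') (t := t) (r := r),
      ae_restrict_of_ae_restrict_of_subset (Icc_subset_Icc_right hr) hβ.2] with s h1 h2
    rwa [h1]
  · filter_upwards [concat_ae_right (u := β) (v := β') (r := r) (T := G.T), hβ'.2] with s h1 h2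
    rwa [h1]

theorem mass_congr (h : ∀ᵐ s ∂(volume.restrict (Icc t G.T)), β s = β' s) :
    G.mass m₀ t β = G.mass m₀ t β' := by
  have : G.IsMassEvolution m₀ t β = G.IsMassEvolution m₀ t β' := funext fun m => propext
    ⟨fun hm => IsWeak.congr hm h, fun hm => IsWeak.congr hm (h.mono fun _ hs => hs.symm)⟩
  rw [mass, mass, this]

theorem mass_eq_of_isWeak (hM : 0 ≤ G.M) (hβ : β ∈ G.ControlB t) {m : ℝ → H1 d}
    (h : IsWeak m₀ t G.T β m) {s : ℝ} (hs : s ∈ Icc t G.T) : G.mass m₀ t β s = m s :=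
  IsWeak.unique (Classical.epsilon_spec (p := G.IsMassEvolution m₀ t β) ⟨m, h⟩) h
    (adm_of_controlB hβ) hM s hs

theorem ae_abs_gradi_le {m : H1 d} {R : ℝ} (h : m.normW1inf ≤ ENNReal.ofReal R) (i : Fin d) :
    ∀ᵐ x, |H1.gradi i m x| ≤ max R 0 := by
  have h1 : eLpNorm m.grad ∞ volume ≤ ENNReal.ofReal R := le_trans le_add_self h
  rw [H1.gradi_apply]
  rw [eLpNorm_exponent_top] at h1
  filter_upwards [comp_coe i m.grad, ae_le_eLpNormEssSup (f := m.grad) (μ := volume)] with x h2 h3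
  have h4 := h3.trans h1
  rw [← ofReal_norm] at h4
  replace h4 := h4.trans (ENNReal.ofReal_le_ofReal (le_max_left R 0))
  rw [h2]
  exact (PiLp.norm_apply_le (m.grad x) i).trans
    ((ENNReal.ofReal_le_ofReal_iff (le_max_right _ _)).1 h4)

/-- For d ≥ 2 and t < T each constant field has its own C^{1,1} constant, so its evolution exists
and agrees with `mass`. Membership in X(t) bounds its gradient by R, and rigidity applies. -/
theorem X_cases (hG : G.Standing) (hd : 1 ≤ d) (ht : t ∈ Icc 0 G.T) (hm : m₀ ∈ G.X t) :
    d = 1 ∨ m₀ = 0 ∨ t = G.T := by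
  rcases hd.eq_or_lt with h1 | h2
  · exact Or.inl h1.symm
  rcases ht.2.eq_or_lt with h3 | h3
  · exact Or.inr (Or.inr h3)
  refine Or.inr (Or.inl ?_)
  have hM := hG.M_pos
  obtain ⟨ρ, hρ⟩ := (hG.Ω_bdd.cthickening (δ := G.M * t)).subset_closedBall 0
  refine eq_zero_of_bounded_evolutions (M := G.M) (R := max G.R 0) (ρ := max ρ 0) h2 hM h3
    (le_max_right _ _) (le_max_right _ _) ?_ fun b hb => ?_
  · filter_upwards [hm.2.1] with x hx hn
    refine hx fun hmem => ?_
    have := hρ hmem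
    rw [mem_closedBall_zero_iff] at this
    exact absurd (this.trans (le_max_left ρ 0)) (not_le.2 hn)
  · obtain ⟨K, hK, hC⟩ := b.exists_C11
    have hβ : (fun _ => b) ∈ G.ControlB t := const_mem_controlB hb
    obtain ⟨m, h0, h1, h2⟩ := exists_isStrong ht.2 (adm_of_controlB hβ) hK hM.le
      (Eventually.of_forall fun _ => hC) m₀
    refine ⟨m, h0, h1, fun s hs l => ?_⟩
    rw [← mass_eq_of_isWeak hM.le hβ (h1.isWeak h2 h0) hs]
    exact ae_abs_gradi_le (hm.2.2 _ hβ s hs) l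

/-- Since `mass` is a choice, it has meaning only once a solution exists. In dimension one the
uniform constant M yields one; otherwise the density is zero or the time interval is a point, and a
constant curve works. -/
theorem mass_spec (hG : G.Standing) (hd : 1 ≤ d) (ht : t ∈ Icc 0 G.T) (hm : m₀ ∈ G.X t)
    (hβ : β ∈ G.ControlB t) : IsWeak m₀ t G.T β (G.mass m₀ t β) := by
  suffices h : ∃ m, IsWeak m₀ t G.T β m from
    Classical.epsilon_spec (p := G.IsMassEvolution m₀ t β) h
  rcases X_cases hG hd ht hm with rfl | rfl | h
  · have hA := adm_of_controlB hβ
    obtain ⟨m, h0, h1, h2⟩ := exists_isStrong ht.2 hA hG.M_pos.le hG.M_pos.le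
      (hA.2.mono fun s hs => C11_of_Btilde_one hs) m₀
    exact ⟨m, h1.isWeak h2 h0⟩
  · exact ⟨_, isWeak_zero⟩
  · exact ⟨_, isWeak_of_ge h.ge⟩

theorem mass_isStrong (hG : G.Standing) (hd : 1 ≤ d) (ht : t ∈ Icc 0 G.T) (hm : m₀ ∈ G.X t)
    (hβ : β ∈ G.ControlB t) : IsStrong t G.T β (G.mass m₀ t β) :=
  (mass_spec hG hd ht hm hβ).isStrong ht.2 (adm_of_controlB hβ) hG.M_pos.le

theorem mass_init (hG : G.Standing) (hd : 1 ≤ d) (ht : t ∈ Icc 0 G.T) (hm : m₀ ∈ G.X t)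
    (hβ : β ∈ G.ControlB t) : G.mass m₀ t β t = m₀ :=
  (mass_spec hG hd ht hm hβ).init ht.2

theorem mass_restart (hG : G.Standing) (hd : 1 ≤ d) (ht : t ∈ Icc 0 G.T) (hm : m₀ ∈ G.X t)
    (hβ : β ∈ G.ControlB t) {r s : ℝ} (hr : r ∈ Icc t G.T) (hs : s ∈ Icc r G.T) :
    G.mass (G.mass m₀ t β r) r β s = G.mass m₀ t β s :=
  mass_eq_of_isWeak hG.M_pos.le (controlB_mono hβ hr.1)
    ((mass_spec hG hd ht hm hβ).restart (adm_of_controlB hβ) hG.M_pos.le hr) hs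

theorem mass_congr_of_le (hG : G.Standing) (hd : 1 ≤ d) (ht : t ∈ Icc 0 G.T) (hm : m₀ ∈ G.X t)
    (hβ : β ∈ G.ControlB t) (hβ' : β' ∈ G.ControlB t) {r : ℝ} (hr : r ∈ Icc t G.T)
    (h : ∀ᵐ s ∂(volume.restrict (Icc t r)), β s = β' s) {s : ℝ} (hs : s ∈ Icc t r) :
    G.mass m₀ t β s = G.mass m₀ t β' s :=
  (((mass_spec hG hd ht hm hβ).mono_right hr.2).congr h).unique
    ((mass_spec hG hd ht hm hβ').mono_right hr.2) ((adm_of_controlB hβ').mono_right hr.2)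
    hG.M_pos.le s hs

/-- Support is preserved by finite speed of propagation. The bound R is preserved because continuing
with β' from time r is an evolution from time t under the concatenated control. -/
theorem mass_mem_X (hG : G.Standing) (hd : 1 ≤ d) (ht : t ∈ Icc 0 G.T) (hm : m₀ ∈ G.X t)
    (hβ : β ∈ G.ControlB t) {r : ℝ} (hr : r ∈ Icc t G.T) : G.mass m₀ t β r ∈ G.X r := by
  refine ⟨(hm.2.2 β hβ r hr).trans_lt ENNReal.ofReal_lt_top, ?_, fun β' hβ' s hs => ?_⟩
  · refine (mass_isStrong hG hd ht hm hβ).ae_eq_zero_of_notMem_cthickening (adm_of_controlB hβ)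
      hG.M_pos.le ht.1 hr ?_
    rw [mass_init hG hd ht hm hβ]
    exact hm.2.1
  · have hc := concat_mem_controlB hβ hβ' hr.2
    have h1 : G.mass m₀ t β r = G.mass m₀ t (concat r β β') r :=
      mass_congr_of_le hG hd ht hm hβ hc hr
        (concat_ae_left.mono fun _ h => h.symm) ⟨hr.1, le_rfl⟩
    rw [h1, ← mass_congr (concat_ae_right (u := β) (v := β') (r := r) (T := G.T)),
      mass_restart hG hd ht hm hc hr hs]
    exact hm.2.2 _ hc s ⟨hr.1.trans hs.1, hs.2⟩

/-- Lipschitz dependence of the mass on the initial density. -/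
theorem exists_mass_lipschitz (hG : G.Standing) (hd : 1 ≤ d) : ∃ Λ : ℝ, 1 ≤ Λ ∧
    ∀ t ∈ Icc 0 G.T, ∀ m₁ ∈ G.X t, ∀ m₂ ∈ G.X t, ∀ β ∈ G.ControlB t, ∀ s ∈ Icc t G.T,
      ‖G.mass m₁ t β s - G.mass m₂ t β s‖ ≤ Λ * ‖m₁ - m₂‖ := by
  have hM := hG.M_pos
  set c := (d + 1) * (G.M + 4 * d * G.M) with hc
  have hc0 : 0 ≤ c := by positivity
  refine ⟨Real.exp (c * G.T), Real.one_le_exp (mul_nonneg hc0 hG.T_pos.le),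
    fun t ht m₁ h₁ m₂ h₂ β hβ s hs => ?_⟩
  have hΛ : 1 ≤ Real.exp (c * G.T) := Real.one_le_exp (mul_nonneg hc0 hG.T_pos.le)
  by_cases h : s = t
  · rw [h, mass_init hG hd ht h₁ hβ, mass_init hG hd ht h₂ hβ]
    exact le_mul_of_one_le_left (norm_nonneg _) hΛ
  have htT : t ≠ G.T := fun h' => h (le_antisymm (hs.2.trans h'.ge) hs.1)
  -- As s > t forces t < T, outside dimension one both densities are zero.
  by_cases h1 : d = 1
  · subst h1
    have hA := adm_of_controlB hβ
    have hst := (mass_isStrong hG hd ht h₁ hβ).sub (mass_isStrong hG hd ht h₂ hβ)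
    have hcont := (mass_spec hG hd ht h₁ hβ).1.sub (mass_spec hG hd ht h₂ hβ).1
    have := hst.norm_sq_le hcont hA hM.le hM.le (hA.2.mono fun s hs => C11_of_Btilde_one hs) s hs
    rw [mass_init hG hd ht h₁ hβ, mass_init hG hd ht h₂ hβ, ← hc] at this
    have h3 : Real.exp (c * (s - t)) ≤ Real.exp (c * G.T) ^ 2 := by
      rw [pow_two]
      refine le_trans ?_ (le_mul_of_one_le_left (Real.exp_pos _).le hΛ)
      refine Real.exp_le_exp.2 (mul_le_mul_of_nonneg_left ?_ hc0)
      linarith [ht.1, hs.2]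
    refine le_of_sq_le_sq (this.trans ?_) (by positivity)
    rw [mul_pow, mul_comm]
    gcongr
  · have e₁ : m₁ = 0 := by simpa [h1, htT] using X_cases hG hd ht h₁
    have e₂ : m₂ = 0 := by simpa [h1, htT] using X_cases hG hd ht h₂
    rw [e₁, e₂]
    simp

/-- Over short times the mass stays close in `H¹` to a density close to a given one. -/
theorem exists_mass_short_time (hG : G.Standing) (hd : 1 ≤ d) (n₀ : H1 d) {ε : ℝ} (hε : 0 < ε) :
    ∃ δ > 0, ∀ t ∈ Icc 0 G.T, ∀ m ∈ G.X t, ‖m - n₀‖ < δ → ∀ β ∈ G.ControlB t, ∀ s ∈ Icc t G.T,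
      s - t < δ → ‖G.mass m t β s - m‖ < ε := by
  have hM := hG.M_pos
  set c := (d + 1) * (G.M + 4 * d * G.M) with hc
  have hc0 : 0 ≤ c := by positivity
  -- The estimate is centred at n₀ rather than at m, so that one δ serves all m near n₀ and all
  -- fields. The norm grows at most to (‖n₀‖ + δ)² exp(cδ), which is below ‖n₀‖² + δ₀ for small δ.
  obtain ⟨δ₀, hδ₀, H⟩ := H1.radial_close n₀ (half_pos hε)
  have hf : Tendsto (fun δ : ℝ => (‖n₀‖ + δ) ^ 2 * Real.exp (c * δ)) (𝓝 0) (𝓝 (‖n₀‖ ^ 2)) := by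
    have : Continuous (fun δ : ℝ => (‖n₀‖ + δ) ^ 2 * Real.exp (c * δ)) := by fun_prop
    simpa using this.tendsto 0
  set B := (‖n₀‖ + 1) * Real.exp (c * G.T) with hB
  have hB0 : 0 ≤ B := by positivity
  have hg : Tendsto (fun δ : ℝ => δ + (d + 1) * G.M * B * δ) (𝓝 0) (𝓝 0) := by
    have : Continuous (fun δ : ℝ => δ + (d + 1) * G.M * B * δ) := by fun_prop
    simpa using this.tendsto 0
  have hev := ((hf.eventually_lt_const (lt_add_of_pos_right _ hδ₀)).and
    (hg.eventually_lt_const hδ₀)).and (eventually_lt_nhds (show (0 : ℝ) < min 1 (ε / 2) by positivity))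
  obtain ⟨δ, hδ, hδ'⟩ := (((hev.filter_mono nhdsWithin_le_nhds).and
    (self_mem_nhdsWithin (s := Ioi (0 : ℝ)))).exists)
  obtain ⟨⟨h1, h2⟩, h3⟩ := hδ
  rw [lt_min_iff] at h3
  refine ⟨δ, hδ', fun t ht m hm hmn β hβ s hs hst => ?_⟩
  by_cases h : s = t
  · rw [h, mass_init hG hd ht hm hβ, sub_self, norm_zero]
    exact hε
  have htT : t ≠ G.T := fun h' => h (le_antisymm (hs.2.trans h'.ge) hs.1)
  by_cases hd1 : d = 1
  · subst hd1
    have hA := adm_of_controlB hβ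
    have hS := mass_isStrong hG hd ht hm hβ
    have hi := mass_init hG hd ht hm hβ
    have hmδ : ‖m‖ ≤ ‖n₀‖ + δ := by
      have := norm_le_insert' m n₀
      linarith
    have hsq : ∀ r ∈ Icc t G.T, ‖G.mass m t β r‖ ^ 2 ≤ (‖n₀‖ + δ) ^ 2 * Real.exp (c * (r - t)) :=
      fun r hr => by
      have := hS.norm_sq_le (mass_spec hG hd ht hm hβ).1 hA hM.le hM.le
        (hA.2.mono fun s hs => C11_of_Btilde_one hs) r hr
      rw [hi, ← hc] at this
      exact this.trans (mul_le_mul_of_nonneg_right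
        (pow_le_pow_left₀ (norm_nonneg _) hmδ 2) (Real.exp_pos _).le)
    have hbd : ∀ r ∈ Icc t G.T, ‖G.mass m t β r‖ ≤ B := fun r hr => by
      refine le_of_sq_le_sq ((hsq r hr).trans ?_) hB0
      rw [hB, mul_pow]
      have h4 : (1 : ℝ) ≤ Real.exp (c * G.T) := Real.one_le_exp (mul_nonneg hc0 hG.T_pos.le)
      refine mul_le_mul (pow_le_pow_left₀ (by positivity) (by linarith) 2) ?_
        (Real.exp_pos _).le (by positivity)
      rw [pow_two]
      refine le_trans ?_ (le_mul_of_one_le_left (Real.exp_pos _).le h4)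
      refine Real.exp_le_exp.2 (mul_le_mul_of_nonneg_left ?_ hc0)
      linarith [ht.1, hr.2]
    have hL2 := IsPrim.norm_sub_le hS (hA.bdd_divMul hM.le hbd) ⟨le_rfl, ht.2⟩ hs
    simp only [hi] at hL2
    have key : ‖G.mass m t β s - n₀‖ < ε / 2 := by
      refine H _ ((hsq s hs).trans ((mul_le_mul_of_nonneg_left (Real.exp_le_exp.2
        (mul_le_mul_of_nonneg_left hst.le hc0)) (by positivity)).trans h1.le)) ?_
      have e : (G.mass m t β s).toL2 - n₀.toL2 =
        ((G.mass m t β s).toL2 - m.toL2) + (m - n₀).toL2 := by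
        rw [show (m - n₀).toL2 = m.toL2 - n₀.toL2 from map_sub H1.toL2L m n₀]
        abel
      rw [e]
      refine (norm_add_le _ _).trans_lt ?_
      have h5 : ‖(m - n₀).toL2‖ ≤ ‖m - n₀‖ := H1.norm_toL2_le _
      rw [abs_of_nonneg (sub_nonneg.2 hs.1)] at hL2
      have h6 : (((1 : ℕ) : ℝ) + 1) * G.M * B * (s - t) ≤ (((1 : ℕ) : ℝ) + 1) * G.M * B * δ :=
        mul_le_mul_of_nonneg_left hst.le (by positivity)
      linarith
    have e : G.mass m t β s - m = (G.mass m t β s - n₀) - (m - n₀) := by abel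
    rw [e]
    refine (norm_sub_le _ _).trans_lt ?_
    linarith [h3.2]
  · have e₁ : m = 0 := by simpa [hd1, htT] using X_cases hG hd ht hm
    have : G.mass m t β s = 0 := by
      rw [e₁]
      exact mass_eq_of_isWeak hM.le hβ isWeak_zero hs
    rw [this, e₁]
    simpa using hε

end Data

end

/-! ### Trajectories of the single player. -/

section

open FieldSpace

theorem IsPrim.norm_sub_le_exp {E : Type*} [NormedAddCommGroup E] [NormedSpace ℝ E] {t T L : ℝ}
    {v v' w w' : ℝ → E} (h : IsPrim t T v w) (h' : IsPrim t T v' w') (hL : 0 ≤ L)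
    (hw : ∀ᵐ s ∂(volume.restrict (Icc t T)), ‖w s - w' s‖ ≤ L * ‖v s - v' s‖) :
    ∀ s ∈ Icc t T, ‖v s - v' s‖ ≤ ‖v t - v' t‖ * Real.exp (L * (s - t)) := by
  have hs := h.sub h'
  have hc : ContinuousOn (fun s => ‖v s - v' s‖) (Icc t T) := hs.continuousOn.norm
  refine gronwall_integral hL hc fun s hst => ?_
  have ht : t ∈ Icc t T := ⟨le_rfl, hst.1.trans hst.2⟩
  have e := hs.eq s hst
  rw [e]
  refine (norm_add_le _ _).trans (add_le_add le_rfl ?_)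
  rw [← intervalIntegral.integral_const_mul]
  refine (intervalIntegral.norm_integral_le_integral_norm hst.1).trans ?_
  refine integral_mono_of_ae ht hst hst.1 (hs.intervalIntegrable ht hst).norm ?_ hw
  refine ContinuousOn.intervalIntegrable ?_
  rw [uIcc_of_le hst.1]
  exact (hc.mono (Icc_subset_Icc_right hst.2)).const_smul L

theorem IsPrim.mono_right {E : Type*} [NormedAddCommGroup E] [NormedSpace ℝ E] {t T r : ℝ}
    {v w : ℝ → E} (h : IsPrim t T v w) (hr : r ≤ T) : IsPrim t r v w := by
  have hsub : Icc t r ⊆ Icc t T := Icc_subset_Icc_right hr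
  obtain ⟨C, hC⟩ := h.bdd
  exact ⟨h.meas.mono_measure (Measure.restrict_mono hsub le_rfl),
    ⟨C, ae_restrict_of_ae_restrict_of_subset hsub hC⟩, fun s hs => h.eq s (hsub hs)⟩

namespace Data

variable {d k : ℕ} {G : Data d k} {t : ℝ} {α α' : ℝ → Pt k} {x : Pt d}

theorem controlA_mono (hα : α ∈ G.ControlA t) {r : ℝ} (hr : t ≤ r) : α ∈ G.ControlA r :=
  ⟨hα.1.mono_measure (Measure.restrict_mono (Icc_subset_Icc_left hr) le_rfl),
    fun s hs => hα.2 s ⟨hr.trans hs.1, hs.2⟩⟩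

theorem const_mem_controlA {a : Pt k} (ha : a ∈ G.A) : (fun _ => a) ∈ G.ControlA t :=
  ⟨aemeasurable_const, fun _ _ => ha⟩

theorem concat_mem_controlA {r : ℝ} (hα : α ∈ G.ControlA t) (hα' : α' ∈ G.ControlA r)
    (hr : r ≤ G.T) : concat r α α' ∈ G.ControlA t := by
  refine ⟨?_, fun s hs => ?_⟩
  · refine AEMeasurable.mono_measure ?_ (restrict_Icc_le_add t r G.T)
    refine aemeasurable_add_measure_iff.2 ⟨?_, ?_⟩
    · exact (hα.1.mono_measure (Measure.restrict_mono (Icc_subset_Icc_right hr) le_rfl)).congr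
        (concat_ae_left.mono fun _ h => h.symm)
    · exact hα'.1.congr (concat_ae_right.mono fun _ h => h.symm)
  · rcases le_or_gt s r with h | h
    · rw [concat_of_le h]
      exact hα.2 s hs
    · rw [concat_of_gt h]
      exact hα'.2 s ⟨h.le, hs.2⟩

/-- Measurability along a control of a function that is continuous on the control set. -/
theorem aestronglyMeasurable_comp_control (hG : G.Standing) {Y Z : Type*} [TopologicalSpace Y]
    [TopologicalSpace Z] {h : Y × Pt k → Z} (hh : ContinuousOn h (univ ×ˢ G.A)) {u : ℝ → Y}
    (hu : AEStronglyMeasurable u (volume.restrict (Icc t G.T))) (hα : α ∈ G.ControlA t) :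
    AEStronglyMeasurable (fun τ => h (u τ, α τ)) (volume.restrict (Icc t G.T)) := by
  obtain ⟨g, hg1, hg2, hg3⟩ := hα.1.exists_ae_eq_range_subset
    ((ae_restrict_mem measurableSet_Icc).mono hα.2) hG.A_nonempty
  have hc : Continuous fun z : Y × G.A => h (z.1, z.2.1) :=
    hh.comp_continuous (by fun_prop) fun z => ⟨mem_univ _, z.2.2⟩
  have hg4 : Measurable fun τ => (⟨g τ, hg2 ⟨τ, rfl⟩⟩ : G.A) := hg1.subtype_mk
  refine (hc.comp_aestronglyMeasurable
    (hu.prodMk hg4.aestronglyMeasurable)).congr ?_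
  filter_upwards [hg3] with τ hτ
  rw [hτ]

theorem C_nonneg (hG : G.Standing) : 0 ≤ G.C := by
  obtain ⟨a, ha⟩ := hG.A_nonempty
  exact (norm_nonneg _).trans (hG.f_bdd 0 a ha)

theorem isTrajectory_iff (hG : G.Standing) (ht : t ≤ G.T) (hα : α ∈ G.ControlA t) {y : ℝ → Pt d} :
    G.IsTrajectory x t α y ↔ y t = x ∧ IsPrim t G.T y fun τ => G.f (y τ) (α τ) := by
  constructor
  · rintro ⟨h1, h2⟩
    have h0 : y t = x := by simpa using h2 t ⟨le_rfl, ht⟩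
    refine ⟨h0, aestronglyMeasurable_comp_control hG hG.f_cont
      (h1.aestronglyMeasurable measurableSet_Icc) hα, ⟨G.C, ?_⟩, fun s hs => by rw [h0, h2 s hs]⟩
    filter_upwards [ae_restrict_mem measurableSet_Icc] with s hs using hG.f_bdd _ _ (hα.2 s hs)
  · rintro ⟨rfl, h⟩
    exact ⟨h.continuousOn, h.eq⟩

theorem traj_spec (hG : G.Standing) (ht : t ≤ G.T) (hα : α ∈ G.ControlA t) (x : Pt d) :
    G.IsTrajectory x t α (G.traj x t α) := by
  suffices h : ∃ y, G.IsTrajectory x t α y from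
    Classical.epsilon_spec (p := G.IsTrajectory x t α) h
  obtain ⟨L, hL, hlip⟩ := hG.f_lip
  have hA := (ae_restrict_mem (μ := volume) (measurableSet_Icc (a := t) (b := G.T))).mono hα.2
  obtain ⟨y, hy, h0, hp⟩ := exists_integral_solution (C := G.C) ht (fun τ u => G.f u (α τ)) hL.le
    (fun u hu => aestronglyMeasurable_comp_control hG hG.f_cont hu.aestronglyMeasurable hα)
    (hA.mono fun τ h u v => hlip u v _ h) (hA.mono fun τ h => hG.f_bdd _ _ h) x
  exact ⟨y, (isTrajectory_iff hG ht hα).2 ⟨h0, hp⟩⟩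

theorem traj_init (hG : G.Standing) (ht : t ≤ G.T) (hα : α ∈ G.ControlA t) (x : Pt d) :
    G.traj x t α t = x := ((isTrajectory_iff hG ht hα).1 (traj_spec hG ht hα x)).1

theorem traj_isPrim (hG : G.Standing) (ht : t ≤ G.T) (hα : α ∈ G.ControlA t) (x : Pt d) :
    IsPrim t G.T (G.traj x t α) fun τ => G.f (G.traj x t α τ) (α τ) :=
  ((isTrajectory_iff hG ht hα).1 (traj_spec hG ht hα x)).2

theorem traj_congr (h : ∀ᵐ s ∂(volume.restrict (Icc t G.T)), α s = α' s) :
    G.traj x t α = G.traj x t α' := by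
  have key : ∀ {α α' : ℝ → Pt k}, (∀ᵐ s ∂(volume.restrict (Icc t G.T)), α s = α' s) → ∀ y,
      G.IsTrajectory x t α y → G.IsTrajectory x t α' y := by
    refine fun h y hy => ⟨hy.1, fun s hs => ?_⟩
    rw [hy.2 s hs]
    congr 1
    refine integral_congr_of_ae ⟨le_rfl, hs.1.trans hs.2⟩ hs ?_
    filter_upwards [h] with τ hτ
    rw [hτ]
  have : G.IsTrajectory x t α = G.IsTrajectory x t α' :=
    funext fun y => propext ⟨key h y, key (h.mono fun _ h => h.symm) y⟩
  rw [traj, traj, this]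

/-- Lipschitz dependence of the trajectories on the initial position. -/
theorem exists_traj_lipschitz (hG : G.Standing) : ∃ Λ : ℝ, 1 ≤ Λ ∧ ∀ t ∈ Icc 0 G.T,
    ∀ r ∈ Icc t G.T, ∀ α ∈ G.ControlA t, ∀ α' ∈ G.ControlA t,
    (∀ᵐ s ∂(volume.restrict (Icc t r)), α s = α' s) → ∀ x x' : Pt d, ∀ s ∈ Icc t r,
      ‖G.traj x t α s - G.traj x' t α' s‖ ≤ Λ * ‖x - x'‖ := by
  obtain ⟨L, hL, hlip⟩ := hG.f_lip
  refine ⟨Real.exp (L * G.T), Real.one_le_exp (mul_nonneg hL.le hG.T_pos.le),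
    fun t ht r hr α hα α' hα' h x x' s hs => ?_⟩
  have := IsPrim.norm_sub_le_exp (IsPrim.mono_right (traj_isPrim hG ht.2 hα x) hr.2)
    (IsPrim.mono_right (traj_isPrim hG ht.2 hα' x') hr.2) hL.le (by
      filter_upwards [h, ae_restrict_mem measurableSet_Icc] with τ h1 h2
      rw [← h1]
      exact hlip _ _ _ (hα.2 τ ⟨h2.1, h2.2.trans hr.2⟩)) s hs
  rw [traj_init hG ht.2 hα, traj_init hG ht.2 hα', mul_comm] at this
  refine this.trans (mul_le_mul_of_nonneg_right (Real.exp_le_exp.2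
    (mul_le_mul_of_nonneg_left ?_ hL.le)) (norm_nonneg _))
  linarith [ht.1, hs.2, hr.2]

/-- Causality: only the control up to time r matters, by the Lipschitz estimate with equal initial
points. -/
theorem traj_congr_of_le (hG : G.Standing) (ht : t ∈ Icc 0 G.T) (hα : α ∈ G.ControlA t)
    (hα' : α' ∈ G.ControlA t) {r : ℝ} (hr : r ∈ Icc t G.T)
    (h : ∀ᵐ s ∂(volume.restrict (Icc t r)), α s = α' s) {s : ℝ} (hs : s ∈ Icc t r) :
    G.traj x t α s = G.traj x t α' s := by
  obtain ⟨Λ, -, hΛ⟩ := exists_traj_lipschitz hG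
  have := hΛ t ht r hr α hα α' hα' h x x s hs
  rw [sub_self, norm_zero, mul_zero] at this
  exact sub_eq_zero.1 (norm_le_zero_iff.1 this)

theorem traj_restart (hG : G.Standing) (ht : t ∈ Icc 0 G.T) (hα : α ∈ G.ControlA t)
    {r s : ℝ} (hr : r ∈ Icc t G.T) (hs : s ∈ Icc r G.T) :
    G.traj (G.traj x t α r) r α s = G.traj x t α s := by
  obtain ⟨L, hL, hlip⟩ := hG.f_lip
  have hαr := controlA_mono hα hr.1
  have := IsPrim.norm_sub_le_exp (traj_isPrim hG hr.2 hαr (G.traj x t α r))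
    (IsPrim.mono (traj_isPrim hG ht.2 hα x) hr) hL.le (by
      filter_upwards [ae_restrict_mem measurableSet_Icc] with τ h2
      exact hlip _ _ _ (hαr.2 τ h2)) s hs
  rw [traj_init hG hr.2 hαr, sub_self, norm_zero, zero_mul] at this
  exact sub_eq_zero.1 (norm_le_zero_iff.1 this)

theorem norm_traj_sub_le (hG : G.Standing) (ht : t ≤ G.T) (hα : α ∈ G.ControlA t)
    {s : ℝ} (hs : s ∈ Icc t G.T) : ‖G.traj x t α s - x‖ ≤ G.C * (s - t) := by
  have h := IsPrim.norm_sub_le (traj_isPrim hG ht hα x) (C := G.C) (by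
    filter_upwards [ae_restrict_mem measurableSet_Icc] with τ h2
    exact hG.f_bdd _ _ (hα.2 τ h2)) ⟨le_rfl, ht⟩ hs
  rwa [traj_init hG ht hα, abs_of_nonneg (sub_nonneg.2 hs.1)] at h

theorem traj_mem_Omega2 (hG : G.Standing) (ht : t ∈ Icc 0 G.T) (hα : α ∈ G.ControlA t)
    (hx : x ∈ G.Omega2 t) {r : ℝ} (hr : r ∈ Icc t G.T) : G.traj x t α r ∈ G.Omega2 r := by
  have hC := C_nonneg hG
  have h := norm_traj_sub_le (x := x) hG ht.2 hα hr
  rw [← dist_eq_norm] at h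
  have h1 := Metric.cthickening_cthickening_subset (mul_nonneg hC (sub_nonneg.2 hr.1))
    (mul_nonneg hC ht.1) G.Ω (Metric.mem_cthickening_of_dist_le _ _ _ _ hx h)
  rwa [← mul_add, sub_add_cancel] at h1

end Data

end

/-! ### The dynamic programming principle. -/

section

open FieldSpace

namespace Data

variable {d k : ℕ} {G : Data d k} {z : Pt d × H1 d × ℝ} {α α' : ℝ → Pt k}
  {β β' : ℝ → FieldSpace d}

variable (G z α β) in
/-- The running cost along the controls `α`, `β` from the state `z`. -/
def running (s : ℝ) : ℝ :=
  G.ℓ (G.traj z.1 z.2.2 α s) (G.mass z.2.1 z.2.2 β s) s (α s) (β s).toL2v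

variable (G z α β) in
/-- The state reached at time `s` from `z` under the controls `α`, `β`. -/
def state (s : ℝ) : Pt d × H1 d × ℝ :=
  (G.traj z.1 z.2.2 α s, G.mass z.2.1 z.2.2 β s, s)

variable (G z α β) in
/-- The total cost of the controls `α`, `β` from the state `z`. -/
def cost : ℝ := G.J z.1 z.2.1 z.2.2 α β

theorem state_mem_Xtilde (hG : G.Standing) (hd : 1 ≤ d) (hz : z ∈ G.Xtilde)
    (hα : α ∈ G.ControlA z.2.2) (hβ : β ∈ G.ControlB z.2.2) {r : ℝ} (hr : r ∈ Icc z.2.2 G.T) :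
    G.state z α β r ∈ G.Xtilde :=
  ⟨⟨hz.1.1.trans hr.1, hr.2⟩, traj_mem_Omega2 hG hz.1 hα hz.2.1 hr,
    mass_mem_X hG hd hz.1 hz.2.2 hβ hr⟩

theorem aestronglyMeasurable_running (hG : G.Standing) (hd : 1 ≤ d) (hz : z ∈ G.Xtilde)
    (hα : α ∈ G.ControlA z.2.2) (hβ : β ∈ G.ControlB z.2.2) :
    AEStronglyMeasurable (G.running z α β) (volume.restrict (Icc z.2.2 G.T)) := by
  -- Continuity of ℓ is available only for times in [0, T]; projecting the time onto this interval
  -- gives a globally continuous function.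
  set h : (Pt d × H1 d × ℝ × L2v d) × Pt k → ℝ := fun w =>
    G.ℓ w.1.1 w.1.2.1 (projIcc 0 G.T hG.T_pos.le w.1.2.2.1) w.2 w.1.2.2.2 with hh
  have hc : Continuous h := by
    refine hG.ℓ_cont.comp_continuous (f := fun w : (Pt d × H1 d × ℝ × L2v d) × Pt k =>
      (w.1.1, w.1.2.1, (projIcc 0 G.T hG.T_pos.le w.1.2.2.1 : ℝ), w.2, w.1.2.2.2)) ?_
      fun w => (projIcc 0 G.T hG.T_pos.le w.1.2.2.1).2
    have := (continuous_projIcc (h := hG.T_pos.le))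
    fun_prop
  have hu : AEStronglyMeasurable (fun s => (G.traj z.1 z.2.2 α s, G.mass z.2.1 z.2.2 β s, s,
      (β s).toL2v)) (volume.restrict (Icc z.2.2 G.T)) := by
    refine AEStronglyMeasurable.prodMk ((traj_spec hG hz.1.2 hα z.1).1.aestronglyMeasurable
      measurableSet_Icc) (AEStronglyMeasurable.prodMk ?_ (AEStronglyMeasurable.prodMk
        aestronglyMeasurable_id (continuous_toL2v.comp_aestronglyMeasurable hβ.1.1)))
    have : SecondCountableTopologyEither ℝ (H1 d) := secondCountableTopologyEither_of_left _ _
    exact (mass_spec hG hd hz.1 hz.2.2 hβ).1.aestronglyMeasurable measurableSet_Icc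
  refine (aestronglyMeasurable_comp_control hG hc.continuousOn hu hα).congr ?_
  filter_upwards [ae_restrict_mem measurableSet_Icc] with s hs
  simp only [hh, running, projIcc_of_mem hG.T_pos.le ⟨hz.1.1.trans hs.1, hs.2⟩]

theorem intervalIntegrable_running (hG : G.Standing) (hd : 1 ≤ d) (hz : z ∈ G.Xtilde)
    (hα : α ∈ G.ControlA z.2.2) (hβ : β ∈ G.ControlB z.2.2) {r s : ℝ} (hr : r ∈ Icc z.2.2 G.T)
    (hs : s ∈ Icc z.2.2 G.T) : IntervalIntegrable (G.running z α β) volume r s := by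
  obtain ⟨B, hB⟩ := hG.ℓ_bdd
  refine intervalIntegrable_of_bdd (C := B) hr hs (aestronglyMeasurable_running hG hd hz hα hβ) ?_
  filter_upwards [ae_restrict_mem measurableSet_Icc] with τ hτ
  have h : τ ∈ Icc 0 G.T := ⟨hz.1.1.trans hτ.1, hτ.2⟩
  rw [Real.norm_eq_abs, running, abs_of_nonneg (hG.ℓ_nonneg _ _ _ h _ _)]
  exact hB _ _ _ h _ _

theorem cost_congr (hα : ∀ᵐ s ∂(volume.restrict (Icc z.2.2 G.T)), α s = α' s)
    (hβ : ∀ᵐ s ∂(volume.restrict (Icc z.2.2 G.T)), β s = β' s) (ht : z.2.2 ≤ G.T) :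
    G.cost z α β = G.cost z α' β' := by
  rw [cost, cost, J, J, traj_congr hα, mass_congr hβ]
  congr 1
  refine integral_congr_of_ae ⟨le_rfl, ht⟩ ⟨ht, le_rfl⟩ ?_
  filter_upwards [hα, hβ] with s h1 h2
  rw [h1, h2]

theorem state_congr (hG : G.Standing) (hd : 1 ≤ d) (hz : z ∈ G.Xtilde)
    (hα : α ∈ G.ControlA z.2.2) (hβ : β ∈ G.ControlB z.2.2) (hα' : α' ∈ G.ControlA z.2.2)
    (hβ' : β' ∈ G.ControlB z.2.2) {r : ℝ} (hr : r ∈ Icc z.2.2 G.T)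
    (h1 : ∀ᵐ s ∂(volume.restrict (Icc z.2.2 r)), α s = α' s)
    (h2 : ∀ᵐ s ∂(volume.restrict (Icc z.2.2 r)), β s = β' s) {s : ℝ} (hs : s ∈ Icc z.2.2 r) :
    G.state z α β s = G.state z α' β' s := by
  rw [state, state, traj_congr_of_le hG hz.1 hα hα' hr h1 hs,
    mass_congr_of_le hG hd hz.1 hz.2.2 hβ hβ' hr h2 hs]

theorem integral_running_congr (hG : G.Standing) (hd : 1 ≤ d) (hz : z ∈ G.Xtilde)
    (hα : α ∈ G.ControlA z.2.2) (hβ : β ∈ G.ControlB z.2.2) (hα' : α' ∈ G.ControlA z.2.2)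
    (hβ' : β' ∈ G.ControlB z.2.2) {r : ℝ} (hr : r ∈ Icc z.2.2 G.T)
    (h1 : ∀ᵐ s ∂(volume.restrict (Icc z.2.2 r)), α s = α' s)
    (h2 : ∀ᵐ s ∂(volume.restrict (Icc z.2.2 r)), β s = β' s) :
    ∫ s in z.2.2..r, G.running z α β s = ∫ s in z.2.2..r, G.running z α' β' s := by
  refine integral_congr_of_ae (T := r) ⟨le_rfl, hr.1⟩ ⟨hr.1, le_rfl⟩ ?_
  filter_upwards [h1, h2, ae_restrict_mem measurableSet_Icc] with s e1 e2 hs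
  rw [running, running, traj_congr_of_le hG hz.1 hα hα' hr h1 hs,
    mass_congr_of_le hG hd hz.1 hz.2.2 hβ hβ' hr h2 hs, e1, e2]

theorem cost_eq_add (hG : G.Standing) (hd : 1 ≤ d) (hz : z ∈ G.Xtilde)
    (hα : α ∈ G.ControlA z.2.2) (hβ : β ∈ G.ControlB z.2.2) {r : ℝ} (hr : r ∈ Icc z.2.2 G.T) :
    G.cost z α β = (∫ s in z.2.2..r, G.running z α β s) + G.cost (G.state z α β r) α β := by
  have ht := hz.1.2
  have e : G.cost z α β = (∫ s in z.2.2..G.T, G.running z α β s) +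
      G.ψ (G.traj z.1 z.2.2 α G.T) (G.mass z.2.1 z.2.2 β G.T) := rfl
  have hT : G.T ∈ Icc r G.T := ⟨hr.2, le_rfl⟩
  have e' : G.cost (G.state z α β r) α β = (∫ s in r..G.T, G.running z α β s) +
      G.ψ (G.traj z.1 z.2.2 α G.T) (G.mass z.2.1 z.2.2 β G.T) := by
    rw [cost, J]
    simp only [state]
    rw [traj_restart hG hz.1 hα hr hT, mass_restart hG hd hz.1 hz.2.2 hβ hr hT]
    congr 1
    refine intervalIntegral.integral_congr fun s hs => ?_
    rw [uIcc_of_le hr.2] at hs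
    simp only [running]
    rw [traj_restart hG hz.1 hα hr hs, mass_restart hG hd hz.1 hz.2.2 hβ hr hs]
  rw [e, e', ← add_assoc, intervalIntegral.integral_add_adjacent_intervals
    (intervalIntegrable_running hG hd hz hα hβ ⟨le_rfl, ht⟩ hr)
    (intervalIntegrable_running hG hd hz hα hβ hr ⟨ht, le_rfl⟩)]

theorem running_nonneg (hG : G.Standing) {s : ℝ} (hs : s ∈ Icc 0 G.T) :
    0 ≤ G.running z α β s := hG.ℓ_nonneg _ _ _ hs _ _

theorem cost_nonneg (hG : G.Standing) (hz : z.2.2 ∈ Icc 0 G.T) : 0 ≤ G.cost z α β :=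
  add_nonneg (intervalIntegral.integral_nonneg hz.2 fun _ hs =>
    running_nonneg hG ⟨hz.1.trans hs.1, hs.2⟩) (hG.ψ_nonneg _ _)

theorem exists_running_le (hG : G.Standing) : ∃ B : ℝ, 0 ≤ B ∧ ∀ z α β, ∀ s ∈ Icc 0 G.T,
    G.running z α β s ≤ B := by
  obtain ⟨B, hB⟩ := hG.ℓ_bdd
  exact ⟨B, (hG.ℓ_nonneg 0 0 0 ⟨le_rfl, hG.T_pos.le⟩ 0 0).trans
    (hB 0 0 0 ⟨le_rfl, hG.T_pos.le⟩ 0 0), fun z α β s hs => hB _ _ _ hs _ _⟩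

theorem exists_integral_running_le (hG : G.Standing) : ∃ B : ℝ, 0 ≤ B ∧ ∀ z α β,
    ∀ t ∈ Icc 0 G.T, ∀ r ∈ Icc t G.T, |∫ s in t..r, G.running z α β s| ≤ B * (r - t) := by
  obtain ⟨B, hB0, hB⟩ := exists_running_le hG
  refine ⟨B, hB0, fun z α β t ht r hr => ?_⟩
  have := intervalIntegral.norm_integral_le_of_norm_le_const (a := t) (b := r)
    (f := G.running z α β) (C := B) fun s hs => ?_
  · rwa [abs_of_nonneg (sub_nonneg.2 hr.1)] at this
  · rw [uIoc_of_le hr.1] at hs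
    have h : s ∈ Icc 0 G.T := ⟨ht.1.trans hs.1.le, hs.2.trans hr.2⟩
    rw [Real.norm_eq_abs, abs_of_nonneg (running_nonneg hG h)]
    exact hB _ _ _ _ h

theorem exists_cost_le (hG : G.Standing) : ∃ B : ℝ, ∀ z α β, z.2.2 ∈ Icc 0 G.T →
    G.cost z α β ≤ B := by
  obtain ⟨B, hB0, hB⟩ := exists_integral_running_le hG
  obtain ⟨B', hB'⟩ := hG.ψ_bdd
  refine ⟨B * G.T + B', fun z α β hz => add_le_add ?_ (hB' _ _)⟩
  refine (le_abs_self _).trans ((hB z α β _ hz G.T ⟨hz.2, le_rfl⟩).trans ?_)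
  exact mul_le_mul_of_nonneg_left (by linarith [hz.1]) hB0

theorem zero_mem_controlB (hG : G.Standing) (t : ℝ) : (fun _ => 0) ∈ G.ControlB t :=
  const_mem_controlB (zero_mem_Btilde hG.M_pos.le)

theorem exists_const_strategy (hG : G.Standing) (t : ℝ) :
    ∃ a ∈ G.A, (fun _ _ => a) ∈ G.Strategy t := by
  obtain ⟨a, ha⟩ := hG.A_nonempty
  exact ⟨a, ha, fun _ _ => const_mem_controlA ha, fun _ _ _ _ _ _ _ =>
    Eventually.of_forall fun _ => rfl⟩

theorem bddAbove_cost (hG : G.Standing) (hz : z.2.2 ∈ Icc 0 G.T)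
    (γ : (ℝ → FieldSpace d) → ℝ → Pt k) :
    BddAbove (range fun β : G.ControlB z.2.2 => J G z.1 z.2.1 z.2.2 (γ β.1) β.1) := by
  obtain ⟨B, hB⟩ := exists_cost_le hG
  refine ⟨B, ?_⟩
  rintro _ ⟨β, rfl⟩
  exact hB z _ _ hz

theorem lowerValue_le (hG : G.Standing) (hz : z.2.2 ∈ Icc 0 G.T)
    {γ : (ℝ → FieldSpace d) → ℝ → Pt k} (hγ : γ ∈ G.Strategy z.2.2) {c : ℝ}
    (h : ∀ β ∈ G.ControlB z.2.2, G.cost z (γ β) β ≤ c) : G.lowerValue z ≤ c := by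
  have : Nonempty (G.ControlB z.2.2) := ⟨⟨_, zero_mem_controlB hG _⟩⟩
  refine (ciInf_le ?_ (⟨γ, hγ⟩ : G.Strategy z.2.2)).trans (ciSup_le fun β => h β.1 β.2)
  refine ⟨0, ?_⟩
  rintro _ ⟨γ, rfl⟩
  exact le_ciSup_of_le (bddAbove_cost hG hz γ.1) ⟨_, zero_mem_controlB hG _⟩ (cost_nonneg hG hz)

theorem exists_strategy (hG : G.Standing) (hz : z.2.2 ∈ Icc 0 G.T) {c : ℝ}
    (h : G.lowerValue z < c) :
    ∃ γ ∈ G.Strategy z.2.2, ∀ β ∈ G.ControlB z.2.2, G.cost z (γ β) β ≤ c := by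
  have : Nonempty (G.Strategy z.2.2) := by
    obtain ⟨a, -, ha⟩ := exists_const_strategy hG z.2.2
    exact ⟨⟨_, ha⟩⟩
  obtain ⟨γ, hγ⟩ := exists_lt_of_ciInf_lt h
  exact ⟨γ.1, γ.2, fun β hβ => (le_ciSup (bddAbove_cost hG hz γ.1) ⟨β, hβ⟩).trans hγ.le⟩

theorem le_lowerValue (hG : G.Standing) (hz : z.2.2 ∈ Icc 0 G.T) {c : ℝ}
    (h : ∀ γ ∈ G.Strategy z.2.2, ∀ ε > 0, ∃ β ∈ G.ControlB z.2.2, c - ε ≤ G.cost z (γ β) β) :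
    c ≤ G.lowerValue z := by
  by_contra! hc
  obtain ⟨c', h1, h2⟩ := exists_between hc
  obtain ⟨γ, hγ, hle⟩ := exists_strategy hG hz h1
  obtain ⟨β, hβ, hβ'⟩ := h γ hγ ((c - c') / 2) (by linarith)
  linarith [hle β hβ]

/-- Dynamic programming: a strategy on `[t, r]` that guarantees at most `c`. -/
theorem lowerValue_le_of_strategy (hG : G.Standing) (hd : 1 ≤ d) (hz : z ∈ G.Xtilde) {r : ℝ}
    (hr : r ∈ Icc z.2.2 G.T) {γ : (ℝ → FieldSpace d) → ℝ → Pt k} (hγ : γ ∈ G.Strategy z.2.2)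
    {c : ℝ} (h : ∀ β ∈ G.ControlB z.2.2, (∫ s in z.2.2..r, G.running z (γ β) β s) +
      G.lowerValue (G.state z (γ β) β r) ≤ c) : G.lowerValue z ≤ c := by
  refine le_of_forall_pos_le_add fun ε hε => ?_
  have hr0 : r ∈ Icc 0 G.T := ⟨hz.1.1.trans hr.1, hr.2⟩
  -- An almost optimal continuation is fixed for every state at time r. Strategies are arbitrary
  -- maps of the field, so no measurability in w is required.
  have hex : ∀ w : Pt d × H1 d, ∃ γ' ∈ G.Strategy r, ∀ β ∈ G.ControlB r,
      G.cost (w.1, w.2, r) (γ' β) β ≤ G.lowerValue (w.1, w.2, r) + ε := fun w =>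
    exists_strategy (z := (w.1, w.2, r)) hG hr0 (lt_add_of_pos_right _ hε)
  choose Γ hΓ hΓ' using hex
  set w : (ℝ → FieldSpace d) → Pt d × H1 d := fun β =>
    (G.traj z.1 z.2.2 (γ β) r, G.mass z.2.1 z.2.2 β r) with hw
  set δ : (ℝ → FieldSpace d) → ℝ → Pt k := fun β => concat r (γ β) (Γ (w β) β) with hδ
  have hδA : ∀ β ∈ G.ControlB z.2.2, δ β ∈ G.ControlA z.2.2 := fun β hβ =>
    concat_mem_controlA (hγ.1 β hβ) ((hΓ _).1 β (controlB_mono hβ hr.1)) hr.2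
  refine lowerValue_le hG hz.1 (γ := δ) ⟨hδA, fun τ hτ β₁ h₁ β₂ h₂ he => ?_⟩ fun β hβ => ?_
  · have hleft : ∀ σ, σ ≤ r → σ ∈ Icc z.2.2 τ →
        ∀ᵐ s ∂(volume.restrict (Icc z.2.2 σ)), δ β₁ s = δ β₂ s := fun σ hσ hσ' => by
      filter_upwards [hγ.2 σ ⟨hσ'.1, hσ'.2.trans hτ.2⟩ β₁ h₁ β₂ h₂
        (ae_restrict_of_ae_restrict_of_subset (Icc_subset_Icc_right hσ'.2) he),
        ae_restrict_mem measurableSet_Icc] with s e1 hs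
      rw [hδ]
      simp only
      rw [concat_of_le (hs.2.trans hσ), concat_of_le (hs.2.trans hσ), e1]
    rcases le_total τ r with h1 | h1
    · exact hleft τ h1 ⟨hτ.1, le_rfl⟩
    · refine ae_Icc_of_ae (r := r) (hleft r le_rfl ⟨hr.1, h1⟩) ?_
      have he' := ae_restrict_of_ae_restrict_of_subset (Icc_subset_Icc_right h1) he
      -- The composite strategy does not anticipate: the state at time r is determined by β on [t,
      -- r], so equal pasts select the same continuation.
      have ew : w β₁ = w β₂ := by
        have := state_congr hG hd hz (hγ.1 β₁ h₁) h₁ (hγ.1 β₂ h₂) h₂ hr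
          (hγ.2 r hr β₁ h₁ β₂ h₂ he') he' ⟨hr.1, le_rfl⟩
        simp only [state, Prod.mk.injEq] at this
        exact Prod.ext this.1 this.2.1
      filter_upwards [(hΓ (w β₁)).2 τ ⟨h1, hτ.2⟩ β₁ (controlB_mono h₁ hr.1) β₂
        (controlB_mono h₂ hr.1) (ae_restrict_of_ae_restrict_of_subset
          (Icc_subset_Icc_left hr.1) he), concat_ae_right (u := γ β₁) (v := Γ (w β₁) β₁) (r := r)
          (T := τ), concat_ae_right (u := γ β₂) (v := Γ (w β₂) β₂) (r := r) (T := τ)]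
        with s e1 e2 e3
      simp only [hδ]
      rw [e2, e3, e1, ew]
  · rw [cost_eq_add hG hd hz (hδA β hβ) hβ hr]
    have hl : ∀ᵐ s ∂(volume.restrict (Icc z.2.2 r)), δ β s = γ β s := concat_ae_left
    have hβe : ∀ᵐ s ∂(volume.restrict (Icc z.2.2 r)), β s = β s := Eventually.of_forall fun _ => rfl
    rw [integral_running_congr hG hd hz (hδA β hβ) hβ (hγ.1 β hβ) hβ hr hl hβe,
      state_congr hG hd hz (hδA β hβ) hβ (hγ.1 β hβ) hβ hr hl hβe ⟨hr.1, le_rfl⟩,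
      cost_congr (z := G.state z (γ β) β r) (α := δ β) (α' := Γ (w β) β) concat_ae_right
        (Eventually.of_forall fun _ => rfl) hr.2]
    have h1 := hΓ' (w β) β (controlB_mono hβ hr.1)
    have h2 := h β hβ
    have h3 : G.state z (γ β) β r = ((w β).1, (w β).2, r) := rfl
    rw [h3] at h2 ⊢
    linarith

/-- Dynamic programming: a control of the mass on `[t, r]` that guarantees at least `c`. -/
theorem le_lowerValue_of_control (hG : G.Standing) (hd : 1 ≤ d) (hz : z ∈ G.Xtilde) {r : ℝ}
    (hr : r ∈ Icc z.2.2 G.T) (hβ : β ∈ G.ControlB z.2.2)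
    {c : ℝ} (h : ∀ α ∈ G.ControlA z.2.2, c ≤ (∫ s in z.2.2..r, G.running z α β s) +
      G.lowerValue (G.state z α β r)) : c ≤ G.lowerValue z := by
  have hr0 : r ∈ Icc 0 G.T := ⟨hz.1.1.trans hr.1, hr.2⟩
  refine le_lowerValue hG hz.1 fun γ hγ ε hε => ?_
  have hγβ := hγ.1 β hβ
  -- With the mass committed to β up to time r, any strategy γ induces a strategy on [r, T]. The
  -- mass then answers it almost optimally from the state reached, a state that does not depend on
  -- this answer.
  set γ' : (ℝ → FieldSpace d) → ℝ → Pt k := fun β' => γ (concat r β β') with hγ'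
  have hS : γ' ∈ G.Strategy r := by
    refine ⟨fun β' hβ' => controlA_mono (hγ.1 _ (concat_mem_controlB hβ hβ' hr.2)) hr.1,
      fun τ hτ β₁ h₁ β₂ h₂ he => ?_⟩
    refine ae_restrict_of_ae_restrict_of_subset (Icc_subset_Icc_left hr.1)
      (hγ.2 τ ⟨hr.1.trans hτ.1, hτ.2⟩ _ (concat_mem_controlB hβ h₁ hr.2) _
        (concat_mem_controlB hβ h₂ hr.2) (ae_Icc_of_ae (r := r) ?_ ?_))
    · filter_upwards [ae_restrict_mem measurableSet_Icc] with s hs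
      rw [concat_of_le hs.2, concat_of_le hs.2]
    · filter_upwards [concat_ae_right (u := β) (v := β₁) (r := r) (T := τ),
        concat_ae_right (u := β) (v := β₂) (r := r) (T := τ), he] with s e1 e2 e3
      rw [e1, e2, e3]
  set w := G.state z (γ β) β r with hw
  obtain ⟨β', hβ', hlt⟩ : ∃ β' ∈ G.ControlB r, G.lowerValue w - ε < G.cost w (γ' β') β' := by
    by_contra! hcon
    have := lowerValue_le (z := w) hG hr0 hS hcon
    linarith
  have hc := concat_mem_controlB hβ hβ' hr.2
  refine ⟨_, hc, ?_⟩
  have he : ∀ᵐ s ∂(volume.restrict (Icc z.2.2 r)), concat r β β' s = β s := concat_ae_left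
  have hγe := hγ.2 r hr _ hc β hβ he
  rw [cost_eq_add hG hd hz (hγ.1 _ hc) hc hr,
    integral_running_congr hG hd hz (hγ.1 _ hc) hc hγβ hβ hr hγe he,
    state_congr hG hd hz (hγ.1 _ hc) hc hγβ hβ hr hγe he ⟨hr.1, le_rfl⟩, ← hw,
    cost_congr (z := w) (α := γ (concat r β β')) (β' := β') (Eventually.of_forall fun _ => rfl)
      (concat_ae_right (r := r) (T := G.T)) hr.2]
  have := h (γ β) hγβ
  linarith

theorem lowerValue_final (hG : G.Standing) (hd : 1 ≤ d) {x : Pt d} {m : H1 d} (hm : m ∈ G.X G.T) :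
    G.lowerValue (x, m, G.T) = G.ψ x m := by
  have hT : G.T ∈ Icc 0 G.T := ⟨hG.T_pos.le, le_rfl⟩
  have hc : ∀ α ∈ G.ControlA G.T, ∀ β ∈ G.ControlB G.T, G.cost (x, m, G.T) α β = G.ψ x m := by
    intro α hα β hβ
    have e1 := traj_init hG le_rfl hα x
    have e2 := mass_init hG hd hT hm hβ
    have e3 : G.cost (x, m, G.T) α β = (∫ s in G.T..G.T, G.running (x, m, G.T) α β s) +
      G.ψ (G.traj x G.T α G.T) (G.mass m G.T β G.T) := rfl
    rw [e3, intervalIntegral.integral_same, zero_add, e1, e2]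
  refine le_antisymm ?_ (le_lowerValue (z := (x, m, G.T)) hG hT fun γ hγ ε hε => ?_)
  · obtain ⟨a, ha, hs⟩ := exists_const_strategy hG G.T
    exact lowerValue_le (z := (x, m, G.T)) hG hT hs fun β hβ => (hc _ (hs.1 β hβ) _ hβ).le
  · have h0 := zero_mem_controlB hG G.T
    refine ⟨_, h0, ?_⟩
    rw [hc _ (hγ.1 _ h0) _ h0]
    linarith

end Data

end

/-! ### Continuity of the lower value. -/

section

open FieldSpace

theorem IsModulus.exists_lt {ω : ℝ → ℝ} (h : IsModulus ω) {ε : ℝ} (hε : 0 < ε) :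
    ∃ δ > 0, ∀ r, 0 ≤ r → r < δ → ω r < ε := by
  have h1 := h.2.2
  rw [Metric.continuousWithinAt_iff] at h1
  obtain ⟨δ, hδ, H⟩ := h1 ε hε
  refine ⟨δ, hδ, fun r hr hrδ => ?_⟩
  have := H (mem_Ici.2 hr) (by rwa [Real.dist_eq, sub_zero, abs_of_nonneg hr])
  rw [h.2.1, Real.dist_eq, sub_zero] at this
  exact (le_abs_self _).trans_lt this

namespace Data

variable {d k : ℕ} {G : Data d k} {z : Pt d × H1 d × ℝ} {α α' : ℝ → Pt k}
  {β β' : ℝ → FieldSpace d}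

theorem exists_cost_close (hG : G.Standing) (hd : 1 ≤ d) {ε : ℝ} (hε : 0 < ε) : ∃ δ > 0,
    ∀ (x x' : Pt d) (m m' : H1 d) (t : ℝ), (x, m, t) ∈ G.Xtilde → (x', m', t) ∈ G.Xtilde →
      ‖x - x'‖ < δ → ‖m - m'‖ < δ → ∀ α ∈ G.ControlA t, ∀ β ∈ G.ControlB t,
        G.cost (x, m, t) α β ≤ G.cost (x', m', t) α β + ε := by
  obtain ⟨Λ₁, hΛ₁, H₁⟩ := exists_traj_lipschitz hG
  obtain ⟨Λ₂, hΛ₂, H₂⟩ := exists_mass_lipschitz hG hd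
  obtain ⟨ω, hω, Hℓ⟩ := hG.ℓ_unif
  have hT := hG.T_pos
  obtain ⟨δ₁, hδ₁, Hω⟩ := hω.exists_lt (show 0 < ε / 2 / G.T by positivity)
  obtain ⟨δ₂, hδ₂, Hψ⟩ := Metric.uniformContinuous_iff.1 hG.ψ_unif (ε / 2) (by positivity)
  set Λ := max Λ₁ Λ₂ with hΛ
  have hΛ0 : 0 < Λ := lt_of_lt_of_le one_pos (hΛ₁.trans (le_max_left _ _))
  set μ := min (δ₁ / 2) δ₂ with hμ
  have hμ0 : 0 < μ := by positivity
  refine ⟨μ / Λ, by positivity, fun x x' m m' t hz hz' hx hm α hα β hβ => ?_⟩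
  have ht : t ∈ Icc 0 G.T := hz.1
  have hy : ∀ s ∈ Icc t G.T, ‖G.traj x t α s - G.traj x' t α s‖ < μ := fun s hs => by
    refine (H₁ t ht G.T ⟨ht.2, le_rfl⟩ α hα α hα (Eventually.of_forall fun _ => rfl) x x' s
      hs).trans_lt ?_
    refine (mul_le_mul_of_nonneg_right (le_max_left Λ₁ Λ₂) (norm_nonneg _)).trans_lt ?_
    rwa [mul_comm, ← lt_div_iff₀ hΛ0]
  have hmm : ∀ s ∈ Icc t G.T, ‖G.mass m t β s - G.mass m' t β s‖ < μ := fun s hs => by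
    refine (H₂ t ht m hz.2.2 m' hz'.2.2 β hβ s hs).trans_lt ?_
    refine (mul_le_mul_of_nonneg_right (le_max_right Λ₁ Λ₂) (norm_nonneg _)).trans_lt ?_
    rwa [mul_comm, ← lt_div_iff₀ hΛ0]
  have htt : t ∈ Icc t G.T := ⟨le_rfl, ht.2⟩
  have hTT : G.T ∈ Icc t G.T := ⟨ht.2, le_rfl⟩
  have i₁ := intervalIntegrable_running hG hd hz hα hβ htt hTT
  have i₂ := intervalIntegrable_running hG hd hz' hα hβ htt hTT
  have h1 : (∫ s in t..G.T, G.running (x, m, t) α β s) ≤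
      (∫ s in t..G.T, G.running (x', m', t) α β s) + ε / 2 := by
    have h2 : (∫ s in t..G.T, G.running (x, m, t) α β s) ≤
        ∫ s in t..G.T, (G.running (x', m', t) α β s + ε / 2 / G.T) := by
      refine intervalIntegral.integral_mono_on ht.2 i₁ (i₂.add intervalIntegrable_const)
        fun s hs => ?_
      have h0 : s ∈ Icc 0 G.T := ⟨ht.1.trans hs.1, hs.2⟩
      have := Hℓ (α s) (β s).toL2v (G.traj x t α s) (G.traj x' t α s) (G.mass m t β s)
        (G.mass m' t β s) s h0 s h0
      have h3 := Hω (‖G.traj x t α s - G.traj x' t α s‖ + ‖G.mass m t β s - G.mass m' t β s‖ +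
        |s - s|) (by positivity) (by
          rw [sub_self, abs_zero]
          linarith [hy s hs, hmm s hs, min_le_left (δ₁ / 2) δ₂])
      have h4 := (le_abs_self _).trans (this.trans h3.le)
      simp only [running]
      linarith
    rw [intervalIntegral.integral_add i₂ intervalIntegrable_const,
      intervalIntegral.integral_const, smul_eq_mul] at h2
    refine h2.trans (add_le_add le_rfl ?_)
    rw [mul_div_assoc', div_le_iff₀ hT, mul_comm]
    exact mul_le_mul_of_nonneg_left (by linarith [ht.1]) (by positivity)
  have h5 := Hψ (a := (G.traj x t α G.T, G.mass m t β G.T))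
    (b := (G.traj x' t α G.T, G.mass m' t β G.T)) (by
      rw [Prod.dist_eq, max_lt_iff, dist_eq_norm, dist_eq_norm]
      exact ⟨(hy _ hTT).trans_le (min_le_right _ _), (hmm _ hTT).trans_le (min_le_right _ _)⟩)
  rw [Real.dist_eq] at h5
  have h6 := (abs_lt.1 h5).2
  have e1 : G.cost (x, m, t) α β = (∫ s in t..G.T, G.running (x, m, t) α β s) +
    G.ψ (G.traj x t α G.T) (G.mass m t β G.T) := rfl
  have e2 : G.cost (x', m', t) α β = (∫ s in t..G.T, G.running (x', m', t) α β s) +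
    G.ψ (G.traj x' t α G.T) (G.mass m' t β G.T) := rfl
  rw [e1, e2]
  linarith

/-- At a common time the sets of strategies coincide, so an almost optimal strategy for one state is
used from the other, and the costs are close uniformly in the controls. -/
theorem exists_lowerValue_close (hG : G.Standing) (hd : 1 ≤ d) {ε : ℝ} (hε : 0 < ε) : ∃ δ > 0,
    ∀ (x x' : Pt d) (m m' : H1 d) (t : ℝ), (x, m, t) ∈ G.Xtilde → (x', m', t) ∈ G.Xtilde →
      ‖x - x'‖ < δ → ‖m - m'‖ < δ → G.lowerValue (x, m, t) ≤ G.lowerValue (x', m', t) + ε := by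
  obtain ⟨δ, hδ, H⟩ := exists_cost_close hG hd (half_pos hε)
  refine ⟨δ, hδ, fun x x' m m' t hz hz' hx hm => ?_⟩
  obtain ⟨γ, hγ, hle⟩ := exists_strategy (z := (x', m', t)) hG hz'.1
    (lt_add_of_pos_right _ (half_pos hε))
  refine lowerValue_le (z := (x, m, t)) hG hz.1 hγ fun β hβ => ?_
  have h1 := H x x' m m' t hz hz' hx hm _ (hγ.1 β hβ) β hβ
  have h2 := hle β hβ
  linarith

/-- Between the two times any admissible play brings the earlier state close to the later one at
small cost. Dynamic programming with the zero field bounds the earlier value from below, and with a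
constant control from above. -/
theorem exists_lowerValue_close_of_le (hG : G.Standing) (hd : 1 ≤ d) (n₀ : H1 d) {ε : ℝ}
    (hε : 0 < ε) : ∃ δ > 0, ∀ (x x' : Pt d) (m m' : H1 d) (t t' : ℝ), (x, m, t) ∈ G.Xtilde →
      (x', m', t') ∈ G.Xtilde → t ≤ t' → t' - t < δ → ‖x - x'‖ < δ → ‖m - n₀‖ < δ →
      ‖m' - n₀‖ < δ → |G.lowerValue (x, m, t) - G.lowerValue (x', m', t')| ≤ ε := by
  obtain ⟨δ₁, hδ₁, H₁⟩ := exists_lowerValue_close hG hd (half_pos hε)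
  obtain ⟨δ₂, hδ₂, H₂⟩ := exists_mass_short_time hG hd n₀ (show 0 < δ₁ / 3 by positivity)
  obtain ⟨B, hB0, hB⟩ := exists_integral_running_le hG
  have hC := C_nonneg hG
  set δ := min (min δ₂ (δ₁ / 3)) (min (δ₁ / (2 * (G.C + 1))) (ε / (2 * (B + 1)))) with hδ
  refine ⟨δ, by positivity, fun x x' m m' t t' hz hz' htt hτ hx hm hm' => ?_⟩
  have d1 : δ ≤ δ₂ := (min_le_left _ _).trans (min_le_left _ _)
  have d2 : δ ≤ δ₁ / 3 := (min_le_left _ _).trans (min_le_right _ _)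
  have d3 : δ ≤ δ₁ / (2 * (G.C + 1)) := (min_le_right _ _).trans (min_le_left _ _)
  have d4 : δ ≤ ε / (2 * (B + 1)) := (min_le_right _ _).trans (min_le_right _ _)
  have hr : t' ∈ Icc t G.T := ⟨htt, hz'.1.2⟩
  have d5 : (G.C + 1) * δ ≤ δ₁ / 2 := by
    have := mul_le_mul_of_nonneg_left d3 (show 0 ≤ G.C + 1 by positivity)
    refine this.trans (le_of_eq ?_)
    field_simp
  have d6 : (B + 1) * δ ≤ ε / 2 := by
    have := mul_le_mul_of_nonneg_left d4 (show 0 ≤ B + 1 by positivity)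
    refine this.trans (le_of_eq ?_)
    field_simp
  have hclose : ∀ α ∈ G.ControlA t, ∀ β ∈ G.ControlB t,
      ‖G.traj x t α t' - x'‖ < δ₁ ∧ ‖G.mass m t β t' - m'‖ < δ₁ := fun α hα β hβ => by
    constructor
    · have h1 := norm_traj_sub_le (x := x) hG hz.1.2 hα hr
      have h2 := norm_add_le (G.traj x t α t' - x) (x - x')
      rw [sub_add_sub_cancel] at h2
      have h3 : G.C * (t' - t) ≤ G.C * δ := mul_le_mul_of_nonneg_left hτ.le hC
      linarith
    · have h1 := H₂ t hz.1 m hz.2.2 (hm.trans_le d1) β hβ t' hr (hτ.trans_le d1)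
      have h2 := norm_add_le (G.mass m t β t' - m + (m - n₀)) (n₀ - m')
      have h3 := norm_add_le (G.mass m t β t' - m) (m - n₀)
      rw [sub_add_sub_cancel, sub_add_sub_cancel] at h2
      rw [sub_add_sub_cancel] at h3
      rw [norm_sub_rev n₀] at h2
      linarith
  have hint : ∀ α β, 0 ≤ (∫ s in t..t', G.running (x, m, t) α β s) ∧
      (∫ s in t..t', G.running (x, m, t) α β s) ≤ ε / 2 := fun α β => by
    constructor
    · exact intervalIntegral.integral_nonneg htt fun s hs =>
        running_nonneg hG ⟨hz.1.1.trans hs.1, hs.2.trans hr.2⟩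
    · have h1 := (le_abs_self _).trans (hB (x, m, t) α β t hz.1 t' hr)
      have h3 : B * (t' - t) ≤ B * δ := mul_le_mul_of_nonneg_left hτ.le hB0
      have : 0 ≤ t' - t := sub_nonneg.2 htt
      linarith
  rw [abs_le]
  constructor
  · have h0 := zero_mem_controlB hG t
    have := le_lowerValue_of_control (z := (x, m, t)) hG hd hz hr h0
      (c := G.lowerValue (x', m', t') - ε / 2) fun α hα => by
        obtain ⟨c1, c2⟩ := hclose α hα _ h0
        have hw := state_mem_Xtilde (z := (x, m, t)) hG hd hz hα h0 hr
        have := H₁ x' _ m' _ t' hz' hw (by rwa [norm_sub_rev]) (by rwa [norm_sub_rev])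
        have h4 := (hint α fun _ => 0).1
        simp only [state]
        linarith
    linarith
  · obtain ⟨a, ha, hs⟩ := exists_const_strategy hG t
    have := lowerValue_le_of_strategy (z := (x, m, t)) hG hd hz hr hs
      (c := G.lowerValue (x', m', t') + ε) fun β hβ => by
        obtain ⟨c1, c2⟩ := hclose _ (hs.1 β hβ) β hβ
        have hw := state_mem_Xtilde (z := (x, m, t)) hG hd hz (hs.1 β hβ) hβ hr
        have := H₁ _ x' _ m' t' hw hz' c1 c2
        have h4 := (hint (fun _ => a) β).2
        simp only [state]
        linarith
    linarith

theorem continuousOn_lowerValue (hG : G.Standing) (hd : 1 ≤ d) :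
    ContinuousOn G.lowerValue G.Xtilde := by
  rintro ⟨x, m, t⟩ hz
  rw [Metric.continuousWithinAt_iff]
  intro ε hε
  obtain ⟨δ, hδ, H⟩ := exists_lowerValue_close_of_le hG hd m (half_pos hε)
  refine ⟨δ, hδ, ?_⟩
  rintro ⟨x', m', t'⟩ hz' hdist
  rw [Prod.dist_eq, Prod.dist_eq, max_lt_iff, max_lt_iff, dist_eq_norm, dist_eq_norm,
    Real.dist_eq] at hdist
  obtain ⟨h1, h2, h3⟩ := hdist
  have h3' := abs_lt.1 h3
  simp only at h1 h2 h3'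
  have h0 : ‖m - m‖ < δ := by rwa [sub_self, norm_zero]
  rw [Real.dist_eq]
  refine lt_of_le_of_lt ?_ (half_lt_self hε)
  rcases le_total t t' with h | h
  · rw [abs_sub_comm]
    exact H x x' m m' t t' hz hz' h h3'.2 (by rwa [norm_sub_rev]) h0 h2
  · exact H x' x m' m t' t hz' hz h (by linarith) h1 h2 h0

end Data

end

/-! ### First-order expansion of the cost. -/

section

open FieldSpace

/-- First-order expansion of a `C¹` function on `P × Q × [0, T]` by its partial derivatives. -/
theorem exists_first_order {P Q : Type*} [NormedAddCommGroup P] [InnerProductSpace ℝ P]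
    [CompleteSpace P] [NormedAddCommGroup Q] [InnerProductSpace ℝ Q] [CompleteSpace Q] {T : ℝ}
    (hT : 0 < T) {φ : P × Q × ℝ → ℝ} (hφ : ContDiffOn ℝ 1 φ (univ ×ˢ univ ×ˢ Icc 0 T)) (x : P)
    (q : Q) {t : ℝ} (ht : t ∈ Icc 0 T) {η : ℝ} (hη : 0 < η) :
    ∃ δ > 0, ∀ x' q', ∀ s ∈ Icc 0 T, ‖x' - x‖ < δ → ‖q' - q‖ < δ → |s - t| < δ →
      |φ (x', q', s) - φ (x, q, t) - (inner ℝ (gradient (fun x => φ (x, q, t)) x) (x' - x) +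
        inner ℝ (gradient (fun q => φ (x, q, t)) q) (q' - q) +
        derivWithin (fun s => φ (x, q, s)) (Icc 0 T) t * (s - t))| ≤
      η * (‖x' - x‖ + ‖q' - q‖ + |s - t|) := by
  obtain ⟨φ', hφ'⟩ := hφ.differentiableOn one_ne_zero (x, q, t) ⟨mem_univ _, mem_univ _, ht⟩
  have hx : ∀ v, inner ℝ (gradient (fun x => φ (x, q, t)) x) v = φ' (v, 0, 0) := fun v => by
    have h1 : HasFDerivWithinAt (fun x : P => (x, q, t)) (ContinuousLinearMap.inl ℝ P (Q × ℝ))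
        univ x := (hasFDerivAt_prodMk_left x (q, t)).hasFDerivWithinAt
    have hmap : MapsTo (fun x : P => (x, q, t)) univ (univ ×ˢ univ ×ˢ Icc 0 T) :=
      fun _ _ => ⟨mem_univ _, mem_univ _, ht⟩
    have h2 := hφ'.comp x h1 hmap
    have h3 := (hasFDerivWithinAt_univ.1 h2).hasGradientAt.gradient
    rw [show (fun x => φ (x, q, t)) = φ ∘ fun x => (x, q, t) from rfl, h3,
      InnerProductSpace.toDual_symm_apply]
    rfl
  have hq : ∀ v, inner ℝ (gradient (fun q => φ (x, q, t)) q) v = φ' (0, v, 0) := fun v => by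
    have h1 : HasFDerivWithinAt (fun q : Q => (x, q, t))
        ((ContinuousLinearMap.inr ℝ P (Q × ℝ)).comp (ContinuousLinearMap.inl ℝ Q ℝ)) univ q :=
      ((hasFDerivAt_prodMk_right x (q, t)).comp q
        (hasFDerivAt_prodMk_left q t)).hasFDerivWithinAt
    have hmap : MapsTo (fun q : Q => (x, q, t)) univ (univ ×ˢ univ ×ˢ Icc 0 T) :=
      fun _ _ => ⟨mem_univ _, mem_univ _, ht⟩
    have h2 := hφ'.comp q h1 hmap
    have h3 := (hasFDerivWithinAt_univ.1 h2).hasGradientAt.gradient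
    rw [show (fun q => φ (x, q, t)) = φ ∘ fun q => (x, q, t) from rfl, h3,
      InnerProductSpace.toDual_symm_apply]
    rfl
  have hs : derivWithin (fun s => φ (x, q, s)) (Icc 0 T) t = φ' (0, 0, 1) := by
    have h1 : HasDerivWithinAt (fun s : ℝ => (x, q, s)) ((0 : P), (0 : Q), (1 : ℝ)) (Icc 0 T) t :=
      (hasDerivWithinAt_const t _ x).prodMk
        ((hasDerivWithinAt_const t _ q).prodMk (hasDerivWithinAt_id t _))
    have hmap : MapsTo (fun s : ℝ => (x, q, s)) (Icc 0 T) (univ ×ˢ univ ×ˢ Icc 0 T) :=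
      fun _ hs => ⟨mem_univ _, mem_univ _, hs⟩
    exact (hφ'.comp_hasDerivWithinAt t h1 hmap).derivWithin (uniqueDiffOn_Icc hT t ht)
  have hlo := hφ'.isLittleO.def hη
  rw [eventually_nhdsWithin_iff, Metric.eventually_nhds_iff] at hlo
  obtain ⟨δ, hδ, H⟩ := hlo
  refine ⟨δ, hδ, fun x' q' s hs' h1 h2 h3 => ?_⟩
  have h4 := H (y := (x', q', s)) (by
    rw [Prod.dist_eq, Prod.dist_eq, max_lt_iff, max_lt_iff, dist_eq_norm, dist_eq_norm,
      Real.dist_eq]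
    exact ⟨h1, h2, h3⟩) ⟨mem_univ _, mem_univ _, hs'⟩
  have e : φ' ((x', q', s) - (x, q, t)) =
      φ' (x' - x, 0, 0) + φ' (0, q' - q, 0) + φ' (0, 0, 1) * (s - t) := by
    have e1 : ((x', q', s) - (x, q, t) : P × Q × ℝ) =
        (x' - x, 0, 0) + (0, q' - q, 0) + (s - t) • (0, 0, 1) := by
      simp
    rw [e1, map_add, map_add, map_smul, smul_eq_mul, mul_comm (s - t)]
  rw [hx, hq, hs, ← e]
  refine h4.trans (mul_le_mul_of_nonneg_left ?_ hη.le)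
  rw [Prod.mk_sub_mk, Prod.mk_sub_mk, Prod.norm_def, Prod.norm_def, Real.norm_eq_abs]
  have := norm_nonneg (x' - x)
  have := norm_nonneg (q' - q)
  have := abs_nonneg (s - t)
  exact max_le (by linarith) (max_le (by linarith) (by linarith))

theorem inner_neg_L2s {d : ℕ} (u w : L2s d) : inner ℝ u (-w) = -inner ℝ u w :=
  inner_neg_right u w

namespace Data

variable {d k : ℕ} {G : Data d k} {x : Pt d} {m : H1 d} {t : ℝ}

variable (G) in
/-- The rate of change `⟨p, f(x,a)⟩ - ⟨q, div(bm)⟩ + ℓ(x,m,t,a,b)`. -/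
def rate (p : Pt d) (q : L2s d) (x : Pt d) (m : H1 d) (t : ℝ) (a : Pt k) (b : FieldSpace d) : ℝ :=
  inner ℝ p (G.f x a) - inner ℝ q (divMul b m) + G.ℓ x m t a b.toL2v

theorem running_add_eq_rate {p : Pt d} {q : L2s d} {α : ℝ → Pt k} {β : ℝ → FieldSpace d} {s : ℝ} :
    G.running (x, m, t) α β s +
      (inner ℝ p (G.f (G.traj x t α s) (α s)) + inner ℝ q (-divMul (β s) (G.mass m t β s))) =
    G.rate p q (G.traj x t α s) (G.mass m t β s) s (α s) (β s) := by
  rw [inner_neg_L2s, rate, running]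
  ring

/-- The uniformity in a and b comes from the common Lipschitz constant of f, the bound (d + 1)M of
div (b ·) from H¹ to L², and the modulus of ℓ, which does not involve the controls. -/
theorem exists_rate_close (hG : G.Standing) (p : Pt d) (q : L2s d) (x : Pt d) (m : H1 d)
    (ht : t ∈ Icc 0 G.T) {η : ℝ} (hη : 0 < η) :
    ∃ δ > 0, ∀ x' m', ∀ s ∈ Icc 0 G.T, ‖x' - x‖ < δ → ‖m' - m‖ < δ → |s - t| < δ →
      ∀ a ∈ G.A, ∀ b ∈ Btilde d G.M, |G.rate p q x' m' s a b - G.rate p q x m t a b| ≤ η := by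
  obtain ⟨L, hL, hlip⟩ := hG.f_lip
  obtain ⟨ω, hω, Hℓ⟩ := hG.ℓ_unif
  obtain ⟨δ₁, hδ₁, Hω⟩ := hω.exists_lt (show 0 < η / 3 by positivity)
  have hM := hG.M_pos
  set K := ‖p‖ * L + ‖q‖ * ((d + 1) * G.M) + 1 with hK
  have hK0 : 0 < K := by positivity
  set δ := min (δ₁ / 3) (η / 3 / K) with hδ
  refine ⟨δ, by positivity, fun x' m' s hs h1 h2 h3 a ha b hb => ?_⟩
  have d1 : δ ≤ δ₁ / 3 := min_le_left _ _
  have d2 : K * δ ≤ η / 3 := by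
    rw [mul_comm, ← le_div_iff₀ hK0]
    exact min_le_right _ _
  have hδ0 : 0 ≤ δ := (norm_nonneg _).trans h1.le
  have e1 : |inner ℝ p (G.f x' a) - inner ℝ p (G.f x a)| ≤ η / 3 := by
    rw [← inner_sub_right]
    refine (abs_real_inner_le_norm _ _).trans (le_trans ?_ d2)
    calc ‖p‖ * ‖G.f x' a - G.f x a‖ ≤ ‖p‖ * (L * δ) := by
          refine mul_le_mul_of_nonneg_left ((hlip _ _ _ ha).trans ?_) (norm_nonneg _)
          exact mul_le_mul_of_nonneg_left h1.le hL.le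
      _ = ‖p‖ * L * δ := by ring
      _ ≤ K * δ := by
          refine mul_le_mul_of_nonneg_right ?_ hδ0
          have : 0 ≤ ‖q‖ * ((d + 1) * G.M) := by positivity
          linarith
  have e2 : |inner ℝ q (divMul b m') - inner ℝ q (divMul b m)| ≤ η / 3 := by
    rw [← inner_sub_right, ← divMul_sub]
    refine (abs_inner_le _ _).trans (le_trans ?_ d2)
    calc ‖q‖ * ‖divMul b (m' - m)‖ ≤ ‖q‖ * ((d + 1) * G.M * δ) := by
          refine mul_le_mul_of_nonneg_left ((norm_divMul_le hb _).trans ?_) (norm_nonneg _)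
          exact mul_le_mul_of_nonneg_left h2.le (by positivity)
      _ = ‖q‖ * ((d + 1) * G.M) * δ := by ring
      _ ≤ K * δ := by
          refine mul_le_mul_of_nonneg_right ?_ hδ0
          have : 0 ≤ ‖p‖ * L := by positivity
          linarith
  have e3 : |G.ℓ x' m' s a b.toL2v - G.ℓ x m t a b.toL2v| ≤ η / 3 :=
    (Hℓ a b.toL2v x' x m' m s hs t ht).trans
      (Hω _ (by positivity) (by linarith)).le
  rw [abs_le] at e1 e2 e3 ⊢
  simp only [rate]
  constructor <;> linarith [e1.1, e1.2, e2.1, e2.2, e3.1, e3.2]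

theorem exists_state_close (hG : G.Standing) (hd : 1 ≤ d) (hz : (x, m, t) ∈ G.Xtilde) {ε : ℝ}
    (hε : 0 < ε) : ∃ δ > 0, ∀ r ∈ Icc t G.T, r - t < δ → ∀ α ∈ G.ControlA t,
      ∀ β ∈ G.ControlB t, ‖G.traj x t α r - x‖ < ε ∧ ‖G.mass m t β r - m‖ < ε ∧ |r - t| < ε := by
  obtain ⟨δ, hδ, H⟩ := exists_mass_short_time hG hd m hε
  have hC := C_nonneg hG
  refine ⟨min δ (ε / (G.C + 1)), by positivity, fun r hr hrt α hα β hβ => ?_⟩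
  rw [lt_min_iff, lt_div_iff₀ (by positivity)] at hrt
  have h0 : 0 ≤ r - t := sub_nonneg.2 hr.1
  have hCr : 0 ≤ G.C * (r - t) := by positivity
  refine ⟨?_, H t hz.1 m hz.2.2 (by rwa [sub_self, norm_zero]) β hβ r hr hrt.1, ?_⟩
  · refine (norm_traj_sub_le hG hz.1.2 hα hr).trans_lt ?_
    nlinarith
  · rw [abs_of_nonneg h0]
    nlinarith

set_option maxHeartbeats 800000 in
/-- Along admissible controls, running cost plus increment of a test function is governed by the
rate at the initial state, uniformly in the controls. -/
theorem exists_expansion (hG : G.Standing) (hd : 1 ≤ d) (hz : (x, m, t) ∈ G.Xtilde)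
    {φ : Pt d × L2s d × ℝ → ℝ} (hφ : G.IsTest φ) {p : Pt d} {q : L2s d} {c : ℝ}
    (hp : gradient (fun x => φ (x, m.toL2, t)) x = p)
    (hq : gradient (fun q => φ (x, q, t)) m.toL2 = q)
    (hc : derivWithin (fun s => φ (x, m.toL2, s)) (Icc 0 G.T) t = c) {η : ℝ} (hη : 0 < η) :
    ∃ δ > 0, ∀ r ∈ Icc t G.T, r - t < δ → ∀ α ∈ G.ControlA t, ∀ β ∈ G.ControlB t, ∀ κ : ℝ,
      ((∀ᵐ s ∂(volume.restrict (Icc t r)), c + G.rate p q x m t (α s) (β s) ≤ κ) →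
        (∫ s in t..r, G.running (x, m, t) α β s) +
          φ (G.traj x t α r, (G.mass m t β r).toL2, r) ≤
          φ (x, m.toL2, t) + (κ + η) * (r - t)) ∧
      ((∀ᵐ s ∂(volume.restrict (Icc t r)), κ ≤ c + G.rate p q x m t (α s) (β s)) →
        φ (x, m.toL2, t) + (κ - η) * (r - t) ≤ (∫ s in t..r, G.running (x, m, t) α β s) +
          φ (G.traj x t α r, (G.mass m t β r).toL2, r)) := by
  have hM := hG.M_pos
  have hC := C_nonneg hG
  have ht := hz.1
  -- K bounds the speed of the state in ℝ^d × L² × time while the mass stays within distance 1 of m.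
  -- With it the remainder of the Taylor expansion is at most (η/2)(r - t).
  set K := G.C + (d + 1) * G.M * (‖m‖ + 1) + 1 with hK
  have hK0 : 0 < K := by positivity
  obtain ⟨δ₁, hδ₁, H₁⟩ := exists_first_order hG.T_pos hφ x m.toL2 ht
    (show 0 < η / 2 / K by positivity)
  rw [hp, hq, hc] at H₁
  obtain ⟨δ₂, hδ₂, H₂⟩ := exists_rate_close hG p q x m ht (half_pos hη)
  obtain ⟨δ, hδ, H⟩ := exists_state_close hG hd hz (show 0 < min (min δ₁ δ₂) 1 by positivity)
  refine ⟨δ, hδ, fun r hr hrt α hα β hβ => ?_⟩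
  have hrt0 : 0 ≤ r - t := sub_nonneg.2 hr.1
  have hclose : ∀ s ∈ Icc t r, ‖G.traj x t α s - x‖ < min (min δ₁ δ₂) 1 ∧
      ‖G.mass m t β s - m‖ < min (min δ₁ δ₂) 1 ∧ |s - t| < min (min δ₁ δ₂) 1 := fun s hs =>
    H s ⟨hs.1, hs.2.trans hr.2⟩ (by linarith [hs.2]) α hα β hβ
  have l1 : min (min δ₁ δ₂) 1 ≤ δ₁ := (min_le_left _ _).trans (min_le_left _ _)
  have l2 : min (min δ₁ δ₂) 1 ≤ δ₂ := (min_le_left _ _).trans (min_le_right _ _)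
  have l3 : min (min δ₁ δ₂) 1 ≤ 1 := min_le_right _ _
  have htr : t ∈ Icc t r := ⟨le_rfl, hr.1⟩
  have hrr : r ∈ Icc t r := ⟨hr.1, le_rfl⟩
  have hβr := (adm_of_controlB hβ).mono_right hr.2
  have hY := IsPrim.mono_right (traj_isPrim hG ht.2 hα x) hr.2
  have hN : IsPrim t r (fun s => (G.mass m t β s).toL2)
      (fun s => -divMul (β s) (G.mass m t β s)) :=
    IsPrim.mono_right (mass_isStrong hG hd ht hz.2.2 hβ) hr.2
  have hi := mass_init hG hd ht hz.2.2 hβ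
  have hmb : ‖(G.mass m t β r).toL2 - m.toL2‖ ≤ (d + 1) * G.M * (‖m‖ + 1) * (r - t) := by
    have h := IsPrim.norm_sub_le hN (hβr.bdd_divMul (m := G.mass m t β) hM.le
      (B := ‖m‖ + 1) fun s hs => ?_) htr hrr
    · simp only [hi] at h
      rwa [abs_of_nonneg hrt0] at h
    · have := norm_le_insert' (G.mass m t β s) m
      linarith [(hclose s hs).2.1]
  have hyb := norm_traj_sub_le (x := x) hG ht.2 hα hr
  obtain ⟨c1, c2, c3⟩ := hclose r hrr
  have hL2 : ‖(G.mass m t β r).toL2 - m.toL2‖ < δ₁ := by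
    rw [show (G.mass m t β r).toL2 - m.toL2 = (G.mass m t β r - m).toL2 from
      (map_sub H1.toL2L _ _).symm]
    exact (H1.norm_toL2_le _).trans_lt (c2.trans_le l1)
  have hexp := H₁ (G.traj x t α r) (G.mass m t β r).toL2 r ⟨ht.1.trans hr.1, hr.2⟩
    (c1.trans_le l1) hL2 (c3.trans_le l1)
  have herr : η / 2 / K * (‖G.traj x t α r - x‖ + ‖(G.mass m t β r).toL2 - m.toL2‖ + |r - t|) ≤
      η / 2 * (r - t) := by
    rw [abs_of_nonneg hrt0]
    have : ‖G.traj x t α r - x‖ + ‖(G.mass m t β r).toL2 - m.toL2‖ + (r - t) ≤ K * (r - t) := by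
      rw [hK]
      linarith
    refine (mul_le_mul_of_nonneg_left this (by positivity)).trans (le_of_eq ?_)
    field_simp
  replace hexp := abs_le.1 (hexp.trans herr)
  have hPy := IsPrim.clm_comp (v := G.traj x t α) (w := fun τ => G.f (G.traj x t α τ) (α τ)) hY
    (innerSL ℝ p)
  have hPm := IsPrim.clm_comp (v := fun s => (G.mass m t β s).toL2)
    (w := fun s => -divMul (β s) (G.mass m t β s)) hN (innerSL ℝ q)
  have hy1 : inner ℝ p (G.traj x t α r - x) =
      ∫ s in t..r, inner ℝ p (G.f (G.traj x t α s) (α s)) := by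
    have := hPy.sub_eq htr hrr
    simp only [innerSL_apply_apply] at this
    rw [← this, traj_init hG ht.2 hα, inner_sub_right]
  have hm1 : inner ℝ q ((G.mass m t β r).toL2 - m.toL2) =
      ∫ s in t..r, inner ℝ q (-divMul (β s) (G.mass m t β s)) := by
    have := hPm.sub_eq htr hrr
    simp only [innerSL_apply_apply] at this
    rw [← this, hi, inner_sub_right]
  have iR := intervalIntegrable_running hG hd hz hα hβ ⟨le_rfl, ht.2⟩ hr
  have iY : IntervalIntegrable (fun s => inner ℝ p (G.f (G.traj x t α s) (α s))) volume t r :=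
    hPy.intervalIntegrable htr hrr
  have iN : IntervalIntegrable (fun s => inner ℝ q (-divMul (β s) (G.mass m t β s))) volume t r :=
    hPm.intervalIntegrable htr hrr
  set h : ℝ → ℝ := fun s => G.running (x, m, t) α β s +
    (inner ℝ p (G.f (G.traj x t α s) (α s)) + inner ℝ q (-divMul (β s) (G.mass m t β s))) with hh
  have iH : IntervalIntegrable h volume t r := iR.add (iY.add iN)
  have hsum : ∫ s in t..r, h s = (∫ s in t..r, G.running (x, m, t) α β s) +
      (inner ℝ p (G.traj x t α r - x) + inner ℝ q ((G.mass m t β r).toL2 - m.toL2)) := by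
    rw [hy1, hm1, ← intervalIntegral.integral_add iY iN,
      ← intervalIntegral.integral_add iR (iY.add iN)]
  have hrate : ∀ᵐ s ∂(volume.restrict (Icc t r)),
      |h s - G.rate p q x m t (α s) (β s)| ≤ η / 2 := by
    filter_upwards [hβr.2, ae_restrict_mem measurableSet_Icc] with s hb hs
    obtain ⟨b1, b2, b3⟩ := hclose s hs
    have hs' : s ∈ Icc t G.T := ⟨hs.1, hs.2.trans hr.2⟩
    have e : h s = G.rate p q (G.traj x t α s) (G.mass m t β s) s (α s) (β s) :=
      running_add_eq_rate
    rw [e]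
    exact H₂ _ _ s ⟨ht.1.trans hs.1, hs'.2⟩ (b1.trans_le l2) (b2.trans_le l2) (b3.trans_le l2)
      _ (hα.2 s hs') _ hb
  refine fun κ => ⟨fun hκ => ?_, fun hκ => ?_⟩
  · have hI : ∫ s in t..r, h s ≤ ∫ s in t..r, (κ - c + η / 2) := by
      refine integral_mono_of_ae htr hrr hr.1 iH intervalIntegrable_const ?_
      filter_upwards [hκ, hrate] with s h1 h2
      linarith [(abs_le.1 h2).2]
    rw [hsum, intervalIntegral.integral_const, smul_eq_mul] at hI
    linarith [hexp.2]
  · have hI : ∫ s in t..r, (κ - c - η / 2) ≤ ∫ s in t..r, h s := by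
      refine integral_mono_of_ae htr hrr hr.1 intervalIntegrable_const iH ?_
      filter_upwards [hκ, hrate] with s h1 h2
      linarith [(abs_le.1 h2).1]
    rw [hsum, intervalIntegral.integral_const, smul_eq_mul] at hI
    linarith [hexp.1]

end Data

end

/-! ### The Isaacs equation. -/

section

open FieldSpace

namespace Data

variable {d k : ℕ} {G : Data d k} {x : Pt d} {m : H1 d} {t : ℝ} {p : Pt d} {q : L2s d}

theorem neg_rate_eq (a : Pt k) (b : FieldSpace d) :
    -(inner ℝ (G.f x a) p) + pairDiv q b m - G.ℓ x m t a b.toL2v = -G.rate p q x m t a b := by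
  rw [rate, pairDiv_eq, real_inner_comm]
  ring

theorem exists_abs_rate_le (hG : G.Standing) (ht : t ∈ Icc 0 G.T) (p : Pt d) (q : L2s d)
    (x : Pt d) (m : H1 d) :
    ∃ B, ∀ a ∈ G.A, ∀ b ∈ Btilde d G.M, |G.rate p q x m t a b| ≤ B := by
  obtain ⟨B, hB⟩ := hG.ℓ_bdd
  refine ⟨‖p‖ * G.C + ‖q‖ * ((d + 1) * G.M * ‖m‖) + B, fun a ha b hb => ?_⟩
  have h1 : |inner ℝ p (G.f x a)| ≤ ‖p‖ * G.C := (abs_real_inner_le_norm _ _).trans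
    (mul_le_mul_of_nonneg_left (hG.f_bdd x a ha) (norm_nonneg _))
  have h2 : |inner ℝ q (divMul b m)| ≤ ‖q‖ * ((d + 1) * G.M * ‖m‖) := (abs_inner_le _ _).trans
    (mul_le_mul_of_nonneg_left (norm_divMul_le hb m) (norm_nonneg _))
  have h3 := hG.ℓ_nonneg x m t ht a b.toL2v
  have h4 := hB x m t ht a b.toL2v
  rw [abs_le] at h1 h2 ⊢
  rw [rate]
  constructor <;> linarith [h1.1, h1.2, h2.1, h2.2]

theorem bddAbove_neg_rate (hG : G.Standing) (ht : t ∈ Icc 0 G.T) {b : FieldSpace d}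
    (hb : b ∈ Btilde d G.M) : BddAbove (range fun a : G.A => -G.rate p q x m t a.1 b) := by
  obtain ⟨B, hB⟩ := exists_abs_rate_le hG ht p q x m
  refine ⟨B, ?_⟩
  rintro _ ⟨a, rfl⟩
  exact (neg_le_abs _).trans (hB a.1 a.2 b hb)

theorem Ham_eq : G.Ham x m t p q = ⨅ b : Btilde d G.M, ⨆ a : G.A, -G.rate p q x m t a.1 b.1 := by
  simp only [Ham, neg_rate_eq]

/-- A strict lower bound for an infimum over b of suprema over a gives a reply to each field, with a
margin θ independent of the field. This is the order of moves of a strategy. -/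
theorem exists_control_of_lt_Ham (hG : G.Standing) (ht : t ∈ Icc 0 G.T) {c : ℝ}
    (h : c < G.Ham x m t p q) : ∃ θ > 0, ∀ b ∈ Btilde d G.M, ∃ a ∈ G.A,
      c + G.rate p q x m t a b < -θ := by
  refine ⟨(G.Ham x m t p q - c) / 2, by linarith, fun b hb => ?_⟩
  have : Nonempty G.A := hG.A_nonempty.to_subtype
  have hbdd : BddBelow (range fun b : Btilde d G.M =>
      ⨆ a : G.A, -G.rate p q x m t a.1 b.1) := by
    obtain ⟨B, hB⟩ := exists_abs_rate_le hG ht p q x m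
    obtain ⟨a, ha⟩ := hG.A_nonempty
    refine ⟨-B, ?_⟩
    rintro _ ⟨b, rfl⟩
    exact le_ciSup_of_le (bddAbove_neg_rate hG ht b.2) ⟨a, ha⟩
      (neg_le_neg ((le_abs_self _).trans (hB a ha b.1 b.2)))
  have h1 := ciInf_le hbdd ⟨b, hb⟩
  rw [← Ham_eq] at h1
  obtain ⟨a, ha⟩ := exists_lt_of_lt_ciSup (show c + (G.Ham x m t p q - c) / 2 <
    ⨆ a : G.A, -G.rate p q x m t a.1 b from lt_of_lt_of_le (by linarith) h1)
  exact ⟨a.1, a.2, by linarith⟩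

/-- A strict upper bound for the infimum gives a single field that works against every control,
hence a constant control of the mass. -/
theorem exists_field_of_Ham_lt (hG : G.Standing) (ht : t ∈ Icc 0 G.T) {c : ℝ}
    (h : G.Ham x m t p q < c) : ∃ θ > 0, ∃ b ∈ Btilde d G.M, ∀ a ∈ G.A,
      θ < c + G.rate p q x m t a b := by
  have : Nonempty (Btilde d G.M) := ⟨⟨0, zero_mem_Btilde hG.M_pos.le⟩⟩
  rw [Ham_eq] at h
  obtain ⟨c', h1, h2⟩ := exists_between h
  obtain ⟨b, hb⟩ := exists_lt_of_ciInf_lt h1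
  refine ⟨c - c', by linarith, b.1, b.2, fun a ha => ?_⟩
  have := (le_ciSup (bddAbove_neg_rate hG ht b.2) ⟨a, ha⟩).trans_lt hb
  simp only at this
  linarith

theorem continuous_divMul_left (m : H1 d) : Continuous fun b : FieldSpace d => divMul b m := by
  have h : ∀ (A : FieldSpace d → (Pt d →ᵇ ℝ)) (u : L2s d), Continuous A →
      Continuous fun b : FieldSpace d => mulL (A b) u := fun A u hA =>
    (continuous_mulL.comp hA).clm_apply continuous_const
  exact (continuous_finsetSum _ fun i _ => h _ _ (continuous_compB i)).add (h _ _ continuous_divB)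

theorem continuous_inner_L2s (q : L2s d) : Continuous fun u : L2s d => (inner ℝ q u : ℝ) :=
  continuous_const.inner continuous_id

theorem continuous_rate_field (hG : G.Standing) (ht : t ∈ Icc 0 G.T) (a : Pt k) :
    Continuous fun b : FieldSpace d => G.rate p q x m t a b := by
  have h2 : Continuous fun b : FieldSpace d => inner ℝ q (divMul b m) :=
    (continuous_inner_L2s q).comp (continuous_divMul_left m)
  have h3 : Continuous fun b : FieldSpace d => G.ℓ x m t a b.toL2v :=
    hG.ℓ_cont.comp_continuous (f := fun b : FieldSpace d => (x, m, t, a, b.toL2v))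
      (continuous_const.prodMk (continuous_const.prodMk (continuous_const.prodMk
        (continuous_const.prodMk continuous_toL2v)))) fun _ => ht
  exact (continuous_const.sub h2).add h3

theorem continuous_rate_control (hG : G.Standing) (ht : t ∈ Icc 0 G.T) (b : FieldSpace d) :
    Continuous fun a : G.A => G.rate p q x m t a.1 b := by
  have h1 : Continuous fun a : G.A => G.f x a.1 :=
    hG.f_cont.comp_continuous (f := fun a : G.A => (x, a.1)) (by fun_prop)
      fun a => ⟨mem_univ _, a.2⟩
  have h3 : Continuous fun a : G.A => G.ℓ x m t a.1 b.toL2v :=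
    hG.ℓ_cont.comp_continuous (f := fun a : G.A => (x, m, t, a.1, b.toL2v)) (by fun_prop)
      fun _ => ht
  exact ((continuous_const.inner h1).sub continuous_const).add h3

/-- A measurable selection of controls against the current field is a strategy. -/
theorem exists_strategy_of_rate (hG : G.Standing) (ht : t ∈ Icc 0 G.T) {c θ : ℝ}
    (h : ∀ b ∈ Btilde d G.M, ∃ a ∈ G.A, c + G.rate p q x m t a b < -θ) :
    ∃ γ ∈ G.Strategy t, ∀ β ∈ G.ControlB t,
      ∀ᵐ s ∂(volume.restrict (Icc t G.T)), c + G.rate p q x m t (γ β s) (β s) ≤ -θ := by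
  classical
  have : Nonempty G.A := hG.A_nonempty.to_subtype
  -- Because the inequality is strict and `rate` is continuous in a, countably many controls
  -- suffice, and the reply is the first one that works. It depends only on the current value of the
  -- field, so the strategy is non-anticipating.
  set a : ℕ → G.A := TopologicalSpace.denseSeq G.A with ha
  have hdense : ∀ b ∈ Btilde d G.M, ∃ n, c + G.rate p q x m t (a n).1 b < -θ := fun b hb => by
    obtain ⟨a₀, ha₀, hlt⟩ := h b hb
    have ho : IsOpen {a : G.A | c + G.rate p q x m t a.1 b < -θ} :=
      isOpen_lt (continuous_const.add (continuous_rate_control hG ht b)) continuous_const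
    obtain ⟨n, hn⟩ := (TopologicalSpace.denseRange_denseSeq G.A).exists_mem_open ho
      ⟨⟨a₀, ha₀⟩, hlt⟩
    exact ⟨n, hn⟩
  -- The second alternative makes the first index defined for every field, including those outside
  -- `Btilde`, where no reply need exist.
  have hex : ∀ b : FieldSpace d, ∃ n, c + G.rate p q x m t (a n).1 b < -θ ∨
      ∀ j, ¬c + G.rate p q x m t (a j).1 b < -θ := fun b => by
    by_cases hb : ∃ n, c + G.rate p q x m t (a n).1 b < -θ
    · obtain ⟨n, hn⟩ := hb
      exact ⟨n, Or.inl hn⟩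
    · exact ⟨0, Or.inr (not_exists.1 hb)⟩
  set sel : FieldSpace d → Pt k := fun b => (a (Nat.find (hex b))).1 with hsel
  refine ⟨fun β s => sel (β s), ⟨fun β hβ => ⟨?_, fun s _ => (a _).2⟩,
    fun τ _ β₁ _ β₂ _ he => ?_⟩, fun β hβ => ?_⟩
  · set g := hβ.1.1.mk β with hg
    have hgm : StronglyMeasurable g := hβ.1.1.stronglyMeasurable_mk
    have hset : ∀ n, MeasurableSet {s | c + G.rate p q x m t (a n).1 (g s) < -θ} := fun n =>
      measurableSet_lt ((((continuous_rate_field hG ht (a n).1).comp_stronglyMeasurable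
        hgm).measurable).const_add c) measurable_const
    have hfind : Measurable fun s => Nat.find (hex (g s)) := by
      refine measurable_find (fun s => hex (g s)) fun n => ?_
      have hs : {s | c + G.rate p q x m t (a n).1 (g s) < -θ ∨
          ∀ j, ¬c + G.rate p q x m t (a j).1 (g s) < -θ} =
          {s | c + G.rate p q x m t (a n).1 (g s) < -θ} ∪
            ⋂ j, {s | c + G.rate p q x m t (a j).1 (g s) < -θ}ᶜ := by
        ext s
        simp
      rw [hs]
      exact (hset n).union (MeasurableSet.iInter fun j => (hset j).compl)
    have hm : Measurable fun s => sel (g s) :=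
      (measurable_from_nat (f := fun n => (a n).1)).comp hfind
    refine ⟨_, hm, ?_⟩
    filter_upwards [hβ.1.1.ae_eq_mk] with s hs
    rw [hs]
  · filter_upwards [he] with s hs
    rw [hs]
  · filter_upwards [hβ.2] with s hs
    obtain ⟨n, hn⟩ := hdense _ hs
    rcases Nat.find_spec (hex (β s)) with h1 | h1
    · exact h1.le
    · exact absurd hn (h1 n)

theorem exists_near_of_nhdsWithin (hG : G.Standing) (hd : 1 ≤ d) (hz : (x, m, t) ∈ G.Xtilde)
    {P : Pt d × H1 d × ℝ → Prop} (hP : ∀ᶠ w in 𝓝[G.Xtilde] (x, m, t), P w) :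
    ∃ δ > 0, ∀ r ∈ Icc t G.T, r - t < δ → ∀ α ∈ G.ControlA t, ∀ β ∈ G.ControlB t,
      P (G.state (x, m, t) α β r) := by
  rw [eventually_nhdsWithin_iff, Metric.eventually_nhds_iff] at hP
  obtain ⟨ε, hε, H⟩ := hP
  obtain ⟨δ, hδ, H'⟩ := exists_state_close hG hd hz hε
  refine ⟨δ, hδ, fun r hr hrt α hα β hβ => ?_⟩
  obtain ⟨h1, h2, h3⟩ := H' r hr hrt α hα β hβ
  refine H ?_ (state_mem_Xtilde hG hd hz hα hβ hr)
  rw [Prod.dist_eq, Prod.dist_eq, max_lt_iff, max_lt_iff, dist_eq_norm, dist_eq_norm,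
    Real.dist_eq]
  exact ⟨h1, h2, h3⟩

/-- By contradiction: the selected replies lower running cost plus φ by at least θ/2 per unit time.
The local maximum transfers this to the value, and dynamic programming makes the value smaller than
itself. -/
theorem isViscositySubsolution_lowerValue (hG : G.Standing) (hd : 1 ≤ d) :
    G.IsViscositySubsolution G.lowerValue := by
  refine ⟨continuousOn_lowerValue hG hd, ?_⟩
  rintro φ hφ ⟨x, m, t⟩ hz htT hmax
  simp only at htT
  by_contra! hpos
  have ht : t ∈ Icc 0 G.T := hz.1
  rw [isaacs, ← sub_eq_neg_add, sub_pos] at hpos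
  obtain ⟨θ, hθ, hrate⟩ := exists_control_of_lt_Ham hG ht hpos
  obtain ⟨γ, hγ, hγr⟩ := exists_strategy_of_rate hG ht hrate
  obtain ⟨δ₁, hδ₁, H₁⟩ := exists_expansion hG hd hz hφ rfl rfl rfl (half_pos hθ)
  obtain ⟨δ₂, hδ₂, H₂⟩ := exists_near_of_nhdsWithin hG hd hz hmax
  set r := min ((t + G.T) / 2) (t + min δ₁ δ₂ / 2) with hr
  have hδ : 0 < min δ₁ δ₂ := lt_min hδ₁ hδ₂
  have htr : t < r := lt_min (by linarith) (by linarith)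
  have hrT : r ≤ G.T := (min_le_left _ _).trans (by linarith)
  have hrδ : r - t < min δ₁ δ₂ := by
    have : r ≤ t + min δ₁ δ₂ / 2 := min_le_right _ _
    linarith
  have hrm : r ∈ Icc t G.T := ⟨htr.le, hrT⟩
  have key := lowerValue_le_of_strategy (z := (x, m, t)) hG hd hz hrm hγ
    (c := G.lowerValue (x, m, t) - θ / 2 * (r - t)) fun β hβ => by
      have h1 := (H₁ r hrm (hrδ.trans_le (min_le_left _ _)) (γ β) (hγ.1 β hβ) β hβ (-θ)).1
        (ae_restrict_of_ae_restrict_of_subset (Icc_subset_Icc_right hrT) (hγr β hβ))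
      have h2 := H₂ r hrm (hrδ.trans_le (min_le_right _ _)) (γ β) (hγ.1 β hβ) β hβ
      simp only [diffTest, state] at h1 h2 ⊢
      linarith
  have : 0 < θ / 2 * (r - t) := mul_pos (half_pos hθ) (sub_pos.2 htr)
  linarith

/-- The mirror argument: one constant field raises running cost plus φ by at least θ/2 per unit time
against every control. -/
theorem isViscositySupersolution_lowerValue (hG : G.Standing) (hd : 1 ≤ d) :
    G.IsViscositySupersolution G.lowerValue := by
  refine ⟨continuousOn_lowerValue hG hd, ?_⟩
  rintro φ hφ ⟨x, m, t⟩ hz htT hmin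
  simp only at htT
  by_contra! hneg
  have ht : t ∈ Icc 0 G.T := hz.1
  rw [isaacs, ← sub_eq_neg_add, sub_neg] at hneg
  obtain ⟨θ, hθ, b, hb, hrate⟩ := exists_field_of_Ham_lt hG ht hneg
  have hβ : (fun _ => b) ∈ G.ControlB t := const_mem_controlB hb
  obtain ⟨δ₁, hδ₁, H₁⟩ := exists_expansion hG hd hz hφ rfl rfl rfl (half_pos hθ)
  obtain ⟨δ₂, hδ₂, H₂⟩ := exists_near_of_nhdsWithin hG hd hz hmin
  set r := min ((t + G.T) / 2) (t + min δ₁ δ₂ / 2) with hr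
  have hδ : 0 < min δ₁ δ₂ := lt_min hδ₁ hδ₂
  have htr : t < r := lt_min (by linarith) (by linarith)
  have hrT : r ≤ G.T := (min_le_left _ _).trans (by linarith)
  have hrδ : r - t < min δ₁ δ₂ := by
    have : r ≤ t + min δ₁ δ₂ / 2 := min_le_right _ _
    linarith
  have hrm : r ∈ Icc t G.T := ⟨htr.le, hrT⟩
  have key := le_lowerValue_of_control (z := (x, m, t)) hG hd hz hrm hβ
    (c := G.lowerValue (x, m, t) + θ / 2 * (r - t)) fun α hα => by
      have h1 := (H₁ r hrm (hrδ.trans_le (min_le_left _ _)) α hα _ hβ θ).2 (by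
        filter_upwards [ae_restrict_mem measurableSet_Icc] with s hs
        exact (hrate _ (hα.2 s ⟨hs.1, hs.2.trans hrT⟩)).le)
      have h2 := H₂ r hrm (hrδ.trans_le (min_le_right _ _)) α hα _ hβ
      simp only [diffTest, state] at h1 h2 ⊢
      linarith
  have : 0 < θ / 2 * (r - t) := mul_pos (half_pos hθ) (sub_pos.2 htr)
  linarith

end Data

end

end MassGame

end

theorem theorem4p1 {d k : ℕ} (hd : 1 ≤ d) (G : MassGame.Data d k) (hG : G.Standing) :
    G.IsViscositySolution G.lowerValue ∧
      ∀ x ∈ G.Omega2 G.T, ∀ m ∈ G.X G.T, G.lowerValue (x, m, G.T) = G.ψ x m := by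
  exact ⟨⟨MassGame.Data.isViscositySubsolution_lowerValue hG hd,
    MassGame.Data.isViscositySupersolution_lowerValue hG hd⟩,
    fun _ _ _ hm => MassGame.Data.lowerValue_final hG hd hm⟩
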